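/- For a radially symmetric function $M_0:\mathbb R^3\to\mathbb R$ let $m_0(r):=\int_{\mathbb R^2}M_0(r,y)\,dy$, $r\in\mathbb R$, and for $\vartheta>0$ let $\mathcal D_\vartheta:=\{z\in\mathbb C:\ |\Im z|<\vartheta(1+|\Re z|)\}$. For $\vartheta\in(0,\pi/4]$ and $d>1$ the class $\mathcal M_{\vartheta,d}$ of acceptable equilibria consists of the radially symmetric $M_0$ with $\int_{\mathbb R^3}M_0\,dv=1$ such that: $m_0$ is even and positive on $\mathbb R$; $m_0'(r)<0$ for $r>0$; and $m_0$ extends to an analytic function on $\mathcal D_\vartheta$ with $m_0(z)=m_0(-z)=\overline{m_0(\bar z)}$ and $|m_0(z)|\le C(1+|z|)^{-d}$ for all $z\in\mathcal D_\vartheta$, for some constant $C$. For $k\in\mathbb N$ put $a_k:=\int_{\mathbb R}t^km_0(t)\,dt$. With $\widehat M_0(\xi):=\int_{\mathbb R^3} M_0(v)e^{-iv\cdot\xi}dv$ define, for $\xi\in\mathbb R^3\setminus\{0\}$, $$K(\xi,\theta):=\int_0^\infty t\widehat M_0(t\xi)e^{-it\theta}\,dt,\qquad \widehat G(\xi,\tau):=\delta_0(\tau)-\mathbf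 1_{[0,\infty)}(\tau)\frac1{2\pi}\int_{\mathbb R}\frac{K(\xi,\theta)}{1+K(\xi,\theta)}e^{i\theta\tau}\,d\theta ;$$ for fixed $\xi$, $\widehat G(\xi,\cdot)$ is a distribution in $\tau$. Functions of $\tau$ in the formulas for $\widehat G$ below are understood to be multiplied by $\mathbf 1_{[0,\infty)}(\tau)$. **Theorem.** There are functions $b_{2j}$, $j\ge1$, of finitely many real variables, which do not depend on the equilibrium, such that the following holds. Let $\vartheta\in(0,\pi/4]$, $d>1$ and $M_0\in\mathcal M_{\vartheta,d}$. There are $\bar r>0$ and functions $\omega,\mathfrak m_l:[0,\infty)\to\mathbb C$ such that for every $r_0\in(0,\bar r]$ there is $\gamma_0\in(0,\infty)$ with the following properties. The constants implied by $\lesssim$ in (ii)–(iv) depend only on $\vartheta$, $d$ and $M_0$; $\gamma_0$ and the constant in (i) may depend on $r_0$ as well. All bounds hold for all $a\in\{0,\dots,10\}$, $b\in\{0,1\}$, $\tau\ge0$ and all $r$ in the indicated range, and include the existence of the derivatives that occur in them (those in $\tau$ for $\tau>0$; the functions $\mathcal E_h,\mathcal E_l$ are continuous in $\tau\in[0,\infty)$).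 (i) (High frequency.) There is a function $\mathcal E_h(r,\tau)$ such that for $|\xi|>r_0/2$, respectively $r>r_0/2$, $$\widehat G(\xi,\tau)=\delta_0(\tau)+e^{-\gamma_0\tau|\xi|}\mathcal E_h(|\xi|,\tau),\qquad \tau^br^a|\partial_\tau^b\partial_r^a\mathcal E_h(r,\tau)|\lesssim r^{-1}.$$ (ii) (Low frequency.) There is a function $\mathcal E_l(r,\tau)$ such that for $0<|\xi|<2r_0$ $$\widehat G(\xi,\tau)=\delta_0(\tau)+\Re\{i[1+\mathfrak m_l(|\xi|)]e^{i\tau\omega(|\xi|)}\}+e^{-\gamma_0\tau|\xi|}\mathcal E_l(|\xi|,\tau),$$ and, with $\omega_1:=\Re\omega$ and $\omega_2:=\Im\omega$, for $0<r<2r_0$, $$r^a|\partial_r^a\mathfrak m_l(r)|+\tau^br^a|\partial_\tau^b\partial_r^a\mathcal E_l(r,\tau)|+r^a|\partial_r^a(\omega_1(r)-1)|+r^a|\partial_r^a\omega_2(r)|\lesssim r^{d-1}+r^2\log(1/r),$$ $$\omega_2(r)\ge0,\qquad \omega_2(r)\in\Big[\frac{-\pi m_0'(\omega_1(r)/r)}{4r^2},\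 \frac{-\pi m_0'(\omega_1(r)/r)}{r^2}\Big].$$ (iii) (Thin tails.) If $d\ge3$ and $a_2<\infty$, then for $0<r<2r_0$ the same functions satisfy $$r^a|\partial_r^a\mathfrak m_l(r)|\lesssim r^2,\qquad \tau^br^a|\partial_\tau^b\partial_r^a\mathcal E_l(r,\tau)|\lesssim r^{d-1}+r^3,$$ $$r^a|\partial_r^a(\omega_1(r)-1-\tfrac32a_2r^2)|+r^a|\partial_r^a\omega_2(r)|\lesssim r^{d-1}+r^4\log(1/r).$$ (iv) (Higher-order expansions.) If $d>2n+1$ for an integer $n\ge1$, then $\mathfrak m_l,\omega\in C^n([0,\infty))$ and, for $0<r<2r_0$, $$r^a|\partial_r^a(\omega_1(r)-(1+b_2r^2+\dots+b_{2n}r^{2n}))|+r^a|\partial_r^a\omega_2(r)|\lesssim r^{d-1}+r^{2n+2}\log(1/r),$$ where $b_{2j}=b_{2j}(a_0,a_1,\dots,a_{2j})$ depends only on the moments of $m_0$ of order at most $2j$. If moreover $d=2n+3$ and $a_{2n+2}<\infty$, then the factor $\log(1/r)$ in this bound can be removed. -/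

import Mathlib

open Set MeasureTheory

noncomputable section

namespace VlasovPoisson

/-- Three-dimensional Euclidean space. -/
abbrev E3 : Type := EuclideanSpace ℝ (Fin 3)

/-- The reduced distribution `m₀(r) = ∫_{ℝ²} M₀(r, y) dy`. -/
def reduced (M₀ : E3 → ℝ) (r : ℝ) : ℝ :=
  ∫ y : ℝ × ℝ, M₀ !₂[r, y.1, y.2]

/-- The region `𝒟_ϑ = {z : |Im z| < ϑ (1 + |Re z|)}`. -/
def region (ϑ : ℝ) : Set ℂ :=
  {z : ℂ | |z.im| < ϑ * (1 + |z.re|)}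

/-- The class `𝓜_{ϑ,d}` of acceptable equilibria. (The condition `∫ M₀ = 1` includes that `M₀` is
integrable, since the integral of a non-integrable function is `0`; in the same way positivity of
the reduced distribution includes integrability of `M₀` on the planes.) -/
structure IsAcceptable (ϑ d : ℝ) (M₀ : E3 → ℝ) : Prop where
  radial : ∀ v w : E3, ‖v‖ = ‖w‖ → M₀ v = M₀ w
  integral_eq_one : ∫ v, M₀ v = 1
  even : ∀ r : ℝ, reduced M₀ (-r) = reduced M₀ r
  pos : ∀ r : ℝ, 0 < reduced M₀ r
  deriv_neg : ∀ r : ℝ, 0 < r → deriv (reduced M₀) r < 0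
  exists_extension : ∃ m : ℂ → ℂ, AnalyticOnNhd ℂ m (region ϑ) ∧
    (∀ x : ℝ, m x = (reduced M₀ x : ℂ)) ∧
    (∀ z ∈ region ϑ, m z = m (-z) ∧ m z = (starRingEnd ℂ) (m ((starRingEnd ℂ) z))) ∧
    ∃ C : ℝ, ∀ z ∈ region ϑ, ‖m z‖ ≤ C * (1 + ‖z‖) ^ (-d)

/-- The `k`-th moment `∫ tᵏ m₀(t) dt` of the reduced distribution. -/
def moment (M₀ : E3 → ℝ) (k : ℕ) : ℝ :=
  ∫ t : ℝ, t ^ k * reduced M₀ t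

/-- The `k`-th moment of the reduced distribution is finite. -/
def HasFiniteMoment (M₀ : E3 → ℝ) (k : ℕ) : Prop :=
  Integrable (fun t : ℝ => t ^ k * reduced M₀ t)

/-- The Fourier transform `∫ M₀(v) e^{-i v·ξ} dv`. -/
def fourierHat (M₀ : E3 → ℝ) (ξ : E3) : ℂ :=
  ∫ v : E3, (M₀ v : ℂ) * Complex.exp (-Complex.I * ((inner ℝ v ξ : ℝ) : ℂ))

/-- The kernel `K(ξ,θ) = ∫₀^∞ t M̂₀(tξ) e^{-itθ} dt`. -/
def kernelK (M₀ : E3 → ℝ) (ξ : E3) (θ : ℝ) : ℂ :=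
  ∫ t in Ioi (0 : ℝ), (t : ℂ) * fourierHat M₀ (t • ξ) * Complex.exp (-Complex.I * t * θ)

/-- The distribution `δ₀(τ) + 1_{[0,∞)}(τ) f(τ)` in the variable `τ`, as a functional acting on
test functions `φ`. -/
def deltaPlus (f : ℝ → ℂ) (φ : ℝ → ℂ) : ℂ :=
  φ 0 + ∫ τ in Ici (0 : ℝ), f τ * φ τ

/-- The Green's function
`Ĝ(ξ,τ) = δ₀(τ) - 1_{[0,∞)}(τ) (1/2π) ∫_ℝ K(ξ,θ) / (1 + K(ξ,θ)) e^{iθτ} dθ`,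
for fixed `ξ` a distribution in `τ`. -/
def greenHat (M₀ : E3 → ℝ) (ξ : E3) : (ℝ → ℂ) → ℂ :=
  deltaPlus fun τ : ℝ =>
    -((1 / (2 * Real.pi) : ℝ) : ℂ) *
      ∫ θ : ℝ, kernelK M₀ ξ θ / (1 + kernelK M₀ ξ θ) * Complex.exp (Complex.I * θ * τ)

/-- `f` is ten times continuously differentiable on the open interval `(0, R)` and
`rᵃ |∂_rᵃ f(r)| ≤ C w(r)` there, for all `a ∈ {0, …, 10}`. -/
def SymbolBound {F : Type*} [NormedAddCommGroup F] [NormedSpace ℝ F]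
    (C : ℝ) (f : ℝ → F) (R : ℝ) (w : ℝ → ℝ) : Prop :=
  ContDiffOn ℝ 10 f (Ioo 0 R) ∧
    ∀ a : ℕ, a ≤ 10 → ∀ r ∈ Ioo 0 R, r ^ a * ‖iteratedDeriv a f r‖ ≤ C * w r

/-- The mixed derivatives `∂_τᵇ ∂_rᵃ E(r,τ)`. -/
def mixedDeriv (b a : ℕ) (E : ℝ → ℝ → ℂ) (r τ : ℝ) : ℂ :=
  iteratedDeriv b (fun t : ℝ => iteratedDeriv a (fun s : ℝ => E s t) r) τ

/-- For `r` in the open set `U` and `τ ≥ 0` the function `E(r,τ)` is continuous in `τ` and ten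
times continuously differentiable in `r`, the `r`-derivatives are differentiable in `τ > 0`, and
`τᵇ rᵃ |∂_τᵇ ∂_rᵃ E(r,τ)| ≤ C w(r)` for all `a ∈ {0, …, 10}`, `b ∈ {0, 1}`. (At `τ = 0` the bound
with `b = 1` is void, because of the factor `τ`.) -/
def KineticBound (C : ℝ) (E : ℝ → ℝ → ℂ) (U : Set ℝ) (w : ℝ → ℝ) : Prop :=
  (∀ r ∈ U, ContinuousOn (E r) (Ici 0)) ∧
  (∀ τ : ℝ, 0 ≤ τ → ContDiffOn ℝ 10 (fun s : ℝ => E s τ) U) ∧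
  (∀ a : ℕ, a ≤ 10 → ∀ r ∈ U,
    DifferentiableOn ℝ (fun t : ℝ => iteratedDeriv a (fun s : ℝ => E s t) r) (Ioi 0)) ∧
  ∀ a b : ℕ, a ≤ 10 → b ≤ 1 → ∀ τ : ℝ, 0 ≤ τ → ∀ r ∈ U,
    τ ^ b * r ^ a * ‖mixedDeriv b a E r τ‖ ≤ C * w r

end VlasovPoisson

end

open VlasovPoisson

/-! ### Holomorphic parameter integrals, and Cauchy estimates for the symbol and kinetic bounds -/

namespace VlasovPoisson
open Filter Topology Metric

/-! By radial symmetry K(ξ,θ) = k(θ/r)/r² with r = |ξ| and a single function k, the Laplace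
transform of t m̂₀(t). Shifting the integral that defines m̂₀ into the domain of analyticity of m₀
shows that k is holomorphic not only in the lower half plane but everywhere below a cone
(`kernelFun`, `lowerRegion`), and that it is O(|z|⁻²). Three facts about k carry the theorem. On the
real axis Im k = π m₀' (`HoloProfile.hasDerivAt_ofReal`), and k(0) > 0
(`HoloProfile.kernelFun_zero_re_pos`); this is Penrose's criterion, and r² + k has no real zeros
(`Dispersion.one_add_mul_ne_zero`). At infinity k(z) is −Σ (2j+1) a_{2j} z^{−2j−2} up to an error
governed by the tail exponent d (`HoloProfile.exists_norm_kernelFun_sub_main_le`).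

With θ = r sinh w the regular part of Ĝ becomes an integral over real w of k/(r²+k) · e^{irτ sinh w}
cosh w (`greenHat_eq`). This substitution turns cones into strips and powers into exponentials. The
line of integration is raised to Im w = α, where a factor e^{−γτr} can be split off. For r bounded
below there is no zero of r² + k in a thin strip, and only the raised integral remains
(`Dispersion.exists_high`). For small r the right half of the strip contains exactly one zero, and
its residue is the oscillating term (`Dispersion.low_frequency_eq`).

The zero is found by inverting F(v) = √(−k(1/v)), which is close to v on a sector
(`Dispersion.exists_branch`). With V = F⁻¹ the zero is z = 1/V(r), so ω(r) = r/V(r), and the residue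
gives the amplitude 1 + m_l = r²V'/V² = ω − rω'. A polynomial in r² that solves the truncated
dispersion relation, built coefficient by coefficient from the moments (`freqPoly`), is compared
with ω through the defect it leaves in the relation (`Branch.exists_norm_freq_sub_le`). The
two-sided bound for Im ω comes from comparing V(r) with a nearby real point, where Im k is known
exactly (`Branch.im_div_mem`).

The integral over the raised contour is small for small r because it vanishes for the model kernel
−1/(z²−c): on Im w = π/2 the model integrand is odd (`integral_modelIntegrand_eq_zero`). What is
left is controlled by the defect k(z)(z²−c)+1, with c = 0 in general and c = 3a₂ for d > 3
(`Dispersion.norm_contourPart_le_of_defect`). For d ≥ 4 absolute values would lose a logarithm at d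
= 4, and the leading part of the integral is instead evaluated by a second contour shift
(`Dispersion.lowContourBound_of_tail`).

Frequency, amplitude and remainder are holomorphic in r, the remainder also in τ, on sectors about
the positive axis. Bounds on their size therefore imply all the weighted bounds on derivatives, by
Cauchy's estimates on discs of radius proportional to r and τ (`symbolBound_of_holomorphic`,
`kineticBound_of_holomorphic`). -/

theorem differentiableOn_integral_of_dominated {α : Type*} [MeasurableSpace α] {μ : Measure α}
    {F : ℂ → α → ℂ} {U : Set ℂ} (hU : IsOpen U)
    (hm : ∀ z ∈ U, AEStronglyMeasurable (F z) μ)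
    (hd : ∀ a, DifferentiableOn ℂ (fun z => F z a) U)
    (hb : ∀ z ∈ U, ∃ ε > 0, ∃ g : α → ℝ, Integrable g μ ∧
      ∀ w ∈ ball z ε, ∀ a, ‖F w a‖ ≤ g a) :
    DifferentiableOn ℂ (fun z => ∫ a, F z a ∂μ) U := by
  intro z hz
  obtain ⟨ε₁, hε₁, g, hg, hbd⟩ := hb z hz
  obtain ⟨ε₂, hε₂, hsub⟩ := Metric.isOpen_iff.1 hU z hz
  set ε := min ε₁ ε₂ with hε
  have hεp : 0 < ε := lt_min hε₁ hε₂
  have hball : ∀ x ∈ ball z (ε / 2), closedBall x (ε / 4) ⊆ ball z ε := by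
    intro x hx y hy
    rw [mem_ball] at hx ⊢
    rw [mem_closedBall] at hy
    linarith [dist_triangle y x z]
  have hbU : ball z ε ⊆ U := (ball_subset_ball (min_le_right _ _)).trans hsub
  have hdiff : ∀ a, ∀ x ∈ ball z (ε / 2),
      HasDerivAt (fun z => F z a) (deriv (fun z => F z a) x) x := by
    intro a x hx
    have : x ∈ U := hbU (ball_subset_ball (by linarith) hx)
    exact ((hd a).differentiableAt (hU.mem_nhds this)).hasDerivAt
  -- Cauchy's estimate on discs of radius ε/4 turns the domination of F into a domination of its
  -- derivative, so nothing has to be assumed about the derivative.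
  have hbound : ∀ a, ∀ x ∈ ball z (ε / 2),
      ‖deriv (fun z => F z a) x‖ ≤ g a / (ε / 4) := by
    intro a x hx
    refine Complex.norm_deriv_le_of_forall_mem_sphere_norm_le (by positivity) ?_ ?_
    · exact ((hd a).mono ((hball x hx).trans hbU)).diffContOnCl_ball subset_rfl
    · intro y hy
      exact hbd y (ball_subset_ball (min_le_left _ _) (hball x hx (sphere_subset_closedBall hy))) a
  -- The derivative is measurable in a as the pointwise limit of difference quotients along a
  -- sequence of increments s n → 0.
  have hmeas' : AEStronglyMeasurable (fun a => deriv (fun z => F z a) z) μ := by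
    let s : ℕ → ℂ := fun n => (((ε / 2) * (1 / ((n : ℝ) + 2)) : ℝ) : ℂ)
    have hs0 : Tendsto s atTop (𝓝[≠] 0) := by
      rw [tendsto_nhdsWithin_iff]
      constructor
      · have h1 : Tendsto (fun n : ℕ => (ε / 2) * (1 / ((n : ℝ) + 2))) atTop (𝓝 0) := by
          have h2 := (tendsto_one_div_atTop_nhds_zero_nat (𝕜 := ℝ)).comp (tendsto_add_atTop_nat 2)
          have h3 := h2.const_mul (ε / 2)
          simpa [Function.comp_def] using h3
        have := (Complex.continuous_ofReal.tendsto 0).comp h1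
        simpa [Function.comp_def, s] using this
      · refine Eventually.of_forall fun n => ?_
        have : (0 : ℝ) < (ε / 2) * (1 / ((n : ℝ) + 2)) := by positivity
        simpa [s] using (Complex.ofReal_ne_zero.2 this.ne')
    have hsn : ∀ n, z + s n ∈ U := by
      intro n
      apply hbU
      rw [mem_ball, dist_eq_norm, add_sub_cancel_left, Complex.norm_real, Real.norm_eq_abs,
        abs_of_pos (by positivity)]
      have : 1 / ((n : ℝ) + 2) ≤ 1 := by
        rw [div_le_one (by positivity)]; linarith [n.cast_nonneg (α := ℝ)]
      nlinarith
    refine aestronglyMeasurable_of_tendsto_ae (u := atTop)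
      (f := fun n a => (s n)⁻¹ • (F (z + s n) a - F z a)) ?_ ?_
    · intro n
      exact AEStronglyMeasurable.const_smul (𝕜 := ℂ) ((hm _ (hsn n)).sub (hm z hz)) _
    · refine Eventually.of_forall fun a => ?_
      exact (hasDerivAt_iff_tendsto_slope_zero.1 (hdiff a z (mem_ball_self (by positivity)))).comp hs0
  have key := hasDerivAt_integral_of_dominated_loc_of_deriv_le
    (F := F) (F' := fun x a => deriv (fun z => F z a) x) (x₀ := z) (s := ball z (ε / 2))
    (bound := fun a => g a / (ε / 4)) (μ := μ)
    (ball_mem_nhds z (by positivity))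
    (eventually_of_mem (hU.mem_nhds hz) fun x hx => hm x hx)
    (hg.mono' (hm z hz) (Eventually.of_forall fun a => hbd z (mem_ball_self hε₁) a))
    hmeas' (Eventually.of_forall fun a x hx => hbound a x hx) (hg.div_const _)
    (Eventually.of_forall fun a x hx => hdiff a x hx)
  exact key.2.differentiableAt.differentiableWithinAt

theorem iteratedDeriv_ofReal {f : ℂ → ℂ} {U : Set ℂ} (hU : IsOpen U) (hf : DifferentiableOn ℂ f U)
    (n : ℕ) : ∀ r : ℝ, (r : ℂ) ∈ U →
      iteratedDeriv n (fun x : ℝ => f x) r = iteratedDeriv n f r := by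
  induction n with
  | zero => intro r _; simp
  | succ n ih =>
    intro r hr
    rw [iteratedDeriv_succ, iteratedDeriv_succ]
    have h1 : iteratedDeriv n (fun x : ℝ => f x) =ᶠ[𝓝 r] fun x : ℝ => iteratedDeriv n f x := by
      have : (fun x : ℝ => (x : ℂ)) ⁻¹' U ∈ 𝓝 r :=
        Complex.continuous_ofReal.continuousAt.preimage_mem_nhds (hU.mem_nhds hr)
      filter_upwards [this] with x hx using ih x hx
    rw [h1.deriv_eq]
    have h2 : AnalyticAt ℂ (iteratedDeriv n f) r := by
      rw [iteratedDeriv_eq_iterate]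
      exact (hf.analyticAt (hU.mem_nhds hr)).iterated_deriv n
    exact h2.differentiableAt.hasDerivAt.comp_ofReal.deriv

theorem contDiffAt_ofReal {f : ℂ → ℂ} {U : Set ℂ} (hU : IsOpen U) (hf : DifferentiableOn ℂ f U)
    (n : WithTop ℕ∞) {r : ℝ} (hr : (r : ℂ) ∈ U) : ContDiffAt ℝ n (fun x : ℝ => f x) r := by
  have h1 : ContDiffAt ℂ n f r := (hf.analyticAt (hU.mem_nhds hr)).contDiffAt
  have h2 : ContDiffAt ℝ n f r := h1.restrict_scalars ℝ
  exact h2.comp r Complex.ofRealCLM.contDiff.contDiffAt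

theorem norm_iteratedDeriv_ofReal_le {f : ℂ → ℂ} {r ρ M : ℝ} (hρ : 0 < ρ)
    (hf : DifferentiableOn ℂ f (ball (r : ℂ) ρ)) (hM : ∀ s ∈ ball (r : ℂ) ρ, ‖f s‖ ≤ M) (n : ℕ) :
    ‖iteratedDeriv n (fun x : ℝ => f x) r‖ ≤ n.factorial * M / (ρ / 2) ^ n := by
  rw [iteratedDeriv_ofReal isOpen_ball hf n r (mem_ball_self hρ)]
  have hsub : closedBall (r : ℂ) (ρ / 2) ⊆ ball (r : ℂ) ρ := closedBall_subset_ball (by linarith)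
  exact Complex.norm_iteratedDeriv_le_of_forall_mem_sphere_norm_le n (by positivity)
    ((hf.mono hsub).diffContOnCl_ball subset_rfl)
    fun z hz => hM z (hsub (sphere_subset_closedBall hz))

/-- The constant in the Cauchy estimates for the first ten derivatives on discs of radius `δ r`. -/
noncomputable def cauchyConst (δ : ℝ) : ℝ := (Nat.factorial 10 : ℝ) * (1 + 2 / δ) ^ 10

theorem cauchyConst_pos {δ : ℝ} (hδ : 0 < δ) : 0 < cauchyConst δ := by
  unfold cauchyConst; positivity

/-- On a disc of radius δr each derivative costs a multiple of 1/(δr), and the factor r^n removes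
it. The resulting constant depends on δ alone. -/
theorem pow_mul_norm_iteratedDeriv_le {f : ℂ → ℂ} {r δ M : ℝ} (hr : 0 < r) (hδ : 0 < δ)
    (hf : DifferentiableOn ℂ f (ball (r : ℂ) (δ * r)))
    (hM : ∀ s ∈ ball (r : ℂ) (δ * r), ‖f s‖ ≤ M) {n : ℕ} (hn : n ≤ 10) :
    r ^ n * ‖iteratedDeriv n (fun x : ℝ => f x) r‖ ≤ cauchyConst δ * M := by
  have hM0 : 0 ≤ M := (norm_nonneg _).trans (hM r (mem_ball_self (by positivity)))
  have h := norm_iteratedDeriv_ofReal_le (by positivity) hf hM n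
  calc r ^ n * ‖iteratedDeriv n (fun x : ℝ => f x) r‖
      ≤ r ^ n * (n.factorial * M / (δ * r / 2) ^ n) := by gcongr
    _ = n.factorial * (2 / δ) ^ n * M := by
      have : δ * r / 2 = r / (2 / δ) := by field_simp
      rw [this, div_pow]; field_simp
    _ ≤ cauchyConst δ * M := by
      unfold cauchyConst
      have h1 : (n.factorial : ℝ) ≤ Nat.factorial 10 := by
        exact_mod_cast Nat.factorial_le hn
      have h2 : (2 / δ) ^ n ≤ (1 + 2 / δ) ^ 10 := by
        have : 0 < 2 / δ := by positivity
        calc (2 / δ) ^ n ≤ (1 + 2 / δ) ^ n := by gcongr; linarith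
          _ ≤ (1 + 2 / δ) ^ 10 := pow_le_pow_right₀ (by linarith) hn
      gcongr

theorem symbolBound_of_holomorphic {f : ℂ → ℂ} {R δ C : ℝ} {w : ℝ → ℝ} (hδ : 0 < δ)
    (h : ∀ r ∈ Ioo 0 R, DifferentiableOn ℂ f (ball (r : ℂ) (δ * r)) ∧
      ∀ s ∈ ball (r : ℂ) (δ * r), ‖f s‖ ≤ C * w r) :
    SymbolBound (cauchyConst δ * C) (fun r : ℝ => f r) R w := by
  constructor
  · intro r hr
    have hp : 0 < δ * r := mul_pos hδ hr.1
    exact (contDiffAt_ofReal isOpen_ball (h r hr).1 10 (mem_ball_self hp)).contDiffWithinAt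
  · intro a ha r hr
    rw [mul_assoc]
    exact pow_mul_norm_iteratedDeriv_le hr.1 hδ (h r hr).1 (h r hr).2 ha

theorem SymbolBound.re {f : ℝ → ℂ} {R C : ℝ} {w : ℝ → ℝ} (h : SymbolBound C f R w) :
    SymbolBound C (fun r => (f r).re) R w := by
  refine ⟨Complex.reCLM.contDiff.comp_contDiffOn h.1, fun a ha r hr => ?_⟩
  refine le_trans ?_ (h.2 a ha r hr)
  have hr0 : (0 : ℝ) ≤ r := hr.1.le
  have hc : ContDiffAt ℝ a f r :=
    ((h.1.of_le (by exact_mod_cast ha)).contDiffAt (isOpen_Ioo.mem_nhds hr))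
  have : iteratedDeriv a (fun r => (f r).re) r = (iteratedDeriv a f r).re := by
    rw [iteratedDeriv_eq_iteratedFDeriv, iteratedDeriv_eq_iteratedFDeriv]
    have := Complex.reCLM.iteratedFDeriv_comp_left hc le_rfl
    simp only [Function.comp_def, Complex.reCLM_apply] at this
    rw [this]; rfl
  rw [this]
  gcongr
  exact Complex.abs_re_le_norm _

theorem SymbolBound.im {f : ℝ → ℂ} {R C : ℝ} {w : ℝ → ℝ} (h : SymbolBound C f R w) :
    SymbolBound C (fun r => (f r).im) R w := by
  refine ⟨Complex.imCLM.contDiff.comp_contDiffOn h.1, fun a ha r hr => ?_⟩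
  refine le_trans ?_ (h.2 a ha r hr)
  have hr0 : (0 : ℝ) ≤ r := hr.1.le
  have hc : ContDiffAt ℝ a f r :=
    ((h.1.of_le (by exact_mod_cast ha)).contDiffAt (isOpen_Ioo.mem_nhds hr))
  have : iteratedDeriv a (fun r => (f r).im) r = (iteratedDeriv a f r).im := by
    rw [iteratedDeriv_eq_iteratedFDeriv, iteratedDeriv_eq_iteratedFDeriv]
    have := Complex.imCLM.iteratedFDeriv_comp_left hc le_rfl
    simp only [Function.comp_def, Complex.imCLM_apply] at this
    rw [this]; rfl
  rw [this]
  gcongr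
  exact Complex.abs_im_le_norm _

theorem SymbolBound.congr {F : Type*} [NormedAddCommGroup F] [NormedSpace ℝ F] {f g : ℝ → F}
    {R C : ℝ} {w : ℝ → ℝ} (h : SymbolBound C f R w) (hfg : ∀ r ∈ Ioo 0 R, g r = f r) :
    SymbolBound C g R w := by
  refine ⟨h.1.congr hfg, fun a ha r hr => ?_⟩
  have : g =ᶠ[𝓝 r] f := by filter_upwards [isOpen_Ioo.mem_nhds hr] with x hx using hfg x hx
  rw [(this.iteratedDeriv_eq a)]
  exact h.2 a ha r hr

theorem SymbolBound.mono {F : Type*} [NormedAddCommGroup F] [NormedSpace ℝ F] {f : ℝ → F}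
    {R R' C C' : ℝ} {w w' : ℝ → ℝ} (h : SymbolBound C f R w) (hR : R' ≤ R)
    (hw : ∀ r ∈ Ioo 0 R', C * w r ≤ C' * w' r) :
    SymbolBound C' f R' w' :=
  ⟨h.1.mono (Ioo_subset_Ioo_right hR), fun a ha r hr =>
    (h.2 a ha r ⟨hr.1, hr.2.trans_le hR⟩).trans (hw r hr)⟩

/-- Cauchy's formula writes the derivative in s as an integral of E(·,t) over a fixed circle, and
such an integral is holomorphic in t. Separate holomorphy and one uniform bound suffice. -/
theorem differentiableOn_iteratedDeriv_param {E : ℂ → ℂ → ℂ} {c : ℂ} {ρ M : ℝ} {V : Set ℂ}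
    (hV : IsOpen V) (hρ : 0 < ρ) (h1 : ∀ t ∈ V, DifferentiableOn ℂ (fun s => E s t) (ball c ρ))
    (h2 : ∀ s ∈ ball c ρ, DifferentiableOn ℂ (E s) V)
    (hM : ∀ s ∈ ball c ρ, ∀ t ∈ V, ‖E s t‖ ≤ M) (n : ℕ) :
    DifferentiableOn ℂ (fun t => iteratedDeriv n (fun s => E s t) c) V := by
  have hρ2 : 0 < ρ / 2 := by positivity
  have hsub : closedBall c (ρ / 2) ⊆ ball c ρ := closedBall_subset_ball (by linarith)
  have hcm : ∀ θ : ℝ, circleMap c (ρ / 2) θ ∈ ball c ρ := fun θ =>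
    hsub (sphere_subset_closedBall (circleMap_mem_sphere c hρ2.le θ))
  have hfac : (2 * Real.pi * Complex.I / n.factorial : ℂ) ≠ 0 := by
    simp [Nat.factorial_ne_zero, Real.pi_ne_zero]
  set G : ℂ → ℝ → ℂ := fun t θ => deriv (circleMap c (ρ / 2)) θ •
    ((1 / (circleMap c (ρ / 2) θ - c) ^ (n + 1)) • E (circleMap c (ρ / 2) θ) t) with hG
  have hne : ∀ θ : ℝ, circleMap c (ρ / 2) θ - c ≠ 0 := fun θ => by
    rw [sub_ne_zero]; exact circleMap_ne_center hρ2.ne'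
  have hGn : ∀ t ∈ V, ∀ θ, ‖G t θ‖ ≤ ρ / 2 * ((1 / (ρ / 2) ^ (n + 1)) * M) := by
    intro t ht θ
    simp only [hG, norm_smul, deriv_circleMap, norm_mul, Complex.norm_I, mul_one, norm_div, norm_one,
      norm_pow, circleMap_sub_center, norm_circleMap_zero, abs_of_pos hρ2]
    gcongr
    exact hM _ (hcm θ) t ht
  have hc : DifferentiableOn ℂ (fun t => ∫ θ in Ioc 0 (2 * Real.pi), G t θ) V := by
    refine differentiableOn_integral_of_dominated hV ?_ ?_ ?_
    · intro t ht
      refine Continuous.aestronglyMeasurable ?_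
      simp only [hG, deriv_circleMap]
      have hcont : Continuous fun θ : ℝ => E (circleMap c (ρ / 2) θ) t := by
        rw [continuous_iff_continuousAt]
        intro θ
        have := ((h1 t ht).continuousOn.continuousAt (isOpen_ball.mem_nhds (hcm θ)))
        exact this.comp (f := circleMap c (ρ / 2)) (continuous_circleMap c _).continuousAt
      refine ((continuous_circleMap 0 _).mul continuous_const).smul
        (Continuous.smul (continuous_const.div (((continuous_circleMap c _).sub
          continuous_const).pow _) fun θ => pow_ne_zero _ (hne θ)) hcont)
    · intro θ
      simp only [hG, smul_eq_mul]
      exact ((h2 _ (hcm θ)).const_mul _).const_mul _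
    · intro t ht
      obtain ⟨ε, hε, hεV⟩ := Metric.isOpen_iff.1 hV t ht
      exact ⟨ε, hε, fun _ => _, integrable_const _, fun w hw a => hGn w (hεV hw) a⟩
  have heq : ∀ t ∈ V, iteratedDeriv n (fun s => E s t) c =
      (2 * Real.pi * Complex.I / n.factorial : ℂ)⁻¹ * ∫ θ in Ioc 0 (2 * Real.pi), G t θ := by
    intro t ht
    have := (((h1 t ht).mono hsub).diffContOnCl_ball
      subset_rfl).circleIntegral_one_div_sub_center_pow_smul hρ2 n
    rw [circleIntegral, intervalIntegral.integral_of_le (by positivity)] at this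
    rw [hG, this, smul_eq_mul, inv_mul_cancel_left₀ hfac]
  exact (hc.const_mul _).congr heq

/-- Cauchy's estimate is used twice, on discs of radius proportional to r and then to τ; the second
use costs 1/τ, which is the weight τ^b. The condition on t is a closed one, so that at τ = 0, where
the disc degenerates, it still gives the bound without a τ-derivative. -/
theorem kineticBound_of_holomorphic {E : ℂ → ℂ → ℂ} {U : Set ℝ} {δ C : ℝ} {w : ℝ → ℝ}
    (hU : ∀ r ∈ U, 0 < r) (hδ : 0 < δ)
    (hc : ∀ r ∈ U, ContinuousOn (fun τ : ℝ => E r τ) (Ici 0))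
    (hr : ∀ r ∈ U, ∀ τ : ℝ, 0 ≤ τ → ∀ t : ℂ, ‖t - τ‖ ≤ δ * τ →
      DifferentiableOn ℂ (fun s => E s t) (ball (r : ℂ) (δ * r)) ∧
      ∀ s ∈ ball (r : ℂ) (δ * r), ‖E s t‖ ≤ C * w r)
    (hτ : ∀ r ∈ U, ∀ τ : ℝ, 0 < τ → ∀ s ∈ ball (r : ℂ) (δ * r),
      DifferentiableOn ℂ (E s) (ball (τ : ℂ) (δ * τ))) :
    KineticBound (cauchyConst δ * (1 + 2 / δ) * C) (fun r τ => E r τ) U w := by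
  have hr0 : ∀ r ∈ U, ∀ τ : ℝ, 0 ≤ τ →
      DifferentiableOn ℂ (fun s => E s τ) (ball (r : ℂ) (δ * r)) ∧
      ∀ s ∈ ball (r : ℂ) (δ * r), ‖E s τ‖ ≤ C * w r := fun r hrU τ hτ0 =>
    hr r hrU τ hτ0 τ (by simpa using mul_nonneg hδ.le hτ0)
  have hCw : ∀ r ∈ U, 0 ≤ C * w r := fun r hrU => (norm_nonneg _).trans
    ((hr0 r hrU 0 le_rfl).2 r (mem_ball_self (mul_pos hδ (hU r hrU))))
  have hmem : ∀ τ : ℝ, ∀ t ∈ ball (τ : ℂ) (δ * τ), ‖t - τ‖ ≤ δ * τ := fun τ t ht => by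
    rw [mem_ball, dist_eq_norm] at ht; exact ht.le
  have hrest : ∀ r ∈ U, ∀ τ : ℝ, 0 < τ → ∀ a, DifferentiableOn ℂ
      (fun t => iteratedDeriv a (fun s => E s t) (r : ℂ)) (ball (τ : ℂ) (δ * τ)) := by
    intro r hrU τ hτ0 a
    exact differentiableOn_iteratedDeriv_param isOpen_ball (mul_pos hδ (hU r hrU))
      (fun t ht => (hr r hrU τ hτ0.le t (hmem τ t ht)).1) (hτ r hrU τ hτ0)
      (fun s hs t ht => (hr r hrU τ hτ0.le t (hmem τ t ht)).2 s hs) a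
  have heq : ∀ r ∈ U, ∀ a, ∀ τ : ℝ, 0 ≤ τ → iteratedDeriv a (fun s : ℝ => E s τ) r =
      iteratedDeriv a (fun s => E s τ) (r : ℂ) := fun r hrU a τ hτ0 =>
    iteratedDeriv_ofReal isOpen_ball (hr0 r hrU τ hτ0).1 a r
      (mem_ball_self (mul_pos hδ (hU r hrU)))
  have hev : ∀ r ∈ U, ∀ a, ∀ τ : ℝ, 0 < τ → (fun t : ℝ => iteratedDeriv a (fun s : ℝ => E s t) r)
      =ᶠ[𝓝 τ] fun t : ℝ => iteratedDeriv a (fun s => E s (t : ℂ)) (r : ℂ) := by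
    intro r hrU a τ hτ0
    filter_upwards [Ioi_mem_nhds hτ0] with t ht using heq r hrU a t (le_of_lt ht)
  have hda : ∀ r ∈ U, ∀ a, ∀ τ : ℝ, 0 < τ → HasDerivAt
      (fun t : ℝ => iteratedDeriv a (fun s : ℝ => E s t) r)
      (deriv (fun t : ℂ => iteratedDeriv a (fun s => E s t) (r : ℂ)) τ) τ := by
    intro r hrU a τ hτ0
    have h1 := (hrest r hrU τ hτ0 a).differentiableAt
      (isOpen_ball.mem_nhds (mem_ball_self (mul_pos hδ hτ0)))
    exact (h1.hasDerivAt.comp_ofReal).congr_of_eventuallyEq (hev r hrU a τ hτ0)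
  have hK := cauchyConst_pos hδ
  have hd2 : 0 < 2 / δ := by positivity
  refine ⟨hc, ?_, ?_, ?_⟩
  · intro τ hτ0 r hrU
    exact (contDiffAt_ofReal isOpen_ball (hr0 r hrU τ hτ0).1 10
      (mem_ball_self (mul_pos hδ (hU r hrU)))).contDiffWithinAt
  · intro a _ r hrU τ hτ0
    exact (hda r hrU a τ hτ0).differentiableAt.differentiableWithinAt
  · intro a b ha hb τ hτ0 r hrU
    have hrp := hU r hrU
    have hCw' := hCw r hrU
    rcases Nat.le_one_iff_eq_zero_or_eq_one.1 hb with rfl | rfl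
    · have h1 := pow_mul_norm_iteratedDeriv_le hrp hδ (hr0 r hrU τ hτ0).1 (hr0 r hrU τ hτ0).2 ha
      simp only [mixedDeriv, pow_zero, one_mul, iteratedDeriv_zero]
      refine h1.trans ?_
      calc cauchyConst δ * (C * w r) = cauchyConst δ * 1 * (C * w r) := by ring
        _ ≤ cauchyConst δ * (1 + 2 / δ) * (C * w r) := by gcongr; linarith
        _ = _ := by ring
    · rcases hτ0.eq_or_lt with rfl | hτp
      · simp only [pow_one, zero_mul]
        have : 0 ≤ cauchyConst δ * (1 + 2 / δ) * (C * w r) := by positivity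
        linarith
      · have hmd : mixedDeriv 1 a (fun r τ : ℝ => E r τ) r τ =
            deriv (fun t : ℂ => iteratedDeriv a (fun s => E s t) (r : ℂ)) τ := by
          simp only [mixedDeriv, iteratedDeriv_one]
          exact (hda r hrU a τ hτp).deriv
        have hb : ∀ t ∈ ball (τ : ℂ) (δ * τ), ‖iteratedDeriv a (fun s => E s t) (r : ℂ)‖ ≤
            cauchyConst δ * (C * w r) / r ^ a := by
          intro t ht
          have h3 := hr r hrU τ hτ0 t (hmem τ t ht)
          have h1 := pow_mul_norm_iteratedDeriv_le hrp hδ h3.1 h3.2 ha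
          rw [iteratedDeriv_ofReal isOpen_ball h3.1 a r (mem_ball_self (mul_pos hδ hrp))] at h1
          rw [le_div_iff₀ (by positivity)]; linarith
        have h4 : ‖deriv (fun t : ℂ => iteratedDeriv a (fun s => E s t) (r : ℂ)) τ‖ ≤
            cauchyConst δ * (C * w r) / r ^ a / (δ * τ / 2) := by
          have hsub : closedBall (τ : ℂ) (δ * τ / 2) ⊆ ball (τ : ℂ) (δ * τ) :=
            closedBall_subset_ball (by nlinarith [mul_pos hδ hτp])
          exact Complex.norm_deriv_le_of_forall_mem_sphere_norm_le (by positivity)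
            (((hrest r hrU τ hτp a).mono hsub).diffContOnCl_ball subset_rfl)
            fun z hz => hb z (hsub (sphere_subset_closedBall hz))
        rw [hmd, pow_one]
        calc τ * r ^ a * _ ≤ τ * r ^ a * (cauchyConst δ * (C * w r) / r ^ a / (δ * τ / 2)) := by
              gcongr
          _ = cauchyConst δ * (2 / δ) * (C * w r) := by field_simp
          _ ≤ cauchyConst δ * (1 + 2 / δ) * (C * w r) := by gcongr; linarith
          _ = _ := by ring

/-! ### Exponential weights and the geometry of the hyperbolic sine on strips -/

theorem integrable_exp_neg_mul_abs {p : ℝ} (hp : 0 < p) :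
    Integrable (fun u : ℝ => Real.exp (-p * |u|)) := by
  rw [← integrableOn_univ, ← Iic_union_Ioi (a := (0 : ℝ)), integrableOn_union]
  have h1 := integrableOn_exp_mul_Ioi (a := -p) (by linarith) 0
  have h1' : IntegrableOn (fun u : ℝ => Real.exp (-p * |u|)) (Ioi 0) :=
    h1.congr_fun (fun u hu => by simp only [abs_of_pos (mem_Ioi.1 hu)]) measurableSet_Ioi
  refine ⟨?_, h1'⟩
  have h2 : IntegrableOn (fun u : ℝ => Real.exp (-p * |(-u)|)) (Ioi 0) := by simpa using h1'
  have h3 := (IntegrableOn.comp_neg_Iio (c := (0 : ℝ))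
    (f := fun u : ℝ => Real.exp (-p * |u|)) (by simpa using h1'))
  rw [← integrableOn_Iic_iff_integrableOn_Iio] at h3
  simpa using h3

theorem cosh_le_exp_abs (u : ℝ) : Real.cosh u ≤ Real.exp |u| := by
  rw [← Real.cosh_abs, Real.cosh_eq]
  have : Real.exp (-|u|) ≤ Real.exp |u| := Real.exp_le_exp.2 (by linarith [abs_nonneg u])
  linarith

theorem exp_abs_le_cosh (u : ℝ) : Real.exp |u| ≤ 2 * Real.cosh u := by
  rw [← Real.cosh_abs, Real.cosh_eq]
  linarith [Real.exp_pos (-|u|)]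

section sinh

variable (w : ℂ)

theorem sinh_re : (Complex.sinh w).re = Real.sinh w.re * Real.cos w.im := by
  conv_lhs => rw [← Complex.re_add_im w, Complex.sinh_add, Complex.sinh_mul_I, Complex.cosh_mul_I]
  simp [← Complex.ofReal_sinh, ← Complex.ofReal_cosh, ← Complex.ofReal_sin, ← Complex.ofReal_cos]

theorem sinh_im : (Complex.sinh w).im = Real.cosh w.re * Real.sin w.im := by
  conv_lhs => rw [← Complex.re_add_im w, Complex.sinh_add, Complex.sinh_mul_I, Complex.cosh_mul_I]
  simp [← Complex.ofReal_sinh, ← Complex.ofReal_cosh, ← Complex.ofReal_sin, ← Complex.ofReal_cos]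

theorem cosh_re : (Complex.cosh w).re = Real.cosh w.re * Real.cos w.im := by
  conv_lhs => rw [← Complex.re_add_im w, Complex.cosh_add, Complex.sinh_mul_I, Complex.cosh_mul_I]
  simp [← Complex.ofReal_sinh, ← Complex.ofReal_cosh, ← Complex.ofReal_sin, ← Complex.ofReal_cos]

theorem cosh_im : (Complex.cosh w).im = Real.sinh w.re * Real.sin w.im := by
  conv_lhs => rw [← Complex.re_add_im w, Complex.cosh_add, Complex.sinh_mul_I, Complex.cosh_mul_I]
  simp [← Complex.ofReal_sinh, ← Complex.ofReal_cosh, ← Complex.ofReal_sin, ← Complex.ofReal_cos]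

theorem norm_sinh_sq : ‖Complex.sinh w‖ ^ 2 = Real.sinh w.re ^ 2 + Real.sin w.im ^ 2 := by
  rw [Complex.sq_norm, Complex.normSq_apply, sinh_re, sinh_im]
  nlinarith [Real.cosh_sq w.re, Real.sin_sq_add_cos_sq w.im]

theorem norm_cosh_sq : ‖Complex.cosh w‖ ^ 2 = Real.sinh w.re ^ 2 + Real.cos w.im ^ 2 := by
  rw [Complex.sq_norm, Complex.normSq_apply, cosh_re, cosh_im]
  nlinarith [Real.cosh_sq w.re, Real.sin_sq_add_cos_sq w.im]

theorem norm_sinh_le : ‖Complex.sinh w‖ ≤ Real.cosh w.re := by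
  refine abs_le_of_sq_le_sq' ?_ (Real.cosh_pos _).le |>.2
  rw [norm_sinh_sq, Real.cosh_sq]
  linarith [Real.sin_sq_le_one w.im]

theorem norm_cosh_le : ‖Complex.cosh w‖ ≤ Real.cosh w.re := by
  refine abs_le_of_sq_le_sq' ?_ (Real.cosh_pos _).le |>.2
  rw [norm_cosh_sq, Real.cosh_sq]
  linarith [Real.cos_sq_le_one w.im]

theorem abs_sinh_le_norm_sinh : |Real.sinh w.re| ≤ ‖Complex.sinh w‖ := by
  refine abs_le_of_sq_le_sq' ?_ (norm_nonneg _) |>.2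
  rw [norm_sinh_sq, sq_abs]
  linarith [sq_nonneg (Real.sin w.im)]

theorem cosh_le_one_add_abs_sinh (u : ℝ) : Real.cosh u ≤ 1 + |Real.sinh u| := by
  refine abs_le_of_sq_le_sq' ?_ (by positivity) |>.2
  rw [Real.cosh_sq]
  nlinarith [abs_nonneg (Real.sinh u), sq_abs (Real.sinh u)]

theorem cosh_le_one_add_norm_sinh : Real.cosh w.re ≤ 1 + ‖Complex.sinh w‖ :=
  (cosh_le_one_add_abs_sinh _).trans (by linarith [abs_sinh_le_norm_sinh w])

theorem cosh_ne_zero {w : ℂ} (h : |w.im| < Real.pi / 2) : Complex.cosh w ≠ 0 := by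
  intro h0
  have h1 := congrArg Complex.re h0
  rw [cosh_re, Complex.zero_re] at h1
  have : 0 < Real.cos w.im := Real.cos_pos_of_mem_Ioo (abs_lt.1 h)
  exact (mul_pos (Real.cosh_pos _) this).ne' h1

theorem sinh_eq_zero_of_abs_im_lt {w : ℂ} (h : |w.im| < Real.pi) (h0 : Complex.sinh w = 0) :
    w = 0 := by
  have h1 := norm_sinh_sq w
  rw [h0, norm_zero] at h1
  have h2 : Real.sinh w.re = 0 := by nlinarith [sq_nonneg (Real.sinh w.re), sq_nonneg (Real.sin w.im)]
  have h3 : Real.sin w.im = 0 := by nlinarith [sq_nonneg (Real.sinh w.re), sq_nonneg (Real.sin w.im)]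
  rw [Real.sinh_eq_zero] at h2
  rw [Real.sin_eq_zero_iff_of_lt_of_lt (abs_lt.1 h).1 (abs_lt.1 h).2] at h3
  exact Complex.ext h2 h3

/-- The difference of the two values is 2 cosh((w₁+w₂)/2) sinh((w₁−w₂)/2); on the strip the first
factor has no zeros and the second only the trivial one. -/
theorem sinh_injOn_strip {w₁ w₂ : ℂ} (h₁ : |w₁.im| < Real.pi / 2) (h₂ : |w₂.im| < Real.pi / 2)
    (h : Complex.sinh w₁ = Complex.sinh w₂) : w₁ = w₂ := by
  rw [abs_lt] at h₁ h₂
  have e : Complex.sinh w₁ - Complex.sinh w₂ =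
      2 * Complex.cosh ((w₁ + w₂) / 2) * Complex.sinh ((w₁ - w₂) / 2) := by
    have e1 : w₁ = (w₁ + w₂) / 2 + (w₁ - w₂) / 2 := by ring
    have e2 : w₂ = (w₁ + w₂) / 2 - (w₁ - w₂) / 2 := by ring
    conv_lhs => rw [e1, e2, Complex.sinh_add, Complex.sinh_sub]
    ring_nf
  rw [h, sub_self] at e
  have hc : Complex.cosh ((w₁ + w₂) / 2) ≠ 0 := by
    apply cosh_ne_zero
    rw [show ((w₁ + w₂) / 2).im = (w₁.im + w₂.im) / 2 by simp, abs_lt]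
    constructor <;> linarith
  have hs : Complex.sinh ((w₁ - w₂) / 2) = 0 := by
    rcases mul_eq_zero.1 e.symm with h3 | h3
    · exact absurd ((mul_eq_zero.1 h3).resolve_left two_ne_zero) hc
    · exact h3
  have := sinh_eq_zero_of_abs_im_lt (by
    rw [show ((w₁ - w₂) / 2).im = (w₁.im - w₂.im) / 2 by simp, abs_lt]
    constructor <;> linarith [Real.pi_pos]) hs
  linear_combination 2 * this

/-- Every point of the first quadrant is `sinh w` with `w` in a half-strip of height `π / 2`. -/
theorem exists_sinh_eq {z : ℂ} (hx : 0 < z.re) (hy : 0 < z.im) :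
    ∃ w : ℂ, Complex.sinh w = z ∧ 0 < w.re ∧ 0 < w.im ∧ w.im < Real.pi / 2 := by
  obtain ⟨w, hw⟩ : ∃ w, Complex.sinh w = z := by
    obtain ⟨v, hv⟩ := Complex.sin_surjective (z * Complex.I)
    refine ⟨-(v * Complex.I), ?_⟩
    rw [Complex.sinh_neg, Complex.sinh_mul_I, hv, mul_assoc, Complex.I_mul_I]; ring
  have hper : ∀ n : ℤ, Complex.sinh (w - n * (2 * Real.pi * Complex.I)) = z := by
    intro n
    rw [← hw, Complex.sinh, Complex.sinh, neg_sub, Complex.exp_sub, Complex.exp_sub,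
      Complex.exp_int_mul_two_pi_mul_I, Complex.exp_neg]
    simp
  -- Periodicity brings the imaginary part into [−π/2, 3π/2); the sign of Im z then leaves (0, π).
  obtain ⟨n, ⟨hn1, hn2⟩, -⟩ := existsUnique_sub_zsmul_mem_Ico Real.two_pi_pos w.im (-(Real.pi / 2))
  set w' := w - n * (2 * Real.pi * Complex.I) with hw'
  have hz' : Complex.sinh w' = z := hper n
  have him : w'.im = w.im - n * (2 * Real.pi) := by simp [hw']
  rw [zsmul_eq_mul] at hn1 hn2
  rw [← him] at hn1 hn2
  have hre := sinh_re w'; have himm := sinh_im w'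
  rw [hz'] at hre himm
  have hsin : 0 < Real.sin w'.im := by
    rw [himm] at hy; exact (pos_iff_pos_of_mul_pos hy).1 (Real.cosh_pos _)
  have hlow : 0 < w'.im := by
    by_contra hc
    have := Real.sin_nonpos_of_nonpos_of_neg_pi_le (not_lt.1 hc) (by linarith [Real.pi_pos])
    linarith
  have hup : w'.im < Real.pi := by
    by_contra hc
    have h1 : Real.sin w'.im = -Real.sin (w'.im - Real.pi) := by rw [Real.sin_sub_pi, neg_neg]
    have := Real.sin_nonneg_of_nonneg_of_le_pi (x := w'.im - Real.pi) (by linarith) (by linarith)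
    linarith
  have hne : w'.im ≠ Real.pi / 2 := by
    intro h; rw [h, Real.cos_pi_div_two, mul_zero] at hre; linarith
  rcases lt_or_gt_of_ne hne with hlt | hgt
  · have hcos : 0 < Real.cos w'.im := Real.cos_pos_of_mem_Ioo ⟨by linarith, hlt⟩
    refine ⟨w', hz', ?_, hlow, hlt⟩
    rw [hre] at hx
    exact Real.sinh_pos_iff.1 ((pos_iff_pos_of_mul_pos hx).2 hcos)
  -- The imaginary part lies between π/2 and π. The reflection w ↦ πi − w preserves sinh and moves
  -- it below π/2.
  · have hcos : Real.cos w'.im < 0 :=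
      Real.cos_neg_of_pi_div_two_lt_of_lt hgt (by linarith [Real.pi_pos])
    refine ⟨Real.pi * Complex.I - w', ?_, ?_, ?_, ?_⟩
    · rw [Complex.sinh_sub, Complex.sinh_mul_I, Complex.cosh_mul_I, ← hz']; simp
    · rw [hre] at hx
      have : Real.sinh w'.re < 0 := by nlinarith
      simpa using Real.sinh_neg_iff.1 this
    · simpa using hup
    · simp; linarith

end sinh

/-! ### Contour integrals: rectangles, one simple pole, shifts of a horizontal line -/

section contours

variable {f : ℂ → ℂ}

theorem integral_boundary_rect_eq_zero {x₁ x₂ y₁ y₂ : ℝ} (hx : x₁ ≤ x₂) (hy : y₁ ≤ y₂)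
    (hf : ∀ w : ℂ, x₁ ≤ w.re → w.re ≤ x₂ → y₁ ≤ w.im → w.im ≤ y₂ → DifferentiableAt ℂ f w) :
    (∫ x in x₁..x₂, f (x + y₁ * Complex.I)) - (∫ x in x₁..x₂, f (x + y₂ * Complex.I)) +
      Complex.I * (∫ y in y₁..y₂, f (x₂ + y * Complex.I)) -
      Complex.I * (∫ y in y₁..y₂, f (x₁ + y * Complex.I)) = 0 := by
  have := Complex.integral_boundary_rect_eq_zero_of_differentiableOn f ⟨x₁, y₁⟩ ⟨x₂, y₂⟩ ?_
  · simpa using this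
  · intro w hw
    rw [Complex.mem_reProdIm] at hw
    simp only [uIcc_of_le hx, uIcc_of_le hy] at hw
    exact (hf w hw.1.1 hw.1.2 hw.2.1 hw.2.2).differentiableWithinAt

/-- Each side has a logarithm as primitive. On the left side, which crosses the branch cut, the
logarithm of the negated argument is used; its two differences from the principal branch, +πi and
−πi at the two corners, add up to 2πi. -/
theorem integral_boundary_rect_inv {x₁ x₂ y₁ y₂ : ℝ} {c : ℂ} (hx₁ : x₁ < c.re) (hx₂ : c.re < x₂)
    (hy₁ : y₁ < c.im) (hy₂ : c.im < y₂) :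
    (∫ x in x₁..x₂, ((x + y₁ * Complex.I) - c : ℂ)⁻¹) -
      (∫ x in x₁..x₂, ((x + y₂ * Complex.I) - c : ℂ)⁻¹) +
      Complex.I * (∫ y in y₁..y₂, ((x₂ + y * Complex.I) - c : ℂ)⁻¹) -
      Complex.I * (∫ y in y₁..y₂, ((x₁ + y * Complex.I) - c : ℂ)⁻¹) =
      2 * Real.pi * Complex.I := by
  have horiz : ∀ y : ℝ, y ≠ c.im → (∫ x in x₁..x₂, ((x + y * Complex.I) - c : ℂ)⁻¹) =
      Complex.log (x₂ + y * Complex.I - c) - Complex.log (x₁ + y * Complex.I - c) := by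
    intro y hy
    have hs : ∀ x : ℝ, (x + y * Complex.I - c : ℂ) ∈ Complex.slitPlane := fun x =>
      Or.inr (by simpa [sub_eq_zero] using hy)
    refine intervalIntegral.integral_eq_sub_of_hasDerivAt
      (f := fun x : ℝ => Complex.log (x + y * Complex.I - c)) ?_ ?_
    · intro x _
      have : HasDerivAt (fun x : ℝ => (x + y * Complex.I - c : ℂ)) 1 x :=
        ((Complex.ofRealCLM.hasDerivAt (x := x)).add_const _).sub_const _
      simpa using this.clog_real (hs x)
    · refine ContinuousOn.intervalIntegrable ?_
      refine ContinuousOn.inv₀ (by fun_prop) fun x _ => Complex.slitPlane_ne_zero (hs x)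
  have vert : ∀ (s : ℝ) (x : ℝ), s ≠ 0 → 0 < s * (x - c.re) →
      Complex.I * (∫ y in y₁..y₂, ((x + y * Complex.I) - c : ℂ)⁻¹) =
      Complex.log (s * (x + y₂ * Complex.I - c)) - Complex.log (s * (x + y₁ * Complex.I - c)) := by
    intro s x hs0 hx
    have hs : ∀ y : ℝ, (s * (x + y * Complex.I - c) : ℂ) ∈ Complex.slitPlane := fun y =>
      Or.inl (by simpa using hx)
    have hsC : (s : ℂ) ≠ 0 := by exact_mod_cast hs0
    rw [← intervalIntegral.integral_const_mul]
    refine intervalIntegral.integral_eq_sub_of_hasDerivAt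
      (f := fun y : ℝ => Complex.log (s * (x + y * Complex.I - c))) ?_ ?_
    · intro y _
      have h1 : HasDerivAt (fun y : ℝ => (s * (x + y * Complex.I - c) : ℂ)) (s * (1 * Complex.I)) y :=
        ((((Complex.ofRealCLM.hasDerivAt (x := y)).mul_const Complex.I).const_add _).sub_const
          _).const_mul _
      have h2 := h1.clog_real (hs y)
      rwa [one_mul, mul_div_mul_left _ _ hsC, div_eq_mul_inv] at h2
    · refine ContinuousOn.intervalIntegrable ?_
      refine continuousOn_const.mul (ContinuousOn.inv₀ (by fun_prop) fun y _ => ?_)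
      exact right_ne_zero_of_mul (Complex.slitPlane_ne_zero (hs y))
  have v2 := vert 1 x₂ one_ne_zero (by linarith)
  have v1 := vert (-1) x₁ (by norm_num) (by linarith)
  rw [horiz y₁ hy₁.ne, horiz y₂ hy₂.ne', v1, v2]
  have hT : Complex.log (((-1 : ℝ) : ℂ) * (x₁ + y₂ * Complex.I - c)) =
      Complex.log (x₁ + y₂ * Complex.I - c) - Real.pi * Complex.I := by
    have him : 0 < (x₁ + y₂ * Complex.I - c : ℂ).im := by simpa using hy₂
    simp only [Complex.log, Complex.ofReal_neg, Complex.ofReal_one, neg_one_mul, norm_neg,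
      Complex.arg_neg_eq_arg_sub_pi_of_im_pos him]
    push_cast; ring
  have hB : Complex.log (((-1 : ℝ) : ℂ) * (x₁ + y₁ * Complex.I - c)) =
      Complex.log (x₁ + y₁ * Complex.I - c) + Real.pi * Complex.I := by
    have him : (x₁ + y₁ * Complex.I - c : ℂ).im < 0 := by simpa using hy₁
    simp only [Complex.log, Complex.ofReal_neg, Complex.ofReal_one, neg_one_mul, norm_neg,
      Complex.arg_neg_eq_arg_add_pi_of_im_neg him]
    push_cast; ring
  rw [hT, hB]
  simp only [Complex.ofReal_one, one_mul]
  ring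

/-- The residue theorem for a quotient with one simple pole in a rectangle. -/
theorem integral_boundary_rect_div {N D : ℂ → ℂ} {V : Set ℂ} (hV : IsOpen V)
    {x₁ x₂ y₁ y₂ : ℝ} {c : ℂ} (hx₁ : x₁ < c.re) (hx₂ : c.re < x₂) (hy₁ : y₁ < c.im)
    (hy₂ : c.im < y₂)
    (hsub : ∀ w : ℂ, x₁ ≤ w.re → w.re ≤ x₂ → y₁ ≤ w.im → w.im ≤ y₂ → w ∈ V)
    (hN : DifferentiableOn ℂ N V) (hD : DifferentiableOn ℂ D V) (hDc : D c = 0)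
    (hDc' : deriv D c ≠ 0)
    (hne : ∀ w : ℂ, x₁ ≤ w.re → w.re ≤ x₂ → y₁ ≤ w.im → w.im ≤ y₂ → D w = 0 → w = c) :
    (∫ x in x₁..x₂, N (x + y₁ * Complex.I) / D (x + y₁ * Complex.I)) -
      (∫ x in x₁..x₂, N (x + y₂ * Complex.I) / D (x + y₂ * Complex.I)) +
      Complex.I * (∫ y in y₁..y₂, N (x₂ + y * Complex.I) / D (x₂ + y * Complex.I)) -
      Complex.I * (∫ y in y₁..y₂, N (x₁ + y * Complex.I) / D (x₁ + y * Complex.I)) =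
      2 * Real.pi * Complex.I * (N c / deriv D c) := by
  have hx := (hx₁.trans hx₂).le
  have hy := (hy₁.trans hy₂).le
  have hcV : c ∈ V := hsub c hx₁.le hx₂.le hy₁.le hy₂.le
  have hVc : V ∈ 𝓝 c := hV.mem_nhds hcV
  -- D(w) = (w−c) q(w) with q free of zeros on the rectangle. Hence N/D is a holomorphic function
  -- plus (N/q)(c)/(w−c), and q(c) = D'(c).
  set q := dslope D c with hq
  have hqd : DifferentiableOn ℂ q V := (Complex.differentiableOn_dslope hVc).2 hD
  have hDq : ∀ w, D w = (w - c) * q w := by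
    intro w
    have := sub_smul_dslope D c w
    rw [hDc, sub_zero, smul_eq_mul] at this
    exact this.symm
  have hqc : q c = deriv D c := dslope_same D c
  have hqne : ∀ w : ℂ, x₁ ≤ w.re → w.re ≤ x₂ → y₁ ≤ w.im → w.im ≤ y₂ → q w ≠ 0 := by
    intro w h1 h2 h3 h4 h0
    have := hne w h1 h2 h3 h4 (by rw [hDq, h0, mul_zero])
    rw [this, hqc] at h0
    exact hDc' h0
  set V' := V ∩ q ⁻¹' {0}ᶜ with hV'
  have hV'o : IsOpen V' := hqd.continuousOn.isOpen_inter_preimage hV isOpen_compl_singleton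
  have hsub' : ∀ w : ℂ, x₁ ≤ w.re → w.re ≤ x₂ → y₁ ≤ w.im → w.im ≤ y₂ → w ∈ V' :=
    fun w h1 h2 h3 h4 => ⟨hsub w h1 h2 h3 h4, hqne w h1 h2 h3 h4⟩
  have hcV' : V' ∈ 𝓝 c := hV'o.mem_nhds (hsub' c hx₁.le hx₂.le hy₁.le hy₂.le)
  set h := fun w => N w / q w with hh
  have hhd : DifferentiableOn ℂ h V' :=
    (hN.mono inter_subset_left).div (hqd.mono inter_subset_left) fun w hw => hw.2
  set g := dslope h c with hg
  have hgd : DifferentiableOn ℂ g V' := (Complex.differentiableOn_dslope hcV').2 hhd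
  have hdec : ∀ w, w ≠ c → N w / D w = g w + h c * (w - c)⁻¹ := by
    intro w hw
    have hwc : w - c ≠ 0 := sub_ne_zero.2 hw
    have h1 : N w / D w = h w / (w - c) := by
      rw [hDq, hh]; simp only; rw [div_div, mul_comm]
    rw [h1, hg, dslope_of_ne _ hw, slope_def_field]
    field_simp; ring
  have hgz := integral_boundary_rect_eq_zero hx hy (f := g) fun w h1 h2 h3 h4 =>
    hgd.differentiableAt (hV'o.mem_nhds (hsub' w h1 h2 h3 h4))
  have hiz := integral_boundary_rect_inv hx₁ hx₂ hy₁ hy₂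
  have hgc := hgd.continuousOn
  have hor : ∀ y : ℝ, y ≠ c.im → y₁ ≤ y → y ≤ y₂ →
      (∫ x in x₁..x₂, N (x + y * Complex.I) / D (x + y * Complex.I)) =
      (∫ x in x₁..x₂, g (x + y * Complex.I)) +
        h c * ∫ x in x₁..x₂, ((x + y * Complex.I) - c : ℂ)⁻¹ := by
    intro y hyc h1 h2
    have hnc : ∀ x : ℝ, (x + y * Complex.I : ℂ) ≠ c := fun x hxe => hyc (by rw [← hxe]; simp)
    rw [← intervalIntegral.integral_const_mul, ← intervalIntegral.integral_add]
    · exact intervalIntegral.integral_congr fun x _ => hdec _ (hnc x)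
    · refine ContinuousOn.intervalIntegrable (hgc.comp (by fun_prop) fun x hxm => ?_)
      rw [uIcc_of_le hx] at hxm
      exact hsub' _ (by simpa using hxm.1) (by simpa using hxm.2) (by simpa) (by simpa)
    · refine ContinuousOn.intervalIntegrable (continuousOn_const.mul
        (ContinuousOn.inv₀ (by fun_prop) fun x _ => sub_ne_zero.2 (hnc x)))
  have ver : ∀ x : ℝ, x ≠ c.re → x₁ ≤ x → x ≤ x₂ →
      (∫ y in y₁..y₂, N (x + y * Complex.I) / D (x + y * Complex.I)) =
      (∫ y in y₁..y₂, g (x + y * Complex.I)) +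
        h c * ∫ y in y₁..y₂, ((x + y * Complex.I) - c : ℂ)⁻¹ := by
    intro x hxc h1 h2
    have hnc : ∀ y : ℝ, (x + y * Complex.I : ℂ) ≠ c := fun y hye => hxc (by rw [← hye]; simp)
    rw [← intervalIntegral.integral_const_mul, ← intervalIntegral.integral_add]
    · exact intervalIntegral.integral_congr fun y _ => hdec _ (hnc y)
    · refine ContinuousOn.intervalIntegrable (hgc.comp (by fun_prop) fun y hym => ?_)
      rw [uIcc_of_le hy] at hym
      exact hsub' _ (by simpa) (by simpa) (by simpa using hym.1) (by simpa using hym.2)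
    · refine ContinuousOn.intervalIntegrable (continuousOn_const.mul
        (ContinuousOn.inv₀ (by fun_prop) fun y _ => sub_ne_zero.2 (hnc y)))
  rw [hor y₁ hy₁.ne le_rfl hy, hor y₂ hy₂.ne' hy le_rfl, ver x₁ hx₁.ne le_rfl hx,
    ver x₂ hx₂.ne' hx le_rfl]
  have hhc : N c / deriv D c = h c := by rw [hh, ← hqc]
  rw [hhc]
  linear_combination hgz + h c * hiz

theorem integrable_line {C p y : ℝ} (hp : 0 < p)
    (hf : ∀ u : ℝ, DifferentiableAt ℂ f (u + y * Complex.I))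
    (hb : ∀ u : ℝ, ‖f (u + y * Complex.I)‖ ≤ C * Real.exp (-p * |u|)) :
    Integrable fun u : ℝ => f (u + y * Complex.I) := by
  refine Integrable.mono' ((integrable_exp_neg_mul_abs hp).const_mul C) ?_
    (Eventually.of_forall hb)
  refine Continuous.aestronglyMeasurable (continuous_iff_continuousAt.2 fun u => ?_)
  exact (hf u).continuousAt.comp (f := fun u : ℝ => (u + y * Complex.I : ℂ))
    (by fun_prop)

/-- Shift of the line of integration for an exponentially decaying holomorphic function. -/
theorem integral_line_eq {C p y₁ y₂ : ℝ} (hp : 0 < p) (hy : y₁ ≤ y₂)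
    (hf : ∀ w : ℂ, y₁ ≤ w.im → w.im ≤ y₂ → DifferentiableAt ℂ f w)
    (hb : ∀ w : ℂ, y₁ ≤ w.im → w.im ≤ y₂ → ‖f w‖ ≤ C * Real.exp (-p * |w.re|)) :
    (∫ u : ℝ, f (u + y₁ * Complex.I)) = ∫ u : ℝ, f (u + y₂ * Complex.I) := by
  have hi : ∀ y, y₁ ≤ y → y ≤ y₂ → Integrable fun u : ℝ => f (u + y * Complex.I) := by
    intro y h1 h2
    refine integrable_line (C := C) hp (fun u => hf _ (by simpa) (by simpa)) fun u => ?_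
    simpa using hb (u + y * Complex.I) (by simpa) (by simpa)
  have ht : ∀ y, y₁ ≤ y → y ≤ y₂ → Tendsto (fun U : ℝ => ∫ u in (-U)..U, f (u + y * Complex.I))
      atTop (𝓝 (∫ u : ℝ, f (u + y * Complex.I))) := fun y h1 h2 =>
    intervalIntegral_tendsto_integral (hi y h1 h2) tendsto_neg_atTop_atBot tendsto_id
  have hd := (ht y₁ le_rfl hy).sub (ht y₂ hy le_rfl)
  have h0 : Tendsto (fun U : ℝ => (∫ u in (-U)..U, f (u + y₁ * Complex.I)) -
      ∫ u in (-U)..U, f (u + y₂ * Complex.I)) atTop (𝓝 0) := by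
    have hlim : Tendsto (fun U : ℝ => 2 * (C * Real.exp (-p * U) * (y₂ - y₁))) atTop (𝓝 0) := by
      have h1 : Tendsto (fun U : ℝ => Real.exp (-p * U)) atTop (𝓝 0) := by
        refine Real.tendsto_exp_atBot.comp ?_
        exact tendsto_id.const_mul_atTop_of_neg (by linarith)
      simpa using ((h1.const_mul C).mul_const (y₂ - y₁)).const_mul 2
    refine squeeze_zero_norm' ?_ hlim
    filter_upwards [eventually_ge_atTop 0] with U hU
    have h1 := integral_boundary_rect_eq_zero (f := f) (neg_le_self hU) hy
      fun w _ _ h3 h4 => hf w h3 h4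
    have hv : ∀ x : ℝ, |x| = U → ‖∫ y in y₁..y₂, f (x + y * Complex.I)‖ ≤
        C * Real.exp (-p * U) * (y₂ - y₁) := by
      intro x hx
      have := intervalIntegral.norm_integral_le_of_norm_le_const (a := y₁) (b := y₂)
        (f := fun y : ℝ => f (x + y * Complex.I)) (C := C * Real.exp (-p * U)) ?_
      · rwa [abs_of_nonneg (sub_nonneg.2 hy)] at this
      · intro y hym
        rw [uIoc_of_le hy] at hym
        have := hb (x + y * Complex.I) (by simpa using hym.1.le) (by simpa using hym.2)
        simpa [hx] using this
    have e : (∫ u in (-U)..U, f (u + y₁ * Complex.I)) - ∫ u in (-U)..U, f (u + y₂ * Complex.I) =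
        Complex.I * (∫ y in y₁..y₂, f (((-U : ℝ) : ℂ) + y * Complex.I)) -
        Complex.I * (∫ y in y₁..y₂, f (U + y * Complex.I)) := by
      linear_combination h1
    rw [e]
    refine (norm_sub_le _ _).trans ?_
    rw [norm_mul, norm_mul, Complex.norm_I, one_mul, one_mul, two_mul]
    exact add_le_add (hv _ (by rw [abs_neg, abs_of_nonneg hU])) (hv _ (abs_of_nonneg hU))
  have := tendsto_nhds_unique hd h0
  exact sub_eq_zero.1 this

end contours

/-! ### The kernel as a holomorphic function below a cone -/

/-- Holomorphic extensions of symmetric profiles to `region ϑ`, with decay of order `d`. -/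
structure HoloProfile (m : ℂ → ℂ) (ϑ d C : ℝ) : Prop where
  pos : 0 < ϑ
  le_one : ϑ ≤ 1
  one_lt : 1 < d
  nonneg : 0 ≤ C
  diff : DifferentiableOn ℂ m (region ϑ)
  even : ∀ z ∈ region ϑ, m (-z) = m z
  conj : ∀ z ∈ region ϑ, m ((starRingEnd ℂ) z) = (starRingEnd ℂ) (m z)
  bound : ∀ z ∈ region ϑ, ‖m z‖ ≤ C * (1 + ‖z‖) ^ (-d)

theorem isOpen_region (ϑ : ℝ) : IsOpen (region ϑ) := by
  unfold region
  exact isOpen_lt (by fun_prop) (by fun_prop)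

/-- The region below the cone `Im z = c (1 + |Re z|)`. -/
def lowerRegion (c : ℝ) : Set ℂ := {z : ℂ | z.im < c * (1 + |z.re|)}

theorem isOpen_lowerRegion (c : ℝ) : IsOpen (lowerRegion c) := by
  unfold lowerRegion
  exact isOpen_lt (by fun_prop) (by fun_prop)

/-- On the strip |sin(Im w)| ≤ ϑ/2 and cos(Im w) ≥ 7/8, and cosh ≤ 1 + |sinh|. This is the reason
for the parametrization by sinh: horizontal lines in w are curves inside the region, on which powers
of |z| become exponentials. -/
theorem sinh_mem_region {ϑ : ℝ} (h0 : 0 < ϑ) (h1 : ϑ ≤ 1) {w : ℂ} (hw : |w.im| ≤ ϑ / 2) :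
    Complex.sinh w ∈ region ϑ := by
  simp only [region, mem_ofPred_eq, sinh_re, sinh_im, abs_mul, abs_of_pos (Real.cosh_pos _)]
  have hs : |Real.sin w.im| ≤ ϑ / 2 := Real.abs_sin_le_abs.trans hw
  have hc : 1 - (1 / 2) ^ 2 / 2 ≤ |Real.cos w.im| := by
    refine le_trans ?_ (le_abs_self _)
    refine le_trans ?_ (Real.one_sub_sq_div_two_le_cos (x := w.im))
    have : w.im ^ 2 ≤ (1 / 2) ^ 2 := by
      rw [← sq_abs]; exact pow_le_pow_left₀ (abs_nonneg _) (hw.trans (by linarith)) 2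
    linarith
  have hch := cosh_le_one_add_abs_sinh w.re
  have hsn : 0 ≤ |Real.sinh w.re| := abs_nonneg _
  have h2 : Real.cosh w.re * |Real.sin w.im| ≤ (1 + |Real.sinh w.re|) * (ϑ / 2) := by
    gcongr
  have h3 : |Real.sinh w.re| * (1 - (1 / 2) ^ 2 / 2) ≤ |Real.sinh w.re| * |Real.cos w.im| := by
    gcongr
  nlinarith

theorem hasDerivAt_sinh_line (y u : ℝ) : HasDerivAt
    (fun u : ℝ => Complex.sinh (u + y * Complex.I)) (Complex.cosh (u + y * Complex.I)) u := by
  have h1 : HasDerivAt (fun u : ℝ => (u + y * Complex.I : ℂ)) 1 u :=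
    (Complex.ofRealCLM.hasDerivAt (x := u)).add_const _
  have h2 := (Complex.hasDerivAt_sinh _).comp u h1
  rwa [mul_one] at h2

theorem continuous_sinh_line (y : ℝ) :
    Continuous (fun u : ℝ => Complex.sinh (u + y * Complex.I)) :=
  Complex.continuous_sinh.comp (by fun_prop)

theorem continuous_cosh_line (y : ℝ) :
    Continuous (fun u : ℝ => Complex.cosh (u + y * Complex.I)) :=
  Complex.continuous_cosh.comp (by fun_prop)

/-- The constant in the lower bound for the distance of the contour to `lowerRegion`. -/
theorem norm_sub_sinh_ge {β : ℝ} (h0 : 0 < Real.sin β) {z : ℂ}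
    (hz : z ∈ lowerRegion (Real.sin β / 4)) (u : ℝ) :
    Real.sin β / 25 * (1 + ‖z‖ + Real.cosh u) ≤ ‖z - Complex.sinh (u + β * Complex.I)‖ := by
  set σ := Real.sin β with hσ
  set s := Complex.sinh (u + β * Complex.I) with hs
  have hσ1 : σ ≤ 1 := Real.sin_le_one β
  have hsim : s.im = Real.cosh u * σ := by rw [hs, sinh_im]; simp [hσ]
  have hsre : |s.re| ≤ Real.cosh u := by
    rw [hs, sinh_re, abs_mul]
    have h1 : |Real.sinh u| ≤ Real.cosh u :=
      abs_le_of_sq_le_sq' (by rw [sq_abs, Real.cosh_sq]; linarith) (Real.cosh_pos _).le |>.2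
    have h2 := Real.abs_cos_le_one β
    simpa using mul_le_mul h1 h2 (abs_nonneg _) (Real.cosh_pos u).le
  have hc1 := Real.one_le_cosh u
  have hz' : z.im < σ / 4 * (1 + |z.re|) := hz
  have hsn : ‖s‖ ≤ Real.cosh u := by simpa [hs] using norm_sinh_le (u + β * Complex.I)
  have him : s.im - z.im ≤ ‖z - s‖ := by
    have := Complex.abs_im_le_norm (z - s)
    rw [Complex.sub_im] at this
    linarith [neg_abs_le (z.im - s.im)]
  have hre : |z.re| - |s.re| ≤ ‖z - s‖ := by
    have := Complex.abs_re_le_norm (z - s)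
    rw [Complex.sub_re] at this
    linarith [abs_sub_abs_le_abs_sub z.re s.re]
  -- The contour point lies at height σ cosh u, while Im z < (σ/4)(1 + |Re z|) and |Re z| ≤ ‖z−s‖ +
  -- cosh u. The vertical gap thus forces ‖z−s‖ to be of order cosh u.
  have key : σ / 8 * Real.cosh u ≤ ‖z - s‖ := by
    have hn := norm_nonneg (z - s)
    have e1 : Real.cosh u * σ - σ / 4 * (1 + (‖z - s‖ + Real.cosh u)) ≤ ‖z - s‖ := by
      have : σ / 4 * (1 + |z.re|) ≤ σ / 4 * (1 + (‖z - s‖ + Real.cosh u)) := by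
        gcongr; linarith
      rw [hsim] at him
      linarith
    nlinarith
  have h8 : Real.cosh u ≤ 8 / σ * ‖z - s‖ := by
    rw [div_mul_eq_mul_div, le_div_iff₀ h0]; linarith
  have hzn : ‖z‖ ≤ ‖z - s‖ + ‖s‖ := by
    have := norm_add_le (z - s) s; rwa [sub_add_cancel] at this
  -- The left side is at most three times cosh u plus ‖z−s‖; three times 8/σ plus one gives 25/σ.
  have hfin : 1 + ‖z‖ + Real.cosh u ≤ 25 / σ * ‖z - s‖ := by
    have h9 : ‖z - s‖ ≤ 1 / σ * ‖z - s‖ := by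
      have : 1 ≤ 1 / σ := by rw [le_div_iff₀ h0]; linarith
      nlinarith [norm_nonneg (z - s)]
    have : 25 / σ * ‖z - s‖ = 3 * (8 / σ * ‖z - s‖) + 1 / σ * ‖z - s‖ := by ring
    linarith
  calc σ / 25 * (1 + ‖z‖ + Real.cosh u) ≤ σ / 25 * (25 / σ * ‖z - s‖) := by gcongr
    _ = ‖z - s‖ := by field_simp

/-- The holomorphic continuation of the kernel `∫₀^∞ t m̂₀(t) e^{-itz} dt`. -/
noncomputable def kernelFun (m : ℂ → ℂ) (β : ℝ) (z : ℂ) : ℂ :=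
  -∫ u : ℝ, m (Complex.sinh (u + β * Complex.I)) * Complex.cosh (u + β * Complex.I) /
    (z - Complex.sinh (u + β * Complex.I)) ^ 2

namespace HoloProfile

variable {m : ℂ → ℂ} {ϑ d C : ℝ} (H : HoloProfile m ϑ d C)
include H

theorem sinh_mem {w : ℂ} (hw : |w.im| ≤ ϑ / 2) : Complex.sinh w ∈ region ϑ :=
  sinh_mem_region H.pos H.le_one hw

theorem sin_pos : 0 < Real.sin (ϑ / 2) :=
  Real.sin_pos_of_pos_of_lt_pi (by linarith [H.pos]) (by linarith [H.le_one, Real.pi_gt_three])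

theorem norm_sinh_le {w : ℂ} (hw : |w.im| ≤ ϑ / 2) :
    ‖m (Complex.sinh w)‖ ≤ C * 2 ^ d * Real.exp (-d * |w.re|) := by
  refine (H.bound _ (H.sinh_mem hw)).trans ?_
  rw [mul_assoc]
  refine mul_le_mul_of_nonneg_left ?_ H.nonneg
  have h1 : Real.exp |w.re| / 2 ≤ 1 + ‖Complex.sinh w‖ := by
    linarith [exp_abs_le_cosh w.re, cosh_le_one_add_norm_sinh w]
  refine (Real.rpow_le_rpow_of_nonpos (by positivity) h1 (by linarith [H.one_lt])).trans ?_
  rw [Real.div_rpow (Real.exp_pos _).le (by norm_num), ← Real.exp_mul, Real.rpow_neg (by norm_num),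
    div_inv_eq_mul, mul_comm, mul_comm |w.re|]

theorem differentiableAt_sinh {w : ℂ} (hw : |w.im| ≤ ϑ / 2) :
    DifferentiableAt ℂ (fun w => m (Complex.sinh w)) w :=
  (H.diff.differentiableAt ((isOpen_region ϑ).mem_nhds (H.sinh_mem hw))).comp w
    Complex.differentiable_sinh.differentiableAt

theorem norm_mul_cosh_le {w : ℂ} (hw : |w.im| ≤ ϑ / 2) :
    ‖m (Complex.sinh w) * Complex.cosh w‖ ≤ C * 2 ^ d * Real.exp (-(d - 1) * |w.re|) := by
  rw [norm_mul]
  calc _ ≤ C * 2 ^ d * Real.exp (-d * |w.re|) * Real.exp |w.re| := by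
        gcongr
        · have := H.nonneg; positivity
        · exact H.norm_sinh_le hw
        · exact (norm_cosh_le w).trans (cosh_le_exp_abs _)
    _ = _ := by rw [mul_assoc, ← Real.exp_add]; ring_nf

theorem abs_im_line (u : ℝ) : |(u + ((ϑ / 2 : ℝ) : ℂ) * Complex.I : ℂ).im| ≤ ϑ / 2 := by
  have h : (u + ((ϑ / 2 : ℝ) : ℂ) * Complex.I : ℂ).im = ϑ / 2 := by
    simp [-Complex.ofReal_div]
  rw [h, abs_of_pos (by linarith [H.pos])]

theorem continuous_line {y : ℝ} (hy : |y| ≤ ϑ / 2) :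
    Continuous fun u : ℝ => m (Complex.sinh (u + y * Complex.I)) * Complex.cosh (u + y * Complex.I) := by
  refine Continuous.mul (continuous_iff_continuousAt.2 fun u => ?_) (continuous_cosh_line y)
  exact (H.differentiableAt_sinh (w := u + y * Complex.I) (by simpa using hy)).continuousAt.comp
    (f := fun u : ℝ => (u + y * Complex.I : ℂ)) (by fun_prop)

theorem norm_kernel_integrand_le {z : ℂ} (hz : z ∈ lowerRegion (Real.sin (ϑ / 2) / 4)) (u : ℝ) :
    ‖m (Complex.sinh (u + (ϑ / 2 : ℝ) * Complex.I)) * Complex.cosh (u + (ϑ / 2 : ℝ) * Complex.I) /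
      (z - Complex.sinh (u + (ϑ / 2 : ℝ) * Complex.I)) ^ 2‖ ≤
    C * 2 ^ d * (25 / Real.sin (ϑ / 2)) ^ 2 * Real.exp (-(d - 1) * |u|) / (1 + ‖z‖) ^ 2 := by
  have hσ := H.sin_pos
  have h1 := norm_sub_sinh_ge hσ hz u
  have h2 := H.norm_mul_cosh_le (H.abs_im_line u)
  have hc := Real.cosh_pos u
  have h3 : Real.sin (ϑ / 2) / 25 * (1 + ‖z‖) ≤
      ‖z - Complex.sinh (u + (ϑ / 2 : ℝ) * Complex.I)‖ := by
    refine le_trans (mul_le_mul_of_nonneg_left ?_ (by positivity)) h1; linarith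
  have hC := H.nonneg
  rw [norm_div, norm_pow]
  calc _ ≤ C * 2 ^ d * Real.exp (-(d - 1) * |u|) / (Real.sin (ϑ / 2) / 25 * (1 + ‖z‖)) ^ 2 := by
        gcongr
        simpa using h2
    _ = _ := by field_simp

theorem sub_sinh_ne_zero {z : ℂ} (hz : z ∈ lowerRegion (Real.sin (ϑ / 2) / 4)) (u : ℝ) :
    z - Complex.sinh (u + (ϑ / 2 : ℝ) * Complex.I) ≠ 0 := by
  have h1 := norm_sub_sinh_ge H.sin_pos hz u
  have : 0 < Real.sin (ϑ / 2) / 25 * (1 + ‖z‖ + Real.cosh u) := by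
    have := H.sin_pos; have := Real.cosh_pos u; positivity
  exact norm_pos_iff.1 (this.trans_le h1)

theorem continuous_kernel_integrand {z : ℂ} (hz : z ∈ lowerRegion (Real.sin (ϑ / 2) / 4)) :
    Continuous fun u : ℝ => m (Complex.sinh (u + (ϑ / 2 : ℝ) * Complex.I)) *
      Complex.cosh (u + (ϑ / 2 : ℝ) * Complex.I) /
      (z - Complex.sinh (u + (ϑ / 2 : ℝ) * Complex.I)) ^ 2 :=
  (H.continuous_line (by rw [abs_of_pos (by linarith [H.pos])])).div
    ((continuous_const.sub (continuous_sinh_line _)).pow 2)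
    fun u => pow_ne_zero 2 (H.sub_sinh_ne_zero hz u)

theorem integrable_kernel_integrand {z : ℂ} (hz : z ∈ lowerRegion (Real.sin (ϑ / 2) / 4)) :
    Integrable fun u : ℝ => m (Complex.sinh (u + (ϑ / 2 : ℝ) * Complex.I)) *
      Complex.cosh (u + (ϑ / 2 : ℝ) * Complex.I) /
      (z - Complex.sinh (u + (ϑ / 2 : ℝ) * Complex.I)) ^ 2 := by
  refine Integrable.mono' (((integrable_exp_neg_mul_abs (p := d - 1)
    (by linarith [H.one_lt])).const_mul _).div_const _)
    (H.continuous_kernel_integrand hz).aestronglyMeasurable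
    (Eventually.of_forall (H.norm_kernel_integrand_le hz))

theorem differentiableOn_kernelFun :
    DifferentiableOn ℂ (kernelFun m (ϑ / 2)) (lowerRegion (Real.sin (ϑ / 2) / 4)) := by
  refine (differentiableOn_integral_of_dominated (isOpen_lowerRegion _) ?_ ?_ ?_).neg
  · intro z hz
    exact (H.continuous_kernel_integrand hz).aestronglyMeasurable
  · intro u z hz
    have := pow_ne_zero 2 (H.sub_sinh_ne_zero hz u)
    refine DifferentiableAt.differentiableWithinAt ?_
    fun_prop (disch := exact this)
  · intro z hz
    obtain ⟨ε, hε, hsub⟩ := Metric.isOpen_iff.1 (isOpen_lowerRegion _) z hz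
    refine ⟨ε, hε, _, ((integrable_exp_neg_mul_abs (p := d - 1)
      (by linarith [H.one_lt])).const_mul (C * 2 ^ d * (25 / Real.sin (ϑ / 2)) ^ 2)), ?_⟩
    intro w hw u
    refine (H.norm_kernel_integrand_le (hsub hw) u).trans (div_le_self ?_ ?_)
    · have := H.nonneg; have := H.sin_pos; positivity
    · exact one_le_pow₀ (by linarith [norm_nonneg w])

theorem exists_norm_kernelFun_le : ∃ A > 0, ∀ z ∈ lowerRegion (Real.sin (ϑ / 2) / 4),
    ‖kernelFun m (ϑ / 2) z‖ ≤ A / (1 + ‖z‖) ^ 2 := by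
  set B := C * 2 ^ d * (25 / Real.sin (ϑ / 2)) ^ 2 with hB
  set J := ∫ u : ℝ, B * Real.exp (-(d - 1) * |u|) with hJ
  refine ⟨|J| + 1, by positivity, fun z hz => ?_⟩
  rw [kernelFun, norm_neg]
  refine (norm_integral_le_of_norm_le (((integrable_exp_neg_mul_abs (p := d - 1)
    (by linarith [H.one_lt])).const_mul B).div_const _)
    (Eventually.of_forall (H.norm_kernel_integrand_le hz))).trans ?_
  rw [integral_div, ← hJ]
  gcongr
  linarith [le_abs_self J]

/-- The contour is invariant under z ↦ −z̄, which acts on it as u ↦ −u, and m commutes with this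
reflection up to conjugation by evenness and reality. -/
theorem kernelFun_neg_conj (z : ℂ) : kernelFun m (ϑ / 2) (-(starRingEnd ℂ) z) =
    (starRingEnd ℂ) (kernelFun m (ϑ / 2) z) := by
  rw [kernelFun, kernelFun, map_neg, ← integral_conj, ← integral_neg_eq_self (fun u : ℝ => _)]
  congr 1
  refine integral_congr_ae (Eventually.of_forall fun u => ?_)
  have e : (((-u : ℝ) : ℂ) + ((ϑ / 2 : ℝ) : ℂ) * Complex.I) =
      -(starRingEnd ℂ) (u + ((ϑ / 2 : ℝ) : ℂ) * Complex.I) := by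
    simp only [map_add, map_mul, Complex.conj_ofReal, Complex.conj_I, Complex.ofReal_neg]; ring
  have hmem := H.sinh_mem (H.abs_im_line u)
  have hmem' : (starRingEnd ℂ) (Complex.sinh (u + ((ϑ / 2 : ℝ) : ℂ) * Complex.I)) ∈ region ϑ := by
    simpa [region] using hmem
  simp only [e, Complex.sinh_neg, Complex.cosh_neg, Complex.sinh_conj, Complex.cosh_conj, map_div₀,
    map_mul, map_pow, map_sub]
  rw [H.even _ hmem', H.conj _ hmem]
  congr 1
  ring

end HoloProfile

/-! ### Expansion of the kernel at infinity in moments -/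

theorem integral_comp_sinh (f : ℝ → ℂ) :
    ∫ u : ℝ, f (Real.sinh u) * (Real.cosh u : ℂ) = ∫ x : ℝ, f x := by
  have h := integral_image_eq_integral_abs_deriv_smul (s := univ) MeasurableSet.univ
    (fun u _ => (Real.hasDerivAt_sinh u).hasDerivWithinAt) Real.sinh_injective.injOn f
  rw [image_univ, Real.sinh_surjective.range_eq, Measure.restrict_univ] at h
  rw [h]
  refine integral_congr_ae (Eventually.of_forall fun u => ?_)
  simp only [abs_of_pos (Real.cosh_pos u), Complex.real_smul]
  ring

theorem integrable_comp_sinh {f : ℝ → ℂ} (hf : Integrable f) :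
    Integrable fun u : ℝ => f (Real.sinh u) * (Real.cosh u : ℂ) := by
  have h := (integrableOn_image_iff_integrableOn_abs_deriv_smul (s := univ) MeasurableSet.univ
    (fun u _ => (Real.hasDerivAt_sinh u).hasDerivWithinAt) Real.sinh_injective.injOn f).1
    (by rw [image_univ, Real.sinh_surjective.range_eq]; exact hf.integrableOn)
  rw [integrableOn_univ] at h
  refine h.congr (Eventually.of_forall fun u => ?_)
  simp only [abs_of_pos (Real.cosh_pos u), Complex.real_smul]
  ring

/-- The differentiated geometric series with its remainder in closed form. The remainder keeps the
factor (z−s)⁻², so that it can be estimated also where |s| exceeds |z|. -/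
theorem inv_sq_sub_eq {z s : ℂ} (hz : z ≠ 0) (hs : z - s ≠ 0) (N : ℕ) :
    1 / (z - s) ^ 2 = (∑ j ∈ Finset.range N, (j + 1 : ℂ) * s ^ j / z ^ (j + 2)) +
      s ^ N * ((N + 1) * z - N * s) / (z ^ (N + 1) * (z - s) ^ 2) := by
  induction N with
  | zero => simp; field_simp
  | succ N ih =>
    rw [ih, Finset.sum_range_succ]
    have : s ^ N * ((N + 1) * z - N * s) / (z ^ (N + 1) * (z - s) ^ 2) =
        (N + 1 : ℂ) * s ^ N / z ^ (N + 2) +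
        s ^ (N + 1) * ((↑(N + 1) + 1) * z - ↑(N + 1) * s) / (z ^ (N + 1 + 1) * (z - s) ^ 2) := by
      push_cast
      field_simp
      ring
    rw [this]; ring

theorem two_sided_exp_bound {p U t : ℝ} :
    Real.exp (-p * |(|t| - U)|) ≤ Real.exp (-p * |t - U|) + Real.exp (-p * |t + U|) := by
  rcases abs_cases t with ⟨h, -⟩ | ⟨h, -⟩
  · rw [h]; linarith [Real.exp_pos (-p * |t + U|)]
  · rw [h, show |(-t - U)| = |t + U| by rw [← abs_neg]; ring_nf]
    linarith [Real.exp_pos (-p * |t - U|)]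

theorem integral_two_sided_exp (p U : ℝ) :
    ∫ t : ℝ, (Real.exp (-p * |t - U|) + Real.exp (-p * |t + U|)) ≤
      2 * ∫ t : ℝ, Real.exp (-p * |t|) := by
  by_cases hi : Integrable (fun t : ℝ => Real.exp (-p * |t|))
  · rw [integral_add (hi.comp_sub_right U) (hi.comp_add_right U),
      integral_sub_right_eq_self (fun t : ℝ => Real.exp (-p * |t|)) U,
      integral_add_right_eq_self (fun t : ℝ => Real.exp (-p * |t|)) U, two_mul]
  -- Without integrability both integrals have the default value zero.
  · have h2 : ¬ Integrable (fun t : ℝ => (Real.exp (-p * |t - U|) + Real.exp (-p * |t + U|))) := by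
      intro h
      apply hi
      have h3 : Integrable fun t : ℝ => Real.exp (-p * |t - U|) := by
        refine Integrable.mono' h (by fun_prop) (Eventually.of_forall fun t => ?_)
        rw [Real.norm_of_nonneg (Real.exp_pos _).le]
        linarith [Real.exp_pos (-p * |t + U|)]
      simpa using h3.comp_add_right U
    rw [integral_undef hi, integral_undef h2]; simp

/-- Complex-valued moments of a profile. -/
noncomputable def profileMoment (m : ℂ → ℂ) (j : ℕ) : ℂ := ∫ x : ℝ, (x : ℂ) ^ j * m x

/-- The truncated asymptotic expansion of the kernel at infinity. -/
noncomputable def kernelMain (a : ℕ → ℂ) (n : ℕ) (z : ℂ) : ℂ :=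
  -∑ j ∈ Finset.range (n + 1), (2 * j + 1 : ℂ) * a (2 * j) / z ^ (2 * j + 2)

namespace HoloProfile

variable {m : ℂ → ℂ} {ϑ d C : ℝ} (H : HoloProfile m ϑ d C)
include H

theorem mem_region_ofReal (x : ℝ) : (x : ℂ) ∈ region ϑ := by
  have := H.pos
  simp only [region, mem_ofPred_eq, Complex.ofReal_im, abs_zero]
  positivity

theorem profileMoment_odd {j : ℕ} (hj : Odd j) : profileMoment m j = 0 := by
  have h := integral_neg_eq_self (fun x : ℝ => (x : ℂ) ^ j * m x) (volume : Measure ℝ)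
  have e : ∀ x : ℝ, ((-x : ℝ) : ℂ) ^ j * m ((-x : ℝ) : ℂ) = -((x : ℂ) ^ j * m x) := fun x => by
    rw [Complex.ofReal_neg, hj.neg_pow, H.even _ (H.mem_region_ofReal x)]; ring
  simp only [e, integral_neg] at h
  rw [profileMoment]
  linear_combination (-1 / 2 : ℂ) * h

theorem norm_moment_integrand_le {w : ℂ} (hw : |w.im| ≤ ϑ / 2) (j : ℕ) :
    ‖m (Complex.sinh w) * Complex.cosh w * Complex.sinh w ^ j‖ ≤
      C * 2 ^ d * Real.exp ((j + 1 - d) * |w.re|) := by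
  rw [norm_mul, norm_pow]
  have hC := H.nonneg
  calc _ ≤ C * 2 ^ d * Real.exp (-(d - 1) * |w.re|) * Real.exp |w.re| ^ j := by
        gcongr
        · exact H.norm_mul_cosh_le hw
        · exact (VlasovPoisson.norm_sinh_le w).trans (cosh_le_exp_abs _)
    _ = _ := by rw [mul_assoc, ← Real.exp_nat_mul, ← Real.exp_add]; ring_nf

theorem differentiableAt_moment_integrand {w : ℂ} (hw : |w.im| ≤ ϑ / 2) (j : ℕ) :
    DifferentiableAt ℂ (fun w => m (Complex.sinh w) * Complex.cosh w * Complex.sinh w ^ j) w :=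
  ((H.differentiableAt_sinh hw).mul Complex.differentiable_cosh.differentiableAt).mul
    (Complex.differentiable_sinh.differentiableAt.pow j)

omit H in
theorem abs_le_of_mem {w : ℂ} (h0 : 0 ≤ w.im) (h1 : w.im ≤ ϑ / 2) : |w.im| ≤ ϑ / 2 := by
  rwa [abs_of_nonneg h0]

/-- For j < d − 1 the integrand decays like e^{(j+1−d)|u|}, uniformly in the strip. The line can
then be lowered to the real axis, where x = sinh u gives back the moment. -/
theorem integral_moment_line {j : ℕ} (hj : (j : ℝ) < d - 1) :
    ∫ u : ℝ, m (Complex.sinh (u + (ϑ / 2 : ℝ) * Complex.I)) *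
      Complex.cosh (u + (ϑ / 2 : ℝ) * Complex.I) *
      Complex.sinh (u + (ϑ / 2 : ℝ) * Complex.I) ^ j = profileMoment m j := by
  have h := integral_line_eq (f := fun w => m (Complex.sinh w) * Complex.cosh w *
      Complex.sinh w ^ j) (p := d - 1 - j) (C := C * 2 ^ d) (y₁ := 0) (y₂ := ϑ / 2) (by linarith)
      (by linarith [H.pos])
      (fun w h0 h1 => H.differentiableAt_moment_integrand (abs_le_of_mem h0 h1) j)
      (fun w h0 h1 => by
        refine (H.norm_moment_integrand_le (abs_le_of_mem h0 h1) j).trans_eq ?_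
        ring_nf)
  rw [← h, profileMoment, ← integral_comp_sinh (fun x : ℝ => (x : ℂ) ^ j * m x)]
  refine integral_congr_ae (Eventually.of_forall fun u => ?_)
  simp only [Complex.ofReal_zero, zero_mul, add_zero, Complex.ofReal_sinh, Complex.ofReal_cosh]
  ring

theorem integrable_moment_line {j : ℕ} (hj : (j : ℝ) < d - 1) :
    Integrable fun u : ℝ => m (Complex.sinh (u + (ϑ / 2 : ℝ) * Complex.I)) *
      Complex.cosh (u + (ϑ / 2 : ℝ) * Complex.I) *
      Complex.sinh (u + (ϑ / 2 : ℝ) * Complex.I) ^ j := by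
  refine integrable_line (f := fun w => m (Complex.sinh w) * Complex.cosh w *
      Complex.sinh w ^ j) (p := d - 1 - j) (C := C * 2 ^ d) (by linarith)
    (fun u => H.differentiableAt_moment_integrand (H.abs_im_line u) j) fun u => ?_
  refine (H.norm_moment_integrand_le (H.abs_im_line u) j).trans_eq ?_
  have hre : (u + ((ϑ / 2 : ℝ) : ℂ) * Complex.I : ℂ).re = u := by simp [-Complex.ofReal_div]
  rw [hre]
  ring_nf

/-- The remainder of the kernel after `N` terms of its expansion. -/
theorem kernelFun_eq {N : ℕ} (hN : (N : ℝ) < d) {z : ℂ}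
    (hz : z ∈ lowerRegion (Real.sin (ϑ / 2) / 4)) (hz0 : z ≠ 0) :
    kernelFun m (ϑ / 2) z =
      -(∑ j ∈ Finset.range N, (j + 1 : ℂ) * profileMoment m j / z ^ (j + 2)) -
      ∫ u : ℝ, m (Complex.sinh (u + (ϑ / 2 : ℝ) * Complex.I)) *
        Complex.cosh (u + (ϑ / 2 : ℝ) * Complex.I) *
        (Complex.sinh (u + (ϑ / 2 : ℝ) * Complex.I) ^ N *
        ((N + 1) * z - N * Complex.sinh (u + (ϑ / 2 : ℝ) * Complex.I)) /
        (z ^ (N + 1) * (z - Complex.sinh (u + (ϑ / 2 : ℝ) * Complex.I)) ^ 2)) := by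
  have hjd : ∀ j ∈ Finset.range N, (j : ℝ) < d - 1 := fun j hj => by
    have : (j : ℝ) + 1 ≤ N := by exact_mod_cast Finset.mem_range.1 hj
    linarith
  have hint : ∀ j ∈ Finset.range N, Integrable fun u : ℝ => (j + 1 : ℂ) / z ^ (j + 2) *
      (m (Complex.sinh (u + (ϑ / 2 : ℝ) * Complex.I)) *
      Complex.cosh (u + (ϑ / 2 : ℝ) * Complex.I) *
      Complex.sinh (u + (ϑ / 2 : ℝ) * Complex.I) ^ j) := fun j hj =>
    (H.integrable_moment_line (hjd j hj)).const_mul _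
  have hsum : ∑ j ∈ Finset.range N, (j + 1 : ℂ) * profileMoment m j / z ^ (j + 2) =
      ∫ u : ℝ, ∑ j ∈ Finset.range N, (j + 1 : ℂ) / z ^ (j + 2) *
      (m (Complex.sinh (u + (ϑ / 2 : ℝ) * Complex.I)) *
      Complex.cosh (u + (ϑ / 2 : ℝ) * Complex.I) *
      Complex.sinh (u + (ϑ / 2 : ℝ) * Complex.I) ^ j) := by
    rw [integral_finsetSum _ hint]
    refine Finset.sum_congr rfl fun j hj => ?_
    rw [integral_const_mul, H.integral_moment_line (hjd j hj)]
    ring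
  rw [hsum, kernelFun, ← neg_add', neg_inj]
  rw [← sub_eq_iff_eq_add', ← integral_sub (H.integrable_kernel_integrand hz)
    (integrable_finsetSum _ hint)]
  refine integral_congr_ae (Eventually.of_forall fun u => ?_)
  simp only
  have h := inv_sq_sub_eq hz0 (H.sub_sinh_ne_zero hz u) N
  set s := Complex.sinh (u + (ϑ / 2 : ℝ) * Complex.I)
  rw [div_eq_mul_one_div, h, mul_add, Finset.mul_sum]
  rw [add_sub_right_comm, ← Finset.sum_sub_distrib]
  rw [Finset.sum_eq_zero fun j _ => by ring, zero_add]

/-- Both factors z − s are at least a multiple of ‖z‖ + cosh u; one of them absorbs the linear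
factor in the numerator and the other remains. -/
theorem norm_remainder_le {N : ℕ} {z : ℂ}
    (hz : z ∈ lowerRegion (Real.sin (ϑ / 2) / 4)) (hz0 : z ≠ 0) (u : ℝ) :
    ‖Complex.sinh (u + (ϑ / 2 : ℝ) * Complex.I) ^ N *
        ((N + 1) * z - N * Complex.sinh (u + (ϑ / 2 : ℝ) * Complex.I)) /
        (z ^ (N + 1) * (z - Complex.sinh (u + (ϑ / 2 : ℝ) * Complex.I)) ^ 2)‖ ≤
      (N + 1) * (25 / Real.sin (ϑ / 2)) ^ 2 * Real.exp |u| ^ N /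
        (‖z‖ ^ (N + 1) * (‖z‖ + Real.cosh u)) := by
  have hσ := H.sin_pos
  have h1 := norm_sub_sinh_ge hσ hz u
  set s := Complex.sinh (u + (ϑ / 2 : ℝ) * Complex.I) with hs
  have hsn : ‖s‖ ≤ Real.cosh u := by
    simpa [hs, -Complex.ofReal_div] using
      VlasovPoisson.norm_sinh_le (u + (ϑ / 2 : ℝ) * Complex.I)
  have hc := Real.cosh_pos u
  have hzp : 0 < ‖z‖ := norm_pos_iff.2 hz0
  have hnum : ‖((N : ℂ) + 1) * z - N * s‖ ≤ (N + 1) * (‖z‖ + Real.cosh u) := by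
    refine (norm_sub_le _ _).trans ?_
    rw [norm_mul, norm_mul, show ‖((N : ℂ) + 1)‖ = N + 1 by
      rw [show ((N : ℂ) + 1) = ((N + 1 : ℕ) : ℂ) by push_cast; ring, Complex.norm_natCast]
      push_cast; ring, Complex.norm_natCast]
    have : (N : ℝ) * ‖s‖ ≤ (N + 1) * Real.cosh u := by
      gcongr; linarith
    linarith
  have h2 : Real.sin (ϑ / 2) / 25 * (‖z‖ + Real.cosh u) ≤ ‖z - s‖ := by
    refine le_trans (mul_le_mul_of_nonneg_left ?_ (by positivity)) h1; linarith
  rw [norm_div, norm_mul, norm_mul, norm_pow, norm_pow, norm_pow]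
  calc _ ≤ Real.exp |u| ^ N * ((N + 1) * (‖z‖ + Real.cosh u)) /
        (‖z‖ ^ (N + 1) * (Real.sin (ϑ / 2) / 25 * (‖z‖ + Real.cosh u)) ^ 2) := by
        gcongr
        exact hsn.trans (cosh_le_exp_abs u)
    _ = _ := by field_simp

/-- Remainder estimate without logarithmic loss, far from the critical order. -/
theorem exists_norm_kernelFun_add_sum_le {N : ℕ} (hN : (N : ℝ) < d - 1) :
    ∃ B > 0, ∀ z ∈ lowerRegion (Real.sin (ϑ / 2) / 4), 1 ≤ ‖z‖ →
      ‖kernelFun m (ϑ / 2) z +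
        ∑ j ∈ Finset.range N, (j + 1 : ℂ) * profileMoment m j / z ^ (j + 2)‖ ≤
      B / ‖z‖ ^ (N + 2) := by
  set B₀ := C * 2 ^ d * ((N + 1) * (25 / Real.sin (ϑ / 2)) ^ 2)
  set J := ∫ u : ℝ, B₀ * Real.exp (-(d - 1 - N) * |u|)
  refine ⟨|J| + 1, by positivity, fun z hz hz1 => ?_⟩
  have hzp : 0 < ‖z‖ := by linarith
  have hz0 : z ≠ 0 := norm_pos_iff.1 hzp
  rw [H.kernelFun_eq (by linarith) hz hz0, show ∀ a b : ℂ, -a - b + a = -b by intros; ring, norm_neg]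
  have hb : ∀ u : ℝ, _ := fun u => H.norm_remainder_le (N := N) hz hz0 u
  refine (norm_integral_le_of_norm_le (((integrable_exp_neg_mul_abs (p := d - 1 - N)
    (by linarith)).const_mul B₀).div_const (‖z‖ ^ (N + 2)))
    (Eventually.of_forall fun u => ?_)).trans ?_
  · rw [norm_mul]
    have hC := H.nonneg
    have hg := H.norm_mul_cosh_le (H.abs_im_line u)
    have hre : (u + ((ϑ / 2 : ℝ) : ℂ) * Complex.I : ℂ).re = u := by simp [-Complex.ofReal_div]
    rw [hre] at hg
    calc _ ≤ C * 2 ^ d * Real.exp (-(d - 1) * |u|) *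
          ((N + 1) * (25 / Real.sin (ϑ / 2)) ^ 2 * Real.exp |u| ^ N /
          (‖z‖ ^ (N + 1) * (‖z‖ + 0))) := by
          refine mul_le_mul hg ((hb u).trans ?_) (norm_nonneg _) (by positivity)
          gcongr
          exact (Real.cosh_pos u).le
      _ = B₀ * (Real.exp (-(d - 1) * |u|) * Real.exp |u| ^ N) / ‖z‖ ^ (N + 2) := by
          rw [add_zero, ← pow_succ]; simp only [B₀]; ring
      _ = _ := by
          rw [← Real.exp_nat_mul, ← Real.exp_add]; ring_nf
  · rw [integral_div]
    gcongr
    linarith [le_abs_self J]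

/-- Truncated moments along the real line in the variable `u = arsinh x`. -/
theorem norm_truncated_line_sub_le {N : ℕ} {U : ℝ} (hU : 0 ≤ U) :
    ‖(∫ u in (-U)..U, m (Complex.sinh (u + (ϑ / 2 : ℝ) * Complex.I)) *
      Complex.cosh (u + (ϑ / 2 : ℝ) * Complex.I) *
      Complex.sinh (u + (ϑ / 2 : ℝ) * Complex.I) ^ N) -
      ∫ u in (-U)..U, m (Complex.sinh u) * Complex.cosh u * Complex.sinh u ^ N‖ ≤
      C * 2 ^ d * Real.exp ((N + 1 - d) * U) * ϑ := by
  have hϑ := H.pos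
  set f := fun w => m (Complex.sinh w) * Complex.cosh w * Complex.sinh w ^ N with hf
  have h1 := integral_boundary_rect_eq_zero (f := f) (neg_le_self hU)
    (show (0 : ℝ) ≤ ϑ / 2 by linarith) fun w _ _ h3 h4 =>
      H.differentiableAt_moment_integrand (abs_le_of_mem h3 h4) N
  have hv : ∀ x : ℝ, |x| = U → ‖∫ y in (0 : ℝ)..(ϑ / 2), f (x + y * Complex.I)‖ ≤
      C * 2 ^ d * Real.exp ((N + 1 - d) * U) * (ϑ / 2) := by
    intro x hx
    have := intervalIntegral.norm_integral_le_of_norm_le_const (a := 0) (b := ϑ / 2)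
      (f := fun y : ℝ => f (x + y * Complex.I)) (C := C * 2 ^ d * Real.exp ((N + 1 - d) * U)) ?_
    · rwa [sub_zero, abs_of_nonneg (by linarith : (0 : ℝ) ≤ ϑ / 2)] at this
    · intro y hym
      rw [uIoc_of_le (by linarith)] at hym
      have hy2 : |(x + y * Complex.I : ℂ).im| ≤ ϑ / 2 := by
        simpa [abs_of_pos hym.1] using hym.2
      have := H.norm_moment_integrand_le hy2 N
      simpa [hx, hf] using this
  have e : (∫ u in (-U)..U, f (u + (ϑ / 2 : ℝ) * Complex.I)) -
      ∫ u in (-U)..U, f (u + (0 : ℝ) * Complex.I) =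
      Complex.I * (∫ y in (0 : ℝ)..(ϑ / 2), f (U + y * Complex.I)) -
      Complex.I * (∫ y in (0 : ℝ)..(ϑ / 2), f (((-U : ℝ) : ℂ) + y * Complex.I)) := by
    linear_combination -h1
  simp only [Complex.ofReal_zero, zero_mul, add_zero] at e
  simp only [hf] at e hv
  rw [e]
  refine (norm_sub_le _ _).trans ?_
  rw [norm_mul, norm_mul, Complex.norm_I, one_mul, one_mul]
  have e1 := hv U (abs_of_nonneg hU)
  have e2 := hv (-U) (by rw [abs_neg, abs_of_nonneg hU])
  linarith

/-- Remainder estimate at the critical order, with the truncated moment split off. -/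
theorem exists_norm_kernelFun_add_truncated_le {N : ℕ} (hN : (N : ℝ) < d) (hN' : d ≤ N + 1) :
    ∃ B > 0, ∀ z ∈ lowerRegion (Real.sin (ϑ / 2) / 4), 1 ≤ ‖z‖ →
      ‖kernelFun m (ϑ / 2) z +
        (∑ j ∈ Finset.range N, (j + 1 : ℂ) * profileMoment m j / z ^ (j + 2)) +
        (N + 1) / z ^ (N + 2) * ∫ u in (-Real.log ‖z‖)..Real.log ‖z‖,
          m (Complex.sinh u) * Complex.cosh u * Complex.sinh u ^ N‖ ≤
      B * ‖z‖ ^ (-(d + 1)) := by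
  -- Decay rates away from |u| = log ‖z‖: inside, once the term of order N has been taken out, the
  -- integrand grows at rate N + 2 − d; outside, it decays at rate d − N.
  set p := min (N + 2 - d) (d - N) with hp
  have hp0 : 0 < p := lt_min (by linarith) (by linarith)
  have hσ := H.sin_pos
  have hC := H.nonneg
  set B₀ := C * 2 ^ d * ((N + 2) * (25 / Real.sin (ϑ / 2)) ^ 2) * 2 with hB₀
  have hB₀n : 0 ≤ B₀ := by positivity
  set J := ∫ u : ℝ, Real.exp (-p * |u|) with hJ
  have hJ0 : 0 ≤ J := integral_nonneg fun u => (Real.exp_pos _).le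
  have hϑ := H.pos
  refine ⟨B₀ * (2 * J) + (N + 1) * (C * 2 ^ d * ϑ) + 1, by positivity, fun z hz hz1 => ?_⟩
  set L := ‖z‖ with hL
  have hLp : 0 < L := by linarith
  have hz0 : z ≠ 0 := norm_pos_iff.1 hLp
  set U := Real.log L with hU
  have hU0 : 0 ≤ U := Real.log_nonneg hz1
  have hLrpow : ∀ x : ℝ, L ^ x = Real.exp (x * U) := fun x => by
    rw [Real.rpow_def_of_pos hLp, mul_comm]
  have hLpow : ∀ x : ℕ, L ^ x = Real.exp (x * U) := fun x => by
    rw [← hLrpow, Real.rpow_natCast]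
  set s : ℝ → ℂ := fun u => Complex.sinh (u + (ϑ / 2 : ℝ) * Complex.I) with hs
  set G : ℝ → ℂ := fun u => m (s u) * Complex.cosh (u + (ϑ / 2 : ℝ) * Complex.I) with hG
  set R : ℕ → ℝ → ℂ := fun N u => s u ^ N * ((N + 1) * z - N * s u) /
    (z ^ (N + 1) * (z - s u) ^ 2) with hR
  have hGn : ∀ u, ‖G u‖ ≤ C * 2 ^ d * Real.exp (-(d - 1) * |u|) := fun u => by
    have hg := H.norm_mul_cosh_le (H.abs_im_line u)
    have hre : (u + ((ϑ / 2 : ℝ) : ℂ) * Complex.I : ℂ).re = u := by simp [-Complex.ofReal_div]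
    rwa [hre] at hg
  have hRec : ∀ u, R N u = (N + 1) / z ^ (N + 2) * s u ^ N + R (N + 1) u := by
    intro u
    have hzs := H.sub_sinh_ne_zero hz u
    have h1 := inv_sq_sub_eq hz0 hzs N
    have h2 := inv_sq_sub_eq hz0 hzs (N + 1)
    rw [h1, Finset.sum_range_succ, add_assoc, add_right_inj] at h2
    simp only [hR, hs]
    rw [h2]; push_cast; ring
  have hGc : Continuous G := H.continuous_line (by rw [abs_of_pos (by linarith)])
  have hsc : Continuous s := continuous_sinh_line _
  have hRc : Continuous (R N) := by
    refine Continuous.div (by fun_prop) (by fun_prop) fun u => ?_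
    exact mul_ne_zero (pow_ne_zero _ hz0) (pow_ne_zero _ (H.sub_sinh_ne_zero hz u))
  -- The expansion is carried one term further only for |u| ≤ log ‖z‖, that is where |s| is at most
  -- of order ‖z‖. The extra term yields the truncated moment, and the rest peaks at |u| = log ‖z‖.
  set T : ℝ → ℂ := fun u => G u * R N u -
    (Ioc (-U) U).indicator (fun u => (N + 1) / z ^ (N + 2) * (G u * s u ^ N)) u with hT
  have hTb : ∀ u, ‖T u‖ ≤ B₀ * L ^ (-(d + 1)) *
      (Real.exp (-p * |u - U|) + Real.exp (-p * |u + U|)) := by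
    intro u
    refine le_trans ?_ (mul_le_mul_of_nonneg_left two_sided_exp_bound (by positivity))
    by_cases hu : u ∈ Ioc (-U) U
    · have huU : |u| ≤ U := abs_le.2 ⟨hu.1.le, hu.2⟩
      have e : T u = G u * R (N + 1) u := by
        simp only [hT, indicator_of_mem hu, hRec u]; ring
      have hr := H.norm_remainder_le (N := N + 1) hz hz0 u
      rw [e, norm_mul]
      calc _ ≤ C * 2 ^ d * Real.exp (-(d - 1) * |u|) * (((N + 1 : ℕ) + 1) *
            (25 / Real.sin (ϑ / 2)) ^ 2 * Real.exp |u| ^ (N + 1) /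
            (L ^ (N + 1 + 1) * (L + 0))) := by
            refine mul_le_mul (hGn u) (hr.trans ?_) (norm_nonneg _) (by positivity)
            gcongr
            exact (Real.cosh_pos u).le
        _ = C * 2 ^ d * ((N + 2) * (25 / Real.sin (ϑ / 2)) ^ 2) *
            (Real.exp (-(d - 1) * |u|) * Real.exp |u| ^ (N + 1) / L ^ (N + 3)) := by
            rw [add_zero, ← pow_succ]; push_cast; ring
        _ ≤ C * 2 ^ d * ((N + 2) * (25 / Real.sin (ϑ / 2)) ^ 2) *
            (L ^ (-(d + 1)) * Real.exp (-p * |(|u| - U)|)) := by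
            gcongr
            rw [hLrpow, hLpow, ← Real.exp_nat_mul, ← Real.exp_add, ← Real.exp_add, ← Real.exp_sub,
              abs_of_nonpos (show |u| - U ≤ 0 by linarith)]
            apply Real.exp_le_exp.2
            have : p * (U - |u|) ≤ (N + 2 - d) * (U - |u|) :=
              mul_le_mul_of_nonneg_right (min_le_left _ _) (by linarith)
            push_cast
            nlinarith
        _ ≤ _ := by
            rw [hB₀, mul_assoc _ (L ^ _)]
            have : 0 ≤ C * 2 ^ d * ((N + 2) * (25 / Real.sin (ϑ / 2)) ^ 2) *
              (L ^ (-(d + 1)) * Real.exp (-p * |(|u| - U)|)) := by positivity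
            nlinarith
    · have huU : U ≤ |u| := by
        by_contra hc
        exact hu ⟨(abs_lt.1 (not_le.1 hc)).1, (abs_lt.1 (not_le.1 hc)).2.le⟩
      have e : T u = G u * R N u := by
        simp only [hT, indicator_of_notMem hu, sub_zero]
      have hr := H.norm_remainder_le (N := N) hz hz0 u
      rw [e, norm_mul]
      calc _ ≤ C * 2 ^ d * Real.exp (-(d - 1) * |u|) * ((N + 1) *
            (25 / Real.sin (ϑ / 2)) ^ 2 * Real.exp |u| ^ N /
            (L ^ (N + 1) * (0 + Real.exp |u| / 2))) := by
            refine mul_le_mul (hGn u) (hr.trans ?_) (norm_nonneg _) (by positivity)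
            have := exp_abs_le_cosh u
            gcongr
            linarith
        _ = C * 2 ^ d * ((N + 1) * (25 / Real.sin (ϑ / 2)) ^ 2) * 2 *
            (Real.exp (-(d - 1) * |u|) * Real.exp |u| ^ N / L ^ (N + 1) / Real.exp |u|) := by
            rw [zero_add]; field_simp
        _ ≤ C * 2 ^ d * ((N + 2) * (25 / Real.sin (ϑ / 2)) ^ 2) * 2 *
            (L ^ (-(d + 1)) * Real.exp (-p * |(|u| - U)|)) := by
            have : (Real.exp (-(d - 1) * |u|) * Real.exp |u| ^ N / L ^ (N + 1) / Real.exp |u|) ≤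
                L ^ (-(d + 1)) * Real.exp (-p * |(|u| - U)|) := by
              rw [hLrpow, hLpow, ← Real.exp_nat_mul, ← Real.exp_add, ← Real.exp_add,
                ← Real.exp_sub, ← Real.exp_sub, abs_of_nonneg (show 0 ≤ |u| - U by linarith)]
              apply Real.exp_le_exp.2
              have : p * (|u| - U) ≤ (d - N) * (|u| - U) :=
                mul_le_mul_of_nonneg_right (min_le_right _ _) (by linarith)
              push_cast
              nlinarith
            gcongr
            linarith
        _ = _ := by rw [hB₀]; ring
  have hTm : AEStronglyMeasurable T volume := by
    refine (hGc.mul hRc).aestronglyMeasurable.sub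
      (AEStronglyMeasurable.indicator ?_ measurableSet_Ioc)
    exact (continuous_const.mul (hGc.mul (hsc.pow N))).aestronglyMeasurable
  have hdomi : Integrable fun u : ℝ => B₀ * L ^ (-(d + 1)) *
      (Real.exp (-p * |u - U|) + Real.exp (-p * |u + U|)) :=
    (((integrable_exp_neg_mul_abs hp0).comp_sub_right U).add
      ((integrable_exp_neg_mul_abs hp0).comp_add_right U)).const_mul _
  have hTi : Integrable T := hdomi.mono' hTm (Eventually.of_forall hTb)
  have hTint : ‖∫ u, T u‖ ≤ B₀ * L ^ (-(d + 1)) * (2 * J) := by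
    refine (norm_integral_le_of_norm_le hdomi (Eventually.of_forall hTb)).trans ?_
    rw [integral_const_mul]
    exact mul_le_mul_of_nonneg_left (integral_two_sided_exp p U) (by positivity)
  have hind : Integrable ((Ioc (-U) U).indicator
      (fun u => (N + 1) / z ^ (N + 2) * (G u * s u ^ N))) := by
    rw [integrable_indicator_iff measurableSet_Ioc]
    exact (continuous_const.mul (hGc.mul (hsc.pow N))).integrableOn_Ioc
  have hsplit : ∫ u, G u * R N u = (∫ u, T u) +
      (N + 1) / z ^ (N + 2) * ∫ u in (-U)..U, G u * s u ^ N := by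
    have : (fun u => G u * R N u) = fun u => T u + (Ioc (-U) U).indicator
        (fun u => (N + 1) / z ^ (N + 2) * (G u * s u ^ N)) u := by
      funext u; simp only [hT]; ring
    rw [this, integral_add hTi hind, integral_indicator measurableSet_Ioc, integral_const_mul,
      intervalIntegral.integral_of_le (by linarith)]
  have htr := H.norm_truncated_line_sub_le (N := N) hU0
  set A₁ := ∫ u in (-U)..U, G u * s u ^ N with hA₁
  set A₂ := ∫ u in (-U)..U, m (Complex.sinh u) * Complex.cosh u * Complex.sinh u ^ N with hA₂
  have htr' : ‖A₁ - A₂‖ ≤ C * 2 ^ d * Real.exp ((N + 1 - d) * U) * ϑ := htr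
  rw [H.kernelFun_eq hN hz hz0]
  have e : ∀ S : ℂ, (-S - ∫ u, G u * R N u) + S + (N + 1) / z ^ (N + 2) * A₂ =
      -(∫ u, T u) - (N + 1) / z ^ (N + 2) * (A₁ - A₂) := by
    intro S; rw [hsplit]; ring
  refine (le_of_eq (congrArg norm (e _))).trans ((norm_sub_le _ _).trans ?_)
  have hN1 : ‖((N : ℂ) + 1)‖ = N + 1 := by
    rw [show ((N : ℂ) + 1) = ((N + 1 : ℕ) : ℂ) by push_cast; ring, Complex.norm_natCast]
    push_cast; ring
  rw [norm_neg, norm_mul, norm_div, norm_pow, hN1]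
  have h5 : (N + 1 : ℝ) / L ^ (N + 2) * ‖A₁ - A₂‖ ≤ (N + 1) * (C * 2 ^ d * ϑ) * L ^ (-(d + 1)) := by
    calc _ ≤ (N + 1 : ℝ) / L ^ (N + 2) * (C * 2 ^ d * Real.exp ((N + 1 - d) * U) * ϑ) := by gcongr
      _ = (N + 1) * (C * 2 ^ d * ϑ) * (Real.exp ((N + 1 - d) * U) / L ^ (N + 2)) := by ring
      _ = _ := by
        rw [hLrpow, hLpow, ← Real.exp_sub]; push_cast; ring_nf
  have hLd : 0 < L ^ (-(d + 1)) := Real.rpow_pos_of_pos hLp _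
  calc _ ≤ B₀ * L ^ (-(d + 1)) * (2 * J) + (N + 1) * (C * 2 ^ d * ϑ) * L ^ (-(d + 1)) :=
        add_le_add hTint h5
    _ ≤ _ := by nlinarith

end HoloProfile

theorem sum_range_two_mul_of_odd_eq_zero (f : ℕ → ℂ) (hf : ∀ j, Odd j → f j = 0) (n : ℕ) :
    ∑ j ∈ Finset.range (2 * n + 2), f j = ∑ j ∈ Finset.range (n + 1), f (2 * j) := by
  induction n with
  | zero => simp [Finset.sum_range_succ, hf 1 odd_one]
  | succ n ih =>
    rw [show 2 * (n + 1) + 2 = (2 * n + 2) + 1 + 1 by ring, Finset.sum_range_succ,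
      Finset.sum_range_succ, ih, hf (2 * n + 2 + 1) ⟨n + 1, by ring⟩, add_zero,
      Finset.sum_range_succ _ (n + 1)]
    rfl

theorem sum_range_two_mul_add_one_of_odd_eq_zero (f : ℕ → ℂ) (hf : ∀ j, Odd j → f j = 0) (n : ℕ) :
    ∑ j ∈ Finset.range (2 * n + 1), f j = ∑ j ∈ Finset.range (n + 1), f (2 * j) := by
  rw [← sum_range_two_mul_of_odd_eq_zero f hf, Finset.sum_range_succ _ (2 * n + 1),
    hf _ ⟨n, rfl⟩, add_zero]

namespace HoloProfile

variable {m : ℂ → ℂ} {ϑ d C : ℝ} (H : HoloProfile m ϑ d C)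
include H

theorem neg_kernelMain_eq (n : ℕ) (z : ℂ) : -kernelMain (profileMoment m) n z =
    ∑ j ∈ Finset.range (2 * n + 2), (j + 1 : ℂ) * profileMoment m j / z ^ (j + 2) := by
  rw [kernelMain, neg_neg, sum_range_two_mul_of_odd_eq_zero
    (fun j => (j + 1 : ℂ) * profileMoment m j / z ^ (j + 2))
    fun j hj => by simp only [H.profileMoment_odd hj, mul_zero, zero_div]]
  simp

/-- The odd moments vanish, so the sum may be cut before or after the order 2n+1. Which version is
needed depends on whether d exceeds 2n+2. -/
theorem neg_kernelMain_eq' (n : ℕ) (z : ℂ) : -kernelMain (profileMoment m) n z =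
    ∑ j ∈ Finset.range (2 * n + 1), (j + 1 : ℂ) * profileMoment m j / z ^ (j + 2) := by
  rw [kernelMain, neg_neg, sum_range_two_mul_add_one_of_odd_eq_zero
    (fun j => (j + 1 : ℂ) * profileMoment m j / z ^ (j + 2))
    fun j hj => by simp only [H.profileMoment_odd hj, mul_zero, zero_div]]
  simp

theorem truncated_odd {N : ℕ} (hN : Odd N) (U : ℝ) :
    ∫ u in (-U)..U, m (Complex.sinh u) * Complex.cosh u * Complex.sinh u ^ N = 0 := by
  have h := intervalIntegral.integral_comp_neg (a := -U) (b := U)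
    (fun u : ℝ => m (Complex.sinh u) * Complex.cosh u * Complex.sinh u ^ N)
  have e : ∀ u : ℝ, m (Complex.sinh (-u : ℝ)) * Complex.cosh (-u : ℝ) * Complex.sinh (-u : ℝ) ^ N =
      -(m (Complex.sinh u) * Complex.cosh u * Complex.sinh u ^ N) := by
    intro u
    have hm : Complex.sinh u ∈ region ϑ := by
      rw [← Complex.ofReal_sinh]; exact H.mem_region_ofReal _
    rw [Complex.ofReal_neg, Complex.sinh_neg, Complex.cosh_neg, H.even _ hm, hN.neg_pow]
    ring
  simp only [e, neg_neg, intervalIntegral.integral_neg] at h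
  linear_combination (-1 / 2 : ℂ) * h

/-- Above the critical order the integrand grows at the positive rate N + 1 − d, and the integral is
dominated by the two ends |u| = U. -/
theorem norm_truncated_le_exp {N : ℕ} (hN : d < N + 1) : ∃ B > 0, ∀ U : ℝ, 0 ≤ U →
    ‖∫ u in (-U)..U, m (Complex.sinh u) * Complex.cosh u * Complex.sinh u ^ N‖ ≤
      B * Real.exp ((N + 1 - d) * U) := by
  set p := (N + 1 - d : ℝ) with hp
  have hp0 : 0 < p := by linarith
  have hC := H.nonneg
  set J := ∫ u : ℝ, Real.exp (-p * |u|) with hJ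
  have hJ0 : 0 ≤ J := integral_nonneg fun u => (Real.exp_pos _).le
  refine ⟨C * 2 ^ d * (2 * J) + 1, by positivity, fun U hU => ?_⟩
  have hdom : Integrable fun u : ℝ => C * 2 ^ d * Real.exp (p * U) *
      (Real.exp (-p * |u - U|) + Real.exp (-p * |u + U|)) :=
    (((integrable_exp_neg_mul_abs hp0).comp_sub_right U).add
      ((integrable_exp_neg_mul_abs hp0).comp_add_right U)).const_mul _
  rw [intervalIntegral.integral_of_le (by linarith), ← integral_indicator measurableSet_Ioc]
  refine (norm_integral_le_of_norm_le hdom (Eventually.of_forall fun u => ?_)).trans ?_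
  · by_cases hu : u ∈ Ioc (-U) U
    · have huU : |u| ≤ U := abs_le.2 ⟨hu.1.le, hu.2⟩
      rw [indicator_of_mem hu]
      have := H.norm_moment_integrand_le (w := u) (by simp; linarith [H.pos]) N
      refine this.trans ?_
      rw [mul_assoc (C * 2 ^ d)]
      refine mul_le_mul_of_nonneg_left ?_ (show 0 ≤ C * 2 ^ d by positivity)
      refine le_trans ?_ (mul_le_mul_of_nonneg_left two_sided_exp_bound (Real.exp_pos _).le)
      rw [← Real.exp_add, abs_of_nonpos (show |u| - U ≤ 0 by linarith), Complex.ofReal_re]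
      apply Real.exp_le_exp.2
      linarith
    · rw [indicator_of_notMem hu, norm_zero]
      have h1 := Real.exp_pos (-p * |u - U|)
      have h2 := Real.exp_pos (-p * |u + U|)
      positivity
  · rw [integral_const_mul]
    have := mul_le_mul_of_nonneg_left (integral_two_sided_exp p U)
      (show 0 ≤ C * 2 ^ d * Real.exp (p * U) by positivity)
    refine this.trans ?_
    have := Real.exp_pos (p * U)
    nlinarith

theorem norm_truncated_le_linear {N : ℕ} (hN : d = N + 1) {U : ℝ} (hU : 0 ≤ U) :
    ‖∫ u in (-U)..U, m (Complex.sinh u) * Complex.cosh u * Complex.sinh u ^ N‖ ≤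
      C * 2 ^ d * (2 * U) := by
  have := intervalIntegral.norm_integral_le_of_norm_le_const (a := -U) (b := U)
    (f := fun u : ℝ => m (Complex.sinh u) * Complex.cosh u * Complex.sinh u ^ N)
    (C := C * 2 ^ d) fun u _ => by
      have := H.norm_moment_integrand_le (w := u) (by simp; linarith [H.pos]) N
      rwa [show ((N : ℝ) + 1 - d) = 0 by linarith, zero_mul, Real.exp_zero, mul_one] at this
  rwa [abs_of_nonneg (by linarith : 0 ≤ U - -U), show U - -U = 2 * U by ring] at this

omit H in
theorem norm_truncated_le_moment {N : ℕ} (hi : Integrable fun x : ℝ => (x : ℂ) ^ N * m x) {U : ℝ}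
    (hU : 0 ≤ U) :
    ‖∫ u in (-U)..U, m (Complex.sinh u) * Complex.cosh u * Complex.sinh u ^ N‖ ≤
      ∫ u : ℝ, ‖m (Complex.sinh u) * Complex.cosh u * Complex.sinh u ^ N‖ := by
  have h : Integrable fun u : ℝ => m (Complex.sinh u) * Complex.cosh u * Complex.sinh u ^ N := by
    refine (integrable_comp_sinh hi).congr (Eventually.of_forall fun u => ?_)
    simp only [Complex.ofReal_sinh, Complex.ofReal_cosh]; ring
  rw [intervalIntegral.integral_of_le (by linarith)]
  exact (norm_integral_le_integral_norm _).trans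
    (setIntegral_le_integral h.norm (Eventually.of_forall fun u => norm_nonneg _))

omit H in
theorem norm_coeff_mul_le {N : ℕ} {z t : ℂ} (hz : 1 ≤ ‖z‖) {B : ℝ} (ht : ‖t‖ ≤ B) :
    ‖(N + 1) / z ^ (N + 2) * t‖ ≤ (N + 1) * (B / ‖z‖ ^ (N + 2)) := by
  have hN1 : ‖((N : ℂ) + 1)‖ = N + 1 := by
    rw [show ((N : ℂ) + 1) = ((N + 1 : ℕ) : ℂ) by push_cast; ring, Complex.norm_natCast]
    push_cast; ring
  rw [norm_mul, norm_div, norm_pow, hN1]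
  calc (N + 1 : ℝ) / ‖z‖ ^ (N + 2) * ‖t‖ ≤ (N + 1 : ℝ) / ‖z‖ ^ (N + 2) * B := by gcongr
    _ = _ := by ring

/-- Expansion of the kernel at infinity, with logarithmic loss. -/
theorem exists_norm_kernelFun_sub_main_le {n : ℕ} (hn : 2 * (n : ℝ) + 1 < d) :
    ∃ B > 0, ∀ z ∈ lowerRegion (Real.sin (ϑ / 2) / 4), 1 ≤ ‖z‖ →
      ‖kernelFun m (ϑ / 2) z - kernelMain (profileMoment m) n z‖ ≤
      B * (‖z‖ ^ (-(d + 1)) + (1 + Real.log ‖z‖) / ‖z‖ ^ (2 * n + 4)) := by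
  have hlast : ∀ z : ℂ, 1 ≤ ‖z‖ → 0 < ‖z‖ ^ (-(d + 1)) ∧
      0 < (1 + Real.log ‖z‖) / ‖z‖ ^ (2 * n + 4) := fun z hz => by
    have := Real.log_nonneg hz
    exact ⟨Real.rpow_pos_of_pos (by linarith) _, by positivity⟩
  -- For d ≤ 2n+2 the truncated moment has the odd order 2n+1 and is zero. For 2n+2 < d ≤ 2n+3 it
  -- has the even order 2n+2 and grows with ‖z‖. For larger d all moments that occur converge.
  rcases le_or_gt d (2 * n + 2) with h1 | h1
  · obtain ⟨B, hB, h⟩ := H.exists_norm_kernelFun_add_truncated_le (N := 2 * n + 1)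
      (by push_cast; linarith) (by push_cast; linarith)
    refine ⟨B, hB, fun z hz hz1 => ?_⟩
    have := h z hz hz1
    rw [H.truncated_odd ⟨n, rfl⟩, mul_zero, add_zero, ← H.neg_kernelMain_eq', ← sub_eq_add_neg] at this
    refine this.trans (mul_le_mul_of_nonneg_left ?_ hB.le)
    linarith [(hlast z hz1).2]
  rcases le_or_gt d (2 * n + 3) with h2 | h2
  · obtain ⟨B, hB, h⟩ := H.exists_norm_kernelFun_add_truncated_le (N := 2 * n + 2)
      (by push_cast; linarith) (by push_cast; linarith)
    have htr : ∃ B' > 0, ∀ z : ℂ, 1 ≤ ‖z‖ → ‖∫ u in (-Real.log ‖z‖)..Real.log ‖z‖,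
        m (Complex.sinh u) * Complex.cosh u * Complex.sinh u ^ (2 * n + 2)‖ / ‖z‖ ^ (2 * n + 2 + 2) ≤
        B' * (‖z‖ ^ (-(d + 1)) + (1 + Real.log ‖z‖) / ‖z‖ ^ (2 * n + 4)) := by
      rcases h2.lt_or_eq with h3 | h3
      · obtain ⟨B', hB', h'⟩ := H.norm_truncated_le_exp (N := 2 * n + 2) (by push_cast; linarith)
        refine ⟨B', hB', fun z hz1 => ?_⟩
        have hlp : 0 < ‖z‖ := by linarith
        have e : Real.exp (((2 * n + 2 : ℕ) + 1 - d) * Real.log ‖z‖) / ‖z‖ ^ (2 * n + 2 + 2) =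
            ‖z‖ ^ (-(d + 1)) := by
          rw [mul_comm, ← Real.rpow_def_of_pos hlp, ← Real.rpow_natCast, ← Real.rpow_sub hlp]
          push_cast; ring_nf
        calc _ ≤ B' * Real.exp (((2 * n + 2 : ℕ) + 1 - d) * Real.log ‖z‖) / ‖z‖ ^ (2 * n + 2 + 2) := by
              gcongr; exact h' _ (Real.log_nonneg hz1)
          _ = B' * ‖z‖ ^ (-(d + 1)) := by rw [mul_div_assoc, e]
          _ ≤ _ := mul_le_mul_of_nonneg_left (by linarith [(hlast z hz1).2]) hB'.le
      -- The borderline d = 2n+3 is where the logarithm arises: the truncated moment grows linearly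
      -- in log ‖z‖.
      · have hC := H.nonneg
        refine ⟨C * 2 ^ d * 2 + 1, by positivity, fun z hz1 => ?_⟩
        have hlg := Real.log_nonneg hz1
        have := H.norm_truncated_le_linear (N := 2 * n + 2) (by push_cast; linarith) hlg
        have hlp : 0 < ‖z‖ := by linarith
        calc _ ≤ C * 2 ^ d * (2 * Real.log ‖z‖) / ‖z‖ ^ (2 * n + 2 + 2) := by gcongr
          _ = C * 2 ^ d * 2 * (Real.log ‖z‖ / ‖z‖ ^ (2 * n + 4)) := by ring
          _ ≤ (C * 2 ^ d * 2 + 1) * (‖z‖ ^ (-(d + 1)) + (1 + Real.log ‖z‖) / ‖z‖ ^ (2 * n + 4)) := by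
              have h0 := (hlast z hz1).1
              have : Real.log ‖z‖ / ‖z‖ ^ (2 * n + 4) ≤ (1 + Real.log ‖z‖) / ‖z‖ ^ (2 * n + 4) := by
                gcongr; linarith
              refine mul_le_mul (by linarith) (by linarith) (by positivity) (by positivity)
    obtain ⟨B', hB', h'⟩ := htr
    refine ⟨B + ((2 * n + 2 : ℕ) + 1) * B', by positivity, fun z hz hz1 => ?_⟩
    have h4 := h z hz hz1
    have h5 := norm_coeff_mul_le (N := 2 * n + 2) hz1 (le_refl ‖∫ u in (-Real.log ‖z‖)..Real.log ‖z‖,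
        m (Complex.sinh u) * Complex.cosh u * Complex.sinh u ^ (2 * n + 2)‖)
    have h6 := h' z hz1
    rw [← H.neg_kernelMain_eq, ← sub_eq_add_neg] at h4
    have h7 := (norm_le_add_norm_add _ _).trans (add_le_add h4 le_rfl)
    set X := ‖z‖ ^ (-(d + 1)) + (1 + Real.log ‖z‖) / ‖z‖ ^ (2 * n + 4)
    have h8 : B * ‖z‖ ^ (-(d + 1)) ≤ B * X :=
      mul_le_mul_of_nonneg_left (by linarith [(hlast z hz1).2]) hB.le
    have h9 : (((2 * n + 2 : ℕ) : ℝ) + 1) * _ ≤ (((2 * n + 2 : ℕ) : ℝ) + 1) * (B' * X) :=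
      mul_le_mul_of_nonneg_left h6 (by positivity)
    calc _ ≤ B * ‖z‖ ^ (-(d + 1)) + _ := h7
      _ ≤ B * X + (((2 * n + 2 : ℕ) : ℝ) + 1) * (B' * X) := add_le_add h8 (h5.trans h9)
      _ = _ := by ring
  · obtain ⟨B, hB, h⟩ := H.exists_norm_kernelFun_add_sum_le (N := 2 * n + 2)
      (by push_cast; linarith)
    refine ⟨B, hB, fun z hz hz1 => ?_⟩
    have := h z hz hz1
    rw [← H.neg_kernelMain_eq, ← sub_eq_add_neg] at this
    refine this.trans ?_
    rw [div_eq_mul_one_div]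
    refine mul_le_mul_of_nonneg_left ?_ hB.le
    have h0 := (hlast z hz1).1
    have : 1 / ‖z‖ ^ (2 * n + 2 + 2) ≤ (1 + Real.log ‖z‖) / ‖z‖ ^ (2 * n + 4) := by
      gcongr; linarith [Real.log_nonneg hz1]
    linarith

/-- Expansion of the kernel at infinity, without logarithmic loss. -/
theorem exists_norm_kernelFun_sub_main_le' {n : ℕ} (hn : 2 * (n : ℝ) + 3 ≤ d)
    (hi : Integrable fun x : ℝ => (x : ℂ) ^ (2 * n + 2) * m x) :
    ∃ B > 0, ∀ z ∈ lowerRegion (Real.sin (ϑ / 2) / 4), 1 ≤ ‖z‖ →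
      ‖kernelFun m (ϑ / 2) z - kernelMain (profileMoment m) n z‖ ≤ B / ‖z‖ ^ (2 * n + 4) := by
  -- At d = 2n+3 the finite moment of order 2n+2 bounds the truncated moments uniformly and thereby
  -- removes the logarithm.
  rcases hn.eq_or_lt with h2 | h2
  · obtain ⟨B, hB, h⟩ := H.exists_norm_kernelFun_add_truncated_le (N := 2 * n + 2)
      (by push_cast; linarith) (by push_cast; linarith)
    set J := ∫ u : ℝ, ‖m (Complex.sinh u) * Complex.cosh u * Complex.sinh u ^ (2 * n + 2)‖
    have hJ0 : 0 ≤ J := integral_nonneg fun u => norm_nonneg _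
    refine ⟨B + ((2 * n + 2 : ℕ) + 1) * J, by positivity, fun z hz hz1 => ?_⟩
    have hlp : 0 < ‖z‖ := by linarith
    have h4 := h z hz hz1
    have h5 := norm_coeff_mul_le (N := 2 * n + 2) hz1
      (norm_truncated_le_moment hi (Real.log_nonneg hz1))
    rw [← H.neg_kernelMain_eq, ← sub_eq_add_neg] at h4
    have h7 := (norm_le_add_norm_add _ _).trans (add_le_add h4 le_rfl)
    have e : ‖z‖ ^ (-(d + 1)) = 1 / ‖z‖ ^ (2 * n + 4) := by
      rw [Real.rpow_neg hlp.le, ← h2, one_div, ← Real.rpow_natCast]; push_cast; ring_nf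
    rw [e] at h7
    refine h7.trans ((add_le_add le_rfl h5).trans_eq ?_)
    ring
  · obtain ⟨B, hB, h⟩ := H.exists_norm_kernelFun_add_sum_le (N := 2 * n + 2)
      (by push_cast; linarith)
    refine ⟨B, hB, fun z hz hz1 => ?_⟩
    have := h z hz hz1
    rwa [← H.neg_kernelMain_eq, ← sub_eq_add_neg] at this

end HoloProfile

/-! ### From the radial distribution to the one-dimensional profile -/

/-- Coordinates on three-dimensional space, splitting off the first one. -/
noncomputable def coordEquiv : E3 ≃ᵐ ℝ × (ℝ × ℝ) :=
  ((MeasurableEquiv.toLp 2 (Fin 3 → ℝ)).symm.trans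
    (MeasurableEquiv.piFinSuccAbove (fun _ : Fin 3 => ℝ) 0)).trans
    ((MeasurableEquiv.refl ℝ).prodCongr MeasurableEquiv.finTwoArrow)

theorem measurePreserving_coordEquiv : MeasurePreserving coordEquiv := by
  refine ((EuclideanSpace.volume_preserving_symm_measurableEquiv_toLp (Fin 3)).trans
    (volume_preserving_piFinSuccAbove (fun _ : Fin 3 => ℝ) 0)).trans ?_
  exact (MeasurePreserving.id _).prod (volume_preserving_finTwoArrow ℝ)

theorem coordEquiv_apply (v : E3) : coordEquiv v = (v 0, (v 1, v 2)) := rfl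

theorem coordEquiv_symm_apply (p : ℝ × (ℝ × ℝ)) :
    coordEquiv.symm p = !₂[p.1, p.2.1, p.2.2] := by
  apply coordEquiv.injective
  rw [MeasurableEquiv.apply_symm_apply, coordEquiv_apply]
  rfl

theorem integrable_of_integral_eq_one {M₀ : E3 → ℝ} (h : ∫ v, M₀ v = 1) : Integrable M₀ := by
  by_contra hc
  rw [integral_undef hc] at h
  exact zero_ne_one h

theorem integral_first_coord {M₀ : E3 → ℝ} (h : Integrable M₀) {g : ℝ → ℂ} (hg : Continuous g)
    (hb : ∀ x, ‖g x‖ ≤ 1) :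
    ∫ v : E3, (M₀ v : ℂ) * g (v 0) = ∫ x : ℝ, (reduced M₀ x : ℂ) * g x := by
  rw [← measurePreserving_coordEquiv.symm.integral_comp' (f := coordEquiv.symm)
    (g := fun v : E3 => (M₀ v : ℂ) * g (v 0))]
  have hi : Integrable (fun p : ℝ × (ℝ × ℝ) => (M₀ (coordEquiv.symm p) : ℂ)) :=
    ((measurePreserving_coordEquiv.symm.integrable_comp_emb
      coordEquiv.symm.measurableEmbedding).2 h).ofReal
  have hi2 : Integrable (fun p : ℝ × (ℝ × ℝ) => (M₀ (coordEquiv.symm p) : ℂ) * g p.1) :=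
    hi.mul_bdd (c := 1) (hg.comp continuous_fst).aestronglyMeasurable
      (Eventually.of_forall fun p => hb _)
  have e : ∀ p : ℝ × (ℝ × ℝ), (coordEquiv.symm p) 0 = p.1 := fun p => by
    rw [coordEquiv_symm_apply]; rfl
  simp only [e]
  rw [Measure.volume_eq_prod, integral_prod _ hi2]
  refine integral_congr_ae (Eventually.of_forall fun x => ?_)
  simp only
  rw [integral_mul_const, integral_complex_ofReal]
  simp only [coordEquiv_symm_apply, reduced]

theorem integrable_reduced {M₀ : E3 → ℝ} (h : Integrable M₀) : Integrable (reduced M₀) := by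
  have hi : Integrable (fun p : ℝ × (ℝ × ℝ) => M₀ (coordEquiv.symm p)) :=
    (measurePreserving_coordEquiv.symm.integrable_comp_emb
      coordEquiv.symm.measurableEmbedding).2 h
  have := hi.integral_prod_left
  simpa only [coordEquiv_symm_apply] using! this

theorem integral_reduced {M₀ : E3 → ℝ} (h : ∫ v, M₀ v = 1) : ∫ x, reduced M₀ x = 1 := by
  have := integral_first_coord (integrable_of_integral_eq_one h) (g := fun _ => 1) continuous_const
    (by simp)
  simp only [mul_one, integral_complex_ofReal, h] at this
  exact_mod_cast this.symm

/-- The reflection that interchanges ξ and the vector of the same length on the first axis preserves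
M₀ and the measure. After this change of variables the phase depends on the first coordinate only,
and Fubini's theorem applies. -/
theorem fourierHat_eq {M₀ : E3 → ℝ} (hrad : ∀ v w : E3, ‖v‖ = ‖w‖ → M₀ v = M₀ w)
    (hint : Integrable M₀) (ξ : E3) :
    fourierHat M₀ ξ = ∫ x : ℝ, (reduced M₀ x : ℂ) * Complex.exp (-Complex.I * (x * ‖ξ‖ : ℝ)) := by
  set e : E3 := EuclideanSpace.single 0 ‖ξ‖ with he
  have hn : ‖e‖ = ‖ξ‖ := by simp [he]
  set R := (ℝ ∙ (e - ξ))ᗮ.reflection with hR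
  have hRe : R e = ξ := Submodule.reflection_sub hn
  have hin : ∀ v : E3, inner ℝ (R v) ξ = v 0 * ‖ξ‖ := fun v => by
    rw [← hRe, R.inner_map_map, he, EuclideanSpace.inner_single_right]
    simp [mul_comm]
  rw [← integral_first_coord hint (g := fun x => Complex.exp (-Complex.I * (x * ‖ξ‖ : ℝ)))
    (by fun_prop) (fun x => by
      rw [Complex.norm_exp]; simp)]
  rw [fourierHat, ← (LinearIsometryEquiv.measurePreserving R).integral_comp
    R.toHomeomorph.measurableEmbedding]
  refine integral_congr_ae (Eventually.of_forall fun v => ?_)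
  simp only [hin, hrad (R v) v (R.norm_map v)]

/-- The holomorphic extension of the reduced distribution. -/
theorem IsAcceptable.exists_profile {ϑ d : ℝ} {M₀ : E3 → ℝ} (h0 : 0 < ϑ) (h1 : ϑ ≤ Real.pi / 4)
    (hd : 1 < d) (h : IsAcceptable ϑ d M₀) :
    ∃ (m : ℂ → ℂ) (C : ℝ), HoloProfile m ϑ d C ∧ ∀ x : ℝ, m x = (reduced M₀ x : ℂ) := by
  obtain ⟨m, han, hm, hs, C, hC⟩ := h.exists_extension
  have hneg : ∀ z ∈ region ϑ, -z ∈ region ϑ := fun z hz => by simpa [region] using hz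
  have hconj : ∀ z ∈ region ϑ, (starRingEnd ℂ) z ∈ region ϑ := fun z hz => by
    simpa [region] using hz
  refine ⟨m, max C 0, ⟨h0, by linarith [Real.pi_lt_four], hd, le_max_right _ _,
    han.differentiableOn, fun z hz => (hs z hz).1.symm, fun z hz => ?_, fun z hz => ?_⟩, hm⟩
  · rw [(hs z hz).2, Complex.conj_conj]
  · refine (hC z hz).trans ?_
    have : 0 ≤ (1 + ‖z‖) ^ (-d) := by positivity
    gcongr
    exact le_max_left _ _

/-! ### The kernel as a Laplace transform of the Fourier transform -/

theorem integral_mul_exp_neg_mul_Ioi {p : ℂ} (hp : 0 < p.re) :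
    ∫ t in Ioi (0 : ℝ), (t : ℂ) * Complex.exp (-p * t) = 1 / p ^ 2 := by
  have hp0 : p ≠ 0 := fun h => by simp [h] at hp
  have hnorm : ∀ t : ℝ, ‖Complex.exp (-p * t)‖ = Real.exp (-p.re * t) := fun t => by
    rw [Complex.norm_exp]; simp
  have hd : ∀ t ∈ Ici (0 : ℝ), HasDerivAt (fun t : ℝ => -(t / p + 1 / p ^ 2) * Complex.exp (-p * t))
      ((t : ℂ) * Complex.exp (-p * t)) t := by
    intro t _
    have h1 : HasDerivAt (fun t : ℂ => -(t / p + 1 / p ^ 2) * Complex.exp (-p * t))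
        (-(1 / p) * Complex.exp (-p * t) + -(t / p + 1 / p ^ 2) *
          (Complex.exp (-p * t) * (-p * 1))) (t : ℂ) :=
      (((hasDerivAt_id (t : ℂ)).div_const p).add_const _).neg.mul
        ((hasDerivAt_id (t : ℂ)).const_mul (-p)).cexp
    convert h1.comp_ofReal using 1
    field_simp; ring
  have hint : IntegrableOn (fun t : ℝ => (t : ℂ) * Complex.exp (-p * t)) (Ioi 0) := by
    have h2 := integrableOn_rpow_mul_exp_neg_mul_rpow (p := 1) (s := 1) (b := p.re)
      (by norm_num) one_pos hp
    refine Integrable.mono' h2 (by fun_prop) ?_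
    filter_upwards [self_mem_ae_restrict measurableSet_Ioi] with t ht
    have ht0 : (0 : ℝ) < t := ht
    rw [norm_mul, hnorm, Complex.norm_real, Real.norm_of_nonneg ht0.le, Real.rpow_one]
  have ht : Tendsto (fun t : ℝ => -(t / p + 1 / p ^ 2) * Complex.exp (-p * t)) atTop (𝓝 0) := by
    have h0 := tendsto_rpow_mul_exp_neg_mul_atTop_nhds_zero 0 p.re hp
    have h1 := tendsto_rpow_mul_exp_neg_mul_atTop_nhds_zero 1 p.re hp
    have h3 : Tendsto (fun t : ℝ => t ^ (1 : ℝ) * Real.exp (-p.re * t) * ‖1 / p‖ +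
        t ^ (0 : ℝ) * Real.exp (-p.re * t) * ‖1 / p ^ 2‖) atTop (𝓝 0) := by
      simpa only [zero_mul, add_zero] using (h1.mul_const ‖1 / p‖).add (h0.mul_const ‖1 / p ^ 2‖)
    refine squeeze_zero_norm' ?_ h3
    filter_upwards [eventually_gt_atTop 0] with t ht
    rw [norm_mul, norm_neg, hnorm, Real.rpow_one, Real.rpow_zero]
    have : ‖(t : ℂ) / p + 1 / p ^ 2‖ ≤ t * ‖1 / p‖ + ‖1 / p ^ 2‖ := by
      refine (norm_add_le _ _).trans_eq ?_
      rw [div_eq_mul_one_div, norm_mul, Complex.norm_real, Real.norm_of_nonneg ht.le]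
    calc _ ≤ (t * ‖1 / p‖ + ‖1 / p ^ 2‖) * Real.exp (-p.re * t) := by gcongr
      _ = _ := by ring
  rw [integral_Ioi_of_hasDerivAt_of_tendsto' hd hint ht]
  simp

namespace HoloProfile

variable {m : ℂ → ℂ} {ϑ d C : ℝ} (H : HoloProfile m ϑ d C)
include H

omit H in
theorem sinh_im_line (u : ℝ) : (Complex.sinh (u + (ϑ / 2 : ℝ) * Complex.I)).im =
    Real.cosh u * Real.sin (ϑ / 2) := by
  rw [sinh_im]; simp [-Complex.ofReal_div]

theorem sin_le_sinh_im_line (u : ℝ) : Real.sin (ϑ / 2) ≤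
    (Complex.sinh (u + (ϑ / 2 : ℝ) * Complex.I)).im := by
  rw [sinh_im_line]
  nlinarith [Real.one_le_cosh u, H.sin_pos]

theorem norm_line_le (u : ℝ) : ‖m (Complex.sinh (u + (ϑ / 2 : ℝ) * Complex.I)) *
    Complex.cosh (u + (ϑ / 2 : ℝ) * Complex.I)‖ ≤ C * 2 ^ d * Real.exp (-(d - 1) * |u|) := by
  have hg := H.norm_mul_cosh_le (H.abs_im_line u)
  have hre : (u + ((ϑ / 2 : ℝ) : ℂ) * Complex.I : ℂ).re = u := by simp [-Complex.ofReal_div]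
  rwa [hre] at hg

/-- The Fourier transform of the profile, after shifting the contour. -/
theorem fourier_profile_eq {t : ℝ} (ht : 0 ≤ t) :
    ∫ x : ℝ, m x * Complex.exp (-Complex.I * (x * t : ℝ)) =
    ∫ u : ℝ, m (Complex.sinh (u + (ϑ / 2 : ℝ) * Complex.I)) *
      Complex.cosh (u + (ϑ / 2 : ℝ) * Complex.I) *
      Complex.exp (Complex.I * t * Complex.sinh (u + (ϑ / 2 : ℝ) * Complex.I)) := by
  have h := integral_line_eq (f := fun w => m (Complex.sinh w) * Complex.cosh w *
      Complex.exp (Complex.I * t * Complex.sinh w)) (p := d - 1) (C := C * 2 ^ d) (y₁ := 0)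
      (y₂ := ϑ / 2) (by linarith [H.one_lt]) (by linarith [H.pos])
      (fun w h0 h1 => ((H.differentiableAt_sinh (abs_le_of_mem h0 h1)).mul
        Complex.differentiable_cosh.differentiableAt).mul (by fun_prop))
      (fun w h0 h1 => by
        rw [norm_mul]
        refine (mul_le_of_le_one_right (norm_nonneg _) ?_).trans
          (H.norm_mul_cosh_le (abs_le_of_mem h0 h1))
        rw [Complex.norm_exp, Real.exp_le_one_iff]
        have : (Complex.I * t * Complex.sinh w).re = -(t * (Complex.sinh w).im) := by
          simp [Complex.mul_re]
        rw [this, sinh_im, neg_nonpos]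
        have hs := Real.sin_nonneg_of_nonneg_of_le_pi h0
          (by linarith [H.le_one, Real.pi_gt_three])
        have := Real.cosh_pos w.re
        positivity)
  -- Evenness of m replaces e^{−ixt} by e^{ixt}, which for t ≥ 0 is bounded by one in the upper half
  -- plane.
  rw [← h, ← integral_neg_eq_self (fun x : ℝ => m x * _),
    ← integral_comp_sinh (fun x : ℝ => m (-x : ℝ) * Complex.exp (-Complex.I * (-x * t : ℝ)))]
  refine integral_congr_ae (Eventually.of_forall fun u => ?_)
  simp only [Complex.ofReal_zero, zero_mul, add_zero]
  rw [Complex.ofReal_neg, H.even _ (H.mem_region_ofReal _)]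
  push_cast
  ring_nf

/-- On the raised contour Im s ≥ sin(ϑ/2), so e^{its} supplies the exponential decay. -/
theorem norm_fourier_profile_le : ∃ B > 0, ∀ t : ℝ, 0 ≤ t →
    ‖∫ x : ℝ, m x * Complex.exp (-Complex.I * (x * t : ℝ))‖ ≤
      B * Real.exp (-(Real.sin (ϑ / 2) * t)) := by
  set J := ∫ u : ℝ, C * 2 ^ d * Real.exp (-(d - 1) * |u|) with hJ
  refine ⟨|J| + 1, by positivity, fun t ht => ?_⟩
  rw [H.fourier_profile_eq ht]
  refine (norm_integral_le_of_norm_le (g := fun u : ℝ => C * 2 ^ d * Real.exp (-(d - 1) * |u|) *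
    Real.exp (-(Real.sin (ϑ / 2) * t))) (((integrable_exp_neg_mul_abs
      (by linarith [H.one_lt])).const_mul _).mul_const _)
    (Eventually.of_forall fun u => ?_)).trans ?_
  · rw [norm_mul]
    have hC := H.nonneg
    refine mul_le_mul (H.norm_line_le u) ?_ (norm_nonneg _) (by positivity)
    rw [Complex.norm_exp, Real.exp_le_exp]
    have : ∀ s : ℂ, (Complex.I * t * s).re = -(s.im * t) := fun s => by
      simp [Complex.mul_re, mul_comm]
    rw [this, neg_le_neg_iff]
    exact mul_le_mul_of_nonneg_right (H.sin_le_sinh_im_line u) ht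
  · rw [integral_mul_const, ← hJ]
    gcongr
    linarith [le_abs_self J]

/-- The Laplace representation of the kernel on the real axis. -/
theorem laplace_fourier_eq_kernelFun (x : ℝ) :
    ∫ t in Ioi (0 : ℝ), (t : ℂ) * (∫ y : ℝ, m y * Complex.exp (-Complex.I * (y * t : ℝ))) *
      Complex.exp (-Complex.I * t * x) = kernelFun m (ϑ / 2) x := by
  set G : ℝ → ℂ := fun u => m (Complex.sinh (u + (ϑ / 2 : ℝ) * Complex.I)) *
    Complex.cosh (u + (ϑ / 2 : ℝ) * Complex.I) with hG
  set s : ℝ → ℂ := fun u => Complex.sinh (u + (ϑ / 2 : ℝ) * Complex.I) with hs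
  have hσ := H.sin_pos
  have hGc : Continuous G := H.continuous_line (by rw [abs_of_pos (by linarith [H.pos])])
  have hsc : Continuous s := continuous_sinh_line _
  have e1 : ∀ t ∈ Ioi (0 : ℝ), (t : ℂ) * (∫ y : ℝ, m y * Complex.exp (-Complex.I * (y * t : ℝ))) *
      Complex.exp (-Complex.I * t * x) =
      ∫ u : ℝ, G u * (t * Complex.exp (-(Complex.I * (x - s u)) * t)) := by
    intro t ht
    rw [H.fourier_profile_eq (le_of_lt ht), mul_comm (t : ℂ), mul_assoc, ← integral_mul_const]
    refine integral_congr_ae (Eventually.of_forall fun u => ?_)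
    simp only [hG, hs]
    rw [show -(Complex.I * (x - Complex.sinh (u + (ϑ / 2 : ℝ) * Complex.I))) * (t : ℂ) =
      Complex.I * t * Complex.sinh (u + (ϑ / 2 : ℝ) * Complex.I) + -Complex.I * t * x by ring,
      Complex.exp_add]
    ring
  rw [setIntegral_congr_fun measurableSet_Ioi e1]
  have hint : Integrable (Function.uncurry fun (t : ℝ) (u : ℝ) =>
      G u * (t * Complex.exp (-(Complex.I * (x - s u)) * t)))
      ((volume.restrict (Ioi 0)).prod volume) := by
    have hd1 : IntegrableOn (fun t : ℝ => t * Real.exp (-(Real.sin (ϑ / 2)) * t)) (Ioi 0) := by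
      have h2 := integrableOn_rpow_mul_exp_neg_mul_rpow (p := 1) (s := 1) (b := Real.sin (ϑ / 2))
        (by norm_num) one_pos hσ
      simpa using h2
    have hd2 : Integrable (fun u : ℝ => C * 2 ^ d * Real.exp (-(d - 1) * |u|)) :=
      (integrable_exp_neg_mul_abs (by linarith [H.one_lt])).const_mul _
    refine Integrable.mono' (hd1.mul_prod hd2) ?_ ?_
    · refine Continuous.aestronglyMeasurable ?_
      simp only [Function.uncurry_def]
      fun_prop
    · rw [Measure.ae_prod_iff_ae_ae]
      · filter_upwards [self_mem_ae_restrict measurableSet_Ioi] with t ht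
        refine Eventually.of_forall fun u => ?_
        have ht0 : (0 : ℝ) < t := ht
        simp only [Function.uncurry]
        rw [norm_mul, norm_mul (t : ℂ), Complex.norm_real, Real.norm_of_nonneg ht0.le, mul_comm]
        refine mul_le_mul ?_ (H.norm_line_le u) (norm_nonneg _) (by positivity)
        gcongr
        rw [Complex.norm_exp, Real.exp_le_exp]
        have : (-(Complex.I * (x - s u)) * t).re = -((s u).im * t) := by
          simp [Complex.mul_re]
        rw [this, neg_mul, neg_le_neg_iff]
        exact mul_le_mul_of_nonneg_right (H.sin_le_sinh_im_line u) ht0.le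
      · refine measurableSet_le ?_ ?_
        · simp only [Function.uncurry_def]
          exact Continuous.measurable (by fun_prop)
        · exact Continuous.measurable (by fun_prop)
  rw [integral_integral_swap hint, kernelFun, ← integral_neg]
  refine integral_congr_ae (Eventually.of_forall fun u => ?_)
  simp only
  rw [integral_const_mul]
  have hre : 0 < (Complex.I * (x - s u)).re := by
    have : (Complex.I * (x - s u)).re = (s u).im := by simp [Complex.mul_re]
    rw [this]
    exact hσ.trans_le (H.sin_le_sinh_im_line u)
  have hlap : ∫ t in Ioi (0 : ℝ), (t : ℂ) * Complex.exp (-(Complex.I * (x - s u)) * t) =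
      1 / (Complex.I * (x - s u)) ^ 2 := integral_mul_exp_neg_mul_Ioi hre
  rw [hlap, mul_pow, Complex.I_sq]
  simp only [hG, hs]
  rw [neg_one_mul, one_div_neg_eq_neg_one_div, mul_neg, mul_one_div]

end HoloProfile

/-- Only |ξ| enters the Fourier transform, and rescaling t by |ξ| in the Laplace integral produces
the factor |ξ|⁻². -/
theorem kernelK_eq {m : ℂ → ℂ} {ϑ d C : ℝ} (H : HoloProfile m ϑ d C) {M₀ : E3 → ℝ}
    (hrad : ∀ v w : E3, ‖v‖ = ‖w‖ → M₀ v = M₀ w) (hint : Integrable M₀)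
    (hm : ∀ x : ℝ, m x = (reduced M₀ x : ℂ)) {ξ : E3} (hξ : ξ ≠ 0) (θ : ℝ) :
    kernelK M₀ ξ θ = kernelFun m (ϑ / 2) ((θ / ‖ξ‖ : ℝ) : ℂ) / (‖ξ‖ : ℂ) ^ 2 := by
  have hr : 0 < ‖ξ‖ := norm_pos_iff.2 hξ
  have hrc : (‖ξ‖ : ℂ) ≠ 0 := by exact_mod_cast hr.ne'
  set F : ℝ → ℂ := fun t => (t : ℂ) * (∫ y : ℝ, m y * Complex.exp (-Complex.I * (y * t : ℝ))) *
    Complex.exp (-Complex.I * t * (θ / ‖ξ‖ : ℝ)) with hF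
  have h1 := integral_comp_mul_left_Ioi F 0 hr
  rw [mul_zero] at h1
  have h2 : ∫ t in Ioi (0 : ℝ), F t = kernelFun m (ϑ / 2) ((θ / ‖ξ‖ : ℝ) : ℂ) :=
    H.laplace_fourier_eq_kernelFun (θ / ‖ξ‖)
  rw [h2] at h1
  have h3 : ∀ t ∈ Ioi (0 : ℝ), F (‖ξ‖ * t) = (‖ξ‖ : ℂ) * ((t : ℂ) * fourierHat M₀ (t • ξ) *
      Complex.exp (-Complex.I * t * θ)) := by
    intro t ht
    have ht0 : (0 : ℝ) < t := ht
    simp only [hF]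
    rw [fourierHat_eq hrad hint, norm_smul, Real.norm_of_nonneg ht0.le]
    simp only [hm, mul_comm t ‖ξ‖]
    have : -Complex.I * ((‖ξ‖ * t : ℝ) : ℂ) * ((θ / ‖ξ‖ : ℝ) : ℂ) = -Complex.I * t * θ := by
      push_cast; field_simp
    rw [this]
    push_cast; ring
  rw [setIntegral_congr_fun measurableSet_Ioi h3, integral_const_mul] at h1
  rw [kernelK, eq_div_iff (pow_ne_zero 2 hrc)]
  rw [Complex.real_smul, Complex.ofReal_inv] at h1
  have h4 := congrArg (fun y => (‖ξ‖ : ℂ) * y) h1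
  simp only [mul_inv_cancel_left₀ hrc] at h4
  rw [← h4]; ring

/-! ### Boundary values of the kernel on the real axis -/

namespace HoloProfile

variable {m : ℂ → ℂ} {ϑ d C : ℝ} (H : HoloProfile m ϑ d C)
include H

theorem conj_ofReal (x : ℝ) : (starRingEnd ℂ) (m x) = m x := by
  have := H.conj _ (H.mem_region_ofReal x)
  rw [Complex.conj_ofReal] at this
  exact this.symm

theorem continuous_ofReal : Continuous fun x : ℝ => m x := by
  refine continuous_iff_continuousAt.2 fun x => ?_
  exact (H.diff.differentiableAt ((isOpen_region ϑ).mem_nhds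
    (H.mem_region_ofReal x))).continuousAt.comp Complex.continuous_ofReal.continuousAt

theorem fourier_even (t : ℝ) : ∫ x : ℝ, m x * Complex.exp (-Complex.I * (x * -t : ℝ)) =
    ∫ x : ℝ, m x * Complex.exp (-Complex.I * (x * t : ℝ)) := by
  rw [← integral_neg_eq_self (fun x : ℝ => m x * Complex.exp (-Complex.I * (x * -t : ℝ)))]
  refine integral_congr_ae (Eventually.of_forall fun x => ?_)
  simp only [Complex.ofReal_neg, H.even _ (H.mem_region_ofReal x), neg_mul_neg]

theorem fourier_conj (t : ℝ) :
    (starRingEnd ℂ) (∫ x : ℝ, m x * Complex.exp (-Complex.I * (x * t : ℝ))) =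
    ∫ x : ℝ, m x * Complex.exp (-Complex.I * (x * t : ℝ)) := by
  rw [← integral_conj, ← H.fourier_even]
  refine integral_congr_ae (Eventually.of_forall fun x => ?_)
  simp only [map_mul, H.conj_ofReal, ← Complex.exp_conj, map_neg, Complex.conj_I,
    Complex.conj_ofReal]
  push_cast
  ring_nf

/-- Fourier inversion under the derivative gives −i/(2π) times the integral of t m̂(t) e^{−itx} over
the line. The half t > 0 is k(x), and by symmetry the half t < 0 is minus its conjugate, so the sum
is 2i Im k(x). This is Plemelj's formula without principal values. -/
theorem hasDerivAt_ofReal (hi : Integrable fun x : ℝ => m x) (x : ℝ) :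
    HasDerivAt (fun x : ℝ => m x) (((kernelFun m (ϑ / 2) x).im / Real.pi : ℝ) : ℂ) x := by
  open FourierTransform in
  set φ : ℝ → ℂ := fun t => ∫ y : ℝ, m y * Complex.exp (-Complex.I * (y * t : ℝ)) with hφ
  have hpi := Real.pi_pos
  have hσ := H.sin_pos
  set f : ℝ → ℂ := fun x => m x with hf
  have hF : ∀ ξ : ℝ, 𝓕 f ξ = φ (2 * Real.pi * ξ) := fun ξ => by
    rw [Real.fourier_real_eq_integral_exp_smul, hφ]
    refine integral_congr_ae (Eventually.of_forall fun y => ?_)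
    simp only [smul_eq_mul, hf]
    rw [mul_comm]; push_cast; ring_nf
  have heven : ∀ t, φ (-t) = φ t := fun t => H.fourier_even t
  obtain ⟨B, hB, hb⟩ := H.norm_fourier_profile_le
  have hφb : ∀ t, ‖φ t‖ ≤ B * Real.exp (-Real.sin (ϑ / 2) * |t|) := fun t => by
    rcases abs_cases t with ⟨h, h'⟩ | ⟨h, h'⟩
    · rw [h, neg_mul]; exact hb t h'
    · rw [h, ← heven, neg_mul]; exact hb (-t) (by linarith)
  have hFc : Continuous (𝓕 f) := by
    exact VectorFourier.fourierIntegral_continuous Real.continuous_fourierChar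
      (by exact continuous_inner) hi
  have hFn : ∀ ξ, ‖𝓕 f ξ‖ ≤ B * Real.exp (-(Real.sin (ϑ / 2) * (2 * Real.pi)) * |ξ|) := fun ξ => by
    rw [hF]
    refine (hφb _).trans_eq ?_
    rw [abs_mul, abs_of_pos (by positivity : 0 < 2 * Real.pi)]; ring_nf
  have hp : 0 < Real.sin (ϑ / 2) * (2 * Real.pi) := by positivity
  have hFi : Integrable (𝓕 f) := by
    refine Integrable.mono' ((integrable_exp_neg_mul_abs hp).const_mul B) hFc.aestronglyMeasurable
      (Eventually.of_forall hFn)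
  have hFxi : Integrable fun ξ : ℝ => ξ • 𝓕 f ξ := by
    refine Integrable.mono' ((integrable_exp_neg_mul_abs (half_pos hp)).const_mul
      (B * (2 / (Real.sin (ϑ / 2) * (2 * Real.pi)))))
      (continuous_id.smul hFc).aestronglyMeasurable (Eventually.of_forall fun ξ => ?_)
    set q := Real.sin (ϑ / 2) * (2 * Real.pi) with hq
    rw [norm_smul, Real.norm_eq_abs]
    have h1 : |ξ| ≤ 2 / q * Real.exp (q / 2 * |ξ|) := by
      have := Real.add_one_le_exp (q / 2 * |ξ|)
      rw [div_mul_eq_mul_div, le_div_iff₀ hp]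
      linarith
    calc |ξ| * ‖𝓕 f ξ‖ ≤ (2 / q * Real.exp (q / 2 * |ξ|)) * (B * Real.exp (-q * |ξ|)) :=
          mul_le_mul h1 (hFn ξ) (norm_nonneg _) (by positivity)
      _ = B * (2 / q) * (Real.exp (q / 2 * |ξ|) * Real.exp (-q * |ξ|)) := by ring
      _ = _ := by rw [← Real.exp_add]; ring_nf
  -- The inverse transform is the transform at −x, and evenness of the profile removes the sign.
  have hinv : ∀ x, f x = 𝓕 (𝓕 f) x := fun x => by
    have h1 := hi.fourierInv_fourier_eq hFi (v := -x) H.continuous_ofReal.continuousAt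
    rw [Real.fourierInv_eq_fourier_neg, neg_neg] at h1
    rw [h1, hf]
    simp only [Complex.ofReal_neg, H.even _ (H.mem_region_ofReal x)]
  have hder := Real.hasDerivAt_fourier hFi hFxi x
  have hfun : 𝓕 (𝓕 f) = fun x : ℝ => m x := funext fun x => (hinv x).symm
  rw [hfun] at hder
  suffices hval : 𝓕 (fun ξ : ℝ => (-2 * Real.pi * Complex.I * ξ) • 𝓕 f ξ) x =
      (((kernelFun m (ϑ / 2) x).im / Real.pi : ℝ) : ℂ) from hval ▸ hder
  set F : ℝ → ℂ := fun t => (t : ℂ) * φ t * Complex.exp (-Complex.I * t * x) with hFdef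
  have e1 : 𝓕 (fun ξ : ℝ => (-2 * Real.pi * Complex.I * ξ) • 𝓕 f ξ) x =
      ∫ ξ : ℝ, (-Complex.I) * F (2 * Real.pi * ξ) := by
    rw [Real.fourier_real_eq_integral_exp_smul]
    refine integral_congr_ae (Eventually.of_forall fun ξ => ?_)
    simp only [smul_eq_mul, hF, hFdef]
    push_cast; ring_nf
  have hFint : Integrable F := by
    have h2 : Integrable fun ξ : ℝ => (2 * Real.pi : ℝ) • ((ξ • 𝓕 f ξ) *
        Complex.exp (-Complex.I * (2 * Real.pi * ξ : ℝ) * x)) := by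
      have hcont : Continuous fun ξ : ℝ =>
          Complex.exp (-Complex.I * (2 * Real.pi * ξ : ℝ) * x) := by fun_prop
      refine (hFxi.mul_bdd (c := 1) hcont.aestronglyMeasurable
        (Eventually.of_forall fun ξ => ?_)).smul (2 * Real.pi : ℝ)
      rw [Complex.norm_exp]; simp [Complex.mul_re]
    have h3 : Integrable fun ξ : ℝ => F (2 * Real.pi * ξ) := by
      refine h2.congr (Eventually.of_forall fun ξ => ?_)
      simp only [hFdef, hF, Complex.real_smul]; push_cast; ring
    exact (integrable_comp_mul_left_iff F (by positivity : (2 * Real.pi : ℝ) ≠ 0)).1 h3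
  have hk := H.laplace_fourier_eq_kernelFun x
  have hpos : ∫ t in Ioi (0 : ℝ), F t = kernelFun m (ϑ / 2) x := hk
  have hneg : ∫ t in Iic (0 : ℝ), F t = -(starRingEnd ℂ) (kernelFun m (ϑ / 2) x) := by
    have h4 := integral_comp_neg_Ioi (0 : ℝ) F
    rw [neg_zero] at h4
    rw [← h4, ← hpos, ← integral_conj, ← integral_neg]
    refine setIntegral_congr_fun measurableSet_Ioi fun t _ => ?_
    simp only [hFdef, map_mul, ← Complex.exp_conj, map_neg, Complex.conj_I, Complex.conj_ofReal,
      heven, Complex.ofReal_neg]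
    rw [show (starRingEnd ℂ) (φ t) = φ t from H.fourier_conj t]
    ring_nf
  rw [e1, integral_const_mul, Measure.integral_comp_mul_left F, ← intervalIntegral.integral_Iic_add_Ioi
    hFint.integrableOn hFint.integrableOn, hpos, hneg, neg_add_eq_sub, Complex.sub_conj,
    abs_of_pos (by positivity), Complex.real_smul]
  push_cast
  have : (Real.pi : ℂ) ≠ 0 := by exact_mod_cast hpi.ne'
  field_simp
  ring_nf
  rw [Complex.I_sq]; ring

/-- The quotient `(m(z) - m(0)) / z²`, extended to `z = 0`. -/
theorem exists_quotient : ∃ q : ℂ → ℂ, DifferentiableOn ℂ q (region ϑ) ∧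
    ∀ z, z ≠ 0 → q z = (m z - m 0) / z ^ 2 := by
  have h0 : (0 : ℂ) ∈ region ϑ := by simpa using H.mem_region_ofReal 0
  have hn : region ϑ ∈ 𝓝 (0 : ℂ) := (isOpen_region ϑ).mem_nhds h0
  have hd0 : deriv m 0 = 0 := by
    have h1 : HasDerivAt m (deriv m 0) 0 := (H.diff.differentiableAt hn).hasDerivAt
    have h2 : HasDerivAt (fun z => m (-z)) (-deriv m 0) 0 := by
      have h3 : HasDerivAt m (deriv m 0) (-0) := by rwa [neg_zero]
      have h5 := h3.scomp (0 : ℂ) (hasDerivAt_neg (0 : ℂ))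
      rwa [neg_smul, one_smul] at h5
    have h4 : HasDerivAt m (-deriv m 0) 0 := by
      refine h2.congr_of_eventuallyEq ?_
      filter_upwards [hn] with z hz using (H.even z hz).symm
    have := h1.unique h4
    linear_combination (1 / 2 : ℂ) * this
  refine ⟨dslope (dslope m 0) 0, ?_, fun z hz => ?_⟩
  · exact (Complex.differentiableOn_dslope hn).2 ((Complex.differentiableOn_dslope hn).2 H.diff)
  · rw [dslope_of_ne _ hz, slope_def_field, dslope_of_ne _ hz, slope_def_field, dslope_same, hd0]
    field_simp
    ring

/-- On the real axis k(0) would be the integral of (m(0) − m(x))/x², which is positive because m has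
its strict maximum at 0. The constant m(0) may be subtracted on the raised contour since cosh/sinh²
has the primitive −1/sinh, which vanishes at both ends. After the subtraction the integrand is
regular at the origin and the contour can be lowered. -/
theorem kernelFun_zero_re_pos (hanti : ∀ x : ℝ, 0 < x → (m x).re < (m 0).re) :
    0 < (kernelFun m (ϑ / 2) 0).re ∧ (kernelFun m (ϑ / 2) 0).im = 0 := by
  have hϑ := H.pos
  have hσ := H.sin_pos
  obtain ⟨q, hq, hqz⟩ := H.exists_quotient
  set f : ℂ → ℂ := fun w => q (Complex.sinh w) * Complex.cosh w with hf
  have hfd : ∀ w : ℂ, 0 ≤ w.im → w.im ≤ ϑ / 2 → DifferentiableAt ℂ f w := fun w h0 h1 =>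
    ((hq.differentiableAt ((isOpen_region ϑ).mem_nhds
      (H.sinh_mem (abs_le_of_mem h0 h1)))).comp w Complex.differentiable_sinh.differentiableAt).mul
      Complex.differentiable_cosh.differentiableAt
  obtain ⟨B, hB⟩ : ∃ B, ∀ w : ℂ, 0 ≤ w.im → w.im ≤ ϑ / 2 → ‖f w‖ ≤ B * Real.exp (-1 * |w.re|) := by
    have hK : IsCompact (Icc (-1 : ℝ) 1 ×ℂ Icc 0 (ϑ / 2)) := isCompact_Icc.reProdIm isCompact_Icc
    obtain ⟨B₁, hB₁⟩ := hK.exists_bound_of_continuousOn (f := f) fun w hw =>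
      (hfd w (Complex.mem_reProdIm.1 hw).2.1
        (Complex.mem_reProdIm.1 hw).2.2).continuousAt.continuousWithinAt
    have hM : ∀ z ∈ region ϑ, ‖m z‖ ≤ C := fun z hz => by
      refine (H.bound z hz).trans (mul_le_of_le_one_right H.nonneg ?_)
      exact Real.rpow_le_one_of_one_le_of_nonpos (by linarith [norm_nonneg z])
        (by linarith [H.one_lt])
    -- The first summand covers |Re w| ≤ 1 by compactness. The second covers |Re w| > 1, where |sinh
    -- w| ≥ e^{|Re w|}/4 and the difference of two values of m is at most 2C.
    refine ⟨|B₁| * Real.exp 1 + 2 * C * 16, fun w h0 h1 => ?_⟩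
    have hC := H.nonneg
    by_cases hw : |w.re| ≤ 1
    · have := hB₁ w (Complex.mem_reProdIm.2 ⟨abs_le.1 hw, h0, h1⟩)
      have h2 : 1 ≤ Real.exp 1 * Real.exp (-1 * |w.re|) := by
        rw [← Real.exp_add]; exact Real.one_le_exp (by linarith)
      have h3 : 0 ≤ 2 * C * 16 * Real.exp (-1 * |w.re|) := by positivity
      calc ‖f w‖ ≤ |B₁| := this.trans (le_abs_self _)
        _ ≤ |B₁| * (Real.exp 1 * Real.exp (-1 * |w.re|)) := le_mul_of_one_le_right (abs_nonneg _) h2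
        _ ≤ _ := by linarith
    · have hw' : 1 < |w.re| := not_le.1 hw
      have hsh : Real.exp |w.re| / 4 ≤ ‖Complex.sinh w‖ := by
        refine le_trans ?_ (abs_sinh_le_norm_sinh w)
        rw [Real.abs_sinh, Real.sinh_eq]
        have h2 : Real.exp (-|w.re|) ≤ 1 / 2 := by
          have h5 : 2 ≤ Real.exp |w.re| := by linarith [Real.add_one_le_exp |w.re|]
          rw [Real.exp_neg, ← one_div]
          exact one_div_le_one_div_of_le two_pos h5
        have h5 : 2 ≤ Real.exp |w.re| := by linarith [Real.add_one_le_exp |w.re|]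
        linarith
      have hne : Complex.sinh w ≠ 0 := norm_pos_iff.1 (lt_of_lt_of_le (by positivity) hsh)
      have hmem := H.sinh_mem (abs_le_of_mem h0 h1)
      have h0m : (0 : ℂ) ∈ region ϑ := by simpa using H.mem_region_ofReal 0
      simp only [hf]
      rw [hqz _ hne, norm_mul, norm_div, norm_pow]
      calc _ ≤ (C + C) / (Real.exp |w.re| / 4) ^ 2 * Real.exp |w.re| := by
            gcongr
            · exact (norm_sub_le _ _).trans (add_le_add (hM _ hmem) (hM _ h0m))
            · exact (norm_cosh_le w).trans (cosh_le_exp_abs _)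
        _ = 2 * C * 16 * Real.exp (-1 * |w.re|) := by
            rw [neg_one_mul, Real.exp_neg]; field_simp; ring
        _ ≤ _ := by
            have : 0 ≤ |B₁| * Real.exp 1 * Real.exp (-1 * |w.re|) := by positivity
            linarith
  have hshift := integral_line_eq (f := f) one_pos (by linarith) hfd hB
  have hsne : ∀ u : ℝ, Complex.sinh (u + (ϑ / 2 : ℝ) * Complex.I) ≠ 0 := fun u h => by
    have := H.sin_le_sinh_im_line u
    rw [h] at this; simp at this; linarith
  have hexact : ∫ u : ℝ, Complex.cosh (u + (ϑ / 2 : ℝ) * Complex.I) /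
      Complex.sinh (u + (ϑ / 2 : ℝ) * Complex.I) ^ 2 = 0 := by
    have hnb : ∀ u : ℝ, Real.sin (ϑ / 2) * Real.exp |u| / 2 ≤
        ‖Complex.sinh (u + (ϑ / 2 : ℝ) * Complex.I)‖ := fun u => by
      have h1 := Complex.abs_im_le_norm (Complex.sinh (u + (ϑ / 2 : ℝ) * Complex.I))
      rw [sinh_im_line] at h1
      have h2 := le_abs_self (Real.cosh u * Real.sin (ϑ / 2))
      nlinarith [exp_abs_le_cosh u]
    have hd : ∀ u : ℝ, HasDerivAt (fun u : ℝ => -(Complex.sinh (u + (ϑ / 2 : ℝ) * Complex.I))⁻¹)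
        (Complex.cosh (u + (ϑ / 2 : ℝ) * Complex.I) /
          Complex.sinh (u + (ϑ / 2 : ℝ) * Complex.I) ^ 2) u := fun u => by
      have := ((hasDerivAt_sinh_line (ϑ / 2) u).fun_inv (hsne u)).fun_neg
      rwa [neg_div, neg_neg] at this
    have hnb' : ∀ u : ℝ, ‖-(Complex.sinh (u + (ϑ / 2 : ℝ) * Complex.I))⁻¹‖ ≤
        2 / Real.sin (ϑ / 2) * Real.exp (-|u|) := fun u => by
      rw [norm_neg, norm_inv, Real.exp_neg, ← div_eq_mul_inv, div_div]
      rw [inv_eq_one_div, div_le_div_iff₀ (norm_pos_iff.2 (hsne u)) (by positivity)]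
      linarith [hnb u]
    have hlim : ∀ l : Filter ℝ, Tendsto (fun u : ℝ => |u|) l atTop →
        Tendsto (fun u : ℝ => -(Complex.sinh (u + (ϑ / 2 : ℝ) * Complex.I))⁻¹) l (𝓝 0) := by
      intro l hl
      refine squeeze_zero_norm hnb' ?_
      have := (Real.tendsto_exp_neg_atTop_nhds_zero.comp hl).const_mul (2 / Real.sin (ϑ / 2))
      simpa using this
    have := integral_of_hasDerivAt_of_tendsto hd ?_ (hlim atBot tendsto_abs_atBot_atTop)
      (hlim atTop tendsto_abs_atTop_atTop)
    · simpa using this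
    · refine Integrable.mono' ((integrable_exp_neg_mul_abs one_pos).const_mul
        (4 / Real.sin (ϑ / 2) ^ 2)) (Continuous.aestronglyMeasurable ?_)
        (Eventually.of_forall fun u => ?_)
      · exact (continuous_cosh_line _).div ((continuous_sinh_line _).pow 2)
          fun u => pow_ne_zero 2 (hsne u)
      · rw [norm_div, norm_pow]
        calc _ ≤ Real.exp |u| / (Real.sin (ϑ / 2) * Real.exp |u| / 2) ^ 2 := by
              gcongr
              · have := norm_cosh_le (u + (ϑ / 2 : ℝ) * Complex.I)
                simp only [Complex.add_re, Complex.ofReal_re, Complex.mul_re, Complex.I_re,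
                  Complex.ofReal_im, Complex.I_im] at this
                simpa using this.trans (cosh_le_exp_abs _)
              · exact hnb u
          _ = _ := by rw [neg_one_mul, Real.exp_neg]; field_simp; ring
  have hk0 : kernelFun m (ϑ / 2) 0 = -∫ u : ℝ, f u := by
    have e : ∀ u : ℝ, m (Complex.sinh (u + (ϑ / 2 : ℝ) * Complex.I)) *
        Complex.cosh (u + (ϑ / 2 : ℝ) * Complex.I) /
        (0 - Complex.sinh (u + (ϑ / 2 : ℝ) * Complex.I)) ^ 2 =
        f (u + (ϑ / 2 : ℝ) * Complex.I) + m 0 * (Complex.cosh (u + (ϑ / 2 : ℝ) * Complex.I) /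
          Complex.sinh (u + (ϑ / 2 : ℝ) * Complex.I) ^ 2) := fun u => by
      simp only [hf]
      rw [hqz _ (hsne u)]
      have := hsne u
      field_simp
      ring
    have hfi : Integrable fun u : ℝ => f (u + (ϑ / 2 : ℝ) * Complex.I) :=
      integrable_line (C := B) one_pos (fun u => hfd _ (by simp; linarith) (by simp)) fun u => by
        simpa using hB (u + (ϑ / 2 : ℝ) * Complex.I) (by simp; linarith) (by simp)
    have hki := H.integrable_kernel_integrand (z := 0) (by
      simp only [lowerRegion, mem_ofPred_eq, Complex.zero_im, Complex.zero_re, abs_zero]; positivity)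
    rw [kernelFun]
    simp only [e] at hki ⊢
    have hgi : Integrable fun u : ℝ => m 0 * (Complex.cosh (u + (ϑ / 2 : ℝ) * Complex.I) /
          Complex.sinh (u + (ϑ / 2 : ℝ) * Complex.I) ^ 2) := by
      refine (hki.sub hfi).congr (Eventually.of_forall fun u => ?_)
      simp
    rw [integral_add hfi hgi, integral_const_mul, hexact, mul_zero, add_zero, ← hshift]
    simp
  have hval : ∀ u : ℝ, u ≠ 0 → f u =
      ((-(((m 0).re - (m (Real.sinh u)).re) / Real.sinh u ^ 2 * Real.cosh u) : ℝ) : ℂ) := by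
    intro u hu
    have hs : Complex.sinh (u : ℂ) ≠ 0 := by
      rw [← Complex.ofReal_sinh]; exact_mod_cast Real.sinh_ne_zero.2 hu
    simp only [hf]
    rw [hqz _ hs]
    have h1 : m 0 = ((m 0).re : ℂ) := by
      have := H.conj_ofReal 0
      simp only [Complex.ofReal_zero] at this
      exact (Complex.conj_eq_iff_re.1 this).symm
    have h2 : m (Real.sinh u) = ((m (Real.sinh u)).re : ℂ) :=
      (Complex.conj_eq_iff_re.1 (H.conj_ofReal _)).symm
    rw [← Complex.ofReal_sinh, ← Complex.ofReal_cosh, h2, h1]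
    push_cast
    simp only [Complex.ofReal_re]
    ring
  set g : ℝ → ℝ := fun u => ((m 0).re - (m (Real.sinh u)).re) / Real.sinh u ^ 2 * Real.cosh u with hg
  have hae : (fun u : ℝ => f u) =ᵐ[volume] fun u => ((-g u : ℝ) : ℂ) := by
    filter_upwards [compl_mem_ae_iff.2 (measure_singleton (0 : ℝ))] with u hu using hval u hu
  have hgk : kernelFun m (ϑ / 2) 0 = ((∫ u, g u : ℝ) : ℂ) := by
    rw [hk0, integral_congr_ae hae, integral_complex_ofReal, integral_neg]
    push_cast; ring
  have hfi0 : Integrable fun u : ℝ => f u := by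
    have := integrable_line (C := B) (f := f) (y := 0) one_pos
      (fun u => hfd _ (by simp) (by simp; linarith)) fun u => by
        simpa using hB (u + (0 : ℝ) * Complex.I) (by simp) (by simp; linarith)
    simpa using this
  have hgi : Integrable g := by
    have := (hfi0.congr hae).re.neg
    simpa using! this
  have hanti' : ∀ x : ℝ, x ≠ 0 → (m x).re < (m 0).re := fun x hx => by
    rcases lt_or_gt_of_ne hx with h | h
    · have := hanti (-x) (by linarith)
      rwa [Complex.ofReal_neg, H.even _ (H.mem_region_ofReal x)] at this
    · exact hanti x h
  have hgpos : ∀ u, u ≠ 0 → 0 < g u := fun u hu => by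
    have h1 := hanti' (Real.sinh u) (Real.sinh_ne_zero.2 hu)
    have h2 : 0 < Real.sinh u ^ 2 := by have := Real.sinh_ne_zero.2 hu; positivity
    have h3 := Real.cosh_pos u
    have h4 : 0 < (m 0).re - (m (Real.sinh u)).re := by linarith
    positivity
  have hg0 : 0 ≤ᵐ[volume] g := by
    filter_upwards [compl_mem_ae_iff.2 (measure_singleton (0 : ℝ))] with u hu using (hgpos u hu).le
  rw [hgk]
  refine ⟨?_, Complex.ofReal_im _⟩
  rw [Complex.ofReal_re, integral_pos_iff_support_of_nonneg_ae hg0 hgi]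
  refine lt_of_lt_of_le ?_ (measure_mono (s := Ioi (0 : ℝ)) fun u hu => (hgpos u (ne_of_gt hu)).ne')
  simp

end HoloProfile

/-! ### The dispersion function and the data used from here on -/

/-- The properties of the dispersion function of an equilibrium with reduced distribution `m₀`. -/
structure Dispersion (k : ℂ → ℂ) (κ d A : ℝ) (m₀ : ℝ → ℝ) : Prop where
  pos : 0 < κ
  le_one : κ ≤ 1
  one_lt : 1 < d
  nonneg : 0 < A
  diff : DifferentiableOn ℂ k (lowerRegion κ)
  bound : ∀ z ∈ lowerRegion κ, ‖k z‖ ≤ A / (1 + ‖z‖) ^ 2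
  symm : ∀ z, k (-(starRingEnd ℂ) z) = (starRingEnd ℂ) (k z)
  im_eq : ∀ x : ℝ, (k x).im = Real.pi * deriv m₀ x
  im_neg : ∀ x : ℝ, 0 < x → (k x).im < 0
  zero_re : 0 < (k 0).re
  leading : ∀ z ∈ lowerRegion κ, 1 ≤ ‖z‖ →
    ‖k z + 1 / z ^ 2‖ ≤ A * (‖z‖ ^ (-(d + 1)) + (1 + Real.log ‖z‖) / ‖z‖ ^ 4)

/-- The main part of `k` is given by the moments `a`, with an error of order `e` at infinity. -/
def KernelExpansion (k : ℂ → ℂ) (κ : ℝ) (a : ℕ → ℝ) (n : ℕ) (e : ℝ → ℝ) : Prop :=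
  ∃ B > 0, ∀ z ∈ lowerRegion κ, 1 ≤ ‖z‖ →
    ‖k z - kernelMain (fun j => a j) n z‖ ≤ B * e ‖z‖

theorem IsAcceptable.exists_dispersion {ϑ d : ℝ} {M₀ : E3 → ℝ} (h0 : 0 < ϑ)
    (h1 : ϑ ≤ Real.pi / 4) (hd : 1 < d) (h : IsAcceptable ϑ d M₀) :
    ∃ (k : ℂ → ℂ) (κ A : ℝ), Dispersion k κ d A (reduced M₀) ∧
      (∀ ξ : E3, ξ ≠ 0 → ∀ θ : ℝ,
        kernelK M₀ ξ θ = k ((θ / ‖ξ‖ : ℝ) : ℂ) / (‖ξ‖ : ℂ) ^ 2) ∧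
      (∀ n : ℕ, 2 * (n : ℝ) + 1 < d → KernelExpansion k κ (moment M₀) n
        fun x => x ^ (-(d + 1)) + (1 + Real.log x) / x ^ (2 * n + 4)) ∧
      (∀ n : ℕ, 2 * (n : ℝ) + 3 ≤ d → HasFiniteMoment M₀ (2 * n + 2) →
        KernelExpansion k κ (moment M₀) n fun x => 1 / x ^ (2 * n + 4)) := by
  obtain ⟨m, C, H, hm⟩ := h.exists_profile h0 h1 hd
  have hM := integrable_of_integral_eq_one h.integral_eq_one
  have hfun : (fun x : ℝ => m x) = fun x => ((reduced M₀ x : ℝ) : ℂ) := funext hm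
  have hi : Integrable fun x : ℝ => m x := by
    rw [hfun]; exact (integrable_reduced hM).ofReal
  have hder : ∀ x : ℝ, HasDerivAt (reduced M₀) ((kernelFun m (ϑ / 2) x).im / Real.pi) x :=
    fun x => by
      have h2 := H.hasDerivAt_ofReal hi x
      rw [hfun] at h2
      exact Complex.reCLM.hasFDerivAt.comp_hasDerivAt x h2
  have him : ∀ x : ℝ, (kernelFun m (ϑ / 2) x).im = Real.pi * deriv (reduced M₀) x := fun x => by
    rw [(hder x).deriv]; field_simp
  have hmom : profileMoment m = fun j => (moment M₀ j : ℂ) := funext fun j => by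
    rw [profileMoment, moment, ← integral_complex_ofReal]
    refine integral_congr_ae (Eventually.of_forall fun x => ?_)
    simp only [hm]; push_cast; ring
  have hmom0 : moment M₀ 0 = 1 := by
    simp only [moment, pow_zero, one_mul]
    exact integral_reduced h.integral_eq_one
  have hanti : ∀ x : ℝ, 0 < x → (m x).re < (m 0).re := fun x hx => by
    have h2 : StrictAntiOn (reduced M₀) (Ici 0) := by
      refine strictAntiOn_of_deriv_neg (convex_Ici 0)
        (fun y _ => (hder y).continuousAt.continuousWithinAt) fun y hy => ?_
      rw [interior_Ici] at hy
      exact h.deriv_neg y hy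
    have h3 := hm 0
    rw [Complex.ofReal_zero] at h3
    rw [hm, h3, Complex.ofReal_re, Complex.ofReal_re]
    exact h2 self_mem_Ici hx.le hx
  obtain ⟨A₁, hA₁, hb⟩ := H.exists_norm_kernelFun_le
  have hexp : ∀ n : ℕ, 2 * (n : ℝ) + 1 < d →
      KernelExpansion (kernelFun m (ϑ / 2)) (Real.sin (ϑ / 2) / 4) (moment M₀) n
        fun x => x ^ (-(d + 1)) + (1 + Real.log x) / x ^ (2 * n + 4) := fun n hn => by
    have := H.exists_norm_kernelFun_sub_main_le hn
    rwa [hmom] at this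
  obtain ⟨A₂, hA₂, hl⟩ := hexp 0 (by simpa using hd)
  have hσ := H.sin_pos
  refine ⟨kernelFun m (ϑ / 2), Real.sin (ϑ / 2) / 4, max A₁ A₂, ⟨by positivity, ?_, hd,
    lt_max_of_lt_left hA₁, H.differentiableOn_kernelFun, fun z hz => ?_, H.kernelFun_neg_conj, him,
    fun x hx => ?_, (H.kernelFun_zero_re_pos hanti).1, fun z hz h1z => ?_⟩, ?_, hexp, ?_⟩
  · linarith [Real.sin_le_one (ϑ / 2)]
  · exact (hb z hz).trans (by gcongr; exact le_max_left _ _)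
  · rw [him]; exact mul_neg_of_pos_of_neg Real.pi_pos (h.deriv_neg x hx)
  · have h2 := hl z hz h1z
    simp only [kernelMain, zero_add, Finset.range_one, Finset.sum_singleton, mul_zero, hmom0,
      sub_neg_eq_add, CharP.cast_eq_zero, Complex.ofReal_one, one_mul] at h2
    refine h2.trans ?_
    have := Real.log_nonneg h1z
    gcongr
    exact le_max_right _ _
  · exact fun ξ hξ θ => kernelK_eq H h.radial hM hm hξ θ
  · intro n hn hf
    obtain ⟨B, hB, h2⟩ := H.exists_norm_kernelFun_sub_main_le' hn (by
      refine (Integrable.ofReal (𝕜 := ℂ) hf).congr (Eventually.of_forall fun x => ?_)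
      simp [hm])
    rw [hmom] at h2
    exact ⟨B, hB, fun z hz h1z => (h2 z hz h1z).trans_eq (by ring)⟩

/-! ### Compactness, thin strips and sectors -/

theorem exists_lower_bound_near {X : Type*} [PseudoMetricSpace X] {K O : Set X} (hK : IsCompact K)
    (hO : IsOpen O) (hKO : K ⊆ O) {f : X → ℝ} (hf : ContinuousOn f O) (hpos : ∀ x ∈ K, 0 < f x) :
    ∃ ε > 0, ∃ c > 0, ∀ x, ∀ y ∈ K, dist x y < ε → x ∈ O ∧ c < f x := by
  obtain ⟨c, hc, hcK⟩ : ∃ c > 0, ∀ x ∈ K, c < f x := by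
    rcases K.eq_empty_or_nonempty with rfl | hne
    · exact ⟨1, one_pos, fun x hx => hx.elim⟩
    · obtain ⟨y, hy, hmin⟩ := hK.exists_isMinOn hne (hf.mono hKO)
      exact ⟨f y / 2, half_pos (hpos y hy), fun x hx =>
        (half_lt_self (hpos y hy)).trans_le (hmin hx)⟩
  have hopen : IsOpen (O ∩ f ⁻¹' Ioi c) := hf.isOpen_inter_preimage hO isOpen_Ioi
  obtain ⟨ε, hε, hsub⟩ := hK.exists_thickening_subset_open hopen
    (fun x hx => ⟨hKO hx, hcK x hx⟩)
  exact ⟨ε, hε, c, hc, fun x y hy hxy => hsub (mem_thickening_iff.2 ⟨y, hy, hxy⟩)⟩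

/-- For Im w in [−π, 0] the image lies in the closed lower half plane, so k ∘ sinh is available far
below the real axis. The deformation of the tail integral to Im w = −π/2 depends on this. -/
theorem sinh_mem_lowerRegion {κ : ℝ} (h0 : 0 < κ) (h1 : κ ≤ 1) {w : ℂ} (hw0 : -Real.pi ≤ w.im)
    (hw1 : w.im ≤ κ / 4) : Complex.sinh w ∈ lowerRegion κ := by
  simp only [lowerRegion, mem_ofPred_eq, sinh_re, sinh_im]
  have hc := Real.cosh_pos w.re
  rcases le_total w.im 0 with h | h
  · have : Real.sin w.im ≤ 0 := Real.sin_nonpos_of_nonpos_of_neg_pi_le h hw0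
    have h2 : 0 < κ * (1 + |Real.sinh w.re * Real.cos w.im|) := by positivity
    nlinarith
  · have h2 : Real.sin w.im ≤ κ / 4 := (Real.sin_le h).trans hw1
    have h3 : 1 / 2 ≤ Real.cos w.im := by
      have := Real.one_sub_sq_div_two_le_cos (x := w.im)
      nlinarith
    rw [abs_mul, abs_of_nonneg (by linarith : (0:ℝ) ≤ Real.cos w.im)]
    have h4 := cosh_le_one_add_abs_sinh w.re
    have h5 := abs_nonneg (Real.sinh w.re)
    have h6 : |Real.sinh w.re| * (1 / 2) ≤ |Real.sinh w.re| * Real.cos w.im := by gcongr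
    calc Real.cosh w.re * Real.sin w.im ≤ Real.cosh w.re * (κ / 4) := by gcongr
      _ ≤ (1 + |Real.sinh w.re|) * (κ / 4) := by gcongr
      _ < κ * (1 + |Real.sinh w.re| * (1 / 2)) := by nlinarith
      _ ≤ _ := by gcongr

/-- A point outside a double sector around the real axis stays away from the square roots of a
number close to the positive real axis. -/
theorem norm_sub_sq_ge {η : ℝ} (h0 : 0 < η) (h1 : η ≤ 1) {z ζ : ℂ} (hz : η * ‖z‖ ≤ |z.im|)
    (hζ : |ζ.im| ≤ η ^ 2 / 2 * ζ.re) : η ^ 2 / 8 * (‖ζ‖ + ‖z‖ ^ 2) ≤ ‖ζ - z ^ 2‖ := by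
  have hn : ‖z ^ 2‖ = ‖z‖ ^ 2 := norm_pow z 2
  have hη2 : η ^ 2 ≤ 1 := by nlinarith
  have hζ0 := norm_nonneg ζ
  have hz0 := norm_nonneg z
  have hre0 : 0 ≤ ζ.re := by
    by_contra h
    have : η ^ 2 / 2 * ζ.re < 0 := mul_neg_of_pos_of_neg (by positivity) (not_le.1 h)
    linarith [abs_nonneg ζ.im]
  -- If ‖ζ‖ and ‖z‖² are not comparable, the triangle inequality suffices. Otherwise either Re z² ≤
  -- 0 and the real parts are separated, or |Im z²| ≥ 2η²‖z‖² exceeds |Im ζ|.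
  by_cases hA : 2 * ‖ζ‖ ≤ ‖z‖ ^ 2
  · have h2 := norm_sub_norm_le (z ^ 2) ζ
    rw [norm_sub_rev, hn] at h2
    nlinarith
  by_cases hB : 2 * ‖z‖ ^ 2 ≤ ‖ζ‖
  · have h2 := norm_sub_norm_le ζ (z ^ 2)
    rw [hn] at h2
    nlinarith
  push Not at hA hB
  have him : (z ^ 2).im = 2 * z.re * z.im := by simp [pow_two, Complex.mul_im]; ring
  have hre : (z ^ 2).re = z.re ^ 2 - z.im ^ 2 := by simp [pow_two, Complex.mul_re]
  rcases le_or_gt (z ^ 2).re 0 with h | h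
  · have h2 : ζ.re ≤ ‖ζ - z ^ 2‖ := by
      refine le_trans ?_ (Complex.re_le_norm _)
      rw [Complex.sub_re]; linarith
    have h3 : ‖ζ‖ ≤ ζ.re + |ζ.im| := by
      refine (Complex.norm_le_abs_re_add_abs_im ζ).trans ?_
      rw [abs_of_nonneg hre0]
    nlinarith
  · have h2 : |z.im| ≤ |z.re| := by
      rw [hre] at h
      exact sq_le_sq.1 (by linarith)
    have h3 : 2 * η ^ 2 * ‖z‖ ^ 2 ≤ |(z ^ 2).im| := by
      rw [him, abs_mul, abs_mul, abs_two]
      nlinarith [abs_nonneg z.re, abs_nonneg z.im, mul_nonneg h0.le hz0]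
    have h4 : |(z ^ 2).im| - |ζ.im| ≤ ‖ζ - z ^ 2‖ := by
      refine le_trans ?_ (Complex.abs_im_le_norm _)
      rw [Complex.sub_im, abs_sub_comm]
      exact abs_sub_abs_le_abs_sub _ _
    have h5 : ζ.re ≤ ‖ζ‖ := Complex.re_le_norm ζ
    nlinarith [sq_nonneg η]

/-- The truncated sector around the positive real axis. -/
def cone (δ ρ : ℝ) : Set ℂ := {s : ℂ | 0 < s.re ∧ |s.im| < δ * s.re ∧ s.re < ρ}

theorem isOpen_cone (δ ρ : ℝ) : IsOpen (cone δ ρ) := by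
  simp only [cone, ofPred_and]
  exact (isOpen_lt (by fun_prop) (by fun_prop)).inter
    ((isOpen_lt (by fun_prop) (by fun_prop)).inter (isOpen_lt (by fun_prop) (by fun_prop)))

theorem convex_cone (δ ρ : ℝ) : Convex ℝ (cone δ ρ) := by
  have : cone δ ρ = {s : ℂ | 0 < s.re} ∩ ({s : ℂ | s.im - δ * s.re < 0} ∩
      ({s : ℂ | -s.im - δ * s.re < 0} ∩ {s : ℂ | s.re < ρ})) := by
    ext s
    simp only [cone, mem_ofPred_eq, mem_inter_iff, abs_lt]
    constructor
    · rintro ⟨h1, ⟨h2, h3⟩, h4⟩; exact ⟨h1, by linarith, by linarith, h4⟩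
    · rintro ⟨h1, h2, h3, h4⟩; exact ⟨h1, ⟨by linarith, by linarith⟩, h4⟩
  rw [this]
  refine (convex_halfSpace_gt Complex.reLm.isLinear 0).inter
    ((convex_halfSpace_lt (Complex.imLm - δ • Complex.reLm).isLinear 0).inter
    ((convex_halfSpace_lt (-Complex.imLm - δ • Complex.reLm).isLinear 0).inter
    (convex_halfSpace_lt Complex.reLm.isLinear ρ)))

theorem cone_mono {δ δ' ρ ρ' : ℝ} (hδ : δ ≤ δ') (hρ : ρ ≤ ρ') : cone δ ρ ⊆ cone δ' ρ' :=
  fun _ hs => ⟨hs.1, hs.2.1.trans_le (mul_le_mul_of_nonneg_right hδ hs.1.le), hs.2.2.trans_le hρ⟩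

theorem norm_le_of_mem_cone {δ ρ : ℝ} (hδ : δ ≤ 1) {s : ℂ} (hs : s ∈ cone δ ρ) :
    ‖s‖ ≤ 2 * s.re := by
  have h1 := Complex.norm_le_abs_re_add_abs_im s
  rw [abs_of_pos hs.1] at h1
  have h2 := hs.2.1
  have h3 := hs.1
  nlinarith

theorem norm_pos_of_mem_cone {δ ρ : ℝ} {s : ℂ} (hs : s ∈ cone δ ρ) : 0 < ‖s‖ :=
  hs.1.trans_le (Complex.re_le_norm s)

theorem ball_subset_cone {δ ρ r : ℝ} (h0 : 0 < δ) (h1 : δ ≤ 1) (hr : r ∈ Ioo 0 (ρ / 2)) :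
    ball (r : ℂ) (δ / 4 * r) ⊆ cone δ ρ := by
  intro s hs
  rw [mem_ball, dist_eq_norm] at hs
  have h2 := (Complex.abs_re_le_norm _).trans_lt hs
  have h3 := (Complex.abs_im_le_norm _).trans_lt hs
  simp only [Complex.sub_re, Complex.ofReal_re, Complex.sub_im, Complex.ofReal_im, sub_zero] at h2 h3
  rw [abs_lt] at h2
  obtain ⟨hr0, hr1⟩ := hr
  have h4 : δ / 4 * r ≤ r / 4 := by nlinarith
  exact ⟨by linarith, by nlinarith, by linarith⟩

theorem ofReal_mem_cone {δ ρ r : ℝ} (h0 : 0 < δ) (hr : r ∈ Ioo 0 ρ) : (r : ℂ) ∈ cone δ ρ := by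
  refine ⟨by simpa using hr.1, ?_, by simpa using hr.2⟩
  simp only [Complex.ofReal_im, abs_zero, Complex.ofReal_re]
  exact mul_pos h0 hr.1

theorem abs_im_sq_le {η ρ : ℝ} (h0 : 0 < η) (h1 : η ≤ 1) {s : ℂ} (hs : s ∈ cone (η ^ 2 / 8) ρ) :
    |(s ^ 2).im| ≤ η ^ 2 / 2 * (s ^ 2).re := by
  have him : (s ^ 2).im = 2 * s.re * s.im := by simp [pow_two, Complex.mul_im]; ring
  have hre : (s ^ 2).re = s.re ^ 2 - s.im ^ 2 := by simp [pow_two, Complex.mul_re]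
  obtain ⟨h2, h3, -⟩ := hs
  have hη2 : η ^ 2 ≤ 1 := by nlinarith
  have h4 : s.im ^ 2 ≤ (1 / 8 * s.re) ^ 2 := by
    rw [← sq_abs s.im]
    have : |s.im| ≤ 1 / 8 * s.re := h3.le.trans (by nlinarith)
    gcongr
  rw [him, hre, abs_mul, abs_mul, abs_two, abs_of_pos h2]
  have h5 : 2 * s.re * |s.im| ≤ 2 * s.re * (η ^ 2 / 8 * s.re) := by gcongr
  nlinarith [sq_nonneg η, sq_nonneg s.re]

theorem abs_im_inv_le {c : ℝ} {ζ : ℂ} (h : |ζ.im| ≤ c * ζ.re) : |(ζ⁻¹).im| ≤ c * (ζ⁻¹).re := by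
  rw [Complex.inv_im, Complex.inv_re, abs_div, abs_neg, abs_of_nonneg (Complex.normSq_nonneg ζ),
    ← mul_div_assoc]
  exact div_le_div_of_nonneg_right h (Complex.normSq_nonneg ζ)

theorem sin_mul_norm_sinh_le {α : ℝ} (h0 : 0 ≤ α) {w : ℂ} (hw0 : α ≤ w.im)
    (hw1 : w.im ≤ Real.pi / 2) : Real.sin α * Real.cosh w.re ≤ |(Complex.sinh w).im| := by
  rw [sinh_im, abs_mul, abs_of_pos (Real.cosh_pos _), mul_comm]
  have h2 : Real.sin α ≤ Real.sin w.im :=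
    Real.sin_le_sin_of_le_of_le_pi_div_two (by linarith [Real.pi_pos]) hw1 hw0
  have := le_abs_self (Real.sin w.im)
  have := Real.cosh_pos w.re
  gcongr
  linarith

/-! ### Lower bounds for the dispersion relation in thin strips -/

namespace Dispersion
variable {k : ℂ → ℂ} {κ d A : ℝ} {m₀ : ℝ → ℝ} (D : Dispersion k κ d A m₀)
include D

theorem sinh_mem {w : ℂ} (h0 : 0 ≤ w.im) (h1 : w.im ≤ κ / 4) : Complex.sinh w ∈ lowerRegion κ :=
  sinh_mem_lowerRegion D.pos D.le_one (by linarith [Real.pi_pos]) h1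

theorem ofReal_mem (x : ℝ) : (x : ℂ) ∈ lowerRegion κ := by
  simp only [lowerRegion, mem_ofPred_eq, Complex.ofReal_im, Complex.ofReal_re]
  have := D.pos
  positivity

theorem differentiableAt {z : ℂ} (hz : z ∈ lowerRegion κ) : DifferentiableAt ℂ k z :=
  D.diff.differentiableAt ((isOpen_lowerRegion κ).mem_nhds hz)

theorem norm_comp_sinh_le {w : ℂ} (hw : Complex.sinh w ∈ lowerRegion κ) :
    ‖k (Complex.sinh w)‖ ≤ 4 * A * Real.exp (-2 * |w.re|) := by
  refine (D.bound _ hw).trans ?_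
  have h1 : Real.exp |w.re| / 2 ≤ 1 + ‖Complex.sinh w‖ := by
    linarith [exp_abs_le_cosh w.re, cosh_le_one_add_norm_sinh w]
  have := D.nonneg
  calc A / (1 + ‖Complex.sinh w‖) ^ 2 ≤ A / (Real.exp |w.re| / 2) ^ 2 := by gcongr
    _ = 4 * A * (Real.exp |w.re| ^ 2)⁻¹ := by field_simp; ring
    _ = _ := by rw [← Real.exp_nat_mul, ← Real.exp_neg]; push_cast; ring_nf

theorem ofReal_im_ne_zero {x : ℝ} (hx : x ≠ 0) : (k x).im ≠ 0 := by
  rcases lt_or_gt_of_ne hx with h | h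
  · have h1 := D.symm (-x : ℝ)
    rw [Complex.conj_ofReal, Complex.ofReal_neg, neg_neg] at h1
    have h2 := D.im_neg (-x) (by linarith)
    rw [Complex.ofReal_neg] at h2
    rw [h1, Complex.conj_im]
    linarith
  · exact (D.im_neg x h).ne

/-- Penrose's criterion: away from the origin k is not real, and at the origin its real part is
positive. -/
theorem one_add_mul_ne_zero {t : ℝ} (ht : 0 ≤ t) (x : ℝ) : 1 + (t : ℂ) * k x ≠ 0 := by
  intro h
  have him := congrArg Complex.im h
  have hre := congrArg Complex.re h
  simp only [Complex.add_im, Complex.one_im, Complex.im_ofReal_mul, zero_add, Complex.zero_im,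
    Complex.add_re, Complex.one_re, Complex.re_ofReal_mul, Complex.zero_re] at him hre
  rcases mul_eq_zero.1 him with h1 | h1
  · rw [h1] at hre; norm_num at hre
  · by_cases hx : x = 0
    · rw [hx, Complex.ofReal_zero] at hre
      have := mul_nonneg ht D.zero_re.le
      linarith
    · exact D.ofReal_im_ne_zero hx h1

theorem ofReal_ne_zero (x : ℝ) : k x ≠ 0 := by
  intro h
  by_cases hx : x = 0
  · have := D.zero_re
    rw [hx, Complex.ofReal_zero] at h
    rw [h] at this; simp at this
  · exact D.ofReal_im_ne_zero hx (by rw [h]; rfl)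

/-- For bounded Re w, compactness extends the nonvanishing on the real line to a thin strip and to
complex q near [0, Q]; for large |Re w| the product qk has modulus at most 1/2. In the application q
is 1/s² with s close to a real r. -/
theorem exists_strip_high (Q : ℝ) : ∃ ε > 0, ε ≤ κ / 4 ∧ ∃ c > 0, ∀ q w : ℂ,
    (∃ t ∈ Icc 0 Q, ‖q - (t : ℝ)‖ < ε) → 0 ≤ w.im → w.im ≤ ε →
      c ≤ ‖1 + q * k (Complex.sinh w)‖ := by
  have hA := D.nonneg
  set P := (|Q| + 1) * (4 * A) with hP
  have hP0 : 0 < P := by positivity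
  obtain ⟨U, hU⟩ : ∃ U : ℝ, P * Real.exp (-2 * U) ≤ 1 / 2 := by
    refine ⟨P, ?_⟩
    have h1 := Real.add_one_le_exp (2 * P)
    rw [neg_mul, Real.exp_neg, ← div_eq_mul_inv, div_le_iff₀ (Real.exp_pos _)]
    linarith
  set O : Set (ℂ × ℂ) := {p | Complex.sinh p.2 ∈ lowerRegion κ} with hO
  have hOo : IsOpen O := (isOpen_lowerRegion κ).preimage (Complex.continuous_sinh.comp continuous_snd)
  have hKO : (Complex.ofReal '' Icc 0 Q) ×ˢ (Complex.ofReal '' Icc (-U) U) ⊆ O := by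
    rintro ⟨q, w⟩ ⟨-, u, -, rfl⟩
    simp only [hO, mem_ofPred_eq, ← Complex.ofReal_sinh]
    exact D.ofReal_mem _
  have hcont : ContinuousOn (fun p : ℂ × ℂ => ‖1 + p.1 * k (Complex.sinh p.2)‖) O := by
    refine ContinuousOn.norm (continuousOn_const.add (continuousOn_fst.mul ?_))
    exact D.diff.continuousOn.comp (Complex.continuous_sinh.comp continuous_snd).continuousOn
      fun p hp => hp
  obtain ⟨ε, hε, c, hc, h⟩ := exists_lower_bound_near
    ((isCompact_Icc.image Complex.continuous_ofReal).prod
      (isCompact_Icc.image Complex.continuous_ofReal)) hOo hKO hcont (by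
        rintro ⟨q, w⟩ ⟨⟨t, ht, rfl⟩, u, -, rfl⟩
        simp only [← Complex.ofReal_sinh]
        exact norm_pos_iff.2 (D.one_add_mul_ne_zero ht.1 _))
  refine ⟨min (min (ε / 2) (κ / 4)) 1, by have := D.pos; positivity,
    (min_le_left _ _).trans (min_le_right _ _), min c (1 / 2), by positivity, ?_⟩
  rintro q w ⟨t, ht, hqt⟩ h0 h1
  have h1a := h1.trans (min_le_left _ _)
  by_cases hw : |w.re| ≤ U
  · refine (min_le_left _ _).trans (h (q, w) ((t : ℂ), (w.re : ℂ))
      ⟨⟨t, ht, rfl⟩, ⟨w.re, abs_le.1 hw, rfl⟩⟩ ?_).2.le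
    rw [Prod.dist_eq, max_lt_iff]
    refine ⟨?_, ?_⟩
    · rw [dist_eq_norm]
      exact hqt.trans_le (((min_le_left _ _).trans (min_le_left _ _)).trans (by linarith))
    · rw [Complex.dist_of_re_eq (by simp), Complex.ofReal_im, Real.dist_eq, sub_zero,
        abs_of_nonneg h0]
      exact (h1a.trans (min_le_left _ _)).trans_lt (by linarith)
  · refine (min_le_right _ _).trans ?_
    have h2 := D.norm_comp_sinh_le (D.sinh_mem h0 (h1a.trans (min_le_right _ _)))
    have hq : ‖q‖ ≤ |Q| + 1 := by
      have h3 := norm_le_add_norm_add q (-(t : ℂ))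
      rw [← sub_eq_add_neg, norm_neg, Complex.norm_real, Real.norm_of_nonneg ht.1] at h3
      have h4 := hqt.le.trans (min_le_right _ _)
      have h5 := ht.2.trans (le_abs_self Q)
      linarith
    have h3 : Real.exp (-2 * |w.re|) ≤ Real.exp (-2 * U) :=
      Real.exp_le_exp.2 (by linarith [not_le.1 hw])
    have h4 : ‖q * k (Complex.sinh w)‖ ≤ 1 / 2 := by
      rw [norm_mul]
      calc _ ≤ (|Q| + 1) * (4 * A * Real.exp (-2 * U)) := by gcongr; exact h2.trans (by gcongr)
        _ = P * Real.exp (-2 * U) := by rw [hP]; ring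
        _ ≤ 1 / 2 := hU
    have h5 := norm_sub_norm_le (1 : ℂ) (-(q * k (Complex.sinh w)))
    rw [sub_neg_eq_add, norm_neg, norm_one] at h5
    linarith

theorem norm_sq_mul_add_one_le {z : ℂ} (hz : z ∈ lowerRegion κ) (h1 : 1 ≤ ‖z‖) :
    ‖z ^ 2 * k z + 1‖ ≤ A * (‖z‖ ^ (-(d - 1)) + 2 / ‖z‖) := by
  have hz0 : z ≠ 0 := norm_pos_iff.1 (by linarith)
  have hx : 0 < ‖z‖ := by linarith
  have hA := D.nonneg
  have e : z ^ 2 * k z + 1 = z ^ 2 * (k z + 1 / z ^ 2) := by field_simp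
  rw [e, norm_mul, norm_pow]
  have h2 : Real.log ‖z‖ ≤ ‖z‖ - 1 := Real.log_le_sub_one_of_pos hx
  have h3 : ‖z‖ ^ (-(d - 1)) = ‖z‖ ^ 2 * ‖z‖ ^ (-(d + 1)) := by
    rw [← Real.rpow_natCast ‖z‖ 2, ← Real.rpow_add hx]; congr 1; push_cast; ring
  calc _ ≤ ‖z‖ ^ 2 * (A * (‖z‖ ^ (-(d + 1)) + (1 + Real.log ‖z‖) / ‖z‖ ^ 4)) := by
        gcongr; exact D.leading z hz h1
    _ ≤ ‖z‖ ^ 2 * (A * (‖z‖ ^ (-(d + 1)) + (2 * ‖z‖) / ‖z‖ ^ 4)) := by gcongr; linarith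
    _ ≤ ‖z‖ ^ 2 * (A * (‖z‖ ^ (-(d + 1)) + (2 * ‖z‖) / ‖z‖ ^ 3 / ‖z‖)) := by
        refine le_of_eq ?_; field_simp
    _ = A * (‖z‖ ^ (-(d - 1)) + 2 / ‖z‖) := by rw [h3]; field_simp

theorem exists_leading_small {ε : ℝ} (hε : 0 < ε) : ∃ R, 1 ≤ R ∧ ∀ z ∈ lowerRegion κ, R ≤ ‖z‖ →
    ‖z ^ 2 * k z + 1‖ ≤ ε := by
  have hA := D.nonneg
  have h1 : Tendsto (fun x : ℝ => A * (x ^ (-(d - 1)) + 2 / x)) atTop (𝓝 (A * (0 + 0))) :=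
    ((tendsto_rpow_neg_atTop (by linarith [D.one_lt])).add
      (tendsto_const_nhds.div_atTop tendsto_id)).const_mul A
  rw [add_zero, mul_zero] at h1
  obtain ⟨R, hR⟩ := eventually_atTop.1 (h1.eventually (gt_mem_nhds hε))
  exact ⟨max 1 R, le_max_left _ _, fun z hz hzR =>
    (D.norm_sq_mul_add_one_le hz ((le_max_left _ _).trans hzR)).trans
      (hR _ ((le_max_right _ _).trans hzR)).le⟩

/-- At infinity z²k(z) tends to −1, which gives the exponential rate. On a compact part of the real
axis k has no zeros, and this persists in a thin strip. -/
theorem exists_strip_low : ∃ α > 0, α ≤ κ / 4 ∧ ∃ c > 0, ∀ w : ℂ, 0 ≤ w.im → w.im ≤ α →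
    c * Real.exp (-2 * |w.re|) ≤ ‖k (Complex.sinh w)‖ := by
  obtain ⟨R, hR1, hR⟩ := D.exists_leading_small (half_pos one_pos)
  set O : Set ℂ := {w | Complex.sinh w ∈ lowerRegion κ} with hO
  have hOo : IsOpen O := (isOpen_lowerRegion κ).preimage Complex.continuous_sinh
  have hKO : Complex.ofReal '' Icc (-(R + 1)) (R + 1) ⊆ O := by
    rintro w ⟨u, -, rfl⟩
    simp only [hO, mem_ofPred_eq, ← Complex.ofReal_sinh]
    exact D.ofReal_mem _
  have hcont : ContinuousOn (fun w => ‖k (Complex.sinh w)‖) O :=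
    (D.diff.continuousOn.comp Complex.continuous_sinh.continuousOn fun p hp => hp).norm
  obtain ⟨ε, hε, c, hc, h⟩ := exists_lower_bound_near
    (isCompact_Icc.image Complex.continuous_ofReal) hOo hKO hcont (by
      rintro w ⟨u, -, rfl⟩
      simp only [← Complex.ofReal_sinh]
      exact norm_pos_iff.2 (D.ofReal_ne_zero _))
  refine ⟨min (ε / 2) (κ / 4), by have := D.pos; positivity, min_le_right _ _, min c (1 / 2),
    by positivity, fun w h0 h1 => ?_⟩
  by_cases hw : |w.re| ≤ R + 1
  · calc _ ≤ c * 1 := by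
          gcongr
          · exact min_le_left _ _
          · exact Real.exp_le_one_iff.2 (by linarith [abs_nonneg w.re])
      _ ≤ _ := by
          rw [mul_one]
          refine (h w w.re ⟨w.re, abs_le.1 hw, rfl⟩ ?_).2.le
          rw [Complex.dist_of_re_eq (by simp), Complex.ofReal_im, Real.dist_eq, sub_zero,
            abs_of_nonneg h0]
          exact (h1.trans (min_le_left _ _)).trans_lt (by linarith)
  · have hmem := D.sinh_mem h0 (h1.trans (min_le_right _ _))
    have h2 : R ≤ ‖Complex.sinh w‖ := by
      refine le_trans ?_ (abs_sinh_le_norm_sinh w)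
      rw [Real.abs_sinh]
      exact (by linarith [not_le.1 hw] : R ≤ |w.re|).trans (Real.self_le_sinh_iff.2 (abs_nonneg _))
    have h3 := hR _ hmem h2
    have h4 := norm_sub_norm_le (1 : ℂ) (Complex.sinh w ^ 2 * k (Complex.sinh w) + 1)
    rw [norm_one, sub_add_cancel_right, norm_neg, norm_mul, norm_pow] at h4
    have h5 : ‖Complex.sinh w‖ ≤ Real.exp |w.re| := (norm_sinh_le w).trans (cosh_le_exp_abs _)
    have h6 : 1 / 2 ≤ Real.exp |w.re| ^ 2 * ‖k (Complex.sinh w)‖ := by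
      calc (1:ℝ) / 2 ≤ ‖Complex.sinh w‖ ^ 2 * ‖k (Complex.sinh w)‖ := by linarith
        _ ≤ _ := by gcongr
    calc _ ≤ 1 / 2 * Real.exp (-2 * |w.re|) := by gcongr; exact min_le_right _ _
      _ ≤ Real.exp |w.re| ^ 2 * ‖k (Complex.sinh w)‖ * Real.exp (-2 * |w.re|) := by gcongr
      _ = ‖k (Complex.sinh w)‖ * (Real.exp |w.re| ^ 2 * Real.exp (-2 * |w.re|)) := by ring
      _ = _ := by
          rw [← Real.exp_nat_mul, ← Real.exp_add]; push_cast
          rw [neg_mul, add_neg_cancel, Real.exp_zero, mul_one]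

end Dispersion

/-! ### The Green's function as a contour integral, and the high-frequency regime -/

/-- The integrand of the Green's function in the variable `w`, where `θ = r sinh w`. -/
noncomputable def greenIntegrand (k : ℂ → ℂ) (γ : ℝ) (s t w : ℂ) : ℂ :=
  k (Complex.sinh w) / (s ^ 2 + k (Complex.sinh w)) *
    Complex.exp (s * t * (γ + Complex.I * Complex.sinh w)) * Complex.cosh w

/-- The contribution of the contour `Im w = α`, with the factor `e^{-γτr}` split off. -/
noncomputable def contourPart (k : ℂ → ℂ) (γ α : ℝ) (s t : ℂ) : ℂ :=
  -(s / (2 * Real.pi)) * ∫ u : ℝ, greenIntegrand k γ s t (u + α * Complex.I)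

/-- The substitution θ = |ξ| sinh u, after K/(1+K) has been simplified to k/(|ξ|² + k). -/
theorem greenHat_eq {k : ℂ → ℂ} {M₀ : E3 → ℝ} {ξ : E3} (hξ : ξ ≠ 0) (hk : ∀ θ : ℝ,
    kernelK M₀ ξ θ = k ((θ / ‖ξ‖ : ℝ) : ℂ) / (‖ξ‖ : ℂ) ^ 2) :
    greenHat M₀ ξ = deltaPlus fun τ : ℝ =>
      -((‖ξ‖ : ℂ) / (2 * Real.pi)) * ∫ u : ℝ, greenIntegrand k 0 ‖ξ‖ τ u := by
  have hr : 0 < ‖ξ‖ := norm_pos_iff.2 hξ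
  have hrc : (‖ξ‖ : ℂ) ≠ 0 := by exact_mod_cast hr.ne'
  rw [greenHat]
  congr 1
  funext τ
  set g : ℝ → ℂ := fun x => k x / ((‖ξ‖ : ℂ) ^ 2 + k x) *
    Complex.exp (‖ξ‖ * τ * (Complex.I * x)) with hg
  have h1 : ∀ θ : ℝ, kernelK M₀ ξ θ / (1 + kernelK M₀ ξ θ) * Complex.exp (Complex.I * θ * τ) =
      g (‖ξ‖⁻¹ * θ) := fun θ => by
    simp only [hk, hg]
    congr 1
    · rw [div_eq_inv_mul θ]
      have h2 : (1 : ℂ) + k ((‖ξ‖⁻¹ * θ : ℝ) : ℂ) / (‖ξ‖ : ℂ) ^ 2 =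
          ((‖ξ‖ : ℂ) ^ 2 + k ((‖ξ‖⁻¹ * θ : ℝ) : ℂ)) / (‖ξ‖ : ℂ) ^ 2 := by field_simp
      rw [h2, div_div_div_cancel_right₀ (pow_ne_zero 2 hrc)]
    · congr 1
      push_cast
      field_simp
  have h2 : ∫ u : ℝ, greenIntegrand k 0 ‖ξ‖ τ u = ∫ x, g x := by
    rw [← integral_comp_sinh g]
    refine integral_congr_ae (Eventually.of_forall fun u => ?_)
    simp only [greenIntegrand, hg, Complex.ofReal_zero, zero_add, Complex.ofReal_sinh,
      Complex.ofReal_cosh]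
  simp only [h1]
  rw [Measure.integral_comp_mul_left g, h2, inv_inv, abs_of_pos hr, Complex.real_smul]
  push_cast
  ring

theorem exp_mul_contourPart (k : ℂ → ℂ) (γ α : ℝ) (s t : ℂ) :
    Complex.exp (-(γ * (s * t))) * contourPart k γ α s t = contourPart k 0 α s t := by
  rw [contourPart, contourPart, mul_left_comm, ← integral_const_mul]
  congr 2
  funext u
  simp only [greenIntegrand]
  rw [mul_comm, mul_right_comm, mul_assoc (_ / _), ← Complex.exp_add]
  congr 3
  push_cast
  ring

theorem differentiableAt_greenIntegrand_left {k : ℂ → ℂ} (γ : ℝ) {s t w : ℂ}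
    (hne : s ^ 2 + k (Complex.sinh w) ≠ 0) :
    DifferentiableAt ℂ (fun s => greenIntegrand k γ s t w) s := by
  have h1 : DifferentiableAt ℂ (fun s : ℂ => k (Complex.sinh w) / (s ^ 2 + k (Complex.sinh w))) s :=
    (differentiableAt_const _).div ((differentiableAt_pow 2).add_const _) hne
  have h2 : DifferentiableAt ℂ
      (fun s : ℂ => Complex.exp (s * t * (γ + Complex.I * Complex.sinh w))) s :=
    ((differentiableAt_fun_id.mul_const _).mul_const _).cexp
  exact (h1.mul h2).mul_const _

theorem differentiable_greenIntegrand_right (k : ℂ → ℂ) (γ : ℝ) (s w : ℂ) :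
    Differentiable ℂ (fun t => greenIntegrand k γ s t w) := by
  have h2 : Differentiable ℂ
      (fun t : ℂ => Complex.exp (s * t * (γ + Complex.I * Complex.sinh w))) :=
    ((differentiable_fun_id.const_mul _).mul_const _).cexp
  exact (h2.const_mul _).mul_const _

/-- The relative error of the product st is at most 3δ ≤ σ/8. Hence st stays in a narrow sector
about the positive axis, which is where the exponential on the raised contour is bounded. -/
theorem abs_im_mul_le_of_near {σ δ r τ : ℝ} (hσ0 : 0 < σ) (hσ1 : σ ≤ 1) (hδ0 : 0 < δ)
    (hδ : δ ≤ σ / 24) (hr : 0 < r) (hτ : 0 ≤ τ) {s t : ℂ} (hs : ‖s - r‖ ≤ δ * r)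
    (ht : ‖t - τ‖ ≤ δ * τ) : |(s * t).im| ≤ σ / 4 * (s * t).re ∧
      ‖s * t‖ ≤ 2 * (s * t).re := by
  have h1 : ‖s * t - (r * τ : ℝ)‖ ≤ 3 * δ * (r * τ) := by
    have e : s * t - (r * τ : ℝ) = (s - r) * (t - τ) + (s - r) * τ + r * (t - τ) := by
      push_cast; ring
    have hrτ := mul_nonneg hr.le hτ
    rw [e]
    refine (norm_add₃_le).trans ?_
    rw [norm_mul, norm_mul, norm_mul, Complex.norm_real, Complex.norm_real,
      Real.norm_of_nonneg hr.le, Real.norm_of_nonneg hτ]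
    have h2 : ‖s - r‖ * ‖t - τ‖ ≤ δ * r * (δ * τ) := by gcongr
    have h3 : ‖s - r‖ * τ ≤ δ * r * τ := by gcongr
    have h4 : r * ‖t - τ‖ ≤ r * (δ * τ) := by gcongr
    have h5 : δ * r * (δ * τ) ≤ δ * (r * τ) := by nlinarith [mul_nonneg hδ0.le hrτ]
    linarith
  have h2 := (Complex.abs_re_le_norm _).trans h1
  have h3 := (Complex.abs_im_le_norm _).trans h1
  simp only [Complex.sub_re, Complex.ofReal_re, Complex.sub_im, Complex.ofReal_im, sub_zero] at h2 h3
  have h4 := (abs_le.1 h2).1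
  have hrτ := mul_nonneg hr.le hτ
  have h5 : 3 * δ * (r * τ) ≤ σ / 8 * (r * τ) := by gcongr; linarith
  have h6 : (1 - σ / 8) * (r * τ) ≤ (s * t).re := by linarith
  have h7 : σ / 8 * (r * τ) ≤ σ / 4 * ((1 - σ / 8) * (r * τ)) := by nlinarith [mul_nonneg hσ0.le hrτ]
  have h8 : |(s * t).im| ≤ σ / 4 * (s * t).re :=
    h3.trans (h5.trans (h7.trans (by gcongr)))
  have hre : 0 ≤ (s * t).re := le_trans (mul_nonneg (by linarith) hrτ) h6
  refine ⟨h8, (Complex.norm_le_abs_re_add_abs_im _).trans ?_⟩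
  rw [abs_of_nonneg hre]
  nlinarith

/-- The real part of the exponent on a contour in the upper half plane. -/
theorem re_exponent_le {σ γ : ℝ} (hγ : γ ≤ σ / 4) {p w : ℂ} (hp : |p.im| ≤ σ / 4 * p.re)
    (hσ : 0 < σ) (hw : σ * Real.cosh w.re ≤ (Complex.sinh w).im) :
    (p * (γ + Complex.I * Complex.sinh w)).re ≤ -(σ / 4 * p.re * Real.cosh w.re) := by
  have hre : 0 ≤ p.re := by
    by_contra h
    have := mul_neg_of_pos_of_neg (by positivity : 0 < σ / 4) (not_le.1 h)
    linarith [abs_nonneg p.im]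
  have hc := Real.one_le_cosh w.re
  have e : (p * (γ + Complex.I * Complex.sinh w)).re =
      p.re * (γ - (Complex.sinh w).im) - p.im * (Complex.sinh w).re := by
    simp only [Complex.mul_re, Complex.mul_im, Complex.add_re, Complex.add_im, Complex.ofReal_re,
      Complex.ofReal_im, Complex.I_re, Complex.I_im]; ring
  have h1 : -(p.im * (Complex.sinh w).re) ≤ σ / 4 * p.re * Real.cosh w.re := by
    refine (neg_le_abs _).trans ?_
    rw [abs_mul]
    have := (Complex.abs_re_le_norm _).trans (norm_sinh_le w)
    gcongr
  -- Of the decay σ · Re p · cosh one quarter is spent on γ and one quarter on Im p; half of it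
  -- remains.
  have h2 : p.re * (γ - (Complex.sinh w).im) ≤ p.re * (σ / 4 * Real.cosh w.re - σ * Real.cosh w.re) := by
    gcongr
    nlinarith
  have h3 : 0 ≤ σ * p.re * Real.cosh w.re := by positivity
  rw [e]
  linarith

theorem line_re_im (u α : ℝ) : (u + α * Complex.I : ℂ).re = u ∧ (u + α * Complex.I : ℂ).im = α := by
  simp

theorem sin_mul_cosh_line (u α : ℝ) :
    Real.sin α * Real.cosh u = (Complex.sinh (u + α * Complex.I)).im := by
  rw [sinh_im, (line_re_im u α).1, (line_re_im u α).2, mul_comm]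

theorem norm_exp_exponent_le_one {σ γ : ℝ} (hγ : γ ≤ σ / 4) {p w : ℂ} (hp : |p.im| ≤ σ / 4 * p.re)
    (hσ : 0 < σ) (hw : σ * Real.cosh w.re ≤ (Complex.sinh w).im) :
    ‖Complex.exp (p * (γ + Complex.I * Complex.sinh w))‖ ≤ 1 := by
  rw [Complex.norm_exp]
  refine Real.exp_le_one_iff.2 ((re_exponent_le hγ hp hσ hw).trans ?_)
  have hre : 0 ≤ p.re := by
    by_contra h
    have := mul_neg_of_pos_of_neg (by positivity : 0 < σ / 4) (not_le.1 h)
    linarith [abs_nonneg p.im]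
  have := Real.cosh_pos w.re
  have : 0 ≤ σ / 4 * p.re * Real.cosh w.re := by positivity
  linarith

theorem norm_greenIntegrand_le {k : ℂ → ℂ} {σ γ B : ℝ} (hγ : γ ≤ σ / 4) {s t w : ℂ}
    (hp : |(s * t).im| ≤ σ / 4 * (s * t).re) (hσ : 0 < σ)
    (hw : σ * Real.cosh w.re ≤ (Complex.sinh w).im)
    (hb : ‖k (Complex.sinh w) / (s ^ 2 + k (Complex.sinh w))‖ ≤ B * Real.exp (-2 * |w.re|)) :
    ‖greenIntegrand k γ s t w‖ ≤ B * Real.exp (-1 * |w.re|) := by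
  rw [greenIntegrand, norm_mul, norm_mul]
  calc _ ≤ B * Real.exp (-2 * |w.re|) * 1 * Real.exp |w.re| := by
        have h0 := (norm_nonneg _).trans hb
        gcongr
        · exact norm_exp_exponent_le_one hγ hp hσ hw
        · exact (norm_cosh_le w).trans (cosh_le_exp_abs _)
    _ = B * (Real.exp (-2 * |w.re|) * Real.exp |w.re|) := by ring
    _ = _ := by rw [← Real.exp_add]; ring_nf

namespace Dispersion
variable {k : ℂ → ℂ} {κ d A : ℝ} {m₀ : ℝ → ℝ} (D : Dispersion k κ d A m₀)
include D

theorem differentiableAt_comp_sinh {w : ℂ} (h0 : 0 ≤ w.im) (h1 : w.im ≤ κ / 4) :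
    DifferentiableAt ℂ (fun w => k (Complex.sinh w)) w :=
  (D.differentiableAt (D.sinh_mem h0 h1)).comp w Complex.differentiable_sinh.differentiableAt

theorem differentiableAt_greenIntegrand (γ : ℝ) {s t w : ℂ} (h0 : 0 ≤ w.im) (h1 : w.im ≤ κ / 4)
    (hne : s ^ 2 + k (Complex.sinh w) ≠ 0) :
    DifferentiableAt ℂ (greenIntegrand k γ s t) w := by
  have hk := D.differentiableAt_comp_sinh h0 h1
  have hs : DifferentiableAt ℂ Complex.sinh w := Complex.differentiable_sinh.differentiableAt
  have hc : DifferentiableAt ℂ Complex.cosh w := Complex.differentiable_cosh.differentiableAt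
  exact ((hk.div (hk.const_add _) hne).mul (((hs.const_mul _).const_add _).const_mul _).cexp).mul hc

theorem continuous_greenIntegrand_line {α : ℝ} (hα0 : 0 < α) (hα : α ≤ κ / 4) (γ : ℝ) {s t : ℂ}
    (hne : ∀ u : ℝ, s ^ 2 + k (Complex.sinh (u + α * Complex.I)) ≠ 0) :
    Continuous fun u : ℝ => greenIntegrand k γ s t (u + α * Complex.I) := by
  refine continuous_iff_continuousAt.2 fun u => ?_
  exact (D.differentiableAt_greenIntegrand γ (by simpa using hα0.le) (by simpa using hα)
    (hne u)).continuousAt.comp (f := fun u : ℝ => (u + α * Complex.I : ℂ)) (by fun_prop)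

/-- The hypothesis on the quotient serves only for domination, and its constant may depend on r. The
quantitative bound is a separate hypothesis, so that the high-frequency and all low-frequency
regimes can use the same lemma. -/
theorem kineticBound_contourPart {α γ δ C : ℝ} {U : Set ℝ} {w : ℝ → ℝ} (hα0 : 0 < α)
    (hα : α ≤ κ / 4) (hγ : γ ≤ Real.sin α / 4) (hδ0 : 0 < δ) (hδ : δ ≤ Real.sin α / 24)
    (hU : ∀ r ∈ U, 0 < r)
    (hden : ∀ r ∈ U, ∃ B, ∀ s ∈ ball (r : ℂ) (δ * r), ∀ u : ℝ,
      s ^ 2 + k (Complex.sinh (u + α * Complex.I)) ≠ 0 ∧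
      ‖k (Complex.sinh (u + α * Complex.I)) / (s ^ 2 + k (Complex.sinh (u + α * Complex.I)))‖ ≤
        B * Real.exp (-2 * |u|))
    (hb : ∀ r ∈ U, ∀ τ : ℝ, 0 ≤ τ → ∀ t : ℂ, ‖t - τ‖ ≤ δ * τ → ∀ s ∈ ball (r : ℂ) (δ * r),
      ‖contourPart k γ α s t‖ ≤ C * w r) :
    KineticBound (cauchyConst δ * (1 + 2 / δ) * C)
      (fun r τ => contourPart k γ α r τ) U w := by
  have hσ : 0 < Real.sin α :=
    Real.sin_pos_of_pos_of_lt_pi hα0 (by linarith [D.le_one, Real.pi_gt_three])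
  have hσ1 := Real.sin_le_one α
  have hbound : ∀ r ∈ U, ∃ B, ∀ s ∈ ball (r : ℂ) (δ * r), ∀ τ : ℝ, 0 ≤ τ → ∀ t : ℂ,
      ‖t - τ‖ ≤ δ * τ → ∀ u : ℝ,
      ‖greenIntegrand k γ s t (u + α * Complex.I)‖ ≤ B * Real.exp (-1 * |u|) := by
    intro r hr
    obtain ⟨B, hB⟩ := hden r hr
    refine ⟨B, fun s hs τ hτ t ht u => ?_⟩
    rw [mem_ball, dist_eq_norm] at hs
    have h1 := norm_greenIntegrand_le (k := k) (w := u + α * Complex.I) hγ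
      (abs_im_mul_le_of_near hσ hσ1 hδ0 hδ (hU r hr) hτ hs.le ht).1 hσ
      (by rw [(line_re_im u α).1]; exact (sin_mul_cosh_line u α).le)
      (by rw [(line_re_im u α).1]; exact (hB s (by rwa [mem_ball, dist_eq_norm]) u).2)
    rwa [(line_re_im u α).1] at h1
  have hne : ∀ r ∈ U, ∀ s ∈ ball (r : ℂ) (δ * r), ∀ u : ℝ,
      s ^ 2 + k (Complex.sinh (u + α * Complex.I)) ≠ 0 := fun r hr s hs u => by
    obtain ⟨B, hB⟩ := hden r hr
    exact (hB s hs u).1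
  have hint := integrable_exp_neg_mul_abs one_pos
  refine kineticBound_of_holomorphic hU hδ0 (fun r hr => ?_) (fun r hr τ hτ t ht => ⟨?_, ?_⟩)
    fun r hr τ hτ s hs => ?_
  · have hrs : (r : ℂ) ∈ ball (r : ℂ) (δ * r) := mem_ball_self (mul_pos hδ0 (hU r hr))
    obtain ⟨B, hB⟩ := hbound r hr
    refine continuousOn_const.mul ?_
    refine continuousOn_of_dominated (bound := fun u => B * Real.exp (-1 * |u|))
      (fun τ _ => (D.continuous_greenIntegrand_line hα0 hα γ (hne r hr r hrs)).aestronglyMeasurable)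
      (fun τ hτ => Eventually.of_forall
        (hB r hrs τ hτ τ (by simpa using mul_nonneg hδ0.le hτ)))
      (hint.const_mul B) (Eventually.of_forall fun u => ?_)
    exact ((differentiable_greenIntegrand_right k γ r _).continuous.comp
      Complex.continuous_ofReal).continuousOn
  · refine DifferentiableOn.mul (differentiableOn_id.div_const _).neg ?_
    refine differentiableOn_integral_of_dominated isOpen_ball
      (fun s hs => (D.continuous_greenIntegrand_line hα0 hα γ (hne r hr s hs)).aestronglyMeasurable)
      (fun u s hs => ?_) fun s hs => ?_
    · exact (differentiableAt_greenIntegrand_left γ (hne r hr s hs u)).differentiableWithinAt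
    · obtain ⟨B, hB⟩ := hbound r hr
      obtain ⟨ε, hε, hsub⟩ := Metric.isOpen_iff.1 isOpen_ball s hs
      exact ⟨ε, hε, _, hint.const_mul B, fun s' hs' u => hB s' (hsub hs') τ hτ t ht u⟩
  · exact hb r hr τ hτ t ht
  · refine DifferentiableOn.mul (differentiableOn_const _) ?_
    refine differentiableOn_integral_of_dominated isOpen_ball
      (fun t _ => (D.continuous_greenIntegrand_line hα0 hα γ (hne r hr s hs)).aestronglyMeasurable)
      (fun u t _ => ?_) fun t ht => ?_
    · exact (differentiable_greenIntegrand_right k γ s _).differentiableAt.differentiableWithinAt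
    · obtain ⟨B, hB⟩ := hbound r hr
      obtain ⟨ε, hε, hsub⟩ := Metric.isOpen_iff.1 isOpen_ball t ht
      refine ⟨ε, hε, _, hint.const_mul B, fun t' ht' u => hB s hs τ hτ.le t' ?_ u⟩
      have := hsub ht'
      rw [mem_ball, dist_eq_norm] at this
      exact this.le

/-- Shift of the contour from the real line, if there are no poles in between. -/
theorem integral_greenIntegrand_eq {α B : ℝ} (hα0 : 0 < α) (hα : α ≤ κ / 4) {r τ : ℝ} (hr : 0 < r)
    (hτ : 0 ≤ τ) (hden : ∀ w : ℂ, 0 ≤ w.im → w.im ≤ α →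
      (r : ℂ) ^ 2 + k (Complex.sinh w) ≠ 0 ∧
      ‖k (Complex.sinh w) / ((r : ℂ) ^ 2 + k (Complex.sinh w))‖ ≤ B * Real.exp (-2 * |w.re|)) :
    -((r : ℂ) / (2 * Real.pi)) * ∫ u : ℝ, greenIntegrand k 0 r τ u = contourPart k 0 α r τ := by
  have h := integral_line_eq (f := greenIntegrand k 0 r τ) (C := B) one_pos hα0.le
    (fun w h0 h1 => D.differentiableAt_greenIntegrand 0 h0 (h1.trans hα) (hden w h0 h1).1)
    fun w h0 h1 => ?_
  · rw [contourPart, ← h]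
    simp
  · have hb := (hden w h0 h1).2
    rw [greenIntegrand, norm_mul, norm_mul]
    have hsin : 0 ≤ Real.sin w.im := Real.sin_nonneg_of_nonneg_of_le_pi h0
      (by linarith [D.le_one, Real.pi_gt_three])
    calc _ ≤ B * Real.exp (-2 * |w.re|) * 1 * Real.exp |w.re| := by
          have h0 := (norm_nonneg _).trans hb
          gcongr
          · rw [Complex.norm_exp]
            refine Real.exp_le_one_iff.2 ?_
            have e : ((r : ℂ) * τ * ((0 : ℝ) + Complex.I * Complex.sinh w)).re =
                -(r * τ * (Complex.sinh w).im) := by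
              rw [← Complex.ofReal_mul, Complex.re_ofReal_mul]; simp
            rw [e, sinh_im]
            have := Real.cosh_pos w.re
            have : 0 ≤ r * τ * (Real.cosh w.re * Real.sin w.im) := by positivity
            linarith
          · exact (norm_cosh_le w).trans (cosh_le_exp_abs _)
      _ = B * (Real.exp (-2 * |w.re|) * Real.exp |w.re|) := by ring
      _ = _ := by rw [← Real.exp_add]; ring_nf

theorem norm_contourPart_le {α γ B : ℝ} (hα0 : 0 < α) (hα : α ≤ κ / 4) (hγ : γ ≤ Real.sin α / 4)
    {s t : ℂ} (hp : |(s * t).im| ≤ Real.sin α / 4 * (s * t).re)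
    (hb : ∀ u : ℝ, ‖k (Complex.sinh (u + α * Complex.I)) /
      (s ^ 2 + k (Complex.sinh (u + α * Complex.I)))‖ ≤ B * Real.exp (-2 * |u|)) :
    ‖contourPart k γ α s t‖ ≤ ‖s‖ * B * ∫ u : ℝ, Real.exp (-1 * |u|) := by
  have hσ : 0 < Real.sin α :=
    Real.sin_pos_of_pos_of_lt_pi hα0 (by linarith [D.le_one, Real.pi_gt_three])
  have h1 : ‖∫ u : ℝ, greenIntegrand k γ s t (u + α * Complex.I)‖ ≤
      ∫ u : ℝ, B * Real.exp (-1 * |u|) := by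
    refine norm_integral_le_of_norm_le ((integrable_exp_neg_mul_abs one_pos).const_mul B)
      (Eventually.of_forall fun u => ?_)
    have h2 := norm_greenIntegrand_le (k := k) (w := u + α * Complex.I) hγ hp hσ
      (by rw [(line_re_im u α).1]; exact (sin_mul_cosh_line u α).le)
      (by rw [(line_re_im u α).1]; exact hb u)
    rwa [(line_re_im u α).1] at h2
  rw [integral_const_mul] at h1
  rw [contourPart, norm_mul, norm_neg, norm_div, mul_assoc]
  have h3 : 1 ≤ ‖(2 * Real.pi : ℂ)‖ := by
    rw [norm_mul, Complex.norm_real, Real.norm_of_nonneg Real.pi_pos.le]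
    simp only [Complex.norm_ofNat]
    linarith [Real.pi_gt_three]
  gcongr
  exact div_le_self (norm_nonneg _) h3

/-- For r > r₁ the number 1/r² ranges over a bounded interval, so one strip of fixed height contains
no zeros and the contour rises without a residue. Since k/(s²+k) is of order r⁻² and the prefactor
of order r, the bound is r⁻¹. -/
theorem exists_high {r₁ : ℝ} (hr₁ : 0 < r₁) : ∃ γ₁ > 0, ∀ γ : ℝ, 0 < γ → γ ≤ γ₁ →
    ∃ (C : ℝ) (E : ℝ → ℝ → ℂ), KineticBound C E (Ioi r₁) (fun r => r⁻¹) ∧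
      ∀ r : ℝ, r₁ < r → ∀ τ : ℝ, 0 ≤ τ →
        -((r : ℂ) / (2 * Real.pi)) * ∫ u : ℝ, greenIntegrand k 0 r τ u =
          (Real.exp (-γ * τ * r) : ℂ) * E r τ := by
  obtain ⟨α, hα0, hα, c, hc, h⟩ := D.exists_strip_high (1 / r₁ ^ 2)
  have hA := D.nonneg
  have hσ : 0 < Real.sin α :=
    Real.sin_pos_of_pos_of_lt_pi hα0 (by linarith [D.le_one, Real.pi_gt_three])
  have hσ1 := Real.sin_le_one α
  -- The second entry keeps 1/s² within α of 1/r² when ‖s−r‖ < δr: the difference is at most 12δ/r².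
  set δ := min (Real.sin α / 24) (α * r₁ ^ 2 / 24) with hδ
  have hδ0 : 0 < δ := by positivity
  have hδ1 : δ ≤ Real.sin α / 24 := min_le_left _ _
  have hden : ∀ r : ℝ, r₁ < r → ∀ s ∈ ball (r : ℂ) (δ * r), ∀ w : ℂ, 0 ≤ w.im → w.im ≤ α →
      s ^ 2 + k (Complex.sinh w) ≠ 0 ∧ ‖k (Complex.sinh w) / (s ^ 2 + k (Complex.sinh w))‖ ≤
        16 * A / (c * r ^ 2) * Real.exp (-2 * |w.re|) := by
    intro r hr s hs w h0 h1
    have hr0 : 0 < r := hr₁.trans hr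
    rw [mem_ball, dist_eq_norm] at hs
    have hδr : δ * r ≤ r / 24 := by nlinarith
    have hsn : r / 2 ≤ ‖s‖ := by
      have h2 := norm_sub_norm_le (r : ℂ) s
      rw [Complex.norm_real, Real.norm_of_nonneg hr0.le, norm_sub_rev] at h2
      linarith
    have hsn' : ‖s‖ ≤ 2 * r := by
      have h2 := norm_sub_norm_le s (r : ℂ)
      rw [Complex.norm_real, Real.norm_of_nonneg hr0.le] at h2
      linarith
    have hs0 : s ≠ 0 := norm_pos_iff.1 (by linarith)
    have hrc : (r : ℂ) ≠ 0 := by exact_mod_cast hr0.ne'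
    have hq : ‖1 / s ^ 2 - ((1 / r ^ 2 : ℝ) : ℂ)‖ < α := by
      have e : 1 / s ^ 2 - ((1 / r ^ 2 : ℝ) : ℂ) = (r - s) * (r + s) / (s ^ 2 * r ^ 2) := by
        push_cast; field_simp; ring
      rw [e, norm_div, norm_mul, norm_mul, norm_pow, norm_pow, Complex.norm_real,
        Real.norm_of_nonneg hr0.le, norm_sub_rev]
      have h2 : ‖(r : ℂ) + s‖ ≤ 3 * r := by
        refine (norm_add_le _ _).trans ?_
        rw [Complex.norm_real, Real.norm_of_nonneg hr0.le]; linarith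
      have h3 : δ ≤ α * r₁ ^ 2 / 24 := min_le_right _ _
      calc _ ≤ (δ * r) * (3 * r) / ((r / 2) ^ 2 * r ^ 2) := by gcongr
        _ = 12 * δ / r ^ 2 := by field_simp; ring
        _ ≤ 12 * (α * r₁ ^ 2 / 24) / r ^ 2 := by gcongr
        _ ≤ 12 * (α * r ^ 2 / 24) / r ^ 2 := by gcongr
        _ = α / 2 := by field_simp; ring
        _ < α := half_lt_self hα0
    have h2 := h (1 / s ^ 2) w ⟨1 / r ^ 2, ⟨by positivity, by gcongr⟩, hq⟩ h0 h1
    have e2 : s ^ 2 + k (Complex.sinh w) = s ^ 2 * (1 + 1 / s ^ 2 * k (Complex.sinh w)) := by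
      field_simp
    have h3 : c * r ^ 2 / 4 ≤ ‖s ^ 2 + k (Complex.sinh w)‖ := by
      rw [e2, norm_mul, norm_pow]
      calc c * r ^ 2 / 4 = (r / 2) ^ 2 * c := by ring
        _ ≤ _ := by gcongr
    refine ⟨norm_pos_iff.1 (lt_of_lt_of_le (by positivity) h3), ?_⟩
    rw [norm_div]
    calc _ ≤ 4 * A * Real.exp (-2 * |w.re|) / (c * r ^ 2 / 4) := by
          gcongr
          exact D.norm_comp_sinh_le (D.sinh_mem h0 (h1.trans hα))
      _ = _ := by field_simp; ring
  set J := ∫ u : ℝ, Real.exp (-1 * |u|) with hJ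
  have hJ0 : 0 ≤ J := integral_nonneg fun u => (Real.exp_pos _).le
  refine ⟨Real.sin α / 4, by positivity, fun γ hγ0 hγ => ⟨_, _,
    D.kineticBound_contourPart (C := 32 * A / c * J) hα0 hα hγ hδ0 hδ1
      (fun r hr => hr₁.trans hr) (fun r hr => ⟨16 * A / (c * r ^ 2), fun s hs u => ?_⟩)
      fun r hr τ hτ t ht s hs => ?_, fun r hr τ hτ => ?_⟩⟩
  · have := hden r hr s hs (u + α * Complex.I) (by simpa using hα0.le) (by simp)
    rwa [(line_re_im u α).1] at this
  · have hr0 : 0 < r := hr₁.trans hr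
    have hs' := hs
    rw [mem_ball, dist_eq_norm] at hs'
    have hsn' : ‖s‖ ≤ 2 * r := by
      have h2 := norm_sub_norm_le s (r : ℂ)
      rw [Complex.norm_real, Real.norm_of_nonneg hr0.le] at h2
      nlinarith
    have h1 := D.norm_contourPart_le (B := 16 * A / (c * r ^ 2)) hα0 hα hγ
      (abs_im_mul_le_of_near hσ hσ1 hδ0 hδ1 hr0 hτ hs'.le ht).1 fun u => by
        have := (hden r hr s hs (u + α * Complex.I) (by simpa using hα0.le) (by simp)).2
        rwa [(line_re_im u α).1] at this
    refine h1.trans ?_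
    calc _ ≤ 2 * r * (16 * A / (c * r ^ 2)) * J := by gcongr
      _ = _ := by field_simp; ring
  · have hr0 : 0 < r := hr₁.trans hr
    rw [D.integral_greenIntegrand_eq hα0 hα hr0 hτ
      (hden r hr r (mem_ball_self (mul_pos hδ0 hr0))), ← exp_mul_contourPart k γ α]
    congr 2
    push_cast
    ring_nf

end Dispersion

/-! ### The branch of zeros of the dispersion relation near infinity -/

theorem norm_deriv_le_of_ball {f : ℂ → ℂ} {c : ℂ} {R M : ℝ} (hR : 0 < R)
    (hf : DifferentiableOn ℂ f (ball c R)) (hM : ∀ z ∈ ball c R, ‖f z‖ ≤ M) :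
    ‖deriv f c‖ ≤ 2 * M / R := by
  have hsub : closedBall c (R / 2) ⊆ ball c R := closedBall_subset_ball (by linarith)
  have h := Complex.norm_deriv_le_of_forall_mem_sphere_norm_le (half_pos hR)
    ((hf.mono hsub).diffContOnCl_ball subset_rfl)
    fun z hz => hM z (hsub (sphere_subset_closedBall hz))
  rwa [div_div_eq_mul_div, mul_comm M] at h

theorem ball_subset_cone_of_mem {δ ρ : ℝ} (h1 : δ ≤ 1) {v : ℂ}
    (hv : v ∈ cone (δ / 8) (ρ / 2)) : closedBall v (δ / 8 * v.re) ⊆ cone δ ρ := by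
  intro s hs
  rw [mem_closedBall, dist_eq_norm] at hs
  have h2 := (Complex.abs_re_le_norm _).trans hs
  have h3 := (Complex.abs_im_le_norm _).trans hs
  simp only [Complex.sub_re, Complex.sub_im] at h2 h3
  rw [abs_le] at h2
  obtain ⟨hv0, hv1, hv2⟩ := hv
  have h4 : δ / 8 * v.re ≤ v.re / 8 := by nlinarith
  have h5 : |s.im| ≤ |s.im - v.im| + |v.im| := by
    have := abs_add_le (s.im - v.im) v.im; rwa [sub_add_cancel] at this
  have hδ : 0 < δ := by
    have := (abs_nonneg _).trans_lt hv1
    nlinarith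
  exact ⟨by linarith, by nlinarith, by linarith⟩

theorem inv_mem_lowerRegion {κ ρ : ℝ} (h0 : 0 < κ) {v : ℂ} (hv : v ∈ cone κ ρ) :
    v⁻¹ ∈ lowerRegion κ := by
  simp only [lowerRegion, mem_ofPred_eq]
  have h1 : |(v⁻¹).im| ≤ κ * (v⁻¹).re := abs_im_inv_le hv.2.1.le
  have h2 := le_abs_self (v⁻¹).im
  have h3 := le_abs_self (v⁻¹).re
  nlinarith

/-- The principal root has nonnegative real part, so |√q + 1| ≥ 1 in the factorization q − 1 = (√q −
1)(√q + 1). -/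
theorem norm_cpow_half_sub_one_le {q : ℂ} (hq : ‖q - 1‖ ≤ 1 / 2) :
    ‖q ^ (1 / 2 : ℂ) - 1‖ ≤ ‖q - 1‖ ∧ (q ^ (1 / 2 : ℂ)) ^ 2 = q ∧ q ∈ Complex.slitPlane := by
  have hre : 0 < q.re := by
    have := (Complex.abs_re_le_norm _).trans hq
    rw [Complex.sub_re, Complex.one_re, abs_le] at this
    linarith
  have hsq : (q ^ (1 / 2 : ℂ)) ^ 2 = q := by
    have := Complex.cpow_nat_inv_pow q two_ne_zero
    simpa only [Nat.cast_ofNat, one_div] using this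
  refine ⟨?_, hsq, Or.inl hre⟩
  have hq0 : q ≠ 0 := fun h => by rw [h] at hre; simp at hre
  have hre2 : 0 ≤ (q ^ (1 / 2 : ℂ)).re := by
    rw [Complex.cpow_def_of_ne_zero hq0, Complex.exp_re]
    refine mul_nonneg (Real.exp_pos _).le (Real.cos_nonneg_of_neg_pi_div_two_le_of_le ?_ ?_)
    · have e : (Complex.log q * (1 / 2 : ℂ)).im = q.arg / 2 := by
        rw [show (1 / 2 : ℂ) = ((1 / 2 : ℝ) : ℂ) by push_cast; rfl, mul_comm,
          Complex.im_ofReal_mul, Complex.log_im]; ring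
      rw [e]; linarith [Complex.neg_pi_lt_arg q]
    · have e : (Complex.log q * (1 / 2 : ℂ)).im = q.arg / 2 := by
        rw [show (1 / 2 : ℂ) = ((1 / 2 : ℝ) : ℂ) by push_cast; rfl, mul_comm,
          Complex.im_ofReal_mul, Complex.log_im]; ring
      rw [e]; linarith [Complex.arg_le_pi q]
  have h1 : 1 ≤ ‖q ^ (1 / 2 : ℂ) + 1‖ := by
    refine le_trans ?_ (Complex.re_le_norm _)
    rw [Complex.add_re, Complex.one_re]; linarith
  calc _ ≤ ‖q ^ (1 / 2 : ℂ) - 1‖ * ‖q ^ (1 / 2 : ℂ) + 1‖ := le_mul_of_one_le_right (norm_nonneg _) h1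
    _ = ‖(q ^ (1 / 2 : ℂ)) ^ 2 - 1‖ := by rw [← norm_mul]; congr 1; ring
    _ = _ := by rw [hsq]

/-- A square root `F` of `v ↦ -k (1 / v)` on a truncated sector, with inverse function `V`. -/
structure Branch (k : ℂ → ℂ) (κ δ ρ : ℝ) (F V : ℂ → ℂ) : Prop where
  pos : 0 < δ
  le : δ ≤ κ
  le_one : δ ≤ 1
  rho_pos : 0 < ρ
  rho_le : ρ ≤ 1 / 2
  diff : DifferentiableOn ℂ F (cone δ ρ)
  sq : ∀ v ∈ cone δ ρ, F v ^ 2 = -k v⁻¹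
  approx : ∀ v ∈ cone δ ρ, ∀ v' ∈ cone δ ρ, ‖F v - F v' - (v - v')‖ ≤ 1 / 64 * ‖v - v'‖
  near : ∀ v ∈ cone δ ρ, ‖F v - v‖ ≤ 1 / 64 * ‖v‖
  small : ∀ ε > 0, ∃ ρ' > 0, ∀ v ∈ cone δ ρ, v.re < ρ' → ‖F v - v‖ ≤ ε * ‖v‖
  mem : ∀ s ∈ cone (δ / 8) (ρ / 2), V s ∈ cone δ ρ
  right_inv : ∀ s ∈ cone (δ / 8) (ρ / 2), F (V s) = s
  diff_inv : DifferentiableOn ℂ V (cone (δ / 8) (ρ / 2))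

/-- For small v in a sector −v⁻²k(1/v) is close to 1, so F(v) = v√(−v⁻²k(1/v)) is holomorphic there
with F − id of small relative size. Cauchy's estimate bounds the derivative of F − id on a smaller
sector, which is convex, so F − id is Lipschitz with constant 1/64. The inverse then exists by
Banach's fixed point theorem and is holomorphic because F' is not zero. -/
theorem Dispersion.exists_branch {k : ℂ → ℂ} {κ d A : ℝ} {m₀ : ℝ → ℝ}
    (D : Dispersion k κ d A m₀) : ∃ (δ ρ : ℝ) (F V : ℂ → ℂ), Branch k κ δ ρ F V := by
  have hκ := D.pos
  have hκ1 := D.le_one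
  -- Cauchy's estimate on the disc of radius (κ/8) Re v loses a factor 64/κ; the value κ/4096 leaves
  -- 1/64 for the derivative of F − id.
  obtain ⟨R, hR1, hR⟩ := D.exists_leading_small (ε := κ / 4096) (by positivity)
  set ρ₁ := 1 / (2 * R) with hρ₁
  have hρ₁0 : 0 < ρ₁ := by positivity
  have hρ₁1 : ρ₁ ≤ 1 / 2 := by
    rw [hρ₁]; exact one_div_le_one_div_of_le two_pos (by linarith)
  set q : ℂ → ℂ := fun v => -((v⁻¹) ^ 2 * k v⁻¹) with hq
  set F : ℂ → ℂ := fun v => v * q v ^ (1 / 2 : ℂ) with hF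
  have hne : ∀ v ∈ cone κ ρ₁, v ≠ 0 := fun v hv => norm_pos_iff.1 (norm_pos_of_mem_cone hv)
  have hqe : ∀ v, q v - 1 = -((v⁻¹) ^ 2 * k v⁻¹ + 1) := fun v => by simp only [hq]; ring
  have hqsmall : ∀ v ∈ cone κ ρ₁, ‖q v - 1‖ ≤ κ / 4096 := fun v hv => by
    rw [hqe, norm_neg]
    refine hR _ (inv_mem_lowerRegion hκ hv) ?_
    rw [norm_inv, le_inv_comm₀ (by linarith) (norm_pos_of_mem_cone hv)]
    have := norm_le_of_mem_cone hκ1 hv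
    have h2 := hv.2.2
    calc ‖v‖ ≤ 2 * ρ₁ := by linarith
      _ = R⁻¹ := by rw [hρ₁]; field_simp
  have hroot : ∀ v ∈ cone κ ρ₁, ‖q v ^ (1 / 2 : ℂ) - 1‖ ≤ ‖q v - 1‖ ∧
      (q v ^ (1 / 2 : ℂ)) ^ 2 = q v ∧ q v ∈ Complex.slitPlane := fun v hv =>
    norm_cpow_half_sub_one_le ((hqsmall v hv).trans (by linarith))
  have hFd : DifferentiableOn ℂ F (cone κ ρ₁) := fun v hv => by
    have h0 := hne v hv
    have hi : DifferentiableAt ℂ (fun v : ℂ => v⁻¹) v := differentiableAt_inv h0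
    have hk : DifferentiableAt ℂ (fun v : ℂ => k v⁻¹) v :=
      (D.differentiableAt (inv_mem_lowerRegion hκ hv)).comp v hi
    have hqd : DifferentiableAt ℂ q v := ((hi.pow 2).mul hk).neg
    exact (differentiableAt_id.mul (hqd.cpow_const (hroot v hv).2.2)).differentiableWithinAt
  have hFsub : ∀ v, F v - v = v * (q v ^ (1 / 2 : ℂ) - 1) := fun v => by simp only [hF]; ring
  have hnear : ∀ v ∈ cone κ ρ₁, ‖F v - v‖ ≤ κ / 4096 * ‖v‖ := fun v hv => by
    rw [hFsub, norm_mul, mul_comm]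
    exact mul_le_mul_of_nonneg_right ((hroot v hv).1.trans (hqsmall v hv)) (norm_nonneg _)
  set δ := κ / 8 with hδ
  set ρ := ρ₁ / 2 with hρ
  have hsub : cone δ ρ ⊆ cone κ ρ₁ := cone_mono (by linarith) (by linarith)
  have hGd : ∀ v ∈ cone δ ρ, DifferentiableAt ℂ (fun v => F v - v) v := fun v hv =>
    ((hFd.differentiableAt ((isOpen_cone _ _).mem_nhds (hsub hv))).sub differentiableAt_id)
  have hderiv : ∀ v ∈ cone δ ρ, ‖deriv (fun v => F v - v) v‖ ≤ 1 / 64 := fun v hv => by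
    have hb := ball_subset_closedBall.trans (ball_subset_cone_of_mem hκ1 hv)
    have h1 := norm_deriv_le_of_ball (f := fun v => F v - v) (M := κ / 4096 * (4 * v.re))
      (mul_pos (by positivity) hv.1) (fun s hs =>
        ((hFd.differentiableAt ((isOpen_cone _ _).mem_nhds (hb hs))).sub
          differentiableAt_id).differentiableWithinAt) fun s hs => by
        refine (hnear s (hb hs)).trans ?_
        rw [mem_ball, dist_eq_norm] at hs
        have h2 := norm_le_of_mem_cone (by linarith) hv
        have h3 : ‖s‖ ≤ ‖s - v‖ + ‖v‖ := by
          have := norm_add_le (s - v) v; rwa [sub_add_cancel] at this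
        have h4 : κ / 8 * v.re ≤ v.re := by nlinarith [hv.1]
        gcongr
        linarith [hv.1]
    refine h1.trans (le_of_eq ?_)
    have := hv.1.ne'
    field_simp
    norm_num
  have happrox : ∀ v ∈ cone δ ρ, ∀ v' ∈ cone δ ρ,
      ‖F v - F v' - (v - v')‖ ≤ 1 / 64 * ‖v - v'‖ := fun v hv v' hv' => by
    have := (convex_cone δ ρ).norm_image_sub_le_of_norm_deriv_le hGd hderiv hv' hv
    rwa [show F v - F v' - (v - v') = (F v - v) - (F v' - v') by ring]
  have hnear' : ∀ v ∈ cone δ ρ, ‖F v - v‖ ≤ κ / 4096 * ‖v‖ := fun v hv => hnear v (hsub hv)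
  have hδ0 : 0 < δ := by positivity
  have hδ1 : δ ≤ 1 := by rw [hδ]; linarith
  have hsurj : ∀ s ∈ cone (δ / 8) (ρ / 2), ∃ v ∈ cone δ ρ, F v = s := by
    intro s hs
    have hball := ball_subset_cone_of_mem hδ1 hs
    -- A fixed point of this map solves F v = s; the closed disc about s is mapped into itself
    -- because F − id is relatively small.
    set T : ℂ → ℂ := fun v => s - (F v - v) with hT
    have hmaps : MapsTo T (closedBall s (δ / 8 * s.re)) (closedBall s (δ / 8 * s.re)) := by
      intro v hv
      have h1 := hnear' v (hball hv)
      rw [mem_closedBall, dist_eq_norm] at hv ⊢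
      have h2 : T v - s = -(F v - v) := by simp only [hT]; ring
      rw [h2, norm_neg]
      refine h1.trans ?_
      have h3 : ‖v‖ ≤ ‖v - s‖ + ‖s‖ := by
        have := norm_add_le (v - s) s; rwa [sub_add_cancel] at this
      have h4 := norm_le_of_mem_cone (by linarith) hs
      have h5 : δ / 8 * s.re ≤ s.re := by nlinarith [hs.1]
      calc κ / 4096 * ‖v‖ ≤ κ / 4096 * (4 * s.re) := by gcongr; linarith [hs.1]
        _ ≤ δ / 8 * s.re := by rw [hδ]; nlinarith [mul_pos hκ hs.1]
    have hcon : ContractingWith (1 / 64) (hmaps.restrict T _ _) := by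
      refine ⟨by rw [← NNReal.coe_lt_coe]; norm_num, LipschitzWith.of_dist_le_mul ?_⟩
      rintro ⟨v, hv⟩ ⟨v', hv'⟩
      have := happrox v (hball hv) v' (hball hv')
      rw [Subtype.dist_eq, Subtype.dist_eq, MapsTo.val_restrict_apply, MapsTo.val_restrict_apply,
        dist_eq_norm, dist_eq_norm]
      have e : T v - T v' = -(F v - F v' - (v - v')) := by simp only [hT]; ring
      rw [e, norm_neg]
      simpa using this
    obtain ⟨v, hv, hfix, -⟩ := hcon.exists_fixedPoint' isClosed_closedBall.isComplete hmaps
      (mem_closedBall_self (mul_nonneg (by positivity) hs.1.le)) (edist_ne_top _ _)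
    refine ⟨v, hball hv, ?_⟩
    have : s - (F v - v) = v := hfix
    linear_combination -this
  choose! V hVmem hV using hsurj
  have hFd' : DifferentiableOn ℂ F (cone δ ρ) := hFd.mono hsub
  have hlip : ∀ s ∈ cone (δ / 8) (ρ / 2), ∀ s' ∈ cone (δ / 8) (ρ / 2),
      ‖V s - V s'‖ ≤ 2 * ‖s - s'‖ := fun s hs s' hs' => by
    have h1 := happrox _ (hVmem s hs) _ (hVmem s' hs')
    rw [hV s hs, hV s' hs', norm_sub_rev] at h1
    have h2 := norm_sub_norm_le (V s - V s') (s - s')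
    linarith [norm_nonneg (s - s')]
  refine ⟨δ, ρ, F, V, hδ0, by linarith, hδ1, by positivity, by linarith, hFd', fun v hv => ?_,
    happrox, fun v hv => (hnear' v hv).trans (by gcongr; linarith), fun ε hε => ?_, hVmem, hV,
    fun s hs => ?_⟩
  · simp only [hF]
    rw [mul_pow, (hroot v (hsub hv)).2.1, hq]
    have := hne v (hsub hv)
    field_simp
  · obtain ⟨R', hR'1, hR'⟩ := D.exists_leading_small hε
    refine ⟨1 / (2 * R'), by positivity, fun v hv hv2 => ?_⟩
    rw [hFsub, norm_mul, mul_comm]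
    refine mul_le_mul_of_nonneg_right ((hroot v (hsub hv)).1.trans ?_) (norm_nonneg _)
    rw [hqe, norm_neg]
    refine hR' _ (inv_mem_lowerRegion hκ (hsub hv)) ?_
    rw [norm_inv, le_inv_comm₀ (by linarith) (norm_pos_of_mem_cone hv)]
    have := norm_le_of_mem_cone hδ1 hv
    calc ‖v‖ ≤ 2 * (1 / (2 * R')) := by linarith
      _ = R'⁻¹ := by field_simp
  · have hnhds : cone (δ / 8) (ρ / 2) ∈ 𝓝 s := (isOpen_cone _ _).mem_nhds hs
    have hcont : ContinuousAt V s := by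
      rw [Metric.continuousAt_iff]
      intro ε hε
      obtain ⟨ε', hε', hsub'⟩ := Metric.mem_nhds_iff.1 hnhds
      refine ⟨min ε' (ε / 2), by positivity, fun {s'} hs' => ?_⟩
      rw [dist_eq_norm] at hs' ⊢
      have h1 := hlip s' (hsub' (by rw [mem_ball, dist_eq_norm]; exact hs'.trans_le (min_le_left _ _)))
        s hs
      have h2 := hs'.trans_le (min_le_right _ _)
      linarith
    have hFat : DifferentiableAt ℂ F (V s) :=
      hFd'.differentiableAt ((isOpen_cone _ _).mem_nhds (hVmem s hs))
    refine (HasDerivAt.of_local_left_inverse hcont hFat.hasDerivAt ?_ ?_).differentiableAt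
      |>.differentiableWithinAt
    · intro h0
      have h1 := hderiv _ (hVmem s hs)
      have h2 : deriv (fun v => F v - v) (V s) = deriv F (V s) - 1 := by
        have := (hFat.hasDerivAt.sub (hasDerivAt_id (V s))).deriv
        exact this
      rw [h2, h0, zero_sub, norm_neg, norm_one] at h1
      norm_num at h1
    · filter_upwards [hnhds] with y hy using hV y hy

namespace Branch
variable {k : ℂ → ℂ} {κ δ ρ : ℝ} {F V : ℂ → ℂ} (Br : Branch k κ δ ρ F V)
include Br

theorem injOn : InjOn F (cone δ ρ) := fun v hv v' hv' h => by
  have h1 := Br.approx v hv v' hv'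
  rw [h, sub_self, zero_sub, norm_neg] at h1
  have : ‖v - v'‖ = 0 := by linarith [norm_nonneg (v - v')]
  exact sub_eq_zero.1 (norm_eq_zero.1 this)

theorem norm_inv_sub_le {s : ℂ} (hs : s ∈ cone (δ / 8) (ρ / 2)) {v : ℂ} (hv : v ∈ cone δ ρ) :
    ‖V s - v‖ ≤ 2 * ‖s - F v‖ := by
  have h1 := Br.approx _ (Br.mem s hs) v hv
  rw [Br.right_inv s hs, norm_sub_rev] at h1
  have h2 := norm_sub_norm_le (V s - v) (s - F v)
  linarith [norm_nonneg (s - F v)]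

theorem norm_inv_sub_self_le {s : ℂ} (hs : s ∈ cone (δ / 8) (ρ / 2)) :
    ‖V s - s‖ ≤ 1 / 64 * ‖V s‖ := by
  have := Br.near _ (Br.mem s hs)
  rwa [Br.right_inv s hs, norm_sub_rev] at this

theorem norm_inv_ge {s : ℂ} (hs : s ∈ cone (δ / 8) (ρ / 2)) : ‖s‖ / 2 ≤ ‖V s‖ := by
  have h1 := Br.norm_inv_sub_self_le hs
  have h2 := norm_sub_norm_le s (V s)
  rw [norm_sub_rev] at h2
  linarith [norm_nonneg (V s)]

theorem norm_inv_le {s : ℂ} (hs : s ∈ cone (δ / 8) (ρ / 2)) : ‖V s‖ ≤ 2 * ‖s‖ := by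
  have h1 := Br.norm_inv_sub_self_le hs
  have h2 := norm_sub_norm_le (V s) s
  linarith [norm_nonneg (V s)]

theorem re_pos {v : ℂ} (hv : v ∈ cone δ ρ) : 0 < (F v).re := by
  have h1 := (Complex.abs_re_le_norm _).trans (Br.near v hv)
  rw [Complex.sub_re, abs_le] at h1
  have h2 := norm_le_of_mem_cone Br.le_one hv
  have := hv.1
  linarith

/-- The frequency is determined up to the defect in the dispersion relation. -/
theorem norm_div_inv_sub_le {s p : ℂ} (hs : s ∈ cone (δ / 8) (ρ / 2)) (hp : s / p ∈ cone δ ρ)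
    (hp1 : ‖p‖ ≤ 2) : ‖s / V s - p‖ ≤ 16 * ‖s ^ 2 + k (p / s)‖ / ‖s‖ ^ 2 := by
  have hs0 := norm_pos_of_mem_cone hs
  have hsne : s ≠ 0 := norm_pos_iff.1 hs0
  have hpne : p ≠ 0 := fun h => by
    have := hp.1; rw [h, div_zero] at this; simp at this
  have hV0 : 0 < ‖V s‖ := norm_pos_of_mem_cone (Br.mem s hs)
  have hVne : V s ≠ 0 := norm_pos_iff.1 hV0
  have e1 : s / V s - p = (s / p - V s) * p / V s := by field_simp
  have h1 := Br.norm_inv_sub_le hs hp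
  have h2 : ‖s‖ / 2 ≤ ‖F (s / p) + s‖ := by
    have h3 := Br.re_pos hp
    have h4 := norm_le_of_mem_cone (by linarith [Br.le_one, Br.pos]) hs
    refine le_trans ?_ (Complex.re_le_norm _)
    rw [Complex.add_re]; linarith
  -- Since F(s/p)² = −k(p/s), the defect of the dispersion relation factors as (s − F)(s + F). The
  -- second factor is of order |s|, as both terms have positive real part.
  have h3 : ‖s - F (s / p)‖ * ‖F (s / p) + s‖ = ‖s ^ 2 + k (p / s)‖ := by
    rw [← norm_mul]
    congr 1
    have := Br.sq _ hp
    rw [inv_div] at this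
    linear_combination -this
  have h4 : ‖s - F (s / p)‖ ≤ 2 * ‖s ^ 2 + k (p / s)‖ / ‖s‖ := by
    rw [le_div_iff₀ hs0, ← h3]
    nlinarith [norm_nonneg (s - F (s / p))]
  rw [e1, norm_div, norm_mul, norm_sub_rev]
  calc _ ≤ 2 * (2 * ‖s ^ 2 + k (p / s)‖ / ‖s‖) * 2 / (‖s‖ / 2) := by
        gcongr
        · exact h1.trans (by gcongr)
        · exact Br.norm_inv_ge hs
    _ = _ := by field_simp; ring

end Branch

/-- Let v = V(r), 1/v = x + iy and X = 1/x, so that Re ω = rx and Im ω = ry. At the real point X the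
square of F is −k(x), whose imaginary part is exactly −π m₀'(x). As F(v) = r is real and F − id is
Lipschitz with constant 1/64, Im F(X) is close to minus the imaginary part of v − X, about yr². Thus
−π m₀'(x) is about 2yr³, and the factor 1/2 lies well inside the allowed range from 1/4 to 1. -/
theorem Branch.im_div_mem {k : ℂ → ℂ} {κ d A δ ρ : ℝ} {m₀ : ℝ → ℝ} {F V : ℂ → ℂ}
    (Br : Branch k κ δ ρ F V) (D : Dispersion k κ d A m₀) {r : ℝ} (hr : r ∈ Ioo 0 (ρ / 2)) :
    0 < ((r : ℂ) / V r).im ∧ 0 < ((r : ℂ) / V r).re ∧ ((r : ℂ) / V r).im ∈ Icc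
      (-Real.pi * deriv m₀ (((r : ℂ) / V r).re / r) / (4 * r ^ 2))
      (-Real.pi * deriv m₀ (((r : ℂ) / V r).re / r) / r ^ 2) := by
  have hr0 := hr.1
  have hrS : (r : ℂ) ∈ cone (δ / 8) (ρ / 2) := ofReal_mem_cone (by linarith [Br.pos]) hr
  set v := V r with hv
  have hvS : v ∈ cone δ ρ := Br.mem _ hrS
  have hFv : F v = r := Br.right_inv _ hrS
  set n := ‖v‖ with hn
  have hn0 : 0 < n := norm_pos_of_mem_cone hvS
  have hvne : v ≠ 0 := norm_pos_iff.1 hn0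
  set z := v⁻¹ with hz
  set x := z.re with hx
  set y := z.im with hy
  have e : (r : ℂ) / v = r * z := div_eq_mul_inv _ _
  rw [e, Complex.re_ofReal_mul, Complex.im_ofReal_mul, mul_div_cancel_left₀ _ hr0.ne']
  have hnear : ‖v - r‖ ≤ 1 / 64 * n := Br.norm_inv_sub_self_le hrS
  have hre : r - n / 64 ≤ v.re := by
    have := (abs_le.1 ((Complex.abs_re_le_norm _).trans hnear)).1
    rw [Complex.sub_re, Complex.ofReal_re] at this; linarith
  have hrn1 : r ≤ n + n / 64 := by
    have := norm_sub_norm_le (r : ℂ) v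
    rw [Complex.norm_real, Real.norm_of_nonneg hr0.le, norm_sub_rev] at this
    linarith
  have hrn2 : n - n / 64 ≤ r := by
    have := norm_sub_norm_le v (r : ℂ)
    rw [Complex.norm_real, Real.norm_of_nonneg hr0.le] at this
    linarith
  have hre2 : v.re ≤ n := Complex.re_le_norm v
  have hnsq : Complex.normSq v = n ^ 2 := Complex.normSq_eq_norm_sq v
  have hxe : x = v.re / n ^ 2 := by rw [hx, hz, Complex.inv_re, hnsq]
  have hre0 := hvS.1
  have hx0 : 0 < x := by rw [hxe]; positivity
  set X := x⁻¹ with hX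
  have hXe : X = n ^ 2 / v.re := by rw [hX, hxe, inv_div]
  have hX0 : 0 < X := inv_pos.2 hx0
  have hX1 : n ≤ X := by rw [hXe, le_div_iff₀ hre0]; nlinarith
  have hX2 : X ≤ 32 / 31 * n := by rw [hXe, div_le_iff₀ hre0]; nlinarith
  have hXS : (X : ℂ) ∈ cone δ ρ := ofReal_mem_cone Br.pos ⟨hX0, by linarith [hr.2]⟩
  have hFX := Br.near _ hXS
  rw [Complex.norm_real, Real.norm_of_nonneg hX0.le] at hFX
  have hFXre := abs_le.1 ((Complex.abs_re_le_norm _).trans hFX)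
  rw [Complex.sub_re, Complex.ofReal_re] at hFXre
  -- The reciprocals of v and X have the same real part x, so their difference is iy.
  have hdiff : v - X = -(Complex.I * y * v * X) := by
    have hxz : (x : ℂ) = z - Complex.I * y := by
      rw [hx, hy, eq_sub_iff_add_eq, mul_comm]; exact Complex.re_add_im z
    have hxne : (x : ℂ) ≠ 0 := by exact_mod_cast hx0.ne'
    have hvz : v * z = 1 := mul_inv_cancel₀ hvne
    have : (v - X) * x = -(Complex.I * y * v * X) * x := by
      have hXx : (X : ℂ) * x = 1 := by rw [hX]; push_cast; exact inv_mul_cancel₀ hxne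
      rw [sub_mul, hXx]
      have : -(Complex.I * y * v * X) * x = -(Complex.I * y * v) := by
        rw [mul_assoc, mul_assoc]; linear_combination (-(Complex.I * y * v)) * hXx
      rw [this, hxz]
      linear_combination hvz
    exact mul_right_cancel₀ hxne this
  have hdn : ‖v - X‖ = |y| * n * X := by
    rw [hdiff, norm_neg, norm_mul, norm_mul, norm_mul, Complex.norm_I, Complex.norm_real,
      Complex.norm_real, Real.norm_eq_abs, Real.norm_of_nonneg hX0.le, one_mul]
  have hdi : (v - X).im = -(y * X * v.re) := by
    have : -(Complex.I * y * v * X) = ((-(y * X) : ℝ) : ℂ) * (Complex.I * v) := by push_cast; ring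
    rw [hdiff, this, Complex.im_ofReal_mul, Complex.I_mul_im]; ring
  have happ := (Complex.abs_im_le_norm _).trans (Br.approx v hvS X hXS)
  rw [hFv, hdn, Complex.sub_im, Complex.sub_im, hdi, Complex.ofReal_im, zero_sub, abs_le] at happ
  set b := (F X).im with hb
  set a := (F X).re with ha
  have hsq : 2 * a * b = -Real.pi * deriv m₀ x := by
    have h1 := congrArg Complex.im (Br.sq _ hXS)
    have h2 : ((X : ℂ))⁻¹ = (x : ℂ) := by rw [hX]; push_cast; rw [inv_inv]
    rw [h2, Complex.neg_im, D.im_eq] at h1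
    have h3 : (F X ^ 2).im = 2 * a * b := by rw [pow_two, Complex.mul_im]; ring
    rw [h3] at h1
    rw [h1]; ring
  have hP : 0 < 2 * a * b := by
    have := D.im_neg x hx0
    rw [D.im_eq] at this
    rw [hsq]; linarith
  have ha0 : 0 < a := by linarith [hFXre.1]
  have hb0 : 0 < b := by
    by_contra h
    have := mul_nonneg_of_nonpos_of_nonpos (not_lt.1 h) (by linarith : -(2 * a) ≤ 0)
    linarith
  have hy0 : 0 < y := by
    by_contra h
    have hy' := not_lt.1 h
    rw [abs_of_nonpos hy'] at happ
    have h1 : y * X * v.re ≤ y * X * (n / 2) := by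
      have : y * X ≤ 0 := mul_nonpos_of_nonpos_of_nonneg hy' hX0.le
      exact mul_le_mul_of_nonpos_left (by linarith) this
    have h2 : y * X * n ≤ 0 :=
      mul_nonpos_of_nonpos_of_nonneg (mul_nonpos_of_nonpos_of_nonneg hy' hX0.le) hn0.le
    linarith [happ.1]
  rw [abs_of_pos hy0] at happ
  rw [← hsq]
  refine ⟨by positivity, by positivity, ?_, ?_⟩
  · rw [div_le_iff₀ (by positivity)]
    have h1 : b ≤ y * X * (n + n / 64) := by
      have : y * X * v.re ≤ y * X * n := by gcongr
      linarith [happ.1]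
    calc 2 * a * b ≤ 2 * (X + X / 64) * (y * X * (n + n / 64)) := by gcongr; linarith [hFXre.2]
      _ = 2 * (65 / 64) ^ 2 * (y * X ^ 2 * n) := by ring
      _ ≤ 2 * (65 / 64) ^ 2 * (y * (32 / 31 * n) ^ 2 * n) := by gcongr
      _ ≤ 4 * y * (n - n / 64) ^ 3 := by
          have : 0 < y * n ^ 3 := by positivity
          nlinarith
      _ ≤ 4 * y * r ^ 3 := by gcongr; linarith
      _ = r * y * (4 * r ^ 2) := by ring
  · rw [le_div_iff₀ (by positivity)]
    have h1 : y * X * (n * (61 / 64)) ≤ b := by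
      have : y * X * (n - 2 * (n / 64)) ≤ y * X * v.re := by gcongr; linarith
      linarith [happ.2]
    calc r * y * r ^ 2 = y * r ^ 3 := by ring
      _ ≤ y * (n + n / 64) ^ 3 := by gcongr
      _ ≤ 2 * (63 / 64) * (y * n ^ 2 * (n * (61 / 64))) := by
          have : 0 < y * n ^ 3 := by positivity
          nlinarith
      _ ≤ 2 * (63 / 64) * (y * X ^ 2 * (n * (61 / 64))) := by gcongr
      _ = 2 * (X - X / 64) * (y * X * (n * (61 / 64))) := by ring
      _ ≤ 2 * a * b := by gcongr; linarith [hFXre.1]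

/-! ### The low-frequency regime: one zero in the half strip and its residue -/

theorem greenIntegrand_neg_conj {k : ℂ → ℂ}
    (hk : ∀ z, k (-(starRingEnd ℂ) z) = (starRingEnd ℂ) (k z)) (r τ : ℝ) (w : ℂ) :
    greenIntegrand k 0 r τ (-(starRingEnd ℂ) w) =
      (starRingEnd ℂ) (greenIntegrand k 0 r τ w) := by
  simp only [greenIntegrand, Complex.sinh_neg, Complex.cosh_neg, Complex.sinh_conj,
    Complex.cosh_conj, hk, map_mul, map_div₀, map_add, map_pow, Complex.conj_ofReal,
    ← Complex.exp_conj, Complex.conj_I, mul_neg, neg_mul]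

theorem integral_eq_two_re {f : ℝ → ℂ} (hi : Integrable f)
    (hf : ∀ u, f (-u) = (starRingEnd ℂ) (f u)) :
    ∫ u, f u = ((2 * (∫ u in Ioi (0 : ℝ), f u).re : ℝ) : ℂ) := by
  have h1 := integral_comp_neg_Ioi (0 : ℝ) f
  rw [neg_zero] at h1
  simp only [hf] at h1
  rw [integral_conj] at h1
  rw [← intervalIntegral.integral_Iic_add_Ioi (b := 0) hi.integrableOn hi.integrableOn, ← h1,
    add_comm, Complex.add_conj]

/-- The frequency of the oscillating part. -/
noncomputable def branchFreq (V : ℂ → ℂ) (s : ℂ) : ℂ := s / V s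

/-- The amplitude of the oscillating part. -/
noncomputable def branchAmp (V : ℂ → ℂ) (s : ℂ) : ℂ := s ^ 2 * deriv V s / V s ^ 2

namespace Dispersion
variable {k : ℂ → ℂ} {κ d A : ℝ} {m₀ : ℝ → ℝ} (D : Dispersion k κ d A m₀)
include D

theorem sin_pos {α : ℝ} (hα0 : 0 < α) (hα : α ≤ κ / 4) : 0 < Real.sin α :=
  Real.sin_pos_of_pos_of_lt_pi hα0 (by linarith [D.le_one, Real.pi_gt_three])

/-- On the contour z = sinh w stays away from the real directions. Where |z| ≥ R, k is close to
−z⁻², and s² − z⁻² cannot be small because s² is close to the positive axis while 1/z is outside a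
double sector. Where |z| < R, |k| is bounded below and |s|² is smaller. -/
theorem exists_contour_lower_bound {α c : ℝ} (hα0 : 0 < α) (hα : α ≤ κ / 4) (hc : 0 < c)
    (hk : ∀ w : ℂ, 0 ≤ w.im → w.im ≤ α → c * Real.exp (-2 * |w.re|) ≤ ‖k (Complex.sinh w)‖) :
    ∃ ρ₁ > 0, ∃ c₁ > 0, ∀ s ∈ cone (Real.sin α ^ 2 / 8) ρ₁, ∀ u : ℝ,
      c₁ * (‖s‖ ^ 2 + Real.exp (-2 * |u|)) ≤ ‖s ^ 2 + k (Complex.sinh (u + α * Complex.I))‖ := by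
  have hσ := D.sin_pos hα0 hα
  have hσ1 := Real.sin_le_one α
  set σ := Real.sin α with hσd
  obtain ⟨R, hR1, hR⟩ := D.exists_leading_small (ε := σ ^ 2 / 16) (by positivity)
  set c₂ := c / (4 * (1 + R) ^ 2) with hc₂
  have hc₂0 : 0 < c₂ := by positivity
  refine ⟨min (1 / 2) (c₂ / 8), by positivity, min (σ ^ 2 / 16) (c₂ / 4), by positivity,
    fun s hs u => ?_⟩
  set w : ℂ := u + α * Complex.I with hw
  obtain ⟨hwre, hwim⟩ := line_re_im u α
  rw [← hw] at hwre hwim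
  set z := Complex.sinh w with hz
  have hzl : σ * Real.cosh u ≤ z.im := (sin_mul_cosh_line u α).le
  have hzu : ‖z‖ ≤ Real.cosh u := by have := norm_sinh_le w; rwa [hwre] at this
  have hcosh := Real.cosh_pos u
  have hzim : 0 < z.im := (mul_pos hσ hcosh).trans_le hzl
  have hz0 : 0 < ‖z‖ := hzim.trans_le ((le_abs_self _).trans (Complex.abs_im_le_norm z))
  have hzne : z ≠ 0 := norm_pos_iff.1 hz0
  have hmem : z ∈ lowerRegion κ := D.sinh_mem (by rw [hwim]; exact hα0.le) (by rw [hwim]; exact hα)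
  have hσ2 : σ ^ 2 ≤ 1 := by nlinarith
  have hsn := norm_le_of_mem_cone (by linarith) hs
  have hs2 : ‖s‖ < 1 ∧ ‖s‖ ≤ c₂ / 4 := by
    have h1 := hs.2.2.trans_le (min_le_left _ _)
    have h2 := hs.2.2.trans_le (min_le_right _ _)
    constructor <;> linarith
  rcases le_or_gt R ‖z‖ with h | h
  · have h1 := hR z hmem h
    have h2 := norm_sub_sq_ge (z := z⁻¹) (ζ := s ^ 2) hσ hσ1 ?_ (abs_im_sq_le hσ hσ1 hs)
    · have h3 : ‖k z + z⁻¹ ^ 2‖ ≤ σ ^ 2 / 16 * ‖z⁻¹‖ ^ 2 := by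
        have e : k z + z⁻¹ ^ 2 = z⁻¹ ^ 2 * (z ^ 2 * k z + 1) := by field_simp
        rw [e, norm_mul, norm_pow, mul_comm]
        gcongr
      have h4 := norm_sub_norm_le (s ^ 2 - z⁻¹ ^ 2) (-(k z + z⁻¹ ^ 2))
      rw [norm_neg, sub_neg_eq_add, sub_add_add_cancel] at h4
      have h5 : Real.exp (-2 * |u|) ≤ ‖z⁻¹‖ ^ 2 := by
        rw [norm_inv, inv_pow, neg_mul, Real.exp_neg]
        gcongr
        calc ‖z‖ ^ 2 ≤ Real.exp |u| ^ 2 := by gcongr; exact hzu.trans (cosh_le_exp_abs u)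
          _ = _ := by rw [← Real.exp_nat_mul]; push_cast; rfl
      rw [norm_pow] at h2
      calc _ ≤ σ ^ 2 / 16 * (‖s‖ ^ 2 + ‖z⁻¹‖ ^ 2) := by gcongr; exact min_le_left _ _
        _ ≤ _ := by nlinarith [sq_nonneg ‖s‖, sq_nonneg σ, mul_nonneg (sq_nonneg σ) (sq_nonneg ‖s‖)]
    · rw [Complex.inv_im, norm_inv, abs_div, abs_neg, abs_of_pos hzim,
        abs_of_nonneg (Complex.normSq_nonneg z), Complex.normSq_eq_norm_sq, le_div_iff₀ (by positivity)]
      calc σ * ‖z‖⁻¹ * ‖z‖ ^ 2 = σ * ‖z‖ := by field_simp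
        _ ≤ σ * Real.cosh u := by gcongr
        _ ≤ z.im := hzl
  · have h1 := hk w (by rw [hwim]; exact hα0.le) hwim.le
    rw [hwre] at h1
    have h2 : Real.exp |u| ≤ 2 * (1 + R) := by
      have h3 := cosh_le_one_add_norm_sinh w
      rw [hwre] at h3
      linarith [exp_abs_le_cosh u]
    have h3 : c₂ ≤ c * Real.exp (-2 * |u|) := by
      rw [hc₂, neg_mul, Real.exp_neg, ← div_eq_mul_inv]
      gcongr
      calc Real.exp (2 * |u|) = Real.exp |u| ^ 2 := by rw [← Real.exp_nat_mul]; push_cast; rfl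
        _ ≤ (2 * (1 + R)) ^ 2 := by gcongr
        _ = _ := by ring
    have h4 := norm_sub_norm_le (k z) (-(s ^ 2))
    rw [sub_neg_eq_add, norm_neg, norm_pow, add_comm (k z)] at h4
    have h5 : ‖s‖ ^ 2 ≤ ‖s‖ := by nlinarith [norm_nonneg s, hs2.1]
    have h6 : Real.exp (-2 * |u|) ≤ 1 := Real.exp_le_one_iff.2 (by linarith [abs_nonneg u])
    calc _ ≤ c₂ / 4 * (1 + 1) := by
          gcongr
          · exact min_le_right _ _
          · linarith [hs2.1]
      _ ≤ _ := by linarith [hs2.2]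

/-- For small `r` the only zero of `r² + k (sinh w)` in the right half of a thin strip is the one
given by the branch. -/
theorem exists_low_strip {δ ρ : ℝ} {F V : ℂ → ℂ} (Br : Branch k κ δ ρ F V) :
    ∃ α > 0, α ≤ κ / 4 ∧ (∃ c > 0, ∀ w : ℂ, 0 ≤ w.im → w.im ≤ α →
        c * Real.exp (-2 * |w.re|) ≤ ‖k (Complex.sinh w)‖) ∧
      ∃ ρ₁ > 0, ρ₁ ≤ ρ / 2 ∧ ∀ r ∈ Ioo 0 ρ₁, ∃ c : ℂ, Complex.sinh c = (V r)⁻¹ ∧ 0 < c.re ∧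
        0 < c.im ∧ c.im < α ∧ ∀ w : ℂ, 0 ≤ w.re → 0 ≤ w.im → w.im ≤ α →
          (r : ℂ) ^ 2 + k (Complex.sinh w) = 0 → w = c := by
  obtain ⟨α₀, hα₀, hα₀κ, c₀, hc₀, hk⟩ := D.exists_strip_low
  have hδ := Br.pos
  have hδ1 := Br.le_one
  have hκ1 := D.le_one
  have hpi := Real.pi_gt_three
  set α := min α₀ (δ / 16) with hα
  have hα0 : 0 < α := by positivity
  have hα1 : α ≤ α₀ := min_le_left _ _
  have hα2 : α ≤ δ / 16 := min_le_right _ _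
  have hk' : ∀ w : ℂ, 0 ≤ w.im → w.im ≤ α → c₀ * Real.exp (-2 * |w.re|) ≤ ‖k (Complex.sinh w)‖ :=
    fun w h0 h1 => hk w h0 (h1.trans hα1)
  obtain ⟨ρ', hρ', hsmall⟩ := Br.small (α / 8) (by positivity)
  -- The entry √c₀/4 forces e^{Re w} > 4 at a zero, and √c₀ρ/8 places 1/sinh w inside the truncated
  -- sector. The entry ρ'/2 matches |V(r)| ≤ 2r.
  set ρ₁ := min (min (ρ / 2) (ρ' / 2)) (min (Real.sqrt c₀ / 4) (Real.sqrt c₀ * ρ / 8)) with hρ₁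
  have hρ := Br.rho_pos
  have hsc : 0 < Real.sqrt c₀ := Real.sqrt_pos.2 hc₀
  have hle1 : ρ₁ ≤ ρ / 2 := (min_le_left _ _).trans (min_le_left _ _)
  refine ⟨α, hα0, hα1.trans hα₀κ, ⟨c₀, hc₀, hk'⟩, ρ₁, by positivity, hle1, fun r hr => ?_⟩
  have hr0 := hr.1
  have hrS : (r : ℂ) ∈ cone (δ / 8) (ρ / 2) :=
    ofReal_mem_cone (by positivity) ⟨hr0, hr.2.trans_le hle1⟩
  have hV := Br.mem _ hrS
  have hVF := Br.right_inv _ hrS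
  obtain ⟨him, hre, -⟩ := Br.im_div_mem D ⟨hr0, hr.2.trans_le hle1⟩
  have e : (r : ℂ) / V r = r * (V r)⁻¹ := div_eq_mul_inv _ _
  rw [e, Complex.im_ofReal_mul] at him
  rw [e, Complex.re_ofReal_mul] at hre
  have him' := pos_of_mul_pos_right him hr0.le
  have hre' := pos_of_mul_pos_right hre hr0.le
  obtain ⟨c, hc, hcre, hcim, hcpi⟩ := exists_sinh_eq hre' him'
  have hVn : 0 < ‖V r‖ := norm_pos_of_mem_cone hV
  -- Otherwise 1/V(r), and with it V(r), would make an angle comparable to α with the real axis,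
  -- although |r − V(r)| ≤ (α/8)|V(r)| with r real.
  have hcα : c.im < α := by
    by_contra hge
    have hVre : (V r).re < ρ' := by
      have h1 := Br.norm_inv_le hrS
      rw [Complex.norm_real, Real.norm_of_nonneg hr0.le] at h1
      have h2 := hr.2.trans_le ((min_le_left _ _).trans (min_le_right _ _))
      exact (Complex.re_le_norm _).trans_lt (by linarith)
    have h1 := hsmall _ hV hVre
    rw [hVF] at h1
    have h2 := (Complex.abs_im_le_norm _).trans h1
    rw [Complex.sub_im, Complex.ofReal_im, zero_sub, abs_neg] at h2
    have h3 := norm_le_of_mem_cone hδ1 hV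
    have h4 : |(V r).im| ≤ α / 4 * (V r).re := by nlinarith
    have h5 := abs_im_inv_le h4
    rw [← hc, sinh_im, sinh_re, abs_mul, abs_of_pos (Real.cosh_pos _)] at h5
    have h6 : Real.sinh c.re * Real.cos c.im ≤ Real.cosh c.re * 1 := by
      exact mul_le_mul (Real.sinh_lt_cosh c.re).le (Real.cos_le_one _)
        (Real.cos_nonneg_of_neg_pi_div_two_le_of_le (by linarith) hcpi.le) (Real.cosh_pos _).le
    have h7 : Real.sin c.im ≤ α / 4 := by
      have h8 : Real.cosh c.re * |Real.sin c.im| ≤ Real.cosh c.re * (α / 4) := by nlinarith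
      exact (le_abs_self _).trans (le_of_mul_le_mul_left h8 (Real.cosh_pos _))
    have h8 := Real.mul_le_sin hcim.le hcpi.le
    have h9 : 1 / 2 ≤ 2 / Real.pi := by
      rw [div_le_div_iff₀ two_pos Real.pi_pos]; linarith [Real.pi_lt_four]
    nlinarith
  refine ⟨c, hc, hcre, hcim, hcα, fun w hw0 hw1 hw2 hzero => ?_⟩
  have hkr : ‖k (Complex.sinh w)‖ = r ^ 2 := by
    rw [eq_neg_of_add_eq_zero_right hzero, norm_neg, norm_pow, Complex.norm_real,
      Real.norm_of_nonneg hr0.le]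
  have h1 := hk' w hw1 hw2
  rw [hkr, abs_of_nonneg hw0] at h1
  -- At a zero |k(sinh w)| = r², so the lower bound for k pushes every zero out to large Re w. There
  -- 1/sinh w belongs to the sector on which F is injective.
  have hexp : Real.sqrt c₀ * Real.exp (-w.re) ≤ r := by
    refine abs_le_of_sq_le_sq' ?_ hr0.le |>.2
    rw [mul_pow, Real.sq_sqrt hc₀.le, ← Real.exp_nat_mul]
    refine le_trans (le_of_eq ?_) h1
    push_cast; ring_nf
  have hexp4 : 4 < Real.exp w.re := by
    have h2 := hr.2.trans_le ((min_le_right _ _).trans (min_le_left _ _))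
    rw [Real.exp_neg, ← div_eq_mul_inv, div_le_iff₀ (Real.exp_pos _)] at hexp
    by_contra h3
    have h4 : r * Real.exp w.re ≤ r * 4 := by gcongr; linarith
    linarith
  have hexpneg : Real.exp (-w.re) ≤ 1 / 4 := by
    rw [Real.exp_neg, ← one_div]; exact one_div_le_one_div_of_le (by norm_num) hexp4.le
  have hsinh : Real.exp w.re / 4 ≤ Real.sinh w.re := by rw [Real.sinh_eq]; linarith
  have hcs : Real.cosh w.re ≤ 2 * Real.sinh w.re := by rw [Real.sinh_eq, Real.cosh_eq]; linarith
  have hsinh0 : 0 < Real.sinh w.re := lt_of_lt_of_le (by positivity) hsinh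
  have hcos : 1 / 2 ≤ Real.cos w.im := by
    have := Real.one_sub_sq_div_two_le_cos (x := w.im)
    nlinarith
  have hsin0 : 0 ≤ Real.sin w.im := Real.sin_nonneg_of_nonneg_of_le_pi hw1 (by linarith)
  have hzre : 0 < (Complex.sinh w).re := by rw [sinh_re]; positivity
  have hratio : |(Complex.sinh w).im| ≤ δ / 4 * (Complex.sinh w).re := by
    rw [sinh_im, sinh_re, abs_of_nonneg (by positivity [Real.cosh_pos w.re])]
    have h2 : Real.sin w.im ≤ δ / 16 := (Real.sin_le hw1).trans (hw2.trans hα2)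
    calc Real.cosh w.re * Real.sin w.im ≤ 2 * Real.sinh w.re * (δ / 16) := by gcongr
      _ = δ / 4 * (Real.sinh w.re * (1 / 2)) := by ring
      _ ≤ _ := by gcongr
  have hzne : Complex.sinh w ≠ 0 := fun h => by rw [h] at hzre; simp at hzre
  have hvcone : (Complex.sinh w)⁻¹ ∈ cone δ ρ := by
    have hpos : 0 < ((Complex.sinh w)⁻¹).re := by
      rw [Complex.inv_re]; exact div_pos hzre (Complex.normSq_pos.2 hzne)
    refine ⟨hpos, (abs_im_inv_le hratio).trans_lt (by gcongr; linarith), ?_⟩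
    refine (Complex.re_le_norm _).trans_lt ?_
    rw [norm_inv]
    have h2 : Real.exp w.re / 4 ≤ ‖Complex.sinh w‖ :=
      hsinh.trans ((le_abs_self _).trans (abs_sinh_le_norm_sinh w))
    have h3 := hr.2.trans_le ((min_le_right _ _).trans (min_le_right _ _))
    calc ‖Complex.sinh w‖⁻¹ ≤ (Real.exp w.re / 4)⁻¹ := by gcongr
      _ = 4 * Real.exp (-w.re) := by rw [Real.exp_neg]; field_simp
      _ < ρ := by nlinarith
  have hF2 := Br.sq _ hvcone
  rw [inv_inv, eq_neg_of_add_eq_zero_right hzero, neg_neg] at hF2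
  have hFr : F (Complex.sinh w)⁻¹ = r := by
    rcases sq_eq_sq_iff_eq_or_eq_neg.1 hF2 with h2 | h2
    · exact h2
    · have := Br.re_pos hvcone
      rw [h2, Complex.neg_re, Complex.ofReal_re] at this
      linarith
  have hinj := Br.injOn hvcone hV (hFr.trans hVF.symm)
  refine sinh_injOn_strip ?_ ?_ ?_
  · rw [abs_of_nonneg hw1]; linarith
  · rw [abs_of_pos hcim]; exact hcpi
  · rw [hc, ← hinj, inv_inv]

theorem sinh_line_mem {α : ℝ} (hα0 : 0 < α) (hα : α ≤ κ / 4) (u : ℝ) :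
    Complex.sinh (u + α * Complex.I) ∈ lowerRegion κ :=
  D.sinh_mem (by simpa using hα0.le) (by simpa using hα)

theorem norm_quotient_line_le {α c₁ : ℝ} (hα0 : 0 < α) (hα : α ≤ κ / 4) (hc₁ : 0 < c₁) {s : ℂ}
    (hs : s ≠ 0) {u : ℝ} (h : c₁ * (‖s‖ ^ 2 + Real.exp (-2 * |u|)) ≤
      ‖s ^ 2 + k (Complex.sinh (u + α * Complex.I))‖) :
    s ^ 2 + k (Complex.sinh (u + α * Complex.I)) ≠ 0 ∧
      ‖k (Complex.sinh (u + α * Complex.I)) / (s ^ 2 + k (Complex.sinh (u + α * Complex.I)))‖ ≤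
        4 * A / (c₁ * ‖s‖ ^ 2) * Real.exp (-2 * |u|) := by
  have hs0 : 0 < ‖s‖ := norm_pos_iff.2 hs
  have hA := D.nonneg
  have he := Real.exp_pos (-2 * |u|)
  have h2 : c₁ * ‖s‖ ^ 2 ≤ ‖s ^ 2 + k (Complex.sinh (u + α * Complex.I))‖ :=
    le_trans (by gcongr; linarith) h
  refine ⟨norm_pos_iff.1 (lt_of_lt_of_le (by positivity) h2), ?_⟩
  rw [norm_div]
  have h3 := D.norm_comp_sinh_le (D.sinh_line_mem hα0 hα u)
  rw [(line_re_im u α).1] at h3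
  calc _ ≤ 4 * A * Real.exp (-2 * |u|) / (c₁ * ‖s‖ ^ 2) := by gcongr
    _ = _ := by ring

end Dispersion

/-- Differentiation of k(1/V(s)) = −s². It shows that the zero is simple and determines the residue.
-/
theorem Branch.deriv_k {k : ℂ → ℂ} {κ d A δ ρ : ℝ} {m₀ : ℝ → ℝ} {F V : ℂ → ℂ}
    (Br : Branch k κ δ ρ F V) (D : Dispersion k κ d A m₀) {s : ℂ}
    (hs : s ∈ cone (δ / 8) (ρ / 2)) :
    deriv V s ≠ 0 ∧ deriv k (V s)⁻¹ * deriv V s = 2 * s * V s ^ 2 := by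
  have hV := Br.mem s hs
  have hV0 : V s ≠ 0 := norm_pos_iff.1 (norm_pos_of_mem_cone hV)
  have hVd : HasDerivAt V (deriv V s) s :=
    (Br.diff_inv.differentiableAt ((isOpen_cone _ _).mem_nhds hs)).hasDerivAt
  have hkd : HasDerivAt k (deriv k (V s)⁻¹) (V s)⁻¹ :=
    (D.differentiableAt (inv_mem_lowerRegion D.pos (cone_mono Br.le le_rfl hV))).hasDerivAt
  have h1 : HasDerivAt (fun s => k (V s)⁻¹) (deriv k (V s)⁻¹ * (-deriv V s / V s ^ 2)) s :=
    hkd.comp s (hVd.fun_inv hV0)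
  have h2 : HasDerivAt (fun s : ℂ => -s ^ 2) (-(2 * s)) s := by
    have := (hasDerivAt_pow 2 s).fun_neg
    simpa only [Nat.cast_ofNat, Nat.add_one_sub_one, pow_one] using this
  have h3 : HasDerivAt (fun s => k (V s)⁻¹) (-(2 * s)) s := by
    refine h2.congr_of_eventuallyEq ?_
    filter_upwards [(isOpen_cone _ _).mem_nhds hs] with y hy
    have := Br.sq _ (Br.mem y hy)
    rw [Br.right_inv y hy] at this
    rw [this, neg_neg]
  have h4 := h1.unique h3
  have h5 : deriv k (V s)⁻¹ * deriv V s = 2 * s * V s ^ 2 := by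
    field_simp at h4
    rw [one_div] at h4
    linear_combination -h4
  refine ⟨fun h0 => ?_, h5⟩
  rw [h0, mul_zero] at h5
  have hsne : s ≠ 0 := norm_pos_iff.1 (norm_pos_of_mem_cone hs)
  exact mul_ne_zero (mul_ne_zero two_ne_zero hsne) (pow_ne_zero 2 hV0) h5.symm

theorem norm_exp_real_exponent_le_one {r τ : ℝ} (hr : 0 ≤ r) (hτ : 0 ≤ τ) {w : ℂ}
    (h0 : 0 ≤ w.im) (h1 : w.im ≤ Real.pi) :
    ‖Complex.exp ((r : ℂ) * τ * ((0 : ℝ) + Complex.I * Complex.sinh w))‖ ≤ 1 := by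
  rw [Complex.norm_exp]
  refine Real.exp_le_one_iff.2 ?_
  have e : ((r : ℂ) * τ * ((0 : ℝ) + Complex.I * Complex.sinh w)).re =
      -(r * τ * (Complex.sinh w).im) := by
    rw [← Complex.ofReal_mul, Complex.re_ofReal_mul]; simp
  rw [e, sinh_im]
  have := Real.cosh_pos w.re
  have := Real.sin_nonneg_of_nonneg_of_le_pi h0 h1
  have : 0 ≤ r * τ * (Real.cosh w.re * Real.sin w.im) := by positivity
  linarith

namespace Dispersion
variable {k : ℂ → ℂ} {κ d A : ℝ} {m₀ : ℝ → ℝ} (D : Dispersion k κ d A m₀)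
include D

theorem norm_greenIntegrand_strip_le {r τ B : ℝ} (hr : 0 ≤ r) (hτ : 0 ≤ τ) {w : ℂ}
    (h0 : 0 ≤ w.im) (h1 : w.im ≤ κ / 4)
    (hb : ‖k (Complex.sinh w) / ((r : ℂ) ^ 2 + k (Complex.sinh w))‖ ≤ B * Real.exp (-2 * |w.re|)) :
    ‖greenIntegrand k 0 r τ w‖ ≤ B * Real.exp (-1 * |w.re|) := by
  rw [greenIntegrand, norm_mul, norm_mul]
  calc _ ≤ B * Real.exp (-2 * |w.re|) * 1 * Real.exp |w.re| := by
        have h2 := (norm_nonneg _).trans hb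
        gcongr
        · exact norm_exp_real_exponent_le_one hr hτ h0 (by linarith [D.le_one, Real.pi_gt_three])
        · exact (norm_cosh_le w).trans (cosh_le_exp_abs _)
    _ = B * (Real.exp (-2 * |w.re|) * Real.exp |w.re|) := by ring
    _ = _ := by rw [← Real.exp_add]; ring_nf

theorem integrable_greenIntegrand_real {r τ : ℝ} (hr : 0 < r) (hτ : 0 ≤ τ) :
    Integrable fun u : ℝ => greenIntegrand k 0 r τ u := by
  obtain ⟨ε, hε, -, c, hc, h⟩ := D.exists_strip_high (1 / r ^ 2)
  have hA := D.nonneg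
  have hκ := D.pos
  have hrc : (r : ℂ) ≠ 0 := by exact_mod_cast hr.ne'
  have hlow : ∀ u : ℝ, c * r ^ 2 ≤ ‖(r : ℂ) ^ 2 + k (Complex.sinh u)‖ := fun u => by
    have h1 := h ((1 / r ^ 2 : ℝ) : ℂ) u ⟨1 / r ^ 2, ⟨by positivity, le_rfl⟩, by simpa using hε⟩
      (by simp) (by simpa using hε.le)
    have e : (r : ℂ) ^ 2 + k (Complex.sinh u) =
        ((r ^ 2 : ℝ) : ℂ) * (1 + ((1 / r ^ 2 : ℝ) : ℂ) * k (Complex.sinh u)) := by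
      push_cast; field_simp
    rw [e, norm_mul, Complex.norm_real, Real.norm_of_nonneg (by positivity), mul_comm]
    gcongr
  have hne : ∀ u : ℝ, (r : ℂ) ^ 2 + k (Complex.sinh u) ≠ 0 := fun u =>
    norm_pos_iff.1 (lt_of_lt_of_le (by positivity) (hlow u))
  have := integrable_line (f := greenIntegrand k 0 r τ) (C := 4 * A / (c * r ^ 2)) (y := 0) one_pos
    (fun u => D.differentiableAt_greenIntegrand 0 (by simp) (by simp; positivity)
      (by simpa using hne u)) fun u => by
    have h2 := D.norm_greenIntegrand_strip_le (B := 4 * A / (c * r ^ 2)) hr.le hτ (w := u) (by simp)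
      (by simp; positivity) ?_
    · simpa using h2
    · rw [norm_div]
      calc _ ≤ 4 * A * Real.exp (-2 * |(u : ℂ).re|) / (c * r ^ 2) := by
            gcongr
            · exact D.norm_comp_sinh_le (D.sinh_mem (by simp) (by simp; positivity))
            · exact hlow u
        _ = _ := by ring
  simpa using this

/-- Decay of the integrand in a strip, far away from the imaginary axis. -/
theorem exists_norm_greenIntegrand_le {r τ : ℝ} (hr : 0 < r) (hτ : 0 ≤ τ) : ∃ B U : ℝ,
    ∀ w : ℂ, 0 ≤ w.im → w.im ≤ κ / 4 → U ≤ |w.re| →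
      ‖greenIntegrand k 0 r τ w‖ ≤ B * Real.exp (-1 * |w.re|) := by
  have hA := D.nonneg
  -- The threshold makes |k| at most r²/2, so that the denominator is at least r²/2; the constant is
  -- then 4A divided by r²/2.
  refine ⟨8 * A / r ^ 2, 8 * A / r ^ 2, fun w h0 h1 hU => ?_⟩
  refine D.norm_greenIntegrand_strip_le hr.le hτ h0 h1 ?_
  have h2 := D.norm_comp_sinh_le (D.sinh_mem h0 h1)
  have h3 : 4 * A * Real.exp (-2 * |w.re|) ≤ r ^ 2 / 2 := by
    have h4 := Real.add_one_le_exp (2 * |w.re|)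
    rw [neg_mul, Real.exp_neg, ← div_eq_mul_inv, div_le_iff₀ (Real.exp_pos _)]
    rw [div_le_iff₀ (by positivity)] at hU
    nlinarith [mul_le_mul_of_nonneg_left h4 (sq_nonneg r)]
  have h4 := norm_sub_norm_le ((r : ℂ) ^ 2) (-k (Complex.sinh w))
  rw [sub_neg_eq_add, norm_neg, norm_pow, Complex.norm_real, Real.norm_of_nonneg hr.le] at h4
  rw [norm_div]
  calc _ ≤ 4 * A * Real.exp (-2 * |w.re|) / (r ^ 2 / 2) := by
        gcongr
        linarith
    _ = _ := by field_simp; ring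

/-- The residue of the integrand at the pole. -/
theorem residue_eq {δ ρ : ℝ} {F V : ℂ → ℂ} (Br : Branch k κ δ ρ F V) {r τ : ℝ}
    (hr : r ∈ Ioo 0 (ρ / 2)) {c : ℂ} (hc : Complex.sinh c = (V r)⁻¹) (h0 : 0 < c.im)
    (h1 : c.im < κ / 4) :
    deriv (fun w => (r : ℂ) ^ 2 + k (Complex.sinh w)) c ≠ 0 ∧
    (r : ℂ) ^ 2 + k (Complex.sinh c) = 0 ∧
    k (Complex.sinh c) * Complex.exp ((r : ℂ) * τ * ((0 : ℝ) + Complex.I * Complex.sinh c)) *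
      Complex.cosh c / deriv (fun w => (r : ℂ) ^ 2 + k (Complex.sinh w)) c =
      -(branchAmp V r * Complex.exp (Complex.I * τ * branchFreq V r) / (2 * r)) := by
  have hrS : (r : ℂ) ∈ cone (δ / 8) (ρ / 2) := ofReal_mem_cone (by linarith [Br.pos]) hr
  obtain ⟨hV', hk'⟩ := Br.deriv_k D hrS
  have hrc : (r : ℂ) ≠ 0 := by exact_mod_cast hr.1.ne'
  have hV0 : V r ≠ 0 := norm_pos_iff.1 (norm_pos_of_mem_cone (Br.mem _ hrS))
  have hkc : k (Complex.sinh c) = -(r : ℂ) ^ 2 := by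
    have := Br.sq _ (Br.mem _ hrS)
    rw [Br.right_inv _ hrS] at this
    rw [hc, this, neg_neg]
  have hcosh : Complex.cosh c ≠ 0 := cosh_ne_zero (by
    rw [abs_of_pos h0]; linarith [D.le_one, Real.pi_gt_three])
  have hder : deriv (fun w => (r : ℂ) ^ 2 + k (Complex.sinh w)) c =
      deriv k (V r)⁻¹ * Complex.cosh c := by
    have h2 : HasDerivAt k (deriv k (Complex.sinh c)) (Complex.sinh c) :=
      (D.differentiableAt (D.sinh_mem h0.le h1.le)).hasDerivAt
    rw [← hc]
    exact ((h2.comp c (Complex.hasDerivAt_sinh c)).const_add _).deriv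
  have hkn : deriv k (V r)⁻¹ ≠ 0 := fun h => by
    rw [h, zero_mul] at hk'
    exact mul_ne_zero (mul_ne_zero two_ne_zero hrc) (pow_ne_zero 2 hV0) hk'.symm
  refine ⟨by rw [hder]; exact mul_ne_zero hkn hcosh, by rw [hkc]; ring, ?_⟩
  rw [hder, hkc, hc, branchAmp, branchFreq]
  have e : (r : ℂ) * τ * ((0 : ℝ) + Complex.I * (V r)⁻¹) = Complex.I * τ * (r / V r) := by
    push_cast; ring
  rw [e, mul_div_mul_right _ _ hcosh]
  set X := Complex.exp (Complex.I * τ * (r / V r))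
  rw [div_eq_iff hkn]
  generalize deriv k (V r)⁻¹ = K at *
  field_simp
  linear_combination X * hk'

/-- The residue theorem is applied in the right half strip only. The integrand satisfies g(−w̄) =
conj g(w), so the integral over each full line is twice the real part of that over a half line. On
the imaginary segment g is real, and its contribution, multiplied by i, has no real part. The real
part of a single residue therefore accounts for both mirror-image zeros. -/
theorem low_frequency_eq {δ ρ α c₁ : ℝ} {F V : ℂ → ℂ} (Br : Branch k κ δ ρ F V) (hα0 : 0 < α)
    (hα : α ≤ κ / 4) {r τ : ℝ} (hr : r ∈ Ioo 0 (ρ / 2)) (hτ : 0 ≤ τ) (hc₁ : 0 < c₁)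
    (hline : ∀ u : ℝ, c₁ * (‖(r : ℂ)‖ ^ 2 + Real.exp (-2 * |u|)) ≤
      ‖(r : ℂ) ^ 2 + k (Complex.sinh (u + α * Complex.I))‖)
    {c : ℂ} (hc : Complex.sinh c = (V r)⁻¹) (hcre : 0 < c.re) (hcim : 0 < c.im) (hcα : c.im < α)
    (huniq : ∀ w : ℂ, 0 ≤ w.re → 0 ≤ w.im → w.im ≤ α →
      (r : ℂ) ^ 2 + k (Complex.sinh w) = 0 → w = c) :
    -((r : ℂ) / (2 * Real.pi)) * ∫ u : ℝ, greenIntegrand k 0 r τ u =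
      (((Complex.I * branchAmp V r *
        Complex.exp (Complex.I * τ * branchFreq V r)).re : ℝ) : ℂ) + contourPart k 0 α r τ := by
  have hr0 := hr.1
  have hrc : (r : ℂ) ≠ 0 := by exact_mod_cast hr0.ne'
  set g := greenIntegrand k 0 r τ with hg
  obtain ⟨hres1, hres2, hres3⟩ := D.residue_eq Br (τ := τ) hr hc hcim (hcα.trans_le hα)
  set Q := -(branchAmp V r * Complex.exp (Complex.I * τ * branchFreq V r) / (2 * r)) with hQ
  have hsymm := greenIntegrand_neg_conj D.symm r τ
  have hi0 := D.integrable_greenIntegrand_real hr0 hτ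
  have hq := fun u : ℝ => D.norm_quotient_line_le hα0 hα hc₁ hrc (hline u)
  have hiα : Integrable fun u : ℝ => g (u + α * Complex.I) :=
    integrable_line (C := 4 * A / (c₁ * ‖(r : ℂ)‖ ^ 2)) one_pos
      (fun u => D.differentiableAt_greenIntegrand 0 (by simpa using hα0.le) (by simpa using hα)
        (hq u).1) fun u => by
        have h2 := D.norm_greenIntegrand_strip_le (B := 4 * A / (c₁ * ‖(r : ℂ)‖ ^ 2)) hr0.le hτ
          (w := u + α * Complex.I) (by simpa using hα0.le) (by simpa using hα)
          (by rw [(line_re_im u α).1]; exact (hq u).2)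
        rwa [(line_re_im u α).1] at h2
  have hrect : ∀ U : ℝ, c.re < U →
      (∫ x in (0 : ℝ)..U, g x) - (∫ x in (0 : ℝ)..U, g (x + α * Complex.I)) +
      Complex.I * (∫ y in (0 : ℝ)..α, g (U + y * Complex.I)) -
      Complex.I * (∫ y in (0 : ℝ)..α, g (y * Complex.I)) = 2 * Real.pi * Complex.I * Q := by
    intro U hU
    set W : Set ℂ := {w | Complex.sinh w ∈ lowerRegion κ} with hW
    have hWo : IsOpen W := (isOpen_lowerRegion κ).preimage Complex.continuous_sinh
    have hkW : DifferentiableOn ℂ (fun w => k (Complex.sinh w)) W := fun w hw =>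
      ((D.differentiableAt hw).comp w
        Complex.differentiable_sinh.differentiableAt).differentiableWithinAt
    have hN : DifferentiableOn ℂ (fun w => k (Complex.sinh w) *
        Complex.exp ((r : ℂ) * τ * ((0 : ℝ) + Complex.I * Complex.sinh w)) * Complex.cosh w) W := by
      refine (hkW.mul ?_).mul Complex.differentiable_cosh.differentiableOn
      exact (((Complex.differentiable_sinh.const_mul _).const_add _).const_mul _).cexp.differentiableOn
    have := integral_boundary_rect_div hWo (x₁ := 0) (x₂ := U) (y₁ := 0) (y₂ := α) hcre hU hcim hcα
      (fun w _ _ h3 h4 => D.sinh_mem h3 (h4.trans hα)) hN (hkW.const_add ((r : ℂ) ^ 2)) hres2 hres1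
      (fun w h1 _ h3 h4 h5 => huniq w h1 h3 h4 h5)
    rw [hres3] at this
    rw [← this]
    have e : ∀ w, k (Complex.sinh w) *
        Complex.exp ((r : ℂ) * τ * ((0 : ℝ) + Complex.I * Complex.sinh w)) * Complex.cosh w /
        ((r : ℂ) ^ 2 + k (Complex.sinh w)) = g w := fun w => by
      simp only [hg, greenIntegrand]; ring
    simp only [e]
    simp only [Complex.ofReal_zero, zero_mul, add_zero, zero_add]
  have hvert : (Complex.I * (∫ y in (0 : ℝ)..α, g (y * Complex.I))).re = 0 := by
    have h1 : ∀ y : ℝ, g (y * Complex.I) = (((g (y * Complex.I)).re : ℝ) : ℂ) := fun y => by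
      have h2 := hsymm (y * Complex.I)
      have h3 : -(starRingEnd ℂ) (y * Complex.I) = y * Complex.I := by simp
      rw [h3] at h2
      exact (Complex.conj_eq_iff_re.1 h2.symm).symm
    have h2 : ∫ y in (0 : ℝ)..α, g (y * Complex.I) =
        ((∫ y in (0 : ℝ)..α, (g (y * Complex.I)).re : ℝ) : ℂ) := by
      rw [← intervalIntegral.integral_ofReal]
      exact intervalIntegral.integral_congr fun y _ => h1 y
    rw [h2, Complex.I_mul_re, Complex.ofReal_im, neg_zero]
  have hright : Tendsto (fun U : ℝ => ∫ y in (0 : ℝ)..α, g (U + y * Complex.I)) atTop (𝓝 0) := by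
    obtain ⟨B, U₀, hB⟩ := D.exists_norm_greenIntegrand_le hr0 hτ
    have hlim : Tendsto (fun U : ℝ => B * Real.exp (-1 * U) * α) atTop (𝓝 0) := by
      have h1 : Tendsto (fun U : ℝ => Real.exp (-1 * U)) atTop (𝓝 0) :=
        Real.tendsto_exp_atBot.comp (tendsto_id.const_mul_atTop_of_neg (by norm_num))
      simpa using (h1.const_mul B).mul_const α
    refine squeeze_zero_norm' ?_ hlim
    filter_upwards [eventually_ge_atTop 0, eventually_ge_atTop U₀] with U hU hU₀
    have := intervalIntegral.norm_integral_le_of_norm_le_const (a := 0) (b := α)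
      (f := fun y : ℝ => g (U + y * Complex.I)) (C := B * Real.exp (-1 * U)) fun y hy => by
        rw [uIoc_of_le hα0.le] at hy
        have h2 := hB (U + y * Complex.I) (by simpa using hy.1.le) (by simpa using hy.2.trans hα)
          (by rw [(line_re_im U y).1, abs_of_nonneg hU]; exact hU₀)
        rwa [(line_re_im U y).1, abs_of_nonneg hU] at h2
    rwa [sub_zero, abs_of_pos hα0] at this
  have ht0 := intervalIntegral_tendsto_integral_Ioi 0 hi0.integrableOn tendsto_id
  have htα := intervalIntegral_tendsto_integral_Ioi 0 hiα.integrableOn tendsto_id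
  have hlim := (((ht0.sub htα).add (hright.const_mul Complex.I)).sub_const
    (Complex.I * (∫ y in (0 : ℝ)..α, g (y * Complex.I))))
  have hconst : (∫ u in Ioi (0 : ℝ), g u) - (∫ u in Ioi (0 : ℝ), g (u + α * Complex.I)) +
      Complex.I * 0 - Complex.I * (∫ y in (0 : ℝ)..α, g (y * Complex.I)) =
      2 * Real.pi * Complex.I * Q := by
    refine tendsto_nhds_unique hlim (tendsto_const_nhds.congr' ?_)
    filter_upwards [eventually_gt_atTop c.re] with U hU
    exact (hrect U hU).symm
  have hRe := congrArg Complex.re hconst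
  simp only [Complex.sub_re, mul_zero, add_zero, hvert,
    sub_zero] at hRe
  have h0 : ∫ u : ℝ, g u = _ := integral_eq_two_re hi0 fun u => by
    have := hsymm u
    rwa [Complex.conj_ofReal, ← Complex.ofReal_neg] at this
  have hα' : ∫ u : ℝ, g (u + α * Complex.I) = _ := integral_eq_two_re hiα fun u => by
    refine Eq.trans (congrArg g ?_) (hsymm (u + α * Complex.I))
    simp only [map_add, map_mul, Complex.conj_ofReal, Complex.conj_I]
    push_cast
    ring
  have hQ2 : (2 * Real.pi * Complex.I * Q).re = -(Real.pi / r *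
      (Complex.I * branchAmp V r * Complex.exp (Complex.I * τ * branchFreq V r)).re) := by
    rw [← Complex.re_ofReal_mul, ← Complex.neg_re, hQ]
    congr 1
    push_cast
    field_simp
  rw [contourPart, h0, hα']
  rw [hQ2] at hRe
  have hpi := Real.pi_pos.ne'
  rw [show (∫ u in Ioi (0 : ℝ), g u).re = (∫ u in Ioi (0 : ℝ), g (u + α * Complex.I)).re -
    Real.pi / r * (Complex.I * branchAmp V r *
      Complex.exp (Complex.I * τ * branchFreq V r)).re by linarith]
  push_cast
  have hpic : (Real.pi : ℂ) ≠ 0 := by exact_mod_cast hpi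
  field_simp
  ring

end Dispersion

/-! ### The remainder at low frequency: comparison with the model kernel -/

theorem integrable_exp_neg_abs_sub {η : ℝ} (hη : 0 < η) (L : ℝ) :
    Integrable fun u : ℝ => Real.exp (-η * |u - L|) + Real.exp (-η * |u + L|) :=
  ((integrable_exp_neg_mul_abs hη).comp_sub_right L).add
    ((integrable_exp_neg_mul_abs hη).comp_add_right L)

theorem integral_exp_neg_abs_sub {η : ℝ} (hη : 0 < η) (L : ℝ) :
    ∫ u : ℝ, (Real.exp (-η * |u - L|) + Real.exp (-η * |u + L|)) =
      2 * ∫ u : ℝ, Real.exp (-η * |u|) := by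
  rw [integral_add ((integrable_exp_neg_mul_abs hη).comp_sub_right L)
    ((integrable_exp_neg_mul_abs hη).comp_add_right L),
    integral_sub_right_eq_self (fun u => Real.exp (-η * |u|)),
    integral_add_right_eq_self (fun u => Real.exp (-η * |u|)), two_mul]

theorem exp_neg_abs_abs_sub_le {η : ℝ} (u L : ℝ) : Real.exp (-η * |(|u|) - L|) ≤
    Real.exp (-η * |u - L|) + Real.exp (-η * |u + L|) := by
  rcases abs_cases u with ⟨h, -⟩ | ⟨h, -⟩
  · rw [h]; linarith [Real.exp_pos (-η * |u + L|)]
  · rw [h, show -u - L = -(u + L) by ring, abs_neg]; linarith [Real.exp_pos (-η * |u - L|)]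

/-- The weight `e^{q|u|} / (1 + x² e^{2|u|})²` is concentrated at `|u| = log (1 / x)`. -/
theorem weight_le {q η x : ℝ} (hx : 0 < x) (h0 : η ≤ q) (h1 : η ≤ 4 - q) (u : ℝ) :
    Real.exp (q * |u|) / (1 + x ^ 2 * Real.exp (2 * |u|)) ^ 2 ≤
      x ^ (-q) * Real.exp (-η * |(|u|) - Real.log x⁻¹|) := by
  set v := |u| - Real.log x⁻¹ with hv
  have hxe : x * Real.exp |u| = Real.exp v := by
    rw [hv, Real.exp_sub, Real.exp_log (inv_pos.2 hx)]; field_simp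
  have hy : x ^ 2 * Real.exp (2 * |u|) = Real.exp (2 * v) := by
    have : Real.exp (2 * |u|) = Real.exp |u| ^ 2 := by rw [← Real.exp_nat_mul]; push_cast; rfl
    rw [this, ← mul_pow, hxe, ← Real.exp_nat_mul]; push_cast; rfl
  have hq : Real.exp (q * |u|) = x ^ (-q) * Real.exp (q * v) := by
    rw [Real.rpow_def_of_pos hx, ← Real.exp_add, hv, Real.log_inv]; ring_nf
  rw [hy, hq, mul_div_assoc]
  refine mul_le_mul_of_nonneg_left ?_ (by positivity)
  rw [div_le_iff₀ (by positivity)]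
  have he := Real.exp_pos (2 * v)
  rcases le_total 0 v with h | h
  · rw [abs_of_nonneg h]
    calc Real.exp (q * v) ≤ Real.exp (-η * v + 4 * v) := Real.exp_le_exp.2 (by nlinarith)
      _ = Real.exp (-η * v) * Real.exp (2 * v) ^ 2 := by
          rw [Real.exp_add, ← Real.exp_nat_mul]; push_cast; ring_nf
      _ ≤ _ := by gcongr; linarith
  · rw [abs_of_nonpos h]
    calc Real.exp (q * v) ≤ Real.exp (-η * -v) := Real.exp_le_exp.2 (by nlinarith)
      _ ≤ _ := le_mul_of_one_le_right (Real.exp_pos _).le (by nlinarith)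

theorem weight_log_le {x : ℝ} (hx : 0 < x) (hx1 : x ≤ 1) (u : ℝ) :
    (1 + |u|) * Real.exp |u| / (1 + x ^ 2 * Real.exp (2 * |u|)) ^ 2 ≤
      2 * x⁻¹ * (1 + Real.log x⁻¹) * Real.exp (-(1 / 2) * |(|u|) - Real.log x⁻¹|) := by
  have hL : 0 ≤ Real.log x⁻¹ := Real.log_nonneg (one_le_inv_iff₀.2 ⟨hx, hx1⟩)
  have h1 := weight_le (q := 1) (η := 1) hx le_rfl (by norm_num) u
  set L := Real.log x⁻¹ with hLd
  set v := |(|u|) - L| with hv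
  rw [one_mul, Real.rpow_neg_one] at h1
  -- The linear factor costs log(1/x) and half of the exponential decay away from |u| = log(1/x).
  have h2 : 1 + |u| ≤ 2 * (1 + L) * Real.exp (1 / 2 * v) := by
    have h3 : |u| ≤ L + v := by linarith [le_abs_self (|u| - L)]
    have h4 := Real.add_one_le_exp (1 / 2 * v)
    have h5 : 0 ≤ v := abs_nonneg _
    nlinarith
  rw [mul_div_assoc]
  calc _ ≤ 2 * (1 + L) * Real.exp (1 / 2 * v) * (x⁻¹ * Real.exp (-1 * v)) := by gcongr
    _ = 2 * x⁻¹ * (1 + L) * (Real.exp (1 / 2 * v) * Real.exp (-1 * v)) := by ring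
    _ = _ := by rw [← Real.exp_add]; ring_nf

/-- The integrand of the Green's function for the model kernel `-1 / (z² - c)`. -/
noncomputable def modelIntegrand (c γ : ℝ) (s t w : ℂ) : ℂ :=
  -1 / (s ^ 2 * (Complex.sinh w ^ 2 - c) - 1) *
    Complex.exp (s * t * (γ + Complex.I * Complex.sinh w)) * Complex.cosh w

/-- The defect of `k` with respect to the model kernel `-1 / (z² - c)`. -/
noncomputable def defect (k : ℂ → ℂ) (c : ℝ) (z : ℂ) : ℂ := k z * (z ^ 2 - c) + 1

section model

variable {σ c ρ : ℝ} {s : ℂ}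

/-- The denominator is −s²(ζ − z²) with ζ = c + s⁻². As c ≥ 0, ζ stays close to the positive axis,
whereas z lies outside a double sector about it, so `norm_sub_sq_ge` applies. -/
theorem model_denominator_ge (hσ0 : 0 < σ) (hσ1 : σ ≤ 1) (hc : 0 ≤ c)
    (hs : s ∈ cone (σ ^ 2 / 8) ρ) {z : ℂ} (hz : σ * ‖z‖ ≤ |z.im|) :
    σ ^ 2 / 16 * (1 + ‖s‖ ^ 2 * ‖z‖ ^ 2) ≤ ‖s ^ 2 * (z ^ 2 - c) - 1‖ := by
  have hs0 : s ≠ 0 := norm_pos_iff.1 (norm_pos_of_mem_cone hs)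
  have h1 := abs_im_inv_le (abs_im_sq_le hσ0 hσ1 hs)
  set ζ : ℂ := c + (s ^ 2)⁻¹ with hζ
  have hre : ζ.re = c + ((s ^ 2)⁻¹).re := by simp [hζ]
  have him : ζ.im = ((s ^ 2)⁻¹).im := by simp [hζ]
  have hσ2 : σ ^ 2 ≤ 1 := by nlinarith
  have hre0 : 0 ≤ ((s ^ 2)⁻¹).re := by
    by_contra h
    have := mul_neg_of_pos_of_neg (by positivity : 0 < σ ^ 2 / 2) (not_le.1 h)
    linarith [abs_nonneg ((s ^ 2)⁻¹).im]
  have h2 := norm_sub_sq_ge (ζ := ζ) hσ0 hσ1 hz (by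
    rw [him, hre]; exact h1.trans (by gcongr; linarith))
  have h3 : ‖(s ^ 2)⁻¹‖ / 2 ≤ ‖ζ‖ := by
    have h4 := Complex.norm_le_abs_re_add_abs_im (s ^ 2)⁻¹
    rw [abs_of_nonneg hre0] at h4
    have h5 := Complex.re_le_norm ζ
    rw [hre] at h5
    nlinarith
  have e : s ^ 2 * (z ^ 2 - c) - 1 = -(s ^ 2 * (ζ - z ^ 2)) := by
    rw [hζ]; field_simp; ring
  rw [e, norm_neg, norm_mul, norm_pow]
  have hn : 0 < ‖s‖ := norm_pos_iff.2 hs0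
  rw [norm_inv, norm_pow] at h3
  have h4 : 1 / 2 ≤ ‖s‖ ^ 2 * ‖ζ‖ := by
    rw [div_le_iff₀ two_pos, inv_le_iff_one_le_mul₀ (by positivity)] at h3
    linarith
  have h5 : ‖s‖ ^ 2 * (σ ^ 2 / 8 * (‖ζ‖ + ‖z‖ ^ 2)) ≤ ‖s‖ ^ 2 * ‖ζ - z ^ 2‖ := by gcongr
  refine le_trans ?_ h5
  have h6 : 0 ≤ ‖s‖ ^ 2 * ‖z‖ ^ 2 := by positivity
  nlinarith [mul_le_mul_of_nonneg_left h4 (sq_nonneg σ), mul_nonneg (sq_nonneg σ) h6]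

variable {α γ : ℝ} {t : ℂ}

theorem norm_modelIntegrand_le (hα0 : 0 < α) (hα1 : 0 < Real.sin α) (hc : 0 ≤ c)
    (hs : s ∈ cone (Real.sin α ^ 2 / 8) ρ) (hγ : γ ≤ Real.sin α / 4)
    (hp : |(s * t).im| ≤ Real.sin α / 4 * (s * t).re) {w : ℂ} (h0 : α ≤ w.im)
    (h1 : w.im ≤ Real.pi / 2) :
    s ^ 2 * (Complex.sinh w ^ 2 - c) - 1 ≠ 0 ∧ ‖modelIntegrand c γ s t w‖ ≤
      64 / (Real.sin α ^ 4 * ‖s‖ ^ 2) * Real.exp (-1 * |w.re|) := by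
  have hσ1 := Real.sin_le_one α
  have hs0 := norm_pos_of_mem_cone hs
  have him := sin_mul_norm_sinh_le hα0.le h0 h1
  have hcosh := Real.cosh_pos w.re
  have hz : Real.sin α * ‖Complex.sinh w‖ ≤ |(Complex.sinh w).im| :=
    le_trans (by gcongr; exact norm_sinh_le w) him
  have hpos : 0 < (Complex.sinh w).im := by
    rw [sinh_im]
    exact mul_pos hcosh (Real.sin_pos_of_pos_of_lt_pi (hα0.trans_le h0) (by linarith [Real.pi_pos]))
  rw [abs_of_pos hpos] at him
  have h2 := model_denominator_ge hα1 hσ1 hc hs hz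
  have h3 : Real.sin α * Real.exp |w.re| / 2 ≤ ‖Complex.sinh w‖ := by
    refine le_trans ?_ (him.trans ((le_abs_self _).trans (Complex.abs_im_le_norm _)))
    nlinarith [exp_abs_le_cosh w.re]
  refine ⟨norm_pos_iff.1 (lt_of_lt_of_le (by positivity) h2), ?_⟩
  rw [modelIntegrand, norm_mul, norm_mul, norm_div, norm_neg, norm_one]
  calc _ ≤ 1 / (Real.sin α ^ 2 / 16 * (0 + ‖s‖ ^ 2 * (Real.sin α * Real.exp |w.re| / 2) ^ 2)) * 1 *
        Real.exp |w.re| := by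
        gcongr
        · refine le_trans ?_ h2
          gcongr
          norm_num
        · exact norm_exp_exponent_le_one hγ hp hα1 him
        · exact (norm_cosh_le w).trans (cosh_le_exp_abs _)
    _ = _ := by rw [neg_one_mul, Real.exp_neg]; field_simp; ring

theorem differentiableAt_modelIntegrand {w : ℂ}
    (hne : s ^ 2 * (Complex.sinh w ^ 2 - c) - 1 ≠ 0) :
    DifferentiableAt ℂ (modelIntegrand c γ s t) w := by
  have hs : DifferentiableAt ℂ Complex.sinh w := Complex.differentiable_sinh.differentiableAt
  have hc : DifferentiableAt ℂ Complex.cosh w := Complex.differentiable_cosh.differentiableAt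
  exact (((differentiableAt_const _).div ((((hs.pow 2).sub_const _).const_mul _).sub_const _)
    hne).mul (((hs.const_mul _).const_add _).const_mul _).cexp).mul hc

theorem sinh_add_pi_div_two (u : ℝ) :
    Complex.sinh (u + (Real.pi / 2 : ℝ) * Complex.I) = Complex.I * Complex.cosh u ∧
    Complex.cosh (u + (Real.pi / 2 : ℝ) * Complex.I) = Complex.I * Complex.sinh u := by
  rw [Complex.sinh_add, Complex.cosh_add, Complex.sinh_mul_I, Complex.cosh_mul_I,
    ← Complex.ofReal_sin, ← Complex.ofReal_cos, Real.sin_pi_div_two, Real.cos_pi_div_two]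
  push_cast
  constructor <;> ring

/-- The model kernel does not contribute to the contour integral. -/
theorem integral_modelIntegrand_eq_zero (hα0 : 0 < α) (hα : α ≤ Real.pi / 2)
    (hα1 : 0 < Real.sin α) (hc : 0 ≤ c)
    (hs : s ∈ cone (Real.sin α ^ 2 / 8) ρ) (hγ : γ ≤ Real.sin α / 4)
    (hp : |(s * t).im| ≤ Real.sin α / 4 * (s * t).re) :
    ∫ u : ℝ, modelIntegrand c γ s t (u + α * Complex.I) = 0 := by
  rw [integral_line_eq (f := modelIntegrand c γ s t) one_pos hα
    (fun w h0 h1 => differentiableAt_modelIntegrand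
      (norm_modelIntegrand_le hα0 hα1 hc hs hγ hp h0 h1).1)
    fun w h0 h1 => (norm_modelIntegrand_le hα0 hα1 hc hs hγ hp h0 h1).2]
  have h := integral_neg_eq_self
    (fun u : ℝ => modelIntegrand c γ s t (u + (Real.pi / 2 : ℝ) * Complex.I)) (volume : Measure ℝ)
  -- On Im w = π/2 one has sinh w = i cosh u and cosh w = i sinh u; everything is even in u except
  -- the last factor.
  have e : ∀ u : ℝ, modelIntegrand c γ s t (((-u : ℝ) : ℂ) + (Real.pi / 2 : ℝ) * Complex.I) =
      -modelIntegrand c γ s t (u + (Real.pi / 2 : ℝ) * Complex.I) := fun u => by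
    simp only [modelIntegrand, sinh_add_pi_div_two]
    simp only [Complex.ofReal_neg, Complex.cosh_neg, Complex.sinh_neg, mul_neg]
  simp only [e, integral_neg] at h
  linear_combination (-1 / 2 : ℂ) * h

end model

namespace Dispersion
variable {k : ℂ → ℂ} {κ d A : ℝ} {m₀ : ℝ → ℝ} (D : Dispersion k κ d A m₀)
include D

theorem sinh_line_bounds {α : ℝ} (hα0 : 0 < α) (hα : α ≤ κ / 4) (u : ℝ) :
    Real.sin α * Real.exp |u| / 2 ≤ ‖Complex.sinh (u + α * Complex.I)‖ ∧
    ‖Complex.sinh (u + α * Complex.I)‖ ≤ Real.exp |u| ∧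
    Real.sin α * ‖Complex.sinh (u + α * Complex.I)‖ ≤ |(Complex.sinh (u + α * Complex.I)).im| := by
  have hσ := D.sin_pos hα0 hα
  have h1 := sin_mul_cosh_line u α
  have h2 := norm_sinh_le (u + α * Complex.I)
  rw [(line_re_im u α).1] at h2
  refine ⟨?_, h2.trans (cosh_le_exp_abs u), ?_⟩
  · refine le_trans ?_ ((le_abs_self _).trans (Complex.abs_im_le_norm _))
    rw [← h1]
    nlinarith [exp_abs_le_cosh u]
  · rw [← h1, abs_of_pos (mul_pos hσ (Real.cosh_pos u))]
    gcongr

/-- The model integrand has integral zero and may be subtracted. Over the common denominator the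
numerator becomes s² times the defect, which supplies two additional powers of s. -/
theorem contourPart_eq_defect {α c γ c₁ ρ : ℝ} {s t : ℂ} (hα0 : 0 < α) (hα : α ≤ κ / 4)
    (hc : 0 ≤ c) (hs : s ∈ cone (Real.sin α ^ 2 / 8) ρ) (hγ : γ ≤ Real.sin α / 4)
    (hp : |(s * t).im| ≤ Real.sin α / 4 * (s * t).re) (hc₁ : 0 < c₁)
    (hline : ∀ u : ℝ, c₁ * (‖s‖ ^ 2 + Real.exp (-2 * |u|)) ≤
      ‖s ^ 2 + k (Complex.sinh (u + α * Complex.I))‖) :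
    contourPart k γ α s t = -(s ^ 3 / (2 * Real.pi)) * ∫ u : ℝ,
      defect k c (Complex.sinh (u + α * Complex.I)) /
        ((s ^ 2 + k (Complex.sinh (u + α * Complex.I))) *
          (s ^ 2 * (Complex.sinh (u + α * Complex.I) ^ 2 - c) - 1)) *
        Complex.exp (s * t * (γ + Complex.I * Complex.sinh (u + α * Complex.I))) *
        Complex.cosh (u + α * Complex.I) := by
  have hσ := D.sin_pos hα0 hα
  have hpi : α ≤ Real.pi / 2 := by linarith [D.le_one, Real.pi_gt_three]
  have hsne : s ≠ 0 := norm_pos_iff.1 (norm_pos_of_mem_cone hs)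
  have hq := fun u : ℝ => D.norm_quotient_line_le hα0 hα hc₁ hsne (hline u)
  have hm := fun u : ℝ => norm_modelIntegrand_le (w := u + α * Complex.I) hα0 hσ hc hs hγ hp
    (by simp) (by simpa using hpi)
  have hi1 : Integrable fun u : ℝ => greenIntegrand k γ s t (u + α * Complex.I) :=
    integrable_line (C := 4 * A / (c₁ * ‖s‖ ^ 2)) one_pos
      (fun u => D.differentiableAt_greenIntegrand γ (by simpa using hα0.le) (by simpa using hα)
        (hq u).1) fun u => by
        have h1 := norm_greenIntegrand_le (k := k) (w := u + α * Complex.I) hγ hp hσ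
          (by rw [(line_re_im u α).1]; exact (sin_mul_cosh_line u α).le)
          (by rw [(line_re_im u α).1]; exact (hq u).2)
        rwa [(line_re_im u α).1] at h1
  have hi2 : Integrable fun u : ℝ => modelIntegrand c γ s t (u + α * Complex.I) :=
    integrable_line one_pos (fun u => differentiableAt_modelIntegrand (hm u).1) fun u => by
        have h1 := (hm u).2
        rwa [(line_re_im u α).1] at h1
  have h0 := integral_sub hi1 hi2
  rw [integral_modelIntegrand_eq_zero hα0 hpi hσ hc hs hγ hp, sub_zero] at h0
  rw [contourPart, ← h0]
  have e : ∀ u : ℝ, greenIntegrand k γ s t (u + α * Complex.I) -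
      modelIntegrand c γ s t (u + α * Complex.I) =
      s ^ 2 * (defect k c (Complex.sinh (u + α * Complex.I)) /
        ((s ^ 2 + k (Complex.sinh (u + α * Complex.I))) *
          (s ^ 2 * (Complex.sinh (u + α * Complex.I) ^ 2 - c) - 1)) *
        Complex.exp (s * t * (γ + Complex.I * Complex.sinh (u + α * Complex.I))) *
        Complex.cosh (u + α * Complex.I)) := fun u => by
    have h1 := (hq u).1
    have h2 := (hm u).1
    simp only [greenIntegrand, modelIntegrand, defect]
    rw [← sub_mul, ← sub_mul, div_sub_div _ _ h1 h2, ← mul_assoc, ← mul_assoc, ← mul_div_assoc]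
    congr 3
    ring
  simp only [e]
  rw [integral_const_mul]
  ring

/-- With E = e^{|u|} the two denominators are at least multiples of E⁻²(1 + |s|²E²) and 1 + |s|²E².
Together with cosh they give the weight E³/(1 + |s|²E²)². -/
theorem norm_contourPart_le_of_defect {α c₁ : ℝ} (hα0 : 0 < α) (hα : α ≤ κ / 4) (hc₁ : 0 < c₁) :
    ∃ C > 0, ∀ (c γ ρ : ℝ) (s t : ℂ) (G : ℝ → ℝ), 0 ≤ c → s ∈ cone (Real.sin α ^ 2 / 8) ρ →
      γ ≤ Real.sin α / 4 → |(s * t).im| ≤ Real.sin α / 4 * (s * t).re →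
      (∀ u : ℝ, c₁ * (‖s‖ ^ 2 + Real.exp (-2 * |u|)) ≤
        ‖s ^ 2 + k (Complex.sinh (u + α * Complex.I))‖) → Integrable G →
      (∀ u : ℝ, ‖defect k c (Complex.sinh (u + α * Complex.I))‖ * (Real.exp (3 * |u|) /
        (1 + ‖s‖ ^ 2 * Real.exp (2 * |u|)) ^ 2) ≤ G u) →
      ‖contourPart k γ α s t‖ ≤ C * ‖s‖ ^ 3 * ∫ u, G u := by
  have hσ := D.sin_pos hα0 hα
  have hσ1 := Real.sin_le_one α
  set σ := Real.sin α with hσd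
  set C₀ := 1 / (c₁ * (σ ^ 2 / 16 * (σ ^ 2 / 4))) with hC₀
  refine ⟨C₀, by positivity, fun c γ ρ s t G hc hs hγ hp hline hG hb => ?_⟩
  have hC₀0 : 0 < C₀ := by positivity
  have hpt : ∀ u : ℝ, ‖defect k c (Complex.sinh (u + α * Complex.I)) /
        ((s ^ 2 + k (Complex.sinh (u + α * Complex.I))) *
          (s ^ 2 * (Complex.sinh (u + α * Complex.I) ^ 2 - c) - 1)) *
        Complex.exp (s * t * (γ + Complex.I * Complex.sinh (u + α * Complex.I))) *
        Complex.cosh (u + α * Complex.I)‖ ≤ C₀ * G u := fun u => by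
    obtain ⟨hz1, hz2, hz3⟩ := D.sinh_line_bounds hα0 hα u
    have hden := model_denominator_ge hσ hσ1 hc hs hz3
    have hexp := norm_exp_exponent_le_one (w := u + α * Complex.I) hγ hp hσ
      (by rw [(line_re_im u α).1]; exact (sin_mul_cosh_line u α).le)
    have hcosh := (norm_cosh_le (u + α * Complex.I)).trans (cosh_le_exp_abs _)
    rw [(line_re_im u α).1] at hcosh
    have hE := Real.exp_pos |u|
    set E := Real.exp |u| with hEd
    have hE2 : Real.exp (2 * |u|) = E ^ 2 := by rw [hEd, ← Real.exp_nat_mul]; push_cast; rfl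
    have hE3 : Real.exp (3 * |u|) = E ^ 3 := by rw [hEd, ← Real.exp_nat_mul]; push_cast; rfl
    have hEm : Real.exp (-2 * |u|) = (E ^ 2)⁻¹ := by rw [neg_mul, Real.exp_neg, hE2]
    have hl := hline u
    rw [hEm] at hl
    have hb' := hb u
    rw [hE2, hE3] at hb'
    rw [norm_mul, norm_mul, norm_div, norm_mul]
    have hsq : σ ^ 2 / 4 * (1 + ‖s‖ ^ 2 * E ^ 2) ≤
        1 + ‖s‖ ^ 2 * ‖Complex.sinh (u + α * Complex.I)‖ ^ 2 := by
      have h1 : (σ * E / 2) ^ 2 ≤ ‖Complex.sinh (u + α * Complex.I)‖ ^ 2 := by gcongr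
      have h2 := mul_le_mul_of_nonneg_left h1 (sq_nonneg ‖s‖)
      nlinarith
    calc _ ≤ ‖defect k c (Complex.sinh (u + α * Complex.I))‖ /
          (c₁ * (‖s‖ ^ 2 + (E ^ 2)⁻¹) * (σ ^ 2 / 16 * (σ ^ 2 / 4 * (1 + ‖s‖ ^ 2 * E ^ 2)))) * 1 *
          E := by
          gcongr
          exact le_trans (by gcongr) hden
      _ = C₀ * (‖defect k c (Complex.sinh (u + α * Complex.I))‖ *
          (E ^ 3 / (1 + ‖s‖ ^ 2 * E ^ 2) ^ 2)) := by
          rw [hC₀, show ‖s‖ ^ 2 + (E ^ 2)⁻¹ = (1 + ‖s‖ ^ 2 * E ^ 2) / E ^ 2 by field_simp; ring]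
          field_simp
      _ ≤ _ := by gcongr
  have h1 := norm_integral_le_of_norm_le (hG.const_mul C₀) (Eventually.of_forall hpt)
  rw [integral_const_mul] at h1
  rw [D.contourPart_eq_defect hα0 hα hc hs hγ hp hc₁ hline, norm_mul, norm_neg, norm_div, norm_pow]
  have h3 : 1 ≤ ‖(2 * Real.pi : ℂ)‖ := by
    rw [norm_mul, Complex.norm_real, Real.norm_of_nonneg Real.pi_pos.le]
    simp only [Complex.norm_ofNat]
    linarith [Real.pi_gt_three]
  calc _ ≤ ‖s‖ ^ 3 * (C₀ * ∫ u, G u) := by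
        gcongr
        exact div_le_self (by positivity) h3
    _ = _ := by ring

/-- A bound for the defect at infinity gives a bound on the contour. -/
theorem exists_defect_line_le {α c a b B θ : ℝ} (hα0 : 0 < α) (hα : α ≤ κ / 4) (hc : 0 ≤ c)
    (ha : 0 ≤ a) (hb : 0 ≤ b) (hB : 0 ≤ B) (hθ : 0 ≤ θ)
    (h : ∀ z ∈ lowerRegion κ, 1 ≤ ‖z‖ →
      ‖defect k c z‖ ≤ B * (‖z‖ ^ (-a) + θ * ((1 + Real.log ‖z‖) * ‖z‖ ^ (-b)))) :
    ∃ B' > 0, ∀ u : ℝ, ‖defect k c (Complex.sinh (u + α * Complex.I))‖ ≤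
      B' * (Real.exp (-a * |u|) + θ * ((1 + |u|) * Real.exp (-b * |u|))) := by
  have hσ := D.sin_pos hα0 hα
  have hA := D.nonneg
  set σ := Real.sin α with hσd
  set q := σ / 2 with hq
  have hq0 : 0 < q := by positivity
  have hq1 : q ≤ 1 := by have := Real.sin_le_one α; linarith
  have hqa : 1 ≤ q ^ (-a) := Real.one_le_rpow_of_pos_of_le_one_of_nonpos hq0 hq1 (by linarith)
  have hqb : 1 ≤ q ^ (-b) := Real.one_le_rpow_of_pos_of_le_one_of_nonpos hq0 hq1 (by linarith)
  refine ⟨B * (q ^ (-a) + q ^ (-b)) + (A * (1 + c) + 1) * q ^ (-a), by positivity, fun u => ?_⟩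
  obtain ⟨hz1, hz2, -⟩ := D.sinh_line_bounds hα0 hα u
  rw [mul_div_right_comm, ← hq] at hz1
  set z := Complex.sinh (u + α * Complex.I) with hz
  have hmem : z ∈ lowerRegion κ := D.sinh_line_mem hα0 hα u
  have hpow : ∀ x : ℝ, 0 ≤ x → ‖z‖ ^ (-x) ≤ q ^ (-x) * Real.exp (-x * |u|) := fun x hx => by
    have h1 : ‖z‖ ^ (-x) ≤ (q * Real.exp |u|) ^ (-x) :=
      Real.rpow_le_rpow_of_nonpos (by positivity) hz1 (by linarith)
    rwa [Real.mul_rpow hq0.le (Real.exp_pos _).le, ← Real.exp_mul, mul_comm |u|] at h1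
  have hu0 := abs_nonneg u
  have hea := Real.exp_pos (-a * |u|)
  have heb := Real.exp_pos (-b * |u|)
  have hlast : 0 ≤ θ * ((1 + |u|) * Real.exp (-b * |u|)) := by positivity
  rcases le_or_gt 1 ‖z‖ with h1 | h1
  · refine (h z hmem h1).trans ?_
    have hlog : Real.log ‖z‖ ≤ |u| := by
      rw [Real.log_le_iff_le_exp (by linarith)]; exact hz2
    have hlog0 := Real.log_nonneg h1
    have h2 : ‖z‖ ^ (-a) ≤ (q ^ (-a) + q ^ (-b)) * Real.exp (-a * |u|) :=
      (hpow a ha).trans (by gcongr; linarith)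
    have h3 : (1 + Real.log ‖z‖) * ‖z‖ ^ (-b) ≤
        (q ^ (-a) + q ^ (-b)) * ((1 + |u|) * Real.exp (-b * |u|)) := by
      calc _ ≤ (1 + |u|) * (q ^ (-b) * Real.exp (-b * |u|)) := by gcongr; exact hpow b hb
        _ = q ^ (-b) * ((1 + |u|) * Real.exp (-b * |u|)) := by ring
        _ ≤ _ := by gcongr; linarith
    calc _ ≤ B * ((q ^ (-a) + q ^ (-b)) * Real.exp (-a * |u|) +
          θ * ((q ^ (-a) + q ^ (-b)) * ((1 + |u|) * Real.exp (-b * |u|)))) := by gcongr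
      _ = B * (q ^ (-a) + q ^ (-b)) * (Real.exp (-a * |u|) +
          θ * ((1 + |u|) * Real.exp (-b * |u|))) := by ring
      _ ≤ _ := by gcongr; linarith [mul_pos (by positivity : 0 < A * (1 + c) + 1) (by linarith : 0 < q ^ (-a))]
  -- For ‖z‖ < 1 the defect is merely bounded, and the comparison weight q^{−a}e^{−a|u|} is at least
  -- ‖z‖^{−a} ≥ 1.
  · have h2 : ‖defect k c z‖ ≤ A * (1 + c) + 1 := by
      have h3 := D.bound z hmem
      have h4 : A / (1 + ‖z‖) ^ 2 ≤ A := by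
        refine div_le_self hA.le ?_
        have := norm_nonneg z
        nlinarith
      rw [defect]
      refine (norm_add_le _ _).trans ?_
      rw [norm_mul, norm_one]
      have h5 : ‖z ^ 2 - (c : ℂ)‖ ≤ 1 + c := by
        refine (norm_sub_le _ _).trans ?_
        rw [norm_pow, Complex.norm_real, Real.norm_of_nonneg hc]
        have := norm_nonneg z
        nlinarith
      gcongr
      exact h3.trans h4
    have h3 : 1 ≤ q ^ (-a) * Real.exp (-a * |u|) := by
      refine le_trans ?_ (hpow a ha)
      rcases (norm_nonneg z).eq_or_lt with h5 | h5
      · rw [← h5] at hz1; exact absurd hz1 (not_le.2 (by positivity))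
      · exact Real.one_le_rpow_of_pos_of_le_one_of_nonpos h5 h1.le (by linarith)
    have h4 : 0 < A * (1 + c) + 1 := by positivity
    calc _ ≤ (A * (1 + c) + 1) * 1 := by rw [mul_one]; exact h2
      _ ≤ (A * (1 + c) + 1) * (q ^ (-a) * Real.exp (-a * |u|)) := by gcongr
      _ = (A * (1 + c) + 1) * q ^ (-a) * (Real.exp (-a * |u|) + 0) := by ring
      _ ≤ _ := by
          gcongr
          have : 0 ≤ B * (q ^ (-a) + q ^ (-b)) := by positivity
          linarith

end Dispersion

/-! ### Bounds for the remainder by absolute values -/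

theorem one_add_abs_mul_exp_le (u : ℝ) : (1 + |u|) * Real.exp (-1 * |u|) ≤
    2 * Real.exp (-(1 / 2) * |u|) := by
  have h4 := Real.add_one_le_exp (1 / 2 * |u|)
  calc _ ≤ 2 * Real.exp (1 / 2 * |u|) * Real.exp (-1 * |u|) := by gcongr; linarith [abs_nonneg u]
    _ = 2 * (Real.exp (1 / 2 * |u|) * Real.exp (-1 * |u|)) := by ring
    _ = _ := by rw [← Real.exp_add]; ring_nf

/-- The estimates for `contourPart` hold on the set where the dispersion relation is bounded from
below on the contour. -/
def IsLowContour (k : ℂ → ℂ) (α c₁ ρ : ℝ) : Prop :=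
  0 < c₁ ∧ ∀ s ∈ cone (Real.sin α ^ 2 / 8) ρ, ∀ u : ℝ,
    c₁ * (‖s‖ ^ 2 + Real.exp (-2 * |u|)) ≤ ‖s ^ 2 + k (Complex.sinh (u + α * Complex.I))‖

/-- A bound for `contourPart`, uniform in `γ` and in the sector of the variable `s t`. -/
def LowContourBound (k : ℂ → ℂ) (α ρ : ℝ) (w : ℝ → ℝ) : Prop :=
  ∃ C > 0, ∀ γ : ℝ, 0 ≤ γ → γ ≤ Real.sin α / 4 → ∀ s ∈ cone (Real.sin α ^ 2 / 8) ρ, ∀ t : ℂ,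
    |(s * t).im| ≤ Real.sin α / 4 * (s * t).re → ‖contourPart k γ α s t‖ ≤ C * w ‖s‖

theorem norm_lt_one_of_mem_cone {σ ρ : ℝ} (hσ0 : 0 < σ) (hσ1 : σ ≤ 1) (hρ : ρ ≤ 1 / 2) {s : ℂ}
    (hs : s ∈ cone (σ ^ 2 / 8) ρ) : ‖s‖ < 1 := by
  have := norm_le_of_mem_cone (by nlinarith) hs
  linarith [hs.2.2]

theorem integral_nonneg_exp (η : ℝ) : 0 ≤ ∫ u : ℝ, Real.exp (-η * |u|) :=
  integral_nonneg fun _ => (Real.exp_pos _).le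

namespace Dispersion
variable {k : ℂ → ℂ} {κ d A : ℝ} {m₀ : ℝ → ℝ} (D : Dispersion k κ d A m₀)
include D

/-- The choice c = 0 suffices: the defect is then of order |z|^{1−d} + |z|⁻² log |z|, and the weight
is concentrated where |z| is about 1/|s|. -/
theorem lowContourBound_leading {α c₁ ρ : ℝ} (hα0 : 0 < α) (hα : α ≤ κ / 4) (hρ : ρ ≤ 1 / 2)
    (hl : IsLowContour k α c₁ ρ) :
    LowContourBound k α ρ fun x => x ^ (d - 1) + x ^ 2 * (1 + Real.log x⁻¹) := by
  have hσ := D.sin_pos hα0 hα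
  have hd := D.one_lt
  have hA := D.nonneg
  obtain ⟨hc₁, hline⟩ := hl
  obtain ⟨B, hB, hdef⟩ := D.exists_defect_line_le (c := 0) (a := d - 1) (b := 2) (B := A) (θ := 1)
    hα0 hα le_rfl (by linarith) two_pos.le D.nonneg.le one_pos.le fun z hz h1 => by
      have hx : 0 < ‖z‖ := by linarith
      have hz0 : z ≠ 0 := norm_pos_iff.1 hx
      have e : defect k 0 z = z ^ 2 * (k z + 1 / z ^ 2) := by
        rw [defect, Complex.ofReal_zero, sub_zero]; field_simp
      rw [e, norm_mul, norm_pow]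
      have h3 : ‖z‖ ^ (-(d - 1)) = ‖z‖ ^ 2 * ‖z‖ ^ (-(d + 1)) := by
        rw [← Real.rpow_natCast ‖z‖ 2, ← Real.rpow_add hx]; congr 1; push_cast; ring
      have h4 : ‖z‖ ^ (-2 : ℝ) = (‖z‖ ^ 2)⁻¹ := by rw [Real.rpow_neg hx.le]; norm_cast
      calc _ ≤ ‖z‖ ^ 2 * (A * (‖z‖ ^ (-(d + 1)) + (1 + Real.log ‖z‖) / ‖z‖ ^ 4)) := by
            gcongr; exact D.leading z hz h1
        _ = _ := by
            rw [h3, h4]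
            field_simp
  obtain ⟨C, hC, hmain⟩ := D.norm_contourPart_le_of_defect hα0 hα hc₁
  set J := ∫ u : ℝ, Real.exp (-(1 / 2) * |u|) with hJ
  have hJ0 : 0 ≤ J := integral_nonneg_exp _
  refine ⟨C * (B * (3 * (2 * J))) + 1, by positivity, fun γ _ hγ s hs t hp => ?_⟩
  have hx : 0 < ‖s‖ := norm_pos_of_mem_cone hs
  have hx1 : ‖s‖ < 1 := norm_lt_one_of_mem_cone hσ (Real.sin_le_one α) hρ hs
  set x := ‖s‖ with hxd
  have hL : 0 ≤ Real.log x⁻¹ := Real.log_nonneg (one_le_inv_iff₀.2 ⟨hx, hx1.le⟩)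
  set L := Real.log x⁻¹ with hLd
  -- The natural exponent of the weight is 4 − d. For large d it is raised to 1/2, so that the peak
  -- remains at |u| = log(1/x); the resulting x^{5/2} is below x².
  set q := max (4 - d) (1 / 2) with hq
  have hq1 : 1 / 2 ≤ 4 - q := by
    have : q ≤ 3 := max_le (by linarith) (by norm_num)
    linarith
  set P := B * (x ^ (-q) + 2 * x⁻¹ * (1 + L)) with hP
  have h1 := hmain 0 γ ρ s t (fun u => P *
    (Real.exp (-(1 / 2) * |u - L|) + Real.exp (-(1 / 2) * |u + L|))) le_rfl hs hγ hp (hline s hs)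
    ((integrable_exp_neg_abs_sub (by norm_num) L).const_mul P) fun u => by
      have h2 := hdef u
      have h3 := weight_le hx (le_max_right (4 - d) (1 / 2)) hq1 u
      have h4 := weight_log_le hx hx1.le u
      have h5 := exp_neg_abs_abs_sub_le (η := 1 / 2) u L
      set Wt := (1 + x ^ 2 * Real.exp (2 * |u|)) ^ 2 with hWt
      have hWt0 : 0 < Wt := by positivity
      have h6 : Real.exp (-(d - 1) * |u|) * (Real.exp (3 * |u|) / Wt) ≤
          x ^ (-q) * Real.exp (-(1 / 2) * |(|u|) - L|) := by
        refine le_trans ?_ h3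
        rw [← mul_div_assoc, ← Real.exp_add]
        gcongr
        have := le_max_left (4 - d) (1 / 2)
        nlinarith [abs_nonneg u]
      have h7 : (1 + |u|) * Real.exp (-2 * |u|) * (Real.exp (3 * |u|) / Wt) ≤
          2 * x⁻¹ * (1 + L) * Real.exp (-(1 / 2) * |(|u|) - L|) := by
        refine le_trans (le_of_eq ?_) h4
        rw [← mul_div_assoc, mul_assoc, ← Real.exp_add]
        ring_nf
      calc _ ≤ B * (Real.exp (-(d - 1) * |u|) + 1 * ((1 + |u|) * Real.exp (-2 * |u|))) *
            (Real.exp (3 * |u|) / Wt) := by gcongr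
        _ = B * (Real.exp (-(d - 1) * |u|) * (Real.exp (3 * |u|) / Wt) +
            (1 + |u|) * Real.exp (-2 * |u|) * (Real.exp (3 * |u|) / Wt)) := by ring
        _ ≤ B * (x ^ (-q) * Real.exp (-(1 / 2) * |(|u|) - L|) +
            2 * x⁻¹ * (1 + L) * Real.exp (-(1 / 2) * |(|u|) - L|)) := by gcongr
        _ = P * Real.exp (-(1 / 2) * |(|u|) - L|) := by ring
        _ ≤ _ := by gcongr
  rw [integral_const_mul, integral_exp_neg_abs_sub (by norm_num), ← hJ] at h1
  refine h1.trans ?_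
  have hpow : x ^ 3 * x ^ (-q) ≤ x ^ (d - 1) + x ^ 2 := by
    rw [← Real.rpow_natCast x 3, ← Real.rpow_natCast x 2, ← Real.rpow_add hx]
    have h8 := Real.rpow_pos_of_pos hx (d - 1)
    have h9 := Real.rpow_pos_of_pos hx ((2 : ℕ) : ℝ)
    rcases max_choice (4 - d) (1 / 2) with h | h
    · rw [hq, h, show ((3 : ℕ) : ℝ) + -(4 - d) = d - 1 by push_cast; ring]
      linarith
    · rw [hq, h]
      have : x ^ (((3 : ℕ) : ℝ) + -(1 / 2)) ≤ x ^ ((2 : ℕ) : ℝ) :=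
        Real.rpow_le_rpow_of_exponent_ge hx hx1.le (by push_cast; norm_num)
      linarith
  have h8 := Real.rpow_pos_of_pos hx (d - 1)
  calc _ = C * (B * (2 * J)) * (x ^ 3 * x ^ (-q) + 2 * (x ^ 3 * x⁻¹ * (1 + L))) := by rw [hP]; ring
    _ ≤ C * (B * (2 * J)) * ((x ^ (d - 1) + x ^ 2) + 2 * (x ^ 3 * x⁻¹ * (1 + L))) := by gcongr
    _ = C * (B * (2 * J)) * (x ^ (d - 1) + x ^ 2 * 1 + 2 * (x ^ 2 * (1 + L))) := by
        field_simp
    _ ≤ C * (B * (2 * J)) * (3 * (x ^ (d - 1) + x ^ 2 * (1 + L))) := by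
        gcongr
        nlinarith [sq_nonneg x, mul_nonneg (sq_nonneg x) hL]
    _ ≤ _ := by
        have : 0 ≤ x ^ (d - 1) + x ^ 2 * (1 + L) := by positivity
        nlinarith

/-- With a defect O(|z|⁻²) free of logarithms the weight is e^{|u|}/(1 + x²e^{2|u|})², of integral
about 1/x; the prefactor x³ leaves x². -/
theorem lowContourBound_of_defect_two {α c₁ ρ B₀ : ℝ} (hα0 : 0 < α) (hα : α ≤ κ / 4)
    (hl : IsLowContour k α c₁ ρ) (hB₀ : 0 ≤ B₀)
    (hk : ∀ z ∈ lowerRegion κ, 1 ≤ ‖z‖ → ‖defect k 0 z‖ ≤ B₀ * ‖z‖ ^ (-2 : ℝ)) :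
    LowContourBound k α ρ fun x => x ^ 2 := by
  obtain ⟨hc₁, hline⟩ := hl
  obtain ⟨B, hB, hdef⟩ := D.exists_defect_line_le (c := 0) (a := 2) (b := 0) (B := B₀) (θ := 0)
    hα0 hα le_rfl two_pos.le le_rfl hB₀ le_rfl fun z hz h1 => by simpa using hk z hz h1
  obtain ⟨C, hC, hmain⟩ := D.norm_contourPart_le_of_defect hα0 hα hc₁
  set J := ∫ u : ℝ, Real.exp (-1 * |u|) with hJ
  have hJ0 : 0 ≤ J := integral_nonneg_exp _
  refine ⟨C * (B * (2 * J)) + 1, by positivity, fun γ _ hγ s hs t hp => ?_⟩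
  have hx : 0 < ‖s‖ := norm_pos_of_mem_cone hs
  set x := ‖s‖ with hxd
  set L := Real.log x⁻¹ with hLd
  have h1 := hmain 0 γ ρ s t (fun u => B * x⁻¹ *
    (Real.exp (-1 * |u - L|) + Real.exp (-1 * |u + L|))) le_rfl hs hγ hp (hline s hs)
    ((integrable_exp_neg_abs_sub one_pos L).const_mul _) fun u => by
      have h2 := hdef u
      have h3 := weight_le (q := 1) (η := 1) hx le_rfl (by norm_num) u
      rw [one_mul, Real.rpow_neg_one] at h3
      have h5 := exp_neg_abs_abs_sub_le (η := 1) u L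
      rw [zero_mul, add_zero] at h2
      calc _ ≤ B * Real.exp (-2 * |u|) *
            (Real.exp (3 * |u|) / (1 + x ^ 2 * Real.exp (2 * |u|)) ^ 2) := by gcongr
        _ = B * (Real.exp |u| / (1 + x ^ 2 * Real.exp (2 * |u|)) ^ 2) := by
            rw [mul_assoc, ← mul_div_assoc, ← Real.exp_add]; ring_nf
        _ ≤ B * (x⁻¹ * Real.exp (-1 * |(|u|) - L|)) := by gcongr
        _ ≤ _ := by rw [mul_assoc B]; gcongr
  rw [integral_const_mul, integral_exp_neg_abs_sub one_pos, ← hJ] at h1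
  refine h1.trans ?_
  have : C * x ^ 3 * (B * x⁻¹ * (2 * J)) = C * (B * (2 * J)) * x ^ 2 := by field_simp
  rw [this]
  nlinarith [sq_nonneg x]

/-- For d < 4 the first part of the weight grows at the positive rate 4 − d and is dominated by |u|
= log(1/x), giving x^{d−1}. The logarithmic part decays in |u| without any help from the
denominator, and contributes only the prefactor x³. -/
theorem lowContourBound_of_defect_four {α c₁ ρ B₀ c : ℝ} (hα0 : 0 < α) (hα : α ≤ κ / 4)
    (hl : IsLowContour k α c₁ ρ) (hB₀ : 0 ≤ B₀) (hc : 0 ≤ c) (hd : 3 < d) (h4 : d < 4)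
    (hk : ∀ z ∈ lowerRegion κ, 1 ≤ ‖z‖ → ‖defect k c z‖ ≤
      B₀ * (‖z‖ ^ (-(d - 1)) + (1 + Real.log ‖z‖) * ‖z‖ ^ (-4 : ℝ))) :
    LowContourBound k α ρ fun x => x ^ (d - 1) + x ^ 3 := by
  obtain ⟨hc₁, hline⟩ := hl
  obtain ⟨B, hB, hdef⟩ := D.exists_defect_line_le (c := c) (a := d - 1) (b := 4) (B := B₀) (θ := 1)
    hα0 hα hc (by linarith) (by norm_num) hB₀ one_pos.le
    fun z hz h1 => by simpa using hk z hz h1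
  obtain ⟨C, hC, hmain⟩ := D.norm_contourPart_le_of_defect hα0 hα hc₁
  set J := ∫ u : ℝ, Real.exp (-(1 / 2) * |u|) with hJ
  have hJ0 : 0 ≤ J := integral_nonneg_exp _
  have hsecond : ∀ x : ℝ, ∀ u : ℝ, (1 + |u|) * Real.exp (-4 * |u|) *
      (Real.exp (3 * |u|) / (1 + x ^ 2 * Real.exp (2 * |u|)) ^ 2) ≤
      2 * Real.exp (-(1 / 2) * |u|) := fun x u => by
    have h0 : 0 ≤ x ^ 2 * Real.exp (2 * |u|) := by positivity
    refine le_trans ?_ (one_add_abs_mul_exp_le u)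
    calc _ ≤ (1 + |u|) * Real.exp (-4 * |u|) * Real.exp (3 * |u|) := by
          gcongr
          exact div_le_self (Real.exp_pos _).le (by nlinarith)
      _ = _ := by rw [mul_assoc, ← Real.exp_add]; ring_nf
  set η := min (4 - d) 1 with hη
  have hη0 : 0 < η := lt_min (by linarith) one_pos
  set J' := ∫ u : ℝ, Real.exp (-η * |u|) with hJ'
  have hJ'0 : 0 ≤ J' := integral_nonneg_exp _
  refine ⟨C * B * (2 * J' + 2 * J) + 1, by positivity, fun γ _ hγ s hs t hp => ?_⟩
  have hx : 0 < ‖s‖ := norm_pos_of_mem_cone hs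
  set x := ‖s‖ with hxd
  set L := Real.log x⁻¹ with hLd
  have h1 := hmain c γ ρ s t (fun u => B * x ^ (-(4 - d)) *
    (Real.exp (-η * |u - L|) + Real.exp (-η * |u + L|)) + 2 * B * Real.exp (-(1 / 2) * |u|))
    hc hs hγ hp (hline s hs) (((integrable_exp_neg_abs_sub hη0 L).const_mul _).add
      ((integrable_exp_neg_mul_abs (by norm_num)).const_mul _)) fun u => by
      have h2 := hdef u
      have h3 := weight_le (q := 4 - d) (η := η) hx (min_le_left _ _)
        ((min_le_right _ _).trans (by linarith)) u
      have h5 := exp_neg_abs_abs_sub_le (η := η) u L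
      have h6 := hsecond x u
      set Wt := (1 + x ^ 2 * Real.exp (2 * |u|)) ^ 2 with hWt
      calc _ ≤ B * (Real.exp (-(d - 1) * |u|) + 1 * ((1 + |u|) * Real.exp (-4 * |u|))) *
            (Real.exp (3 * |u|) / Wt) := by gcongr
        _ = B * (Real.exp (-(d - 1) * |u|) * Real.exp (3 * |u|) / Wt) +
            B * ((1 + |u|) * Real.exp (-4 * |u|) * (Real.exp (3 * |u|) / Wt)) := by ring
        _ = B * (Real.exp ((4 - d) * |u|) / Wt) +
            B * ((1 + |u|) * Real.exp (-4 * |u|) * (Real.exp (3 * |u|) / Wt)) := by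
            rw [← Real.exp_add]; ring_nf
        _ ≤ B * (x ^ (-(4 - d)) * (Real.exp (-η * |u - L|) + Real.exp (-η * |u + L|))) +
            B * (2 * Real.exp (-(1 / 2) * |u|)) := by
            gcongr
            exact h3.trans (by gcongr)
        _ = _ := by ring
  rw [integral_add ((integrable_exp_neg_abs_sub hη0 L).const_mul _)
      ((integrable_exp_neg_mul_abs (by norm_num)).const_mul _), integral_const_mul,
    integral_const_mul, integral_exp_neg_abs_sub hη0, ← hJ, ← hJ'] at h1
  refine h1.trans ?_
  have hpow : x ^ 3 * x ^ (-(4 - d)) = x ^ (d - 1) := by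
    rw [← Real.rpow_natCast x 3, ← Real.rpow_add hx]; congr 1; push_cast; ring
  have h8 := Real.rpow_pos_of_pos hx (d - 1)
  have h9 : 0 < x ^ 3 := by positivity
  calc _ = C * B * (2 * J') * (x ^ 3 * x ^ (-(4 - d))) + C * B * (2 * J) * x ^ 3 := by ring
    _ = C * B * (2 * J') * x ^ (d - 1) + C * B * (2 * J) * x ^ 3 := by rw [hpow]
    _ ≤ _ := by
        have h10 : 0 ≤ C * B * (2 * J') * x ^ 3 := by positivity
        have h11 : 0 ≤ C * B * (2 * J) * x ^ (d - 1) := by positivity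
        nlinarith

end Dispersion

/-! ### The remainder for d ≥ 4: cancellation in the tail integral -/

theorem norm_exp_sub_one_le_two_mul {w : ℂ} (h : ‖Complex.exp w‖ ≤ 1) :
    ‖Complex.exp w - 1‖ ≤ 2 * ‖w‖ := by
  rcases le_total ‖w‖ 1 with h1 | h1
  · exact Complex.norm_exp_sub_one_le h1
  · refine (norm_sub_le _ _).trans ?_
    rw [norm_one]; linarith

/-- The part of the integrand of `contourPart` that is independent of `s` and `t`. -/
noncomputable def tailIntegrand (k : ℂ → ℂ) (c : ℝ) (w : ℂ) : ℂ :=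
  Complex.sinh w ^ 2 * defect k c (Complex.sinh w) * Complex.cosh w

theorem norm_cosh_le_one_add (w : ℂ) : ‖Complex.cosh w‖ ≤ 1 + ‖Complex.sinh w‖ := by
  refine abs_le_of_sq_le_sq' ?_ (by positivity) |>.2
  rw [← norm_pow, Complex.cosh_sq]
  refine (norm_add_le _ _).trans ?_
  rw [norm_pow, norm_one]
  linarith [norm_nonneg (Complex.sinh w)]

/-- On Im w = −π/2 the function sinh is even and cosh is odd in u. No symmetry of k is needed, since
k enters only through sinh. -/
theorem tailIntegrand_odd (k : ℂ → ℂ) (c : ℝ) (u : ℝ) :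
    tailIntegrand k c (((-u : ℝ) : ℂ) + (-(Real.pi / 2) : ℝ) * Complex.I) =
      -tailIntegrand k c (u + (-(Real.pi / 2) : ℝ) * Complex.I) := by
  have e : ∀ v : ℝ, Complex.sinh (v + (-(Real.pi / 2) : ℝ) * Complex.I) =
      -Complex.I * Complex.cosh v ∧
      Complex.cosh (v + (-(Real.pi / 2) : ℝ) * Complex.I) = -Complex.I * Complex.sinh v :=
    fun v => by
      rw [Complex.sinh_add, Complex.cosh_add, Complex.sinh_mul_I, Complex.cosh_mul_I,
        ← Complex.ofReal_sin, ← Complex.ofReal_cos, Real.sin_neg, Real.cos_neg,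
        Real.sin_pi_div_two, Real.cos_pi_div_two]
      push_cast
      constructor <;> ring
  rw [tailIntegrand, tailIntegrand, (e _).1, (e _).2, (e _).1, (e _).2, Complex.ofReal_neg,
    Complex.cosh_neg, Complex.sinh_neg]
  ring

/-- The prefactor Q is at most the decay exponent on the contour, and Q e^{−Q} ≤ 1. It provides
decay where |st|e^{|u|} is large, even if |s|e^{|u|} is not. -/
theorem mul_norm_exp_exponent_le {σ γ : ℝ} (hγ : γ ≤ σ / 4) {p w : ℂ}
    (hp : |p.im| ≤ σ / 4 * p.re) (hσ : 0 < σ)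
    (hw : σ * Real.cosh w.re ≤ (Complex.sinh w).im) (hσ1 : σ ≤ 1) :
    σ * (‖p‖ * Real.exp |w.re|) / 16 * ‖Complex.exp (p * (γ + Complex.I * Complex.sinh w))‖ ≤
      1 := by
  have hre : ‖p‖ ≤ 2 * p.re := by
    have h1 := Complex.norm_le_abs_re_add_abs_im p
    have h2 : 0 ≤ p.re := by
      by_contra h
      have := mul_neg_of_pos_of_neg (by positivity : 0 < σ / 4) (not_le.1 h)
      linarith [abs_nonneg p.im]
    rw [abs_of_nonneg h2] at h1
    nlinarith
  have hq : σ * (‖p‖ * Real.exp |w.re|) / 16 ≤ σ / 4 * p.re * Real.cosh w.re := by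
    have h1 : ‖p‖ * Real.exp |w.re| ≤ 2 * p.re * (2 * Real.cosh w.re) :=
      mul_le_mul hre (exp_abs_le_cosh _) (Real.exp_pos _).le ((norm_nonneg p).trans hre)
    nlinarith
  set Q := σ * (‖p‖ * Real.exp |w.re|) / 16 with hQ
  have hQ0 : 0 ≤ Q := by positivity
  have hEn : ‖Complex.exp (p * (γ + Complex.I * Complex.sinh w))‖ ≤ Real.exp (-Q) := by
    rw [Complex.norm_exp]
    exact Real.exp_le_exp.2 ((re_exponent_le hγ hp hσ hw).trans (neg_le_neg hq))
  calc _ ≤ Real.exp Q * Real.exp (-Q) := by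
        gcongr
        linarith [Real.add_one_le_exp Q]
    _ = 1 := by rw [← Real.exp_add, add_neg_cancel, Real.exp_zero]

namespace Dispersion
variable {k : ℂ → ℂ} {κ d A : ℝ} {m₀ : ℝ → ℝ} (D : Dispersion k κ d A m₀)
include D

theorem norm_tailIntegrand_le {B c : ℝ}
    (hk : ∀ z ∈ lowerRegion κ, ‖z ^ 2 * defect k c z‖ * (1 + ‖z‖) ≤ B) {w : ℂ}
    (h0 : -Real.pi ≤ w.im) (h1 : w.im ≤ κ / 4) : ‖tailIntegrand k c w‖ ≤ B := by
  rw [tailIntegrand, norm_mul]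
  refine le_trans ?_ (hk _ (sinh_mem_lowerRegion D.pos D.le_one h0 h1))
  gcongr
  exact norm_cosh_le_one_add w

/-- The integrand is bounded but need not decay, so absolute values would give growth in U. Cauchy's
theorem moves the segment to Im w = −π/2, where its integral is zero by oddness; the two vertical
sides have length at most 3 each. -/
theorem norm_integral_tailIntegrand_le {B c α : ℝ} (hα0 : 0 < α) (hα : α ≤ κ / 4)
    (hk : ∀ z ∈ lowerRegion κ, ‖z ^ 2 * defect k c z‖ * (1 + ‖z‖) ≤ B) {U : ℝ} (hU : 0 ≤ U) :
    ‖∫ u in -U..U, tailIntegrand k c (u + α * Complex.I)‖ ≤ B * 6 := by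
  have hπ := Real.pi_pos
  have hκ := D.le_one
  have hlow : -(Real.pi / 2) ≤ α := by linarith
  have hB : 0 ≤ B := (norm_nonneg _).trans
    (D.norm_tailIntegrand_le hk (w := 0) (by simpa using hπ.le) (by have := D.pos; simp; linarith))
  have h := integral_boundary_rect_eq_zero (f := tailIntegrand k c) (x₁ := -U) (x₂ := U)
    (by linarith) hlow fun w _ _ h3 h4 => by
      have hs : DifferentiableAt ℂ Complex.sinh w := Complex.differentiable_sinh.differentiableAt
      have hkw : DifferentiableAt ℂ (fun w => k (Complex.sinh w)) w :=
        (D.differentiableAt (sinh_mem_lowerRegion D.pos D.le_one (by linarith) (by linarith))).comp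
          w hs
      exact ((hs.pow 2).mul ((hkw.mul ((hs.pow 2).sub_const _)).add_const _)).mul
        Complex.differentiable_cosh.differentiableAt
  have hodd : ∫ x in -U..U, tailIntegrand k c (x + (-(Real.pi / 2) : ℝ) * Complex.I) = 0 := by
    have h1 := intervalIntegral.integral_comp_neg (a := -U) (b := U)
      fun x : ℝ => tailIntegrand k c (x + (-(Real.pi / 2) : ℝ) * Complex.I)
    simp only [tailIntegrand_odd, intervalIntegral.integral_neg, neg_neg] at h1
    linear_combination (-1 / 2 : ℂ) * h1
  have hside : ∀ x : ℝ,
      ‖∫ y in -(Real.pi / 2)..α, tailIntegrand k c (x + y * Complex.I)‖ ≤ B * 3 := fun x => by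
    refine (intervalIntegral.norm_integral_le_of_norm_le_const (C := B) fun y hy => ?_).trans ?_
    · rw [uIoc_of_le hlow] at hy
      exact D.norm_tailIntegrand_le hk (by simp; linarith [hy.1]) (by simpa using hy.2.trans hα)
    · gcongr
      rw [abs_of_nonneg (by linarith)]
      linarith [Real.pi_lt_d2]
  have hR := hside U
  have hL := hside (-U)
  rw [hodd] at h
  have e : ∫ u in -U..U, tailIntegrand k c (u + α * Complex.I) =
      Complex.I * (∫ y in -(Real.pi / 2)..α, tailIntegrand k c ((U : ℝ) + y * Complex.I)) -
      Complex.I * ∫ y in -(Real.pi / 2)..α, tailIntegrand k c ((-U : ℝ) + y * Complex.I) := by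
    linear_combination -h
  rw [e]
  refine (norm_sub_le _ _).trans ?_
  rw [norm_mul, norm_mul, Complex.norm_I, one_mul, one_mul]
  linarith

theorem norm_sq_mul_add_one_mul_le (hd : 2 ≤ d) {z : ℂ} (hz : z ∈ lowerRegion κ) :
    ‖z ^ 2 * k z + 1‖ * ‖z‖ ≤ 3 * A + 1 := by
  have hA := D.nonneg
  rcases le_or_gt 1 ‖z‖ with h | h
  · have h2 := D.norm_sq_mul_add_one_le hz h
    have h3 : ‖z‖ ^ (-(d - 1)) ≤ ‖z‖⁻¹ := by
      rw [← Real.rpow_neg_one]; exact Real.rpow_le_rpow_of_exponent_le h (by linarith)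
    have h0 : ‖z‖ ≠ 0 := by linarith
    calc _ ≤ A * (‖z‖⁻¹ + 2 / ‖z‖) * ‖z‖ := by gcongr; exact h2.trans (by gcongr)
      _ = 3 * A := by field_simp; ring
      _ ≤ _ := by linarith
  · have hz0 := norm_nonneg z
    have h2 : ‖z ^ 2 * k z + 1‖ ≤ A + 1 := by
      refine (norm_add_le _ _).trans ?_
      rw [norm_mul, norm_one, norm_pow]
      have h4 : ‖k z‖ ≤ A := (D.bound z hz).trans (div_le_self hA.le (by nlinarith))
      have h5 : ‖z‖ ^ 2 ≤ 1 := by nlinarith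
      nlinarith [norm_nonneg (k z)]
    nlinarith [norm_nonneg (z ^ 2 * k z + 1)]

set_option maxHeartbeats 1000000 in
/-- The integrand of `contourPart` after subtraction of the model kernel. -/
theorem exists_defect_integrand_sub_le {α c₁ c : ℝ} (hα0 : 0 < α) (hα : α ≤ κ / 4) (hc₁ : 0 < c₁)
    (hc : 0 ≤ c) (hd : 2 ≤ d) : ∃ M > 0, ∀ (γ ρ : ℝ) (s t : ℂ), 0 ≤ γ → γ ≤ Real.sin α / 4 →
      ‖s‖ ≤ 1 → s ∈ cone (Real.sin α ^ 2 / 8) ρ → |(s * t).im| ≤ Real.sin α / 4 * (s * t).re →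
      ∀ u : ℝ, c₁ * (‖s‖ ^ 2 + Real.exp (-2 * |u|)) ≤
        ‖s ^ 2 + k (Complex.sinh (u + α * Complex.I))‖ →
      ‖defect k c (Complex.sinh (u + α * Complex.I)) /
        ((s ^ 2 + k (Complex.sinh (u + α * Complex.I))) *
          (s ^ 2 * (Complex.sinh (u + α * Complex.I) ^ 2 - c) - 1)) *
        Complex.exp (s * t * (γ + Complex.I * Complex.sinh (u + α * Complex.I))) *
        Complex.cosh (u + α * Complex.I) -
        (Icc (-Real.log (max ‖s‖ ‖s * t‖)⁻¹) (Real.log (max ‖s‖ ‖s * t‖)⁻¹)).indicator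
          (fun u : ℝ => tailIntegrand k c (u + α * Complex.I)) u‖ ≤
      ‖tailIntegrand k c (u + α * Complex.I)‖ * (M *
        (Real.exp (-1 * |(|u|) - Real.log (max ‖s‖ ‖s * t‖)⁻¹|) + Real.exp (-1 * |u|))) := by
  have hσ := D.sin_pos hα0 hα
  have hσ1 := Real.sin_le_one α
  have hA := D.nonneg
  set σ := Real.sin α with hσd
  set c₂ := σ ^ 2 * c₁ / 4 with hc₂
  set c₃ := σ ^ 2 / 16 with hc₃
  set K := 2 * (3 * A + 1) / σ with hK
  have hc₂0 : 0 < c₂ := by positivity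
  have hc₃0 : 0 < c₃ := by positivity
  have hK0 : 0 < K := by positivity
  refine ⟨(5 + K) / (c₂ * c₃) + (1 + c) / c₃ + (16 / σ + 1) / (c₂ * c₃), by positivity,
    fun γ ρ s t hγ0 hγ hs1 hs hp u hl => ?_⟩
  obtain ⟨hz1, hz2, hz3⟩ := D.sinh_line_bounds hα0 hα u
  have hcosh : σ * Real.cosh (u + α * Complex.I : ℂ).re ≤ (Complex.sinh (u + α * Complex.I)).im := by
    rw [(line_re_im u α).1]; exact (sin_mul_cosh_line u α).le
  have hE1 := norm_exp_exponent_le_one hγ hp hσ hcosh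
  have hden := model_denominator_ge hσ hσ1 hc hs hz3
  have hmem := D.sinh_line_mem hα0 hα u
  have hy1 : 1 ≤ Real.exp |u| := Real.one_le_exp (abs_nonneg u)
  have hey : Real.exp (-2 * |u|) = (Real.exp |u| ^ 2)⁻¹ := by
    rw [neg_mul, Real.exp_neg, ← Real.exp_nat_mul]; push_cast; rfl
  have hey1 : Real.exp (-1 * |u|) = (Real.exp |u|)⁻¹ := by rw [neg_one_mul, Real.exp_neg]
  rw [hey] at hl
  rw [hey1]
  set z := Complex.sinh (u + α * Complex.I) with hz
  set y := Real.exp |u| with hy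
  set p := s * t with hpd
  set S := ‖s‖ with hS
  have hS0 : 0 < S := norm_pos_of_mem_cone hs
  set E := Complex.exp (p * (γ + Complex.I * z)) with hE
  -- The cut-off log(1/x) is where the larger of |s|e^{|u|} and |st|e^{|u|} reaches one: beyond it
  -- the exponential e^{st(γ + iz)} or the denominators differ appreciably from their limits.
  set x := max S ‖p‖ with hx
  have hx0 : 0 < x := hS0.trans_le (le_max_left _ _)
  have hy0 : 0 < y := by linarith
  have hzp : 0 < ‖z‖ := lt_of_lt_of_le (by positivity) hz1
  have hz0 : z ≠ 0 := norm_pos_iff.1 hzp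
  -- The integrand is the tail integrand times E/(ab). Inside the cut-off E is close to 1 for small
  -- |st|e^{|u|}, and a and b are close to 1 up to terms of order |s|²e^{2|u|}, e^{−|u|} and |s|².
  set a := -(z ^ 2 * (s ^ 2 + k z)) with ha
  set b := -(s ^ 2 * (z ^ 2 - c) - 1) with hb
  have hzz : (σ * y / 2) ^ 2 ≤ ‖z‖ ^ 2 := by gcongr
  have hale : c₂ * (1 + (S * y) ^ 2) ≤ ‖a‖ := by
    rw [ha, norm_neg, norm_mul, norm_pow]
    calc _ = (σ * y / 2) ^ 2 * (c₁ * (S ^ 2 + (y ^ 2)⁻¹)) := by rw [hc₂]; field_simp; ring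
      _ ≤ _ := by gcongr
  have hale' : c₂ ≤ ‖a‖ := (le_mul_of_one_le_right hc₂0.le (by linarith only [sq_nonneg (S * y)])).trans hale
  have hble : c₃ ≤ ‖b‖ := by
    rw [hb, norm_neg]
    have : 0 ≤ S ^ 2 * ‖z‖ ^ 2 := by positivity
    exact (le_mul_of_one_le_right hc₃0.le (by linarith only [this])).trans hden
  have ha0 : a ≠ 0 := norm_pos_iff.1 (by linarith)
  have hb0 : b ≠ 0 := norm_pos_iff.1 (by linarith)
  have hs2k : s ^ 2 + k z ≠ 0 := fun h => ha0 (by rw [ha, h]; ring)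
  have hb0' : s ^ 2 * (z ^ 2 - c) - 1 ≠ 0 := neg_ne_zero.1 hb0
  have hfac : defect k c z / ((s ^ 2 + k z) * (s ^ 2 * (z ^ 2 - c) - 1)) * E *
      Complex.cosh (u + α * Complex.I) =
      tailIntegrand k c (u + α * Complex.I) * (E / (a * b)) := by
    rw [tailIntegrand, ← hz, ha, hb]
    field_simp
  have hadiff : ‖a - 1‖ ≤ (S * y) ^ 2 + K * y⁻¹ := by
    have h1 := D.norm_sq_mul_add_one_mul_le hd hmem
    have h2 : ‖z ^ 2 * k z + 1‖ ≤ K * y⁻¹ := by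
      rw [hK, ← div_eq_mul_inv, div_div, le_div_iff₀ (by positivity)]
      linarith only [mul_le_mul_of_nonneg_left hz1 (norm_nonneg (z ^ 2 * k z + 1)), h1]
    rw [show a - 1 = -(s ^ 2 * z ^ 2 + (z ^ 2 * k z + 1)) by rw [ha]; ring, norm_neg]
    refine (norm_add_le _ _).trans (add_le_add ?_ h2)
    rw [norm_mul, norm_pow, norm_pow, mul_pow]
    gcongr
  have hbdiff : ‖b - 1‖ ≤ (S * y) ^ 2 + S ^ 2 * c := by
    rw [show b - 1 = -(s ^ 2 * z ^ 2) + s ^ 2 * c by rw [hb]; ring]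
    refine (norm_add_le _ _).trans ?_
    rw [norm_neg, norm_mul, norm_mul, norm_pow, norm_pow, mul_pow, Complex.norm_real,
      Real.norm_of_nonneg hc]
    gcongr
  have hEdiff : ‖E - 1‖ ≤ 4 * (‖p‖ * y) := by
    refine (norm_exp_sub_one_le_two_mul hE1).trans ?_
    have h2 : ‖(γ : ℂ) + Complex.I * z‖ ≤ 2 * y := by
      refine (norm_add_le _ _).trans ?_
      rw [Complex.norm_real, Real.norm_of_nonneg hγ0, norm_mul, Complex.norm_I, one_mul]
      linarith
    rw [norm_mul]
    linarith only [mul_le_mul_of_nonneg_left h2 (norm_nonneg p)]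
  rw [hfac]
  set U := Real.log x⁻¹ with hU
  have hxy : x * y = Real.exp (|u| - U) := by
    rw [hU, Real.exp_sub, Real.exp_log (inv_pos.2 hx0), hy]; field_simp
  by_cases hu : u ∈ Icc (-U) U
  · rw [indicator_of_mem hu, ← mul_sub_one, norm_mul]
    have hu' : |u| ≤ U := abs_le.2 hu
    have hxe : Real.exp (-1 * |(|u|) - U|) = x * y := by
      rw [abs_of_nonpos (by linarith), hxy]; ring_nf
    have hxy1 : x * y ≤ 1 := by rw [hxy]; exact Real.exp_le_one_iff.2 (by linarith)
    have hSy : S * y ≤ x * y := by gcongr; exact le_max_left _ _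
    have hpy : ‖p‖ * y ≤ x * y := by gcongr; exact le_max_right _ _
    have hSy0 : 0 < S * y := by positivity
    have hSy2 : (S * y) ^ 2 ≤ x * y :=
      (pow_le_of_le_one hSy0.le (hSy.trans hxy1) two_ne_zero).trans hSy
    have hSc : S ^ 2 * c ≤ x * y * c := by
      gcongr
      exact (pow_le_of_le_one hS0.le hs1 two_ne_zero).trans
        ((le_mul_of_one_le_right hS0.le hy1).trans hSy)
    rw [hxe]
    gcongr
    have e : E / (a * b) - 1 = (E - 1) / (a * b) + (-(a - 1) / (a * b) + -(b - 1) / b) := by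
      field_simp; ring
    have hX : 0 < x * y := by positivity
    have hY : 0 < y⁻¹ := by positivity
    set X := x * y with hXd
    set Y := y⁻¹ with hYd
    rw [e]
    calc _ ≤ ‖(E - 1) / (a * b)‖ + (‖-(a - 1) / (a * b)‖ + ‖-(b - 1) / b‖) :=
          (norm_add_le _ _).trans (by gcongr; exact norm_add_le _ _)
      _ = ‖E - 1‖ / (‖a‖ * ‖b‖) + (‖a - 1‖ / (‖a‖ * ‖b‖) + ‖b - 1‖ / ‖b‖) := by
          simp only [norm_div, norm_mul, norm_neg]
      _ ≤ 4 * X / (c₂ * c₃) + ((X + K * Y) / (c₂ * c₃) + (X + X * c) / c₃) := by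
          gcongr
          · exact hEdiff.trans (by gcongr)
          · exact hadiff.trans (by gcongr)
          · exact hbdiff.trans (by gcongr)
      _ ≤ ((5 + K) / (c₂ * c₃) + (1 + c) / c₃) * (X + Y) := by
          have h1 : 0 ≤ K * X / (c₂ * c₃) := by positivity
          have h2 : 0 ≤ 5 * Y / (c₂ * c₃) := by positivity
          have h3 : 0 ≤ (1 + c) / c₃ * Y := by positivity
          have e : ((5 + K) / (c₂ * c₃) + (1 + c) / c₃) * (X + Y) =
            4 * X / (c₂ * c₃) + ((X + K * Y) / (c₂ * c₃) + (X + X * c) / c₃) +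
              K * X / (c₂ * c₃) + 5 * Y / (c₂ * c₃) + (1 + c) / c₃ * Y := by ring
          linarith
      _ ≤ _ := by
          have : 0 ≤ (16 / σ + 1) / (c₂ * c₃) := by positivity
          exact mul_le_mul_of_nonneg_right (by linarith) (by linarith)
  -- Beyond the cut-off the decay comes from a if |s| is the larger of the two numbers, and from the
  -- exponential if |st| is.
  · rw [indicator_of_notMem hu, sub_zero, norm_mul]
    have hu' : U < |u| := by
      by_contra h
      exact hu (abs_le.1 (not_lt.1 h))
    have hxe : Real.exp (-1 * |(|u|) - U|) = (x * y)⁻¹ := by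
      rw [abs_of_pos (by linarith), hxy, ← Real.exp_neg]; ring_nf
    rw [hxe]
    gcongr
    have hX : 0 < x * y := by positivity
    have hkey : x * y * ‖E‖ ≤ (16 / σ + 1) * (1 + (S * y) ^ 2) := by
      have hσ16 : 0 < 16 / σ := by positivity
      rcases max_choice S ‖p‖ with h | h
      · rw [hx, h]
        have : 0 < S * y := by positivity
        calc S * y * ‖E‖ ≤ S * y * 1 := by gcongr
          _ ≤ 1 * (1 + (S * y) ^ 2) := by linarith only [sq_nonneg (S * y - 1 / 2), sq_nonneg (S * y)]
          _ ≤ _ := by gcongr; linarith only [hσ16]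
      · rw [hx, h]
        have h3 := mul_norm_exp_exponent_le hγ hp hσ hcosh hσ1
        rw [(line_re_im u α).1] at h3
        have h4 : ‖p‖ * y * ‖E‖ = 16 / σ * (σ * (‖p‖ * y) / 16 * ‖E‖) := by field_simp
        rw [h4]
        calc 16 / σ * (σ * (‖p‖ * y) / 16 * ‖E‖) ≤ (16 / σ + 1) * 1 := by
              gcongr
              linarith only
          _ ≤ _ := by gcongr; linarith only [sq_nonneg (S * y)]
    have h1 : ‖E / (a * b)‖ ≤ (16 / σ + 1) / (c₂ * c₃) * (x * y)⁻¹ := by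
      rw [norm_div, norm_mul, div_le_iff₀ (by positivity), ← div_eq_mul_inv, div_div,
        div_mul_eq_mul_div, le_div_iff₀ (by positivity)]
      calc _ = x * y * ‖E‖ * (c₂ * c₃) := by ring
        _ ≤ (16 / σ + 1) * (1 + (S * y) ^ 2) * (c₂ * c₃) := by gcongr
        _ = (16 / σ + 1) * (c₂ * (1 + (S * y) ^ 2) * c₃) := by ring
        _ ≤ _ := by gcongr
    refine h1.trans ?_
    have h2 : 0 ≤ (5 + K) / (c₂ * c₃) + (1 + c) / c₃ := by positivity
    have h3 : 0 < y⁻¹ := by positivity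
    have h4 : 0 < (x * y)⁻¹ := by positivity
    have h5 : 0 ≤ (16 / σ + 1) / (c₂ * c₃) := by positivity
    gcongr <;> linarith

/-- A defect O(|z|⁻³) leaves an integrand that is only bounded for |u| ≤ log(1/|s|), and absolute
values would lose a logarithm. The tail integrand on the cut-off interval is subtracted: its
integral is bounded by cancellation, and the difference is integrable uniformly in s, t and γ. -/
theorem lowContourBound_of_tail {α c₁ ρ B c : ℝ} (hα0 : 0 < α) (hα : α ≤ κ / 4) (hρ : ρ ≤ 1 / 2)
    (hl : IsLowContour k α c₁ ρ) (hc : 0 ≤ c) (hd : 2 ≤ d)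
    (hk : ∀ z ∈ lowerRegion κ, ‖z ^ 2 * defect k c z‖ * (1 + ‖z‖) ≤ B) :
    LowContourBound k α ρ fun x => x ^ 3 := by
  obtain ⟨hc₁, hline⟩ := hl
  have hσ := D.sin_pos hα0 hα
  have hπ := Real.pi_pos
  obtain ⟨M, hM, hmain⟩ := D.exists_defect_integrand_sub_le hα0 hα hc₁ hc hd
  have hB : 0 ≤ B := (norm_nonneg _).trans
    (D.norm_tailIntegrand_le hk (w := 0) (by simpa using hπ.le) (by have := D.pos; simp; linarith))
  set J := ∫ u : ℝ, Real.exp (-1 * |u|) with hJ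
  have hJ0 : 0 ≤ J := integral_nonneg_exp _
  refine ⟨B * (M * (2 * J + J)) + B * 6 + 1, by positivity, fun γ hγ0 hγ s hs t hp => ?_⟩
  have hx : 0 < ‖s‖ := norm_pos_of_mem_cone hs
  have hs1 : ‖s‖ < 1 := norm_lt_one_of_mem_cone hσ (Real.sin_le_one α) hρ hs
  have hpt := fun u : ℝ => hmain γ ρ s t hγ0 hγ hs1.le hs hp u (hline s hs u)
  rw [D.contourPart_eq_defect hα0 hα hc hs hγ hp hc₁ (hline s hs)]
  set F := fun u : ℝ => defect k c (Complex.sinh (u + α * Complex.I)) /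
        ((s ^ 2 + k (Complex.sinh (u + α * Complex.I))) *
          (s ^ 2 * (Complex.sinh (u + α * Complex.I) ^ 2 - c) - 1)) *
        Complex.exp (s * t * (γ + Complex.I * Complex.sinh (u + α * Complex.I))) *
        Complex.cosh (u + α * Complex.I) with hF
  set U := Real.log (max ‖s‖ ‖s * t‖)⁻¹ with hU
  set T := (Icc (-U) U).indicator fun u : ℝ => tailIntegrand k c (u + α * Complex.I) with hT
  have hsinh : Continuous fun u : ℝ => Complex.sinh (u + α * Complex.I) :=
    Complex.continuous_sinh.comp (by fun_prop)
  have hcosh : Continuous fun u : ℝ => Complex.cosh (u + α * Complex.I) :=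
    Complex.continuous_cosh.comp (by fun_prop)
  have hkc : Continuous fun u : ℝ => k (Complex.sinh (u + α * Complex.I)) :=
    continuous_iff_continuousAt.2 fun u =>
      (D.differentiableAt (D.sinh_line_mem hα0 hα u)).continuousAt.comp
        (f := fun u : ℝ => Complex.sinh (u + α * Complex.I)) hsinh.continuousAt
  have hdc : Continuous fun u : ℝ => defect k c (Complex.sinh (u + α * Complex.I)) :=
    (hkc.mul ((hsinh.pow 2).sub continuous_const)).add continuous_const
  have htc : Continuous fun u : ℝ => tailIntegrand k c (u + α * Complex.I) :=
    ((hsinh.pow 2).mul hdc).mul hcosh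
  have hFc : Continuous F := by
    refine ((hdc.div ((continuous_const.add hkc).mul
      ((continuous_const.mul ((hsinh.pow 2).sub continuous_const)).sub continuous_const))
      fun u => ?_).mul ((continuous_const.mul (continuous_const.add
        (continuous_const.mul hsinh))).cexp)).mul hcosh
    obtain ⟨-, -, hz3⟩ := D.sinh_line_bounds hα0 hα u
    have hden := model_denominator_ge hσ (Real.sin_le_one α) hc hs hz3
    have h1 : s ^ 2 * (Complex.sinh (u + α * Complex.I) ^ 2 - c) - 1 ≠ 0 :=
      norm_pos_iff.1 (lt_of_lt_of_le (by positivity) hden)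
    have h2 := (D.norm_quotient_line_le hα0 hα hc₁ (norm_pos_iff.1 hx) (hline s hs u)).1
    exact mul_ne_zero h2 h1
  have hTi : Integrable T :=
    (integrable_indicator_iff measurableSet_Icc).2 htc.continuousOn.integrableOn_Icc
  set G : ℝ → ℝ := fun u => B * (M * ((Real.exp (-1 * |u - U|) + Real.exp (-1 * |u + U|)) +
    Real.exp (-1 * |u|))) with hG
  have hi1 := integrable_exp_neg_abs_sub one_pos U
  have hi2 := integrable_exp_neg_mul_abs (one_pos : (0 : ℝ) < 1)
  have hGi : Integrable G := ((hi1.add hi2).const_mul M).const_mul B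
  have hle : ∀ u, ‖F u - T u‖ ≤ G u := fun u => by
    refine (hpt u).trans ?_
    have h1 := exp_neg_abs_abs_sub_le (η := 1) u U
    simp only [hG]
    gcongr
    refine D.norm_tailIntegrand_le hk ?_ ?_
    · simp; linarith
    · simpa using hα
  have hFT : Integrable fun u => F u - T u :=
    hGi.mono' (hFc.aestronglyMeasurable.sub hTi.aestronglyMeasurable) (Eventually.of_forall hle)
  have hFi : Integrable F := by
    exact (hFT.add hTi).congr (Eventually.of_forall fun u => sub_add_cancel _ _)
  have h1 : ‖∫ u, (F u - T u)‖ ≤ B * (M * (2 * J + J)) := by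
    refine (norm_integral_le_of_norm_le hGi (Eventually.of_forall hle)).trans (le_of_eq ?_)
    simp only [hG]
    rw [integral_const_mul, integral_const_mul, integral_add hi1 hi2,
      integral_exp_neg_abs_sub one_pos]
  have h2 : ‖∫ u, T u‖ ≤ B * 6 := by
    rw [hT, integral_indicator measurableSet_Icc]
    rcases le_or_gt 0 U with h | h
    · rw [integral_Icc_eq_integral_Ioc, ← intervalIntegral.integral_of_le (by linarith)]
      exact D.norm_integral_tailIntegrand_le hα0 hα hk h
    · rw [Icc_eq_empty (by linarith)]
      simpa using hB
  have h3 : ‖∫ u, F u‖ ≤ B * (M * (2 * J + J)) + B * 6 := by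
    have : ∫ u, F u = (∫ u, (F u - T u)) + ∫ u, T u := by rw [integral_sub hFi hTi]; ring
    rw [this]
    exact (norm_add_le _ _).trans (add_le_add h1 h2)
  have h4 : 1 ≤ ‖(2 * Real.pi : ℂ)‖ := by
    rw [norm_mul, Complex.norm_real, Real.norm_of_nonneg Real.pi_pos.le]
    simp only [Complex.norm_ofNat]
    linarith [Real.pi_gt_three]
  rw [norm_mul, norm_neg, norm_div, norm_pow]
  calc _ ≤ ‖s‖ ^ 3 * (B * (M * (2 * J + J)) + B * 6) := by
        gcongr
        exact div_le_self (by positivity) h4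
    _ ≤ _ := by nlinarith [pow_pos hx 3]

end Dispersion

/-! ### The defect in terms of the moments, and the thin-tail remainder -/

theorem kernelMain_zero_eq {a : ℕ → ℝ} (h0 : a 0 = 1) (z : ℂ) :
    kernelMain (fun j => (a j : ℂ)) 0 z = -(1 / z ^ 2) := by
  simp [kernelMain, h0]

theorem defect_eq_of_two_moments {k : ℂ → ℂ} {a : ℕ → ℝ} (h0 : a 0 = 1) {z : ℂ} (hz : z ≠ 0) :
    defect k (3 * a 2) z = (k z - kernelMain (fun j => (a j : ℂ)) 1 z) *
      (z ^ 2 - (3 * a 2 : ℝ)) + ((3 * a 2 : ℝ) : ℂ) ^ 2 / z ^ 4 := by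
  simp only [kernelMain, defect, Finset.sum_range_succ, Finset.sum_range_zero, h0]
  push_cast
  field_simp
  ring

namespace Dispersion
variable {k : ℂ → ℂ} {κ d A : ℝ} {m₀ : ℝ → ℝ} (D : Dispersion k κ d A m₀)

theorem _root_.VlasovPoisson.KernelExpansion.exists_defect_two {a : ℕ → ℝ} (h0 : a 0 = 1)
    (h : KernelExpansion k κ a 0 fun x => 1 / x ^ 4) : ∃ B > 0, ∀ z ∈ lowerRegion κ, 1 ≤ ‖z‖ →
      ‖defect k 0 z‖ ≤ B * ‖z‖ ^ (-2 : ℝ) := by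
  obtain ⟨B, hB, hk⟩ := h
  refine ⟨B, hB, fun z hz h1 => ?_⟩
  have hx : 0 < ‖z‖ := by linarith
  have hz0 : z ≠ 0 := norm_pos_iff.1 hx
  have h2 := hk z hz h1
  rw [kernelMain_zero_eq h0] at h2
  have e : defect k 0 z = z ^ 2 * (k z - -(1 / z ^ 2)) := by
    rw [defect, Complex.ofReal_zero, sub_zero]; field_simp; ring
  have h4 : ‖z‖ ^ (-2 : ℝ) = (‖z‖ ^ 2)⁻¹ := by rw [Real.rpow_neg hx.le]; norm_cast
  rw [e, norm_mul, norm_pow, h4]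
  calc _ ≤ ‖z‖ ^ 2 * (B * (1 / ‖z‖ ^ 4)) := by gcongr
    _ = _ := by field_simp

theorem _root_.VlasovPoisson.KernelExpansion.exists_defect_four {a : ℕ → ℝ} (h0 : a 0 = 1)
    (h2 : 0 ≤ a 2)
    (h : KernelExpansion k κ a 1 fun x => x ^ (-(d + 1)) + (1 + Real.log x) / x ^ (2 * 1 + 4)) :
    ∃ B > 0, ∀ z ∈ lowerRegion κ, 1 ≤ ‖z‖ →
      ‖defect k (3 * a 2) z‖ ≤
        B * (‖z‖ ^ (-(d - 1)) + (1 + Real.log ‖z‖) * ‖z‖ ^ (-4 : ℝ)) := by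
  obtain ⟨B, hB, hk⟩ := h
  set c := 3 * a 2 with hc
  have hc0 : 0 ≤ c := by positivity
  refine ⟨B * (1 + c) + c ^ 2, by positivity, fun z hz h1 => ?_⟩
  have hx : 0 < ‖z‖ := by linarith
  have hz0 : z ≠ 0 := norm_pos_iff.1 hx
  have hL := Real.log_nonneg h1
  have h3 := hk z hz h1
  have h4 : ‖z‖ ^ (-4 : ℝ) = (‖z‖ ^ 4)⁻¹ := by rw [Real.rpow_neg hx.le]; norm_cast
  have h5 : ‖z‖ ^ (-(d - 1)) = ‖z‖ ^ 2 * ‖z‖ ^ (-(d + 1)) := by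
    rw [← Real.rpow_natCast ‖z‖ 2, ← Real.rpow_add hx]; congr 1; push_cast; ring
  have h6 : ‖z ^ 2 - (c : ℂ)‖ ≤ (1 + c) * ‖z‖ ^ 2 := by
    refine (norm_sub_le _ _).trans ?_
    rw [norm_pow, Complex.norm_real, Real.norm_of_nonneg hc0]
    nlinarith [one_le_pow₀ h1 (n := 2)]
  rw [hc, defect_eq_of_two_moments h0 hz0, ← hc]
  have h7 : 0 < ‖z‖ ^ (-(d + 1)) := Real.rpow_pos_of_pos hx _
  calc _ ≤ B * (‖z‖ ^ (-(d + 1)) + (1 + Real.log ‖z‖) / ‖z‖ ^ (2 * 1 + 4)) *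
        ((1 + c) * ‖z‖ ^ 2) + c ^ 2 / ‖z‖ ^ 4 := by
        refine (norm_add_le _ _).trans ?_
        rw [norm_mul, norm_div, norm_pow, norm_pow, Complex.norm_real, Real.norm_of_nonneg hc0]
        gcongr
    _ = B * (1 + c) * (‖z‖ ^ (-(d - 1)) + (1 + Real.log ‖z‖) * ‖z‖ ^ (-4 : ℝ)) +
        c ^ 2 * (1 * ‖z‖ ^ (-4 : ℝ)) := by
        rw [h4, h5]; field_simp; ring
    _ ≤ B * (1 + c) * (‖z‖ ^ (-(d - 1)) + (1 + Real.log ‖z‖) * ‖z‖ ^ (-4 : ℝ)) +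
        c ^ 2 * (‖z‖ ^ (-(d - 1)) + (1 + Real.log ‖z‖) * ‖z‖ ^ (-4 : ℝ)) := by
        have h8 : 0 < ‖z‖ ^ (-4 : ℝ) := Real.rpow_pos_of_pos hx _
        have h9 : 0 < ‖z‖ ^ (-(d - 1)) := Real.rpow_pos_of_pos hx _
        gcongr
        nlinarith
    _ = _ := by ring

include D

/-- The contribution of the contour in the thin-tail case. -/
theorem lowContourBound_thin {a : ℕ → ℝ} {α c₁ ρ : ℝ} (hα0 : 0 < α) (hα : α ≤ κ / 4)
    (hρ : ρ ≤ 1 / 2) (hl : IsLowContour k α c₁ ρ) (h0 : a 0 = 1) (h2 : 0 ≤ a 2) (hd : 3 ≤ d)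
    (he0 : KernelExpansion k κ a 0 fun x => 1 / x ^ 4)
    (he1 : 3 < d → KernelExpansion k κ a 1 fun x =>
      x ^ (-(d + 1)) + (1 + Real.log x) / x ^ (2 * 1 + 4)) :
    LowContourBound k α ρ fun x => x ^ (d - 1) + x ^ 3 := by
  have key : ∀ w : ℝ → ℝ, (∀ x : ℝ, 0 < x → w x ≤ x ^ (d - 1) + x ^ 3) →
      LowContourBound k α ρ w → LowContourBound k α ρ fun x => x ^ (d - 1) + x ^ 3 := by
    rintro w hw ⟨C, hC, h⟩
    refine ⟨C, hC, fun γ g0 g1 s hs t ht => (h γ g0 g1 s hs t ht).trans ?_⟩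
    gcongr
    exact hw _ (norm_pos_of_mem_cone hs)
  -- At d = 3 the bound x² = x^{d−1} from c = 0 is enough. For d > 3 the value c = 3a₂ cancels the
  -- next term; absolute values then suffice for d < 4, and cancellation is used for d ≥ 4.
  rcases hd.eq_or_lt with h3 | h3
  · obtain ⟨B, hB, hk⟩ := he0.exists_defect_two h0
    refine key _ (fun x hx => ?_) (D.lowContourBound_of_defect_two hα0 hα hl hB.le hk)
    rw [← h3, show (3 : ℝ) - 1 = (2 : ℕ) by norm_num, Real.rpow_natCast]
    linarith [pow_pos hx 3]
  obtain ⟨B, hB, hk⟩ := (he1 h3).exists_defect_four h0 h2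
  rcases lt_or_ge d 4 with h4 | h4
  · exact D.lowContourBound_of_defect_four hα0 hα hl hB.le (by positivity) h3 h4 hk
  set c := 3 * a 2 with hc
  have hc0 : 0 ≤ c := by positivity
  have hA := D.nonneg
  refine key _ (fun x hx => ?_) (D.lowContourBound_of_tail (B := 4 * B + 2 * (A * (1 + c) + 1))
    hα0 hα hρ hl hc0 (by linarith) fun z hz => ?_)
  · linarith [Real.rpow_pos_of_pos hx (d - 1)]
  rw [norm_mul, norm_pow]
  rcases le_or_gt 1 ‖z‖ with h1 | h1
  · have hx : 0 < ‖z‖ := by linarith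
    have hL := Real.log_nonneg h1
    have h5 := hk z hz h1
    have h6 : ‖z‖ ^ (-(d - 1)) ≤ (‖z‖ ^ 3)⁻¹ := by
      have e : (‖z‖ ^ 3)⁻¹ = ‖z‖ ^ (-3 : ℝ) := by rw [Real.rpow_neg hx.le]; norm_cast
      rw [e]
      exact Real.rpow_le_rpow_of_exponent_le h1 (by linarith)
    have h7 : (1 + Real.log ‖z‖) * ‖z‖ ^ (-4 : ℝ) ≤ (‖z‖ ^ 3)⁻¹ := by
      have e : ‖z‖ ^ (-4 : ℝ) = (‖z‖ ^ 4)⁻¹ := by rw [Real.rpow_neg hx.le]; norm_cast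
      have h8 : 1 + Real.log ‖z‖ ≤ ‖z‖ := by linarith [Real.log_le_sub_one_of_pos hx]
      calc _ ≤ ‖z‖ * (‖z‖ ^ 4)⁻¹ := by rw [e]; gcongr
        _ = _ := by field_simp
    calc _ ≤ ‖z‖ ^ 2 * (B * ((‖z‖ ^ 3)⁻¹ + (‖z‖ ^ 3)⁻¹)) * (‖z‖ + ‖z‖) := by
          gcongr
          exact h5.trans (by gcongr)
      _ = 4 * B := by field_simp; ring
      _ ≤ _ := by linarith [(by positivity : 0 ≤ A * (1 + c) + 1)]
  · have h2 : ‖defect k c z‖ ≤ A * (1 + c) + 1 := by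
      have h4 : ‖k z‖ ≤ A := (D.bound z hz).trans (div_le_self hA.le (by nlinarith [norm_nonneg z]))
      rw [defect]
      refine (norm_add_le _ _).trans ?_
      rw [norm_mul, norm_one]
      have h5 : ‖z ^ 2 - (c : ℂ)‖ ≤ 1 + c := by
        refine (norm_sub_le _ _).trans ?_
        rw [norm_pow, Complex.norm_real, Real.norm_of_nonneg hc0]
        nlinarith [norm_nonneg z]
      gcongr
    calc _ ≤ 1 ^ 2 * (A * (1 + c) + 1) * (1 + 1) := by gcongr
      _ ≤ _ := by linarith

end Dispersion

/-! ### Formal solution of the dispersion relation in powers of r² -/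

section expansion
open Polynomial

/-- The polynomial in `X = s²` whose smallness expresses that `p / s` is an approximate zero of
`s² + k`. -/
noncomputable def dispersionPoly (a : ℕ → ℝ) (n : ℕ) (p : ℝ[X]) : ℝ[X] :=
  ∑ j ∈ Finset.range (n + 1), C ((2 * j + 1) * a (2 * j)) * X ^ j * p ^ (2 * (n - j)) -
    p ^ (2 * n + 2)

/-- The expansion of the frequency, as a polynomial in `X = r²`. -/
noncomputable def freqPoly (a : ℕ → ℝ) : ℕ → ℝ[X]
  | 0 => 1
  | n + 1 => freqPoly a n +
      C ((dispersionPoly a (n + 1) (freqPoly a n)).coeff (n + 1) / 2) * X ^ (n + 1)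

theorem dispersionPoly_succ (a : ℕ → ℝ) (n : ℕ) (p : ℝ[X]) :
    dispersionPoly a (n + 1) p = p ^ 2 * dispersionPoly a n p +
      C ((2 * (n + 1 : ℕ) + 1) * a (2 * (n + 1))) * X ^ (n + 1) := by
  rw [dispersionPoly, dispersionPoly, Finset.sum_range_succ, Nat.sub_self, mul_zero, pow_zero,
    mul_one, mul_sub, Finset.mul_sum]
  have : ∀ j ∈ Finset.range (n + 1), C ((2 * (j : ℝ) + 1) * a (2 * j)) * X ^ j *
      p ^ (2 * (n + 1 - j)) =
      p ^ 2 * (C ((2 * (j : ℝ) + 1) * a (2 * j)) * X ^ j * p ^ (2 * (n - j))) := fun j hj => by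
    have hj' : j ≤ n := Nat.lt_succ_iff.1 (Finset.mem_range.1 hj)
    rw [show 2 * (n + 1 - j) = 2 * (n - j) + 2 by omega]
    ring
  rw [Finset.sum_congr rfl this]
  ring

theorem freqPoly_congr {a a' : ℕ → ℝ} {n : ℕ} (h : ∀ i ≤ 2 * n, a i = a' i) :
    freqPoly a n = freqPoly a' n := by
  induction n with
  | zero => rfl
  | succ n ih =>
    have h1 := ih fun i hi => h i (by omega)
    have h2 : dispersionPoly a (n + 1) (freqPoly a n) =
        dispersionPoly a' (n + 1) (freqPoly a' n) := by
      rw [h1, dispersionPoly, dispersionPoly]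
      congr 1
      refine Finset.sum_congr rfl fun j hj => ?_
      rw [h (2 * j) (by have := Finset.mem_range.1 hj; omega)]
    rw [freqPoly, freqPoly, h2, h1]

theorem X_dvd_freqPoly_sub_one (a : ℕ → ℝ) (n : ℕ) : X ∣ freqPoly a n - 1 := by
  induction n with
  | zero => simp [freqPoly]
  | succ n ih =>
    rw [freqPoly, add_sub_right_comm]
    exact dvd_add ih (Dvd.dvd.mul_left (dvd_pow_self X (Nat.succ_ne_zero n)) _)

/-- The binomial expansion modulo X^{n+2}: as p ≡ 1 modulo X, the factor p^{m−1} of the linear term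
counts as 1. -/
theorem X_pow_dvd_perturb {p : ℝ[X]} (hp : X ∣ p - 1) (β : ℝ) (n m : ℕ) :
    X ^ (n + 2) ∣ (p + C β * X ^ (n + 1)) ^ m - p ^ m - (m : ℝ[X]) * C β * X ^ (n + 1) := by
  induction m with
  | zero => simp
  | succ m ih =>
    obtain ⟨u, hu⟩ := ih
    obtain ⟨v, hv⟩ := hp
    obtain ⟨w, hw⟩ : X ∣ p ^ m - 1 := by
      have := sub_dvd_pow_sub_pow p 1 m
      rw [one_pow] at this
      exact (Dvd.intro v hv.symm).trans this
    refine ⟨u * (p + C β * X ^ (n + 1)) + (m : ℝ[X]) * C β * v + C β * w +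
      (m : ℝ[X]) * C β ^ 2 * X ^ n, ?_⟩
    push_cast
    linear_combination (p + C β * X ^ (n + 1)) * hu + C β * X ^ (n + 1) * hw +
      (m : ℝ[X]) * C β * X ^ (n + 1) * hv

/-- Adding βX^{n+1} to p changes p^{2(n+1)} and p^{2(n+1)+2} by 2(n+1)βX^{n+1} and (2n+4)βX^{n+1}
modulo X^{n+2}, so the polynomial changes by −2βX^{n+1}. The choice of β as half of the first
nonzero coefficient cancels that coefficient. -/
theorem X_pow_dvd_dispersionPoly {a : ℕ → ℝ} (h0 : a 0 = 1) (n : ℕ) :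
    X ^ (n + 1) ∣ dispersionPoly a n (freqPoly a n) := by
  induction n with
  | zero => simp [dispersionPoly, freqPoly, h0]
  | succ n ih =>
    set p := freqPoly a n with hp
    have hp1 := X_dvd_freqPoly_sub_one a n
    rw [← hp] at hp1
    set Ψ := dispersionPoly a (n + 1) p with hΨ
    have h1 : X ^ (n + 1) ∣ Ψ := by
      rw [hΨ, dispersionPoly_succ]
      exact dvd_add (Dvd.dvd.mul_left ih _) (Dvd.intro_left _ rfl)
    set β := Ψ.coeff (n + 1) / 2 with hβ
    have h2 : X ^ (n + 2) ∣ Ψ - 2 * C β * X ^ (n + 1) := by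
      obtain ⟨q, hq⟩ := h1
      have h3 : Ψ.coeff (n + 1) = q.coeff 0 := by
        rw [hq, mul_comm, coeff_mul_X_pow', if_pos le_rfl, Nat.sub_self]
      have h4 : 2 * C β = C (q.coeff 0) := by
        rw [hβ, h3, ← C_ofNat, ← C_mul]; congr 1; ring
      obtain ⟨v, hv⟩ : X ∣ q - C (q.coeff 0) := X_dvd_iff.2 (by simp)
      refine ⟨v, ?_⟩
      rw [h4]
      linear_combination hq + X ^ (n + 1) * hv
    have h3 : X ^ (n + 2) ∣ dispersionPoly a (n + 1) (p + C β * X ^ (n + 1)) - Ψ +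
        2 * C β * X ^ (n + 1) := by
      -- The term j = 0 is split off. The terms with j ≥ 1 carry an additional factor X and do not
      -- change modulo X^{n+2}.
      rw [hΨ, dispersionPoly, dispersionPoly, Finset.sum_range_succ' _ (n + 1),
        Finset.sum_range_succ' _ (n + 1)]
      obtain ⟨v₁, h5⟩ := X_pow_dvd_perturb hp1 β n (2 * (n + 1 - 0))
      obtain ⟨v₂, h6⟩ := X_pow_dvd_perturb hp1 β n (2 * (n + 1) + 2)
      have h7 : X ^ (n + 2) ∣ ∑ j ∈ Finset.range (n + 1),
          C ((2 * ((j + 1 : ℕ) : ℝ) + 1) * a (2 * (j + 1))) * X ^ (j + 1) *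
            (p + C β * X ^ (n + 1)) ^ (2 * (n + 1 - (j + 1))) -
          ∑ j ∈ Finset.range (n + 1),
          C ((2 * ((j + 1 : ℕ) : ℝ) + 1) * a (2 * (j + 1))) * X ^ (j + 1) *
            p ^ (2 * (n + 1 - (j + 1))) := by
        rw [← Finset.sum_sub_distrib]
        refine Finset.dvd_sum fun j _ => ?_
        rw [← mul_sub]
        have h8 : X ^ (n + 1) ∣ (p + C β * X ^ (n + 1)) ^ (2 * (n + 1 - (j + 1))) -
            p ^ (2 * (n + 1 - (j + 1))) := by
          refine dvd_trans ?_ (sub_dvd_pow_sub_pow _ _ _)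
          rw [add_sub_cancel_left]
          exact Dvd.intro_left _ rfl
        rw [show n + 2 = 1 + (n + 1) by ring, pow_add, pow_one]
        exact mul_dvd_mul (Dvd.dvd.mul_left (dvd_pow_self X (Nat.succ_ne_zero j)) _) h8
      obtain ⟨v₃, h8⟩ := h7
      refine ⟨v₁ - v₂ + v₃, ?_⟩
      simp only [Nat.cast_zero, mul_zero, zero_add, one_mul, h0, C_1, pow_zero] at h5 h6 ⊢
      push_cast at h5 h6 h8 ⊢
      linear_combination h5 - h6 + h8
    have e : freqPoly a (n + 1) = p + C β * X ^ (n + 1) := rfl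
    rw [e]
    have := dvd_add h2 h3
    rwa [show Ψ - 2 * C β * X ^ (n + 1) + (dispersionPoly a (n + 1) (p + C β * X ^ (n + 1)) - Ψ +
      2 * C β * X ^ (n + 1)) = dispersionPoly a (n + 1) (p + C β * X ^ (n + 1)) by ring] at this

/-- The coefficients of the expansion of the frequency, as functions of the moments. -/
noncomputable def freqCoeff (j : ℕ) (x : Fin (2 * j + 1) → ℝ) : ℝ :=
  -- The value 0 beyond order 2j is a filler: by `freqPoly_congr` it does not influence the
  -- polynomial.
  (freqPoly (fun i => if h : i < 2 * j + 1 then x ⟨i, h⟩ else 0) j).coeff j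

theorem freqPoly_natDegree_le (a : ℕ → ℝ) (n : ℕ) : (freqPoly a n).natDegree ≤ n := by
  induction n with
  | zero => simp [freqPoly]
  | succ n ih =>
    rw [freqPoly]
    exact (natDegree_add_le_of_degree_le (ih.trans n.le_succ) (natDegree_C_mul_X_pow_le _ _))

theorem freqPoly_succ (a : ℕ → ℝ) (n : ℕ) : freqPoly a (n + 1) = freqPoly a n +
    C (freqCoeff (n + 1) fun i => a i) * X ^ (n + 1) := by
  have h : freqPoly (fun i => if i < 2 * (n + 1) + 1 then a i else 0) (n + 1) =
      freqPoly a (n + 1) := freqPoly_congr fun i hi => by rw [if_pos (by omega)]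
  have h1 : freqCoeff (n + 1) (fun i => a i) = (freqPoly a (n + 1)).coeff (n + 1) := by
    rw [← h, freqCoeff]; simp
  have h2 : (freqPoly a n).coeff (n + 1) = 0 :=
    coeff_eq_zero_of_natDegree_lt (Nat.lt_succ_of_le (freqPoly_natDegree_le a n))
  rw [h1, freqPoly, coeff_add, h2, coeff_C_mul, coeff_X_pow, if_pos rfl]
  simp

theorem eval_freqPoly (a : ℕ → ℝ) (n : ℕ) (r : ℝ) : (freqPoly a n).eval (r ^ 2) =
    1 + ∑ j ∈ Finset.Icc 1 n, freqCoeff j (fun i => a i) * r ^ (2 * j) := by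
  induction n with
  | zero => simp [freqPoly]
  | succ n ih =>
    rw [freqPoly_succ, Finset.sum_Icc_succ_top (by omega), eval_add, ih]
    simp only [eval_mul, eval_C, eval_pow, eval_X, ← pow_mul]
    ring

theorem eval_freqPoly_one {a : ℕ → ℝ} (h0 : a 0 = 1) (r : ℝ) :
    (freqPoly a 1).eval (r ^ 2) = 1 + 3 * a 2 * r ^ 2 / 2 := by
  simp only [freqPoly, dispersionPoly, Finset.sum_range_succ, Finset.sum_range_zero, one_pow, h0]
  simp [coeff_one]
  ring

end expansion

/-! ### Weights, and the approximation of the frequency -/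

/-- The weights `θ x^q + x^m (1 + η log (1 / x))`. -/
noncomputable def powLogWeight (θ q : ℝ) (m : ℕ) (η x : ℝ) : ℝ :=
  θ * x ^ q + x ^ m * (1 + η * Real.log x⁻¹)

theorem log_inv_nonneg {x : ℝ} (hx : 0 < x) (hx1 : x ≤ 1) : 0 ≤ Real.log x⁻¹ :=
  Real.log_nonneg (one_le_inv_iff₀.2 ⟨hx, hx1⟩)

section weight
variable {θ q η : ℝ} {m : ℕ} (hθ : 0 ≤ θ) (hη : 0 ≤ η)
include hθ hη

theorem pow_le_powLogWeight {x : ℝ} (hx : 0 < x) (hx1 : x ≤ 1) :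
    x ^ m ≤ powLogWeight θ q m η x := by
  have h1 : 0 ≤ θ * x ^ q := mul_nonneg hθ (Real.rpow_nonneg hx.le _)
  have h2 : 0 ≤ η * Real.log x⁻¹ := mul_nonneg hη (log_inv_nonneg hx hx1)
  have h3 : 0 < x ^ m := pow_pos hx m
  rw [powLogWeight]
  nlinarith

theorem powLogWeight_pos {x : ℝ} (hx : 0 < x) (hx1 : x ≤ 1) : 0 < powLogWeight θ q m η x :=
  (pow_pos hx m).trans_le (pow_le_powLogWeight hθ hη hx hx1)

/-- Comparable arguments have comparable weights, as required on discs of radius proportional to r.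
The parameters θ and η act as switches, so that the expansions with and without power term or
logarithm are treated at once. -/
theorem powLogWeight_doubling (hq : 0 ≤ q) {x y : ℝ} (hx : 0 < x) (hx1 : x ≤ 1) (hy : y ≤ 2 * x)
    (hxy : x ≤ 2 * y) :
    powLogWeight θ q m η y ≤ (2 ^ q + 2 ^ m * (1 + η)) * powLogWeight θ q m η x := by
  have hy0 : 0 < y := by linarith
  have hL := log_inv_nonneg hx hx1
  have h1 : y ^ q ≤ 2 ^ q * x ^ q := by
    rw [← Real.mul_rpow two_pos.le hx.le]; exact Real.rpow_le_rpow hy0.le hy hq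
  have h2 : y ^ m ≤ 2 ^ m * x ^ m := by rw [← mul_pow]; exact pow_le_pow_left₀ hy0.le hy m
  have h3 : Real.log y⁻¹ ≤ 1 + Real.log x⁻¹ := by
    have h4 : y⁻¹ ≤ 2 * x⁻¹ := by
      rw [← div_eq_mul_inv, le_div_iff₀ hx, inv_mul_le_iff₀ hy0]; linarith
    refine (Real.log_le_log (inv_pos.2 hy0) h4).trans ?_
    rw [Real.log_mul two_ne_zero (inv_pos.2 hx).ne']
    linarith [Real.log_two_lt_d9]
  have h5 : 1 + η * Real.log y⁻¹ ≤ (1 + η) * (1 + η * Real.log x⁻¹) := by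
    nlinarith [mul_le_mul_of_nonneg_left h3 hη, mul_nonneg (mul_nonneg hη hη) hL]
  have hxq := Real.rpow_pos_of_pos hx q
  have hxm := pow_pos hx m
  have h2q : (0 : ℝ) < 2 ^ q := Real.rpow_pos_of_pos two_pos q
  have hLη : 0 ≤ η * Real.log x⁻¹ := mul_nonneg hη hL
  rw [powLogWeight, powLogWeight]
  calc _ ≤ θ * (2 ^ q * x ^ q) + 2 ^ m * x ^ m * ((1 + η) * (1 + η * Real.log x⁻¹)) := by
        refine add_le_add (mul_le_mul_of_nonneg_left h1 hθ) ?_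
        exact (mul_le_mul_of_nonneg_left h5 (pow_pos hy0 m).le).trans
          (mul_le_mul_of_nonneg_right h2 (by positivity))
    _ ≤ _ := by
        have e1 : 0 ≤ 2 ^ q * (x ^ m * (1 + η * Real.log x⁻¹)) := by positivity
        have e2 : 0 ≤ 2 ^ m * (1 + η) * (θ * x ^ q) := by positivity
        linarith

/-- The error of the kernel at a point of modulus about 1/x equals x² times the frequency weight at
x up to constants; the factor x² is the size of s² in the dispersion relation. -/
theorem error_le_powLogWeight {d : ℝ} (hd : 0 ≤ d) {x y : ℝ} (hx : 0 < x) (hx1 : x ≤ 1 / 2)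
    (hy : 1 / (2 * x) ≤ y) (hy2 : y ≤ 2 / x) :
    θ * y ^ (-(d + 1)) + (1 + η * Real.log y) / y ^ (m + 2) ≤
      (2 ^ (d + 1) + 2 ^ (m + 2) * (1 + η)) * (x ^ 2 * powLogWeight θ (d - 1) m η x) := by
  have h0 : 0 < 1 / (2 * x) := by positivity
  have hy0 : 0 < y := h0.trans_le hy
  have hL := log_inv_nonneg hx (by linarith)
  have h1 : y ^ (-(d + 1)) ≤ 2 ^ (d + 1) * (x ^ 2 * x ^ (d - 1)) := by
    calc y ^ (-(d + 1)) ≤ (1 / (2 * x)) ^ (-(d + 1)) :=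
          Real.rpow_le_rpow_of_nonpos h0 hy (by linarith)
      _ = (2 * x) ^ (d + 1) := by
          rw [one_div, Real.inv_rpow (by positivity), Real.rpow_neg (by positivity), inv_inv]
      _ = 2 ^ (d + 1) * (x ^ 2 * x ^ (d - 1)) := by
          rw [Real.mul_rpow two_pos.le hx.le, ← Real.rpow_natCast x 2, ← Real.rpow_add hx]
          congr 2; push_cast; ring
  have h2 : 1 + η * Real.log y ≤ (1 + η) * (1 + η * Real.log x⁻¹) := by
    have h3 : Real.log y ≤ 1 + Real.log x⁻¹ := by
      refine (Real.log_le_log hy0 hy2).trans ?_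
      rw [div_eq_mul_inv, Real.log_mul two_ne_zero (inv_pos.2 hx).ne']
      linarith [Real.log_two_lt_d9]
    nlinarith [mul_le_mul_of_nonneg_left h3 hη, mul_nonneg (mul_nonneg hη hη) hL]
  have h3 : (y ^ (m + 2))⁻¹ ≤ 2 ^ (m + 2) * (x ^ 2 * x ^ m) := by
    rw [← inv_pow, ← pow_add, add_comm 2 m, ← mul_pow]
    refine pow_le_pow_left₀ (inv_pos.2 hy0).le ?_ _
    rw [inv_le_comm₀ hy0 (by positivity), ← one_div]
    exact hy
  have hLη : 0 ≤ η * Real.log x⁻¹ := mul_nonneg hη hL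
  have hxq := Real.rpow_pos_of_pos hx (d - 1)
  have h2q : (0 : ℝ) < 2 ^ (d + 1) := Real.rpow_pos_of_pos two_pos _
  rw [powLogWeight, div_eq_mul_inv]
  calc _ ≤ θ * (2 ^ (d + 1) * (x ^ 2 * x ^ (d - 1))) +
        (1 + η) * (1 + η * Real.log x⁻¹) * (2 ^ (m + 2) * (x ^ 2 * x ^ m)) := by
        refine add_le_add (mul_le_mul_of_nonneg_left h1 hθ) ?_
        exact (mul_le_mul_of_nonneg_right h2 (by positivity)).trans
          (mul_le_mul_of_nonneg_left h3 (by positivity))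
    _ ≤ _ := by
        have e1 : 0 ≤ 2 ^ (d + 1) * (x ^ 2 * (x ^ m * (1 + η * Real.log x⁻¹))) := by positivity
        have e2 : 0 ≤ 2 ^ (m + 2) * (1 + η) * (x ^ 2 * (θ * x ^ (d - 1))) := by positivity
        linarith

end weight

theorem exists_norm_aeval_le (q : Polynomial ℝ) :
    ∃ M > 0, ∀ x : ℂ, ‖x‖ ≤ 1 → ‖Polynomial.aeval x q‖ ≤ M := by
  obtain ⟨M, hM⟩ := (isCompact_closedBall (0 : ℂ) 1).exists_bound_of_continuousOn
    (f := fun x : ℂ => Polynomial.aeval x q) q.continuous_aeval.continuousOn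
  refine ⟨max M 1, by positivity, fun x hx => (hM x ?_).trans (le_max_left _ _)⟩
  simpa using hx

/-- Inserting z = P(s²)/s into the truncated relation and clearing denominators; the form of
`dispersionPoly` is chosen for this identity. -/
theorem sq_add_kernelMain_eq (a : ℕ → ℝ) (n : ℕ) (P : Polynomial ℝ) {s : ℂ} (hs : s ≠ 0)
    (hp : Polynomial.aeval (s ^ 2) P ≠ 0) :
    s ^ 2 + kernelMain (fun j => (a j : ℂ)) n (Polynomial.aeval (s ^ 2) P / s) =
      -(s ^ 2 / Polynomial.aeval (s ^ 2) P ^ (2 * n + 2)) *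
        Polynomial.aeval (s ^ 2) (dispersionPoly a n P) := by
  rw [kernelMain, dispersionPoly, map_sub, map_sum, mul_sub, Finset.mul_sum, sub_eq_add_neg,
    add_comm, map_pow]
  set p := Polynomial.aeval (s ^ 2) P with hpd
  congr 1
  · rw [← Finset.sum_neg_distrib]
    refine Finset.sum_congr rfl fun j hj => ?_
    have hj' : j ≤ n := Nat.lt_succ_iff.1 (Finset.mem_range.1 hj)
    rw [map_mul, map_mul, map_pow, map_pow, Polynomial.aeval_X, Polynomial.aeval_C, ← hpd,
      show 2 * n + 2 = 2 * j + 2 + 2 * (n - j) by omega, pow_add p]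
    simp only [Complex.coe_algebraMap]
    push_cast
    rw [div_pow]
    field_simp
    ring
  · field_simp

namespace Branch
variable {k : ℂ → ℂ} {κ δ ρ : ℝ} {F V : ℂ → ℂ} (Br : Branch k κ δ ρ F V)
include Br

/-- For p = P(s²) the truncated relation is satisfied up to |s|²|s|^{2n+2}, and the kernel error at
|p/s| of order 1/|s| adds |s|² times the weight. By `norm_div_inv_sub_le` the error of the frequency
is this total divided by |s|². -/
theorem exists_norm_freq_sub_le {a : ℕ → ℝ} (h0 : a 0 = 1) {n : ℕ} {d θ η : ℝ} (hd : 0 ≤ d)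
    (hθ : 0 ≤ θ) (hη : 0 ≤ η)
    (hk : KernelExpansion k κ a n fun x =>
      θ * x ^ (-(d + 1)) + (1 + η * Real.log x) / x ^ (2 * n + 4)) :
    ∃ C > 0, ∃ ρ' > 0, ρ' ≤ ρ / 2 ∧ ∀ s ∈ cone (δ / 8) ρ',
      ‖branchFreq V s - Polynomial.aeval (s ^ 2) (freqPoly a n)‖ ≤
        C * powLogWeight θ (d - 1) (2 * n + 2) η ‖s‖ := by
  have hδ := Br.pos
  have hδ1 := Br.le_one
  obtain ⟨B, hB, hkB⟩ := hk
  obtain ⟨v, hv⟩ := X_dvd_freqPoly_sub_one a n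
  obtain ⟨u, hu⟩ := X_pow_dvd_dispersionPoly h0 n
  obtain ⟨M₁, hM₁, hv1⟩ := exists_norm_aeval_le v
  obtain ⟨M₂, hM₂, hu1⟩ := exists_norm_aeval_le u
  set K : ℝ := 2 ^ (d + 1) + 2 ^ (2 * n + 2 + 2) * (1 + η) with hK
  have hK0 : 0 < K := by positivity
  refine ⟨16 * (2 ^ (2 * n + 2) * M₂ + B * K), by positivity, min (ρ / 2) (δ / (64 * M₁)),
    lt_min (half_pos Br.rho_pos) (by positivity), min_le_left _ _, fun s hs' => ?_⟩
  have hs : s ∈ cone (δ / 8) (ρ / 2) := ⟨hs'.1, hs'.2.1, hs'.2.2.trans_le (min_le_left _ _)⟩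
  have hsre : s.re < δ / (64 * M₁) := hs'.2.2.trans_le (min_le_right _ _)
  have hs0 := norm_pos_of_mem_cone hs
  have hsne : s ≠ 0 := norm_pos_iff.1 hs0
  have hs2 := norm_le_of_mem_cone (by linarith) hs
  have hs12 : ‖s‖ < 1 / 2 := by linarith [hs.2.2, Br.rho_le]
  have hsq1 : ‖s ^ 2‖ ≤ 1 := by rw [norm_pow]; exact pow_le_one₀ hs0.le (by linarith)
  set p := Polynomial.aeval (s ^ 2) (freqPoly a n) with hp
  have hp1 : ‖p - 1‖ ≤ δ / 32 := by
    have e : p - 1 = s ^ 2 * Polynomial.aeval (s ^ 2) v := by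
      have := congrArg (Polynomial.aeval (s ^ 2)) hv
      rwa [map_sub, map_one, map_mul, Polynomial.aeval_X] at this
    rw [lt_div_iff₀ (by positivity)] at hsre
    rw [e, norm_mul, norm_pow]
    calc _ ≤ ‖s‖ ^ 1 * M₁ :=
          mul_le_mul (pow_le_pow_of_le_one hs0.le (by linarith) one_le_two) (hv1 _ hsq1)
            (norm_nonneg _) (by positivity)
      _ ≤ _ := by rw [pow_one]; nlinarith
  have hpge : 1 / 2 ≤ ‖p‖ := by
    have := norm_sub_norm_le 1 p
    rw [norm_one, norm_sub_rev] at this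
    linarith
  have hple : ‖p‖ ≤ 2 := by
    have := norm_sub_norm_le p 1
    rw [norm_one] at this
    linarith
  have hpne : p ≠ 0 := norm_pos_iff.1 (by linarith)
  have hsp : s / p ∈ cone δ ρ := by
    refine ball_subset_cone_of_mem hδ1 hs ?_
    rw [mem_closedBall, dist_eq_norm, show s / p - s = s * (-(p - 1)) / p by field_simp; ring,
      norm_div, norm_mul, norm_neg, div_le_iff₀ (by linarith)]
    have h0 := hs.1
    have h1 : ‖s‖ * ‖p - 1‖ ≤ 2 * s.re * (δ / 32) := by gcongr
    have h2 : δ / 8 * s.re * (1 / 2) ≤ δ / 8 * s.re * ‖p‖ := by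
      gcongr
    linarith
  have hmain := Br.norm_div_inv_sub_le hs hsp hple
  have hz : p / s ∈ lowerRegion κ := by
    have := inv_mem_lowerRegion (hδ.trans_le Br.le) (cone_mono Br.le le_rfl hsp)
    rwa [inv_div] at this
  have hzn : ‖p / s‖ = ‖p‖ / ‖s‖ := norm_div _ _
  have hz1 : 1 / (2 * ‖s‖) ≤ ‖p / s‖ := by
    rw [hzn, div_le_div_iff₀ (by positivity) hs0]; nlinarith
  have hz2 : ‖p / s‖ ≤ 2 / ‖s‖ := by rw [hzn]; gcongr
  have hz3 : 1 ≤ ‖p / s‖ := le_trans (by rw [le_div_iff₀ (by positivity)]; linarith) hz1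
  have herr := hkB _ hz hz3
  have herr2 := error_le_powLogWeight (m := 2 * n + 2) hθ hη hd hs0 hs12.le hz1 hz2
  have hw := pow_le_powLogWeight (q := d - 1) (m := 2 * n + 2) hθ hη hs0 (by linarith)
  set W := powLogWeight θ (d - 1) (2 * n + 2) η ‖s‖ with hW
  have e : s ^ 2 + k (p / s) = -(s ^ 2 / p ^ (2 * n + 2)) *
      ((s ^ 2) ^ (n + 1) * Polynomial.aeval (s ^ 2) u) +
      (k (p / s) - kernelMain (fun j => (a j : ℂ)) n (p / s)) := by
    have h1 := sq_add_kernelMain_eq a n (freqPoly a n) hsne hpne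
    have h2 := congrArg (Polynomial.aeval (s ^ 2)) hu
    rw [map_mul, map_pow, Polynomial.aeval_X] at h2
    rw [← h2, ← h1]
    ring
  have hfin : ‖s ^ 2 + k (p / s)‖ ≤ ‖s‖ ^ 2 * ((2 ^ (2 * n + 2) * M₂ + B * K) * W) := by
    rw [e]
    calc _ ≤ ‖s‖ ^ 2 / (1 / 2) ^ (2 * n + 2) * (‖s‖ ^ (2 * n + 2) * M₂) +
          B * (K * (‖s‖ ^ 2 * W)) := by
          refine (norm_add_le _ _).trans (add_le_add ?_ (herr.trans ?_))
          · rw [norm_mul, norm_neg, norm_div, norm_mul, norm_pow, norm_pow, ← pow_mul, norm_pow,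
              show 2 * (n + 1) = 2 * n + 2 by ring]
            gcongr
            exact hu1 _ hsq1
          · gcongr
      _ = ‖s‖ ^ 2 * (2 ^ (2 * n + 2) * M₂ * ‖s‖ ^ (2 * n + 2) + B * K * W) := by
          rw [one_div, inv_pow]; field_simp
      _ ≤ ‖s‖ ^ 2 * (2 ^ (2 * n + 2) * M₂ * W + B * K * W) := by gcongr
      _ = _ := by ring
  refine hmain.trans ?_
  rw [div_le_iff₀ (by positivity)]
  calc _ ≤ 16 * (‖s‖ ^ 2 * ((2 ^ (2 * n + 2) * M₂ + B * K) * W)) := by gcongr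
    _ = _ := by ring

theorem differentiableOn_freq : DifferentiableOn ℂ (branchFreq V) (cone (δ / 8) (ρ / 2)) :=
  fun s hs => (differentiableWithinAt_id.div (Br.diff_inv s hs)
    (norm_pos_iff.1 (norm_pos_of_mem_cone (Br.mem s hs))))

/-- In this form the amplitude inherits every estimate of the frequency, since s times the
derivative is controlled by Cauchy's estimate on a slightly smaller sector. -/
theorem amp_eq {s : ℂ} (hs : s ∈ cone (δ / 8) (ρ / 2)) :
    branchAmp V s = branchFreq V s - s * deriv (branchFreq V) s := by
  have hV : V s ≠ 0 := norm_pos_iff.1 (norm_pos_of_mem_cone (Br.mem s hs))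
  have hd := Br.diff_inv.differentiableAt ((isOpen_cone _ _).mem_nhds hs)
  have h := (hasDerivAt_id s).div hd.hasDerivAt hV
  have e : deriv (branchFreq V) s = (1 * V s - s * deriv V s) / V s ^ 2 := h.deriv
  rw [e, branchAmp, branchFreq]
  field_simp
  ring

end Branch

/-! ### From sectors to symbol bounds and to regularity at r = 0 -/

section cone
variable {g : ℂ → ℂ} {δ ρ C : ℝ} (hδ : 0 < δ) (hδ1 : δ ≤ 1)
include hδ hδ1

theorem symbolBound_of_cone {θ q η : ℝ} {m : ℕ} (hθ : 0 ≤ θ) (hη : 0 ≤ η) (hq : 0 ≤ q)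
    (hρ : ρ ≤ 1) (hC : 0 ≤ C) (hg : DifferentiableOn ℂ g (cone δ ρ))
    (hb : ∀ s ∈ cone δ ρ, ‖g s‖ ≤ C * powLogWeight θ q m η ‖s‖) :
    SymbolBound (cauchyConst (δ / 4) * (C * (2 ^ q + 2 ^ m * (1 + η)))) (fun r : ℝ => g r) (ρ / 2)
      (powLogWeight θ q m η) := by
  refine symbolBound_of_holomorphic (by positivity) fun r hr => ?_
  have hsub := ball_subset_cone hδ hδ1 hr
  refine ⟨hg.mono hsub, fun s hs => (hb s (hsub hs)).trans ?_⟩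
  rw [mul_assoc]
  refine mul_le_mul_of_nonneg_left ?_ hC
  rw [mem_ball, dist_eq_norm] at hs
  have h1 := norm_sub_norm_le s r
  have h2 := norm_sub_norm_le (r : ℂ) s
  rw [norm_sub_rev (r : ℂ)] at h2
  rw [Complex.norm_real, Real.norm_of_nonneg hr.1.le] at h1 h2
  have h3 : δ / 4 * r ≤ 1 / 4 * r := by have := hr.1; gcongr
  have := hr.1
  exact powLogWeight_doubling hθ hη hq hr.1 (by linarith [hr.2]) (by linarith) (by linarith)

theorem norm_mul_deriv_le_of_cone {w : ℝ → ℝ} {K : ℝ} (hC : 0 ≤ C)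
    (hw : ∀ x y : ℝ, 0 < x → x < ρ → y ≤ 2 * x → x ≤ 2 * y → w y ≤ K * w x)
    (hg : DifferentiableOn ℂ g (cone δ ρ)) (hb : ∀ s ∈ cone δ ρ, ‖g s‖ ≤ C * w ‖s‖) {s : ℂ}
    (hs : s ∈ cone (δ / 8) (ρ / 2)) : ‖s * deriv g s‖ ≤ 32 / δ * (C * K) * w ‖s‖ := by
  have hs0 := norm_pos_of_mem_cone hs
  have hs2 := norm_le_of_mem_cone (by linarith) hs
  have hre := hs.1
  have hR : 0 < δ / 8 * s.re := by positivity
  have hsub := ball_subset_closedBall.trans (ball_subset_cone_of_mem hδ1 hs)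
  have hle := Complex.re_le_norm s
  have h := norm_deriv_le_of_ball hR (hg.mono hsub) (M := C * K * w ‖s‖) fun v hv => by
    refine (hb v (hsub hv)).trans ?_
    rw [mul_assoc]
    refine mul_le_mul_of_nonneg_left ?_ hC
    rw [mem_ball, dist_eq_norm] at hv
    have h1 := norm_sub_norm_le v s
    have h2 := norm_sub_norm_le s v
    rw [norm_sub_rev s] at h2
    have h3 : δ / 8 * s.re ≤ 1 / 8 * s.re := by gcongr
    exact hw _ _ hs0 (by linarith [hs.2.2]) (by linarith) (by linarith)
  rw [norm_mul]
  have hM : 0 ≤ C * K * w ‖s‖ := by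
    have := (norm_nonneg _).trans h
    rw [le_div_iff₀ hR] at this
    linarith
  calc _ ≤ 2 * s.re * (2 * (C * K * w ‖s‖) / (δ / 8 * s.re)) := by gcongr
    _ = _ := by field_simp; ring

omit hδ hδ1 in
theorem hasDerivAt_of_cone (hδ : 0 < δ) (hg : DifferentiableOn ℂ g (cone δ ρ)) {r : ℝ}
    (hr : r ∈ Ioo 0 ρ) :
    HasDerivAt (fun x : ℝ => g x) (deriv g r) r :=
  (hg.differentiableAt ((isOpen_cone δ ρ).mem_nhds (ofReal_mem_cone hδ hr))).hasDerivAt.comp_ofReal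

end cone

/-- A holomorphic function on a cone that vanishes to order `n + 1` at the vertex is `n` times
continuously differentiable up to the vertex. -/
theorem exists_contDiffOn_Ico (n : ℕ) : ∀ {g : ℂ → ℂ} {G : ℝ → ℂ} {δ ρ C : ℝ}, 0 < δ → δ ≤ 1 →
    0 < ρ → 0 ≤ C → DifferentiableOn ℂ g (cone δ ρ) →
    (∀ s ∈ cone δ ρ, ‖g s‖ ≤ C * ‖s‖ ^ (n + 1)) → G 0 = 0 → (∀ r ∈ Ioo 0 ρ, G r = g r) →
    ∃ ρ' > 0, ρ' ≤ ρ ∧ ContDiffOn ℝ n G (Ico 0 ρ') := by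
  have hbig : ∀ {n : ℕ} {g : ℂ → ℂ} {G : ℝ → ℂ} {δ ρ C : ℝ}, 0 < δ → 0 < ρ →
      (∀ s ∈ cone δ ρ, ‖g s‖ ≤ C * ‖s‖ ^ (n + 1)) → G 0 = 0 → (∀ r ∈ Ioo 0 ρ, G r = g r) →
      ∀ r ∈ Ico 0 ρ, ‖G r‖ ≤ C * r ^ (n + 1) := fun hδ hρ hb h0 hG r hr => by
    rcases hr.1.eq_or_lt with h | h
    · rw [← h, h0]; simp
    · rw [hG r ⟨h, hr.2⟩]
      have := hb r (ofReal_mem_cone hδ ⟨h, hr.2⟩)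
      rwa [Complex.norm_real, Real.norm_of_nonneg h.le] at this
  have hev : ∀ {g : ℂ → ℂ} {G : ℝ → ℂ} {ρ : ℝ}, (∀ r ∈ Ioo 0 ρ, G r = g r) → ∀ r ∈ Ioo 0 ρ,
      G =ᶠ[𝓝 r] fun x : ℝ => g x := fun hG r hr => by
    filter_upwards [Ioo_mem_nhds hr.1 hr.2] with x hx using hG x hx
  induction n with
  | zero =>
    intro g G δ ρ C hδ hδ1 hρ hC hg hb h0 hG
    refine ⟨ρ, hρ, le_rfl, contDiffOn_zero.2 fun r hr => ?_⟩
    rcases hr.1.eq_or_lt with h | h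
    · rw [← h, ContinuousWithinAt, h0, tendsto_zero_iff_norm_tendsto_zero]
      have hlim : Tendsto (fun r : ℝ => C * r) (𝓝[Ico 0 ρ] 0) (𝓝 0) := by
        have : Continuous fun r : ℝ => C * r := by fun_prop
        simpa using (this.tendsto 0).mono_left nhdsWithin_le_nhds
      refine squeeze_zero' (Eventually.of_forall fun _ => norm_nonneg _) ?_ hlim
      filter_upwards [self_mem_nhdsWithin] with x hx
      simpa using hbig hδ hρ hb h0 hG x hx
    · have hr' : r ∈ Ioo 0 ρ := ⟨h, hr.2⟩
      exact ((hasDerivAt_of_cone hδ hg hr').continuousAt.congr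
        (hev hG r hr').symm).continuousWithinAt
  | succ n ih =>
    intro g G δ ρ C hδ hδ1 hρ hC hg hb h0 hG
    -- The candidate derivative vanishes to one order less, by Cauchy's estimate on a smaller
    -- sector, and falls under the induction hypothesis.
    set G' : ℝ → ℂ := fun r => if r ∈ Ioo 0 ρ then deriv g r else 0 with hG'
    have hbG := hbig hδ hρ hb h0 hG
    have hg' : DifferentiableOn ℂ (deriv g) (cone (δ / 8) (ρ / 2)) :=
      ((hg.analyticOnNhd (isOpen_cone _ _)).deriv.differentiableOn).mono
        (cone_mono (by linarith) (by linarith))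
    obtain ⟨ρ', hρ'0, hρ', hc⟩ := ih (g := deriv g) (G := G') (δ := δ / 8) (ρ := ρ / 2)
      (C := 32 / δ * (C * 2 ^ (n + 2))) (by positivity) (by linarith) (by positivity)
      (by positivity) hg' (fun s hs => by
        have hs0 := norm_pos_of_mem_cone hs
        have h1 := norm_mul_deriv_le_of_cone hδ hδ1 (w := fun x => x ^ (n + 2)) (K := 2 ^ (n + 2))
          hC (fun x y hx _ hy hxy => by
            rw [← mul_pow]; exact pow_le_pow_left₀ (by linarith) hy _) hg hb hs
        rw [norm_mul] at h1
        refine le_of_mul_le_mul_left (h1.trans (le_of_eq ?_)) hs0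
        ring)
      (by simp [hG']) (fun r hr => by
        simp only [hG']; rw [if_pos ⟨hr.1, by linarith [hr.1, hr.2]⟩])
    refine ⟨ρ', hρ'0, by linarith, ?_⟩
    have hder : ∀ r ∈ Ico 0 ρ', HasDerivWithinAt G (G' r) (Ico 0 ρ') r := fun r hr => by
      rcases hr.1.eq_or_lt with h | h
      · have hz : G' r = 0 := by simp [hG', ← h]
        rw [hz, ← h]
        -- At the vertex the one-sided derivative is zero because G is O(x^{n+2}) with exponent at
        -- least two.
        have hO : G =O[𝓝[Ico 0 ρ'] (0 : ℝ)] fun x => ‖x - 0‖ ^ (n + 2) := by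
          refine Asymptotics.IsBigO.of_bound C ?_
          filter_upwards [self_mem_nhdsWithin] with x hx
          have := hbG x ⟨hx.1, by linarith [hx.2]⟩
          simpa [abs_of_nonneg hx.1] using this
        have := (hO.hasFDerivWithinAt (𝕜 := ℝ) ⟨le_rfl, hρ'0⟩ (by omega)).hasDerivWithinAt
        simpa using this
      · have hr' : r ∈ Ioo 0 ρ := ⟨h, by linarith [hr.2]⟩
        have e : G' r = deriv g r := by simp only [hG']; rw [if_pos hr']
        rw [e]
        exact ((hasDerivAt_of_cone hδ hg hr').congr_of_eventuallyEq (hev hG r hr')).hasDerivWithinAt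
    have hu : UniqueDiffOn ℝ (Ico 0 ρ') := uniqueDiffOn_Ico 0 ρ'
    push_cast
    rw [contDiffOn_succ_iff_derivWithin hu]
    refine ⟨fun r hr => (hder r hr).differentiableWithinAt, by simp, ?_⟩
    exact hc.congr fun r hr => (hder r hr).derivWithin (hu r hr)

/-- The function `f` on `(0, R]`, continued smoothly by the constant `c`. -/
noncomputable def cutoffExtend (f : ℂ → ℂ) (c : ℂ) (R r : ℝ) : ℂ :=
  if r ≤ 0 then c else c + (Real.smoothTransition ((2 * R - r) / R) : ℂ) * (f r - c)

theorem cutoffExtend_eq {f : ℂ → ℂ} {c : ℂ} {R r : ℝ} (hr : r ∈ Ioc 0 R) :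
    cutoffExtend f c R r = f r := by
  have hR : 0 < R := hr.1.trans_le hr.2
  have : 1 ≤ (2 * R - r) / R := by rw [le_div_iff₀ hR]; linarith [hr.2]
  rw [cutoffExtend, if_neg (not_le.2 hr.1), Real.smoothTransition.one_of_one_le this]
  simp

/-- Near the vertex f is a polynomial in r² plus a function vanishing to order n+1. Further out f is
holomorphic, and 2R < ρ ensures that the cut-off has vanished before the sector ends. -/
theorem contDiffOn_cutoffExtend {f : ℂ → ℂ} {c : ℂ} {R δ ρ δ' ρ' C : ℝ} {P : Polynomial ℝ} {n : ℕ}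
    (hδ : 0 < δ) (hR : 0 < R) (hRρ : 2 * R < ρ) (hf : DifferentiableOn ℂ f (cone δ ρ))
    (hP : Polynomial.aeval (0 : ℂ) P = c) (hδ' : 0 < δ') (hδδ : δ' ≤ δ) (hδ1 : δ' ≤ 1)
    (hρ' : 0 < ρ') (hρρ : ρ' ≤ ρ) (hC : 0 ≤ C) (hb : ∀ s ∈ cone δ' ρ',
      ‖f s - Polynomial.aeval (s ^ 2) P‖ ≤ C * ‖s‖ ^ (n + 1)) :
    ContDiffOn ℝ n (cutoffExtend f c R) (Ici 0) := by
  intro r hr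
  have hpoly : Differentiable ℂ fun s : ℂ => Polynomial.aeval (s ^ 2) P :=
    (P.differentiable_aeval (𝕜 := ℂ)).comp (g := fun x : ℂ => Polynomial.aeval x P)
      (f := fun s : ℂ => s ^ 2) (differentiable_pow 2)
  rcases (mem_Ici.1 hr).eq_or_lt with h | h
  · rw [← h]
    set G : ℝ → ℂ := fun x => if x ≤ 0 then 0 else f x - Polynomial.aeval ((x : ℂ) ^ 2) P with hG
    obtain ⟨ρ₁, hρ₁, hρ₁', hc⟩ := exists_contDiffOn_Ico n (G := G) hδ' hδ1 hρ' hC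
      ((hf.mono (cone_mono hδδ hρρ)).sub hpoly.differentiableOn) hb (by simp [hG])
      fun x hx => by simp only [hG]; rw [if_neg (not_le.2 hx.1)]; rfl
    have hp : ContDiffAt ℝ n (fun x : ℝ => Polynomial.aeval ((x : ℂ) ^ 2) P) 0 :=
      contDiffAt_ofReal (f := fun s : ℂ => Polynomial.aeval (s ^ 2) P) isOpen_univ
        hpoly.differentiableOn n (mem_univ _)
    have hsum := hp.contDiffWithinAt.add (hc 0 ⟨le_rfl, hρ₁⟩)
    have hmem : Ico 0 ρ₁ ∈ 𝓝[Ici 0] (0 : ℝ) := Ico_mem_nhdsGE hρ₁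
    have hsum' := hsum.mono_of_mem_nhdsWithin hmem
    refine hsum'.congr_of_eventuallyEq ?_ ?_
    · filter_upwards [Ico_mem_nhdsGE hR] with x hx
      rcases hx.1.eq_or_lt with h1 | h1
      · simp [cutoffExtend, hG, ← h1, hP]
      · rw [cutoffExtend_eq ⟨h1, hx.2.le⟩]
        simp only [hG]
        rw [if_neg (not_le.2 h1)]
        ring
    · simp [cutoffExtend, hG, hP]
  · refine ContDiffAt.contDiffWithinAt ?_
    rcases lt_or_ge r ρ with h1 | h1
    · have hfr : ContDiffAt ℝ n (fun x : ℝ => f x) r :=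
        contDiffAt_ofReal (isOpen_cone δ ρ) hf n (ofReal_mem_cone hδ ⟨h, h1⟩)
      have hχ : ContDiffAt ℝ n
          (fun x : ℝ => ((Real.smoothTransition ((2 * R - x) / R) : ℝ) : ℂ)) r :=
        Complex.ofRealCLM.contDiff.contDiffAt.comp r
          (Real.smoothTransition.contDiff.comp (by fun_prop)).contDiffAt
      refine (contDiffAt_const.add (hχ.mul (hfr.sub contDiffAt_const))).congr_of_eventuallyEq
        (f₁ := cutoffExtend f c R)
        (f := fun x : ℝ => c + (Real.smoothTransition ((2 * R - x) / R) : ℂ) * (f x - c)) ?_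
      filter_upwards [Ioi_mem_nhds h] with x hx
      rw [cutoffExtend, if_neg (not_le.2 hx)]
    · refine (contDiffAt_const (c := c)).congr_of_eventuallyEq ?_
      filter_upwards [Ioi_mem_nhds (hRρ.trans_le h1)] with x hx
      have hx' : 2 * R < x := hx
      have h0 : (2 * R - x) / R ≤ 0 := div_nonpos_of_nonpos_of_nonneg (by linarith) hR.le
      rw [cutoffExtend, Real.smoothTransition.zero_of_nonpos h0]
      simp

/-! ### Uniform choice of constants and radii -/

theorem KineticBound.mono {C C' : ℝ} {E : ℝ → ℝ → ℂ} {U U' : Set ℝ} {w w' : ℝ → ℝ}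
    (h : KineticBound C E U w) (hU : U' ⊆ U) (hw : ∀ r ∈ U', C * w r ≤ C' * w' r) :
    KineticBound C' E U' w' :=
  ⟨fun r hr => h.1 r (hU hr), fun τ hτ => (h.2.1 τ hτ).mono hU,
    fun a ha r hr => h.2.2.1 a ha r (hU hr),
    fun a b ha hb τ hτ r hr => (h.2.2.2 a b ha hb τ hτ r (hU hr)).trans (hw r hr)⟩

theorem deltaPlus_congr {f g : ℝ → ℂ} (h : ∀ τ : ℝ, 0 ≤ τ → f τ = g τ) :
    deltaPlus f = deltaPlus g := by
  funext φ
  rw [deltaPlus, deltaPlus]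
  congr 1
  exact setIntegral_congr_fun measurableSet_Ici fun τ hτ => by simp only [h τ hτ]

/-- Near `0` the weight `w` is bounded by a multiple of `w'`. -/
def WeightLE (w w' : ℝ → ℝ) : Prop :=
  ∃ M > 0, ∃ R > 0, ∀ r ∈ Ioo 0 R, 0 ≤ w r ∧ w r ≤ M * w' r

/-- One number C serves as the constant and as the reciprocal of the radius. Assertions valid for
all large C can be intersected finitely often, so that in the end a single C fits all of them. -/
theorem WeightLE.eventually {w w' : ℝ → ℝ} (h : WeightLE w w') (C₀ : ℝ) {R : ℝ} (hR : 0 < R) :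
    ∀ᶠ C in atTop, C⁻¹ ≤ R ∧ ∀ r ∈ Ioo 0 C⁻¹, C₀ * w r ≤ C * w' r := by
  obtain ⟨M, hM, R₁, hR₁, h⟩ := h
  filter_upwards [eventually_ge_atTop (max (max R⁻¹ R₁⁻¹) (|C₀| * M)), eventually_gt_atTop 0]
    with C hC hC0
  have h1 : R⁻¹ ≤ C := ((le_max_left _ _).trans (le_max_left _ _)).trans hC
  have h2 : R₁⁻¹ ≤ C := ((le_max_right _ _).trans (le_max_left _ _)).trans hC
  have h3 : |C₀| * M ≤ C := (le_max_right _ _).trans hC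
  refine ⟨inv_le_of_inv_le₀ hR h1, fun r hr => ?_⟩
  obtain ⟨h4, h5⟩ := h r ⟨hr.1, hr.2.trans_le (inv_le_of_inv_le₀ hR₁ h2)⟩
  have h6 : 0 ≤ w' r := nonneg_of_mul_nonneg_right (h4.trans h5) hM
  calc C₀ * w r ≤ |C₀| * (M * w' r) := mul_le_mul (le_abs_self _) h5 h4 (abs_nonneg _)
    _ = |C₀| * M * w' r := by ring
    _ ≤ _ := by gcongr

/-- The function `f` satisfies symbol bounds with weight `w` near `0`, as soon as the constant is
large. -/
theorem SymbolBound.eventually {F : Type*} [NormedAddCommGroup F] [NormedSpace ℝ F] {f : ℝ → F}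
    {C₀ R : ℝ} {w w' : ℝ → ℝ} (h : SymbolBound C₀ f R w) (hR : 0 < R) (hw : WeightLE w w') :
    ∀ᶠ C in atTop, SymbolBound C f C⁻¹ w' := by
  filter_upwards [hw.eventually C₀ hR] with C hC using h.mono hC.1 hC.2

theorem weightLE_powLog_log {q : ℝ} {m : ℕ} :
    WeightLE (powLogWeight 1 q m 1) fun r => r ^ q + r ^ m * Real.log (1 / r) := by
  -- For r < 1/e one has log(1/r) > 1, so 1 + log(1/r) ≤ 2 log(1/r).
  refine ⟨2, two_pos, Real.exp (-1), Real.exp_pos _, fun r hr => ?_⟩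
  have h1 : r ≤ 1 := hr.2.le.trans (Real.exp_le_one_iff.2 (by norm_num))
  have h2 : 1 ≤ Real.log (1 / r) := by
    rw [one_div, Real.log_inv]
    linarith [(Real.log_le_iff_le_exp hr.1).2 hr.2.le]
  refine ⟨(powLogWeight_pos zero_le_one zero_le_one hr.1 h1).le, ?_⟩
  rw [powLogWeight, ← one_div]
  have h3 := Real.rpow_pos_of_pos hr.1 q
  have h4 := pow_pos hr.1 m
  nlinarith

theorem weightLE_powLog_of_le {θ q : ℝ} {m : ℕ} {w' : ℝ → ℝ} (hθ : 0 ≤ θ)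
    (h : ∀ r : ℝ, 0 < r → r < 1 → θ * r ^ q + r ^ m ≤ w' r) :
    WeightLE (powLogWeight θ q m 0) w' := by
  refine ⟨1, one_pos, 1, one_pos, fun r hr => ?_⟩
  refine ⟨(powLogWeight_pos hθ le_rfl hr.1 hr.2.le).le, ?_⟩
  rw [powLogWeight, zero_mul, add_zero, mul_one, one_mul]
  exact h r hr.1 hr.2

namespace Branch
variable {k : ℂ → ℂ} {κ δ ρ : ℝ} {F V : ℂ → ℂ} (Br : Branch k κ δ ρ F V)

/-- The frequency is approximated by `P(s²)` up to an error of order `w`. -/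
def _root_.VlasovPoisson.FreqApprox (V : ℂ → ℂ) (δ ρ : ℝ) (P : Polynomial ℝ) (w : ℝ → ℝ) : Prop :=
  ∃ C > 0, ∃ ρ' > 0, ρ' ≤ ρ / 2 ∧ ∀ s ∈ cone (δ / 8) ρ',
    ‖branchFreq V s - Polynomial.aeval (s ^ 2) P‖ ≤ C * w ‖s‖

include Br

variable {P : Polynomial ℝ} {θ q η : ℝ} {m : ℕ}

theorem eventually_freq (hθ : 0 ≤ θ) (hη : 0 ≤ η) (hq : 0 ≤ q) {w' : ℝ → ℝ}
    (h : FreqApprox V δ ρ P (powLogWeight θ q m η)) (hw : WeightLE (powLogWeight θ q m η) w') :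
    ∀ᶠ C in atTop, SymbolBound C (fun r : ℝ => (branchFreq V r).re - P.eval (r ^ 2)) C⁻¹ w' ∧
      SymbolBound C (fun r : ℝ => (branchFreq V r).im) C⁻¹ w' := by
  obtain ⟨C, hC, ρ', hρ', hρ, hb⟩ := h
  have hδ := Br.pos
  have hpoly : Differentiable ℂ fun s : ℂ => Polynomial.aeval (s ^ 2) P :=
    (P.differentiable_aeval (𝕜 := ℂ)).comp (g := fun x : ℂ => Polynomial.aeval x P)
      (f := fun s : ℂ => s ^ 2) (differentiable_pow 2)
  have hS := symbolBound_of_cone (g := fun s => branchFreq V s - Polynomial.aeval (s ^ 2) P)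
    (by linarith) (by linarith [Br.le_one]) hθ hη hq (by linarith [Br.rho_le]) hC.le
    ((Br.differentiableOn_freq.mono (cone_mono le_rfl hρ)).sub hpoly.differentiableOn) hb
  have he : ∀ r : ℝ, Polynomial.aeval ((r : ℂ) ^ 2) P = ((P.eval (r ^ 2) : ℝ) : ℂ) := fun r => by
    rw [← Complex.ofReal_pow, ← Complex.coe_algebraMap, Polynomial.aeval_algebraMap_apply]
    rfl
  filter_upwards [hS.eventually (half_pos hρ') hw] with C hC
  exact ⟨hC.re.congr fun r _ => by rw [he, Complex.sub_re, Complex.ofReal_re],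
    hC.im.congr fun r _ => by rw [he, Complex.sub_im, Complex.ofReal_im, sub_zero]⟩

/-- The amplitude inherits the expansion of the frequency. -/
theorem exists_norm_amp_sub_le (hθ : 0 ≤ θ) (hη : 0 ≤ η) (hq : 0 ≤ q)
    (h : FreqApprox V δ ρ P (powLogWeight θ q m η)) :
    ∃ C > 0, ∃ ρ' > 0, ρ' ≤ ρ / 2 ∧ ∀ s ∈ cone (δ / 64) ρ', ‖branchAmp V s - 1 -
      Polynomial.aeval (s ^ 2) (P - 1 - 2 * Polynomial.X * Polynomial.derivative P)‖ ≤
        C * powLogWeight θ q m η ‖s‖ := by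
  obtain ⟨C, hC, ρ', hρ', hρ, hb⟩ := h
  have hδ := Br.pos
  set K : ℝ := 2 ^ q + 2 ^ m * (1 + η) with hK
  have hK0 : 0 < K := by positivity
  have hpoly : ∀ s : ℂ, HasDerivAt (fun s : ℂ => Polynomial.aeval (s ^ 2) P)
      (Polynomial.aeval (s ^ 2) (Polynomial.derivative P) * (2 * s)) s := fun s => by
    have h1 := (P.hasDerivAt_aeval (s ^ 2)).comp s (hasDerivAt_pow 2 s)
    have e : ((2 : ℕ) : ℂ) * s ^ (2 - 1) = 2 * s := by norm_num
    rw [e] at h1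
    exact h1
  refine ⟨C + 32 / (δ / 8) * (C * K), by positivity, ρ' / 2, by positivity, by linarith,
    fun s hs => ?_⟩
  have hs1 : s ∈ cone (δ / 8) ρ' := cone_mono (by linarith) (by linarith) hs
  have hs2 : s ∈ cone (δ / 8) (ρ / 2) := cone_mono le_rfl hρ hs1
  have hω := Br.differentiableOn_freq.differentiableAt ((isOpen_cone _ _).mem_nhds hs2)
  have h1 := norm_mul_deriv_le_of_cone
    (g := fun s => branchFreq V s - Polynomial.aeval (s ^ 2) P)
    (by linarith) (by linarith [Br.le_one]) (K := K) hC.le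
    (fun x y hx hx1 hy hxy =>
      powLogWeight_doubling hθ hη hq hx (by linarith [Br.rho_le]) hy hxy)
    ((Br.differentiableOn_freq.mono (cone_mono le_rfl hρ)).sub
      fun s _ => (hpoly s).differentiableAt.differentiableWithinAt) hb
    (s := s) (by rwa [show δ / 8 / 8 = δ / 64 by ring])
  have hd : deriv (fun s => branchFreq V s - Polynomial.aeval (s ^ 2) P) s =
      deriv (branchFreq V) s - Polynomial.aeval (s ^ 2) (Polynomial.derivative P) * (2 * s) :=
    (hω.hasDerivAt.sub (hpoly s)).deriv
  rw [hd] at h1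
  have e : branchAmp V s - 1 -
      Polynomial.aeval (s ^ 2) (P - 1 - 2 * Polynomial.X * Polynomial.derivative P) =
      (branchFreq V s - Polynomial.aeval (s ^ 2) P) - s * (deriv (branchFreq V) s -
        Polynomial.aeval (s ^ 2) (Polynomial.derivative P) * (2 * s)) := by
    rw [Br.amp_eq hs2]
    simp only [map_sub, map_mul, map_one, map_ofNat, Polynomial.aeval_X]
    ring
  rw [e, add_mul]
  exact (norm_sub_le _ _).trans (add_le_add (hb s hs1) h1)

theorem differentiableOn_amp :
    DifferentiableOn ℂ (fun s => branchAmp V s - 1) (cone (δ / 8) (ρ / 2)) := by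
  have h := Br.differentiableOn_freq
  have h2 := (h.analyticOnNhd (isOpen_cone _ _)).deriv.differentiableOn
  exact ((h.sub (differentiableOn_id.mul h2)).sub_const 1).congr fun s hs => by
    rw [Br.amp_eq hs]; rfl

theorem eventually_amp (hθ : 0 ≤ θ) (hη : 0 ≤ η) (hq : 0 ≤ q) {w' : ℝ → ℝ}
    (h : FreqApprox V δ ρ 1 (powLogWeight θ q m η)) (hw : WeightLE (powLogWeight θ q m η) w') :
    ∀ᶠ C in atTop, SymbolBound C (fun r : ℝ => branchAmp V r - 1) C⁻¹ w' := by
  obtain ⟨C, hC, ρ', hρ', hρ, hb⟩ := Br.exists_norm_amp_sub_le hθ hη hq h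
  have hδ := Br.pos
  refine SymbolBound.eventually (symbolBound_of_cone (δ := δ / 64) (by linarith)
    (by linarith [Br.le_one]) hθ hη hq (by linarith [Br.rho_le]) hC.le
    (Br.differentiableOn_amp.mono (cone_mono (by linarith) hρ)) fun s hs => ?_)
    (half_pos hρ') hw
  simpa using hb s hs

/-- Regularity of the continued frequency and amplitude at `r = 0`. -/
theorem contDiffOn_cutoffExtend {n : ℕ} (hq : (n : ℝ) + 1 ≤ q) (hn : 1 ≤ n)
    (h : FreqApprox V δ ρ P (powLogWeight 1 q (2 * n + 2) 1)) (hP : Polynomial.aeval (0 : ℂ) P = 1)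
    {R : ℝ} (hR : 0 < R) (hRρ : 2 * R < ρ / 2) :
    ContDiffOn ℝ n (cutoffExtend (branchFreq V) 1 R) (Ici 0) ∧
    ContDiffOn ℝ n (cutoffExtend (fun s => branchAmp V s - 1) 0 R) (Ici 0) := by
  have hδ := Br.pos
  have hδ1 := Br.le_one
  -- The logarithm costs at most one power: x^{2n+2}(1 + log(1/x)) ≤ x^{2n+1}, which is at most
  -- x^{n+1} because n ≥ 1.
  have hw : ∀ {x : ℝ}, 0 < x → x ≤ 1 → powLogWeight 1 q (2 * n + 2) 1 x ≤ 2 * x ^ (n + 1) := by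
    intro x hx hx1
    have h1 : x ^ q ≤ x ^ (n + 1) := by
      rw [← Real.rpow_natCast]
      exact Real.rpow_le_rpow_of_exponent_ge hx hx1 (by push_cast; exact hq)
    have h2 : 1 + Real.log x⁻¹ ≤ x⁻¹ := by linarith [Real.log_le_sub_one_of_pos (inv_pos.2 hx)]
    have h3 : x ^ (2 * n + 2) * (1 + 1 * Real.log x⁻¹) ≤ x ^ (n + 1) := by
      rw [one_mul]
      calc _ ≤ x ^ (2 * n + 2) * x⁻¹ := by gcongr
        _ = x ^ (2 * n + 1) := by rw [pow_succ x (2 * n + 1)]; field_simp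
        _ ≤ _ := pow_le_pow_of_le_one hx.le hx1 (by omega)
    rw [powLogWeight]
    linarith
  have hbd : ∀ {δ' ρ' C : ℝ} {f : ℂ → ℂ}, δ' ≤ 1 → ρ' ≤ 1 / 2 → 0 ≤ C →
      (∀ s ∈ cone δ' ρ', ‖f s‖ ≤ C * powLogWeight 1 q (2 * n + 2) 1 ‖s‖) →
      ∀ s ∈ cone δ' ρ', ‖f s‖ ≤ C * 2 * ‖s‖ ^ (n + 1) := by
    intro δ' ρ' C f h1 h2 hC hb s hs
    refine (hb s hs).trans ?_
    rw [mul_assoc]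
    refine mul_le_mul_of_nonneg_left (hw (norm_pos_of_mem_cone hs) ?_) hC
    linarith [norm_le_of_mem_cone h1 hs, hs.2.2]
  have hρ0 := Br.rho_le
  obtain ⟨C₂, hC₂, ρ₂, hρ₂, hρ₂', hb₂⟩ :=
    Br.exists_norm_amp_sub_le zero_le_one zero_le_one (by linarith [(Nat.cast_nonneg n : (0:ℝ) ≤ n)]) h
  obtain ⟨C₁, hC₁, ρ₁, hρ₁, hρ₁', hb₁⟩ := h
  refine ⟨VlasovPoisson.contDiffOn_cutoffExtend (δ' := δ / 8) (by linarith) hR hRρ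
    Br.differentiableOn_freq hP (by linarith) le_rfl (by linarith) hρ₁ hρ₁' (by positivity)
    (hbd (by linarith) (by linarith) hC₁.le hb₁), ?_⟩
  refine VlasovPoisson.contDiffOn_cutoffExtend (δ := δ / 8) (by linarith) hR hRρ
    Br.differentiableOn_amp (P := P - 1 - 2 * Polynomial.X * Polynomial.derivative P) ?_
    (by linarith) (by linarith) (by linarith) hρ₂ hρ₂' (by positivity)
    (hbd (by linarith) (by linarith) hC₂.le hb₂)
  simp only [map_sub, map_mul, map_one, Polynomial.aeval_X, hP]
  ring

end Branch

/-- The remainder in the low-frequency regime. -/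
theorem Dispersion.eventually_contourPart {k : ℂ → ℂ} {κ d A : ℝ} {m₀ : ℝ → ℝ}
    (D : Dispersion k κ d A m₀) {α c₁ ρ θ q η : ℝ} {m : ℕ} {w' : ℝ → ℝ} (hα0 : 0 < α)
    (hα : α ≤ κ / 4) (hρ0 : 0 < ρ) (hρ : ρ ≤ 1 / 2) (hl : IsLowContour k α c₁ ρ) (hθ : 0 ≤ θ)
    (hη : 0 ≤ η) (hq : 0 ≤ q) (h : LowContourBound k α ρ (powLogWeight θ q m η))
    (hw : WeightLE (powLogWeight θ q m η) w') :
    ∀ᶠ C in atTop, ∀ γ : ℝ, 0 ≤ γ → γ ≤ Real.sin α / 4 →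
      KineticBound C (fun r τ => contourPart k γ α r τ) (Ioo 0 C⁻¹) w' := by
  have hσ := D.sin_pos hα0 hα
  have hσ1 := Real.sin_le_one α
  obtain ⟨C, hC, hb⟩ := h
  obtain ⟨hc₁, hline⟩ := hl
  set σ := Real.sin α with hσd
  set δ := σ ^ 2 / 8 with hδ
  have hδ0 : 0 < δ := by positivity
  have hδ1 : δ ≤ 1 / 8 := by rw [hδ]; nlinarith
  have hδσ : δ / 4 ≤ σ / 24 := by rw [hδ]; nlinarith
  set K : ℝ := 2 ^ q + 2 ^ m * (1 + η) with hK
  have hsub : ∀ r ∈ Ioo 0 (ρ / 2), ball (r : ℂ) (δ / 4 * r) ⊆ cone δ ρ := fun r hr =>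
    ball_subset_cone hδ0 (by linarith) hr
  filter_upwards [hw.eventually (cauchyConst (δ / 4) * (1 + 2 / (δ / 4)) * (C * K)) (half_pos hρ0)]
    with C' hC' γ hγ0 hγ
  refine KineticBound.mono (D.kineticBound_contourPart (δ := δ / 4) (C := C * K)
    (U := Ioo 0 (ρ / 2)) hα0 hα hγ (by positivity) hδσ (fun r hr => hr.1) (fun r hr => ?_)
    fun r hr τ hτ t ht s hs => ?_) (Ioo_subset_Ioo_right hC'.1) hC'.2
  · refine ⟨4 * A / (c₁ * (r / 2) ^ 2), fun s hs u => ?_⟩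
    have hr0 := hr.1
    have hsc := hsub r hr hs
    have hsn : r / 2 ≤ ‖s‖ := by
      rw [mem_ball, dist_eq_norm, norm_sub_rev] at hs
      have h1 := norm_sub_norm_le (r : ℂ) s
      rw [Complex.norm_real, Real.norm_of_nonneg hr0.le] at h1
      nlinarith
    have h2 := D.norm_quotient_line_le hα0 hα hc₁
      (norm_pos_iff.1 (norm_pos_of_mem_cone hsc)) (hline s hsc u)
    refine ⟨h2.1, h2.2.trans ?_⟩
    have := D.nonneg
    gcongr
  · have hr0 := hr.1
    have hsc := hsub r hr hs
    rw [mem_ball, dist_eq_norm] at hs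
    have hp := (abs_im_mul_le_of_near hσ hσ1 (by positivity) hδσ hr0 hτ hs.le ht).1
    refine (hb γ hγ0 hγ s hsc t hp).trans ?_
    rw [mul_assoc]
    refine mul_le_mul_of_nonneg_left ?_ hC.le
    have h1 := norm_sub_norm_le s r
    have h2 := norm_sub_norm_le (r : ℂ) s
    rw [norm_sub_rev (r : ℂ)] at h2
    rw [Complex.norm_real, Real.norm_of_nonneg hr0.le] at h1 h2
    have h3 : δ / 4 * r ≤ 1 / 4 * r := by gcongr; linarith
    exact powLogWeight_doubling hθ hη hq hr0 (by linarith [hr.2]) (by linarith) (by linarith)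

theorem moment_two_nonneg {ϑ d : ℝ} {M₀ : E3 → ℝ} (h : IsAcceptable ϑ d M₀) :
    0 ≤ moment M₀ 2 :=
  integral_nonneg fun t => mul_nonneg (sq_nonneg t) (h.pos t).le

theorem KernelExpansion.congr {k : ℂ → ℂ} {κ : ℝ} {a : ℕ → ℝ} {n : ℕ} {e e' : ℝ → ℝ}
    (h : KernelExpansion k κ a n e) (he : ∀ x, e x = e' x) : KernelExpansion k κ a n e' := by
  rwa [show e' = e from funext fun x => (he x).symm]

theorem LowContourBound.congr {k : ℂ → ℂ} {α ρ : ℝ} {w w' : ℝ → ℝ}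
    (h : LowContourBound k α ρ w) (hw : ∀ x, w x = w' x) : LowContourBound k α ρ w' := by
  rwa [show w' = w from funext fun x => (hw x).symm]

theorem aeval_zero_freqPoly (a : ℕ → ℝ) (n : ℕ) :
    Polynomial.aeval (0 : ℂ) (freqPoly a n) = 1 := by
  obtain ⟨v, hv⟩ := X_dvd_freqPoly_sub_one a n
  have := congrArg (Polynomial.aeval (0 : ℂ)) hv
  rw [map_sub, map_mul, Polynomial.aeval_X, zero_mul, map_one] at this
  linear_combination this

theorem SymbolBound.restrict {F : Type*} [NormedAddCommGroup F] [NormedSpace ℝ F] {f g : ℝ → F}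
    {C R R' : ℝ} {w : ℝ → ℝ} (h : SymbolBound C f R w) (hR : R' ≤ R)
    (hfg : ∀ r ∈ Ioo 0 R', g r = f r) : SymbolBound C g R' w :=
  (h.mono hR fun _ _ => le_rfl).congr hfg

/-- An error of order r² absorbs the difference between the polynomial and 1. This is used at d = 3,
where the correction in a₂ has the size of the admitted error r^{d−1}. -/
theorem FreqApprox.freqPoly_of_one {V : ℂ → ℂ} {δ ρ q : ℝ} (hδ : δ ≤ 1) (hρ : ρ ≤ 1 / 2)
    (a : ℕ → ℝ) (n : ℕ) (h : FreqApprox V δ ρ 1 (powLogWeight 0 q 2 0)) :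
    FreqApprox V δ ρ (freqPoly a n) (powLogWeight 0 q 2 0) := by
  obtain ⟨C, hC, ρ', hρ', hρρ, hb⟩ := h
  obtain ⟨v, hv⟩ := X_dvd_freqPoly_sub_one a n
  obtain ⟨M, hM, hv1⟩ := exists_norm_aeval_le v
  refine ⟨C + M, by positivity, ρ', hρ', hρρ, fun s hs => ?_⟩
  have h1 := hb s hs
  have hs0 := norm_pos_of_mem_cone hs
  have hs1 : ‖s ^ 2‖ ≤ 1 := by
    rw [norm_pow]
    exact pow_le_one₀ hs0.le (by linarith [norm_le_of_mem_cone (by linarith) hs, hs.2.2])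
  have h2 := congrArg (Polynomial.aeval (s ^ 2)) hv
  rw [map_sub, map_mul, Polynomial.aeval_X] at h2
  have e : branchFreq V s - Polynomial.aeval (s ^ 2) (freqPoly a n) =
      (branchFreq V s - Polynomial.aeval (s ^ 2) (1 : Polynomial ℝ)) -
        s ^ 2 * Polynomial.aeval (s ^ 2) v := by rw [← h2]; ring
  have e2 : powLogWeight 0 q 2 0 ‖s‖ = ‖s‖ ^ 2 := by simp [powLogWeight]
  rw [e2] at h1 ⊢
  rw [e, add_mul]
  refine (norm_sub_le _ _).trans (add_le_add h1 ?_)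
  rw [norm_mul, norm_pow, mul_comm M]
  gcongr
  exact hv1 _ hs1

end VlasovPoisson

/-! ### Assembly of the theorem -/

theorem theorem1p1 :
    -- the universal expansion coefficients, as functions of the moments of order `≤ 2j`
    ∃ b : (j : ℕ) → (Fin (2 * j + 1) → ℝ) → ℝ,
    ∀ (ϑ d : ℝ) (M₀ : E3 → ℝ), 0 < ϑ → ϑ ≤ Real.pi / 4 → 1 < d → IsAcceptable ϑ d M₀ →
    ∃ (rbar C : ℝ) (ω m : ℝ → ℂ), 0 < rbar ∧
    ∀ r₀ : ℝ, 0 < r₀ → r₀ ≤ rbar →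
    ∃ γ₀ : ℝ, 0 < γ₀ ∧
      -- high frequency
      (∃ (Ch : ℝ) (Eh : ℝ → ℝ → ℂ),
        (∀ ξ : E3, r₀ / 2 < ‖ξ‖ →
          greenHat M₀ ξ = deltaPlus fun τ : ℝ =>
            (Real.exp (-γ₀ * τ * ‖ξ‖) : ℂ) * Eh ‖ξ‖ τ) ∧
        KineticBound Ch Eh (Set.Ioi (r₀ / 2)) (fun r => r⁻¹)) ∧
      -- low frequency
      (∃ El : ℝ → ℝ → ℂ,
        (∀ ξ : E3, 0 < ‖ξ‖ → ‖ξ‖ < 2 * r₀ →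
          greenHat M₀ ξ = deltaPlus fun τ : ℝ =>
            (((Complex.I * (1 + m ‖ξ‖) * Complex.exp (Complex.I * τ * ω ‖ξ‖)).re : ℝ) : ℂ) +
              (Real.exp (-γ₀ * τ * ‖ξ‖) : ℂ) * El ‖ξ‖ τ) ∧
        SymbolBound C m (2 * r₀) (fun r => r ^ (d - 1) + r ^ 2 * Real.log (1 / r)) ∧
        KineticBound C El (Set.Ioo 0 (2 * r₀))
          (fun r => r ^ (d - 1) + r ^ 2 * Real.log (1 / r)) ∧
        SymbolBound C (fun r => (ω r).re - 1) (2 * r₀)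
          (fun r => r ^ (d - 1) + r ^ 2 * Real.log (1 / r)) ∧
        SymbolBound C (fun r => (ω r).im) (2 * r₀)
          (fun r => r ^ (d - 1) + r ^ 2 * Real.log (1 / r)) ∧
        (∀ r ∈ Set.Ioo 0 (2 * r₀), 0 ≤ (ω r).im ∧
          (ω r).im ∈ Set.Icc
            (-Real.pi * deriv (reduced M₀) ((ω r).re / r) / (4 * r ^ 2))
            (-Real.pi * deriv (reduced M₀) ((ω r).re / r) / r ^ 2)) ∧
        -- the thin-tail case
        (3 ≤ d → HasFiniteMoment M₀ 2 →
          SymbolBound C m (2 * r₀) (fun r => r ^ 2) ∧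
          KineticBound C El (Set.Ioo 0 (2 * r₀)) (fun r => r ^ (d - 1) + r ^ 3) ∧
          SymbolBound C (fun r => (ω r).re - 1 - 3 * moment M₀ 2 * r ^ 2 / 2) (2 * r₀)
            (fun r => r ^ (d - 1) + r ^ 4 * Real.log (1 / r)) ∧
          SymbolBound C (fun r => (ω r).im) (2 * r₀)
            (fun r => r ^ (d - 1) + r ^ 4 * Real.log (1 / r))) ∧
        -- the higher-order expansions
        (∀ n : ℕ, 1 ≤ n → 2 * (n : ℝ) + 1 < d →
          ContDiffOn ℝ n m (Set.Ici 0) ∧ ContDiffOn ℝ n ω (Set.Ici 0) ∧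
          SymbolBound C
            (fun r => (ω r).re -
              (1 + ∑ j ∈ Finset.Icc 1 n, b j (fun i => moment M₀ i) * r ^ (2 * j))) (2 * r₀)
            (fun r => r ^ (d - 1) + r ^ (2 * n + 2) * Real.log (1 / r)) ∧
          SymbolBound C (fun r => (ω r).im) (2 * r₀)
            (fun r => r ^ (d - 1) + r ^ (2 * n + 2) * Real.log (1 / r)) ∧
          (d = 2 * (n : ℝ) + 3 → HasFiniteMoment M₀ (2 * n + 2) →
            SymbolBound C
              (fun r => (ω r).re -
                (1 + ∑ j ∈ Finset.Icc 1 n, b j (fun i => moment M₀ i) * r ^ (2 * j))) (2 * r₀)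
              (fun r => r ^ (d - 1) + r ^ (2 * n + 2)) ∧
            SymbolBound C (fun r => (ω r).im) (2 * r₀)
              (fun r => r ^ (d - 1) + r ^ (2 * n + 2))))) := by
  refine ⟨freqCoeff, fun ϑ d M₀ hϑ hϑ1 hd h => ?_⟩
  obtain ⟨k, κ, A, D, hker, hexp, hexp'⟩ := h.exists_dispersion hϑ hϑ1 hd
  obtain ⟨δ, ρ, F, V, Br⟩ := D.exists_branch
  obtain ⟨α, hα0, hα, ⟨c, hc, hkc⟩, ρ₁, hρ₁, hρ₁ρ, hzero⟩ := D.exists_low_strip Br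
  obtain ⟨ρ₂, hρ₂, c₁, hc₁, hline⟩ := D.exists_contour_lower_bound hα0 hα hc hkc
  have hσ := D.sin_pos hα0 hα
  have hρ₃ : 0 < min ρ₂ (1 / 2) := lt_min hρ₂ (by norm_num)
  have hl : IsLowContour k α c₁ (min ρ₂ (1 / 2)) :=
    ⟨hc₁, fun s hs => hline s (cone_mono le_rfl (min_le_left _ _) hs)⟩
  have ha0 : moment M₀ 0 = 1 := by simp [moment, integral_reduced h.integral_eq_one]
  have hd0 : 0 ≤ d - 1 := by linarith
  have hF : ∀ n : ℕ, 2 * (n : ℝ) + 1 < d →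
      FreqApprox V δ ρ (freqPoly (moment M₀) n) (powLogWeight 1 (d - 1) (2 * n + 2) 1) :=
    fun n hn => Br.exists_norm_freq_sub_le ha0 (by linarith) zero_le_one zero_le_one
      ((hexp n hn).congr fun x => by simp)
  have hF' : ∀ n : ℕ, 2 * (n : ℝ) + 3 ≤ d → HasFiniteMoment M₀ (2 * n + 2) →
      FreqApprox V δ ρ (freqPoly (moment M₀) n) (powLogWeight 0 (d - 1) (2 * n + 2) 0) :=
    fun n hn hm => Br.exists_norm_freq_sub_le ha0 (by linarith) le_rfl le_rfl
      ((hexp' n hn hm).congr fun x => by simp)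
  -- The low-frequency bounds are collected as assertions valid for all large C on the interval (0,
  -- 1/C), to be met simultaneously afterwards.
  have e1 := Br.eventually_amp zero_le_one zero_le_one hd0 (hF 0 (by simpa using hd))
    weightLE_powLog_log
  have e2 := Br.eventually_freq zero_le_one zero_le_one hd0 (hF 0 (by simpa using hd))
    weightLE_powLog_log
  have e3 := D.eventually_contourPart hα0 hα hρ₃ (min_le_right _ _) hl zero_le_one zero_le_one hd0
    ((D.lowContourBound_leading hα0 hα (min_le_right _ _) hl).congr fun x => by
      rw [powLogWeight, one_mul, one_mul]) weightLE_powLog_log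
  have e4 : ∀ᶠ C in Filter.atTop, 3 ≤ d → HasFiniteMoment M₀ 2 →
      SymbolBound C (fun r : ℝ => branchAmp V r - 1) C⁻¹ (fun r => r ^ 2) ∧
      (∀ γ : ℝ, 0 ≤ γ → γ ≤ Real.sin α / 4 → KineticBound C (fun r τ => contourPart k γ α r τ)
        (Set.Ioo 0 C⁻¹) fun r => r ^ (d - 1) + r ^ 3) ∧
      SymbolBound C (fun r : ℝ => (branchFreq V r).re - (freqPoly (moment M₀) 1).eval (r ^ 2)) C⁻¹
        (fun r => r ^ (d - 1) + r ^ 4 * Real.log (1 / r)) ∧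
      SymbolBound C (fun r : ℝ => (branchFreq V r).im) C⁻¹
        (fun r => r ^ (d - 1) + r ^ 4 * Real.log (1 / r)) := by
    by_cases hthin : 3 ≤ d ∧ HasFiniteMoment M₀ 2
    swap
    · exact Filter.Eventually.of_forall fun C h1 h2 => absurd ⟨h1, h2⟩ hthin
    obtain ⟨h3, hm2⟩ := hthin
    have hF0 := hF' 0 (by simpa using h3) hm2
    have f1 := Br.eventually_amp le_rfl le_rfl hd0 hF0 (w' := fun r => r ^ 2)
      (weightLE_powLog_of_le le_rfl fun r _ _ => by rw [zero_mul, zero_add])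
    have f2 := D.eventually_contourPart hα0 hα hρ₃ (min_le_right _ _) hl zero_le_one le_rfl hd0
      (m := 3) (w' := fun r => r ^ (d - 1) + r ^ 3)
      ((D.lowContourBound_thin hα0 hα (min_le_right _ _) hl ha0 (moment_two_nonneg h) h3
        (hexp' 0 (by simpa using h3) hm2) fun h4 => hexp 1 (by push_cast; linarith)).congr
        fun x => by simp [powLogWeight])
      (weightLE_powLog_of_le zero_le_one fun r _ _ => by rw [one_mul])
    have f3 : ∀ᶠ C in Filter.atTop,
        SymbolBound C (fun r : ℝ => (branchFreq V r).re - (freqPoly (moment M₀) 1).eval (r ^ 2)) C⁻¹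
          (fun r => r ^ (d - 1) + r ^ 4 * Real.log (1 / r)) ∧
        SymbolBound C (fun r : ℝ => (branchFreq V r).im) C⁻¹
          (fun r => r ^ (d - 1) + r ^ 4 * Real.log (1 / r)) := by
      -- At d = 3 the expansion of order n = 1 is not available, but r^{d−1} = r² already covers the
      -- term with a₂.
      rcases h3.eq_or_lt with h4 | h4
      · refine Br.eventually_freq le_rfl le_rfl hd0
          (hF0.freqPoly_of_one Br.le_one Br.rho_le (moment M₀) 1)
          (weightLE_powLog_of_le le_rfl fun r hr hr1 => ?_)
        rw [← h4, show (3 : ℝ) - 1 = (2 : ℕ) by norm_num, Real.rpow_natCast, one_div]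
        have := mul_nonneg (pow_pos hr 4).le (log_inv_nonneg hr hr1.le)
        linarith
      · exact Br.eventually_freq zero_le_one zero_le_one hd0 (hF 1 (by push_cast; linarith))
          weightLE_powLog_log
    filter_upwards [f1, f2, f3] with C g1 g2 g3 _ _ using ⟨g1, g2, g3⟩
  -- Only n < ⌈d⌉ can satisfy 2n + 1 < d, so finitely many expansions have to share the constant.
  have e5 : ∀ᶠ C in Filter.atTop, ∀ n ∈ Finset.range ⌈d⌉₊, 2 * (n : ℝ) + 1 < d →
      (SymbolBound C
        (fun r : ℝ => (branchFreq V r).re - (freqPoly (moment M₀) n).eval (r ^ 2)) C⁻¹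
          (fun r => r ^ (d - 1) + r ^ (2 * n + 2) * Real.log (1 / r)) ∧
        SymbolBound C (fun r : ℝ => (branchFreq V r).im) C⁻¹
          (fun r => r ^ (d - 1) + r ^ (2 * n + 2) * Real.log (1 / r))) ∧
      (d = 2 * (n : ℝ) + 3 → HasFiniteMoment M₀ (2 * n + 2) → SymbolBound C
        (fun r : ℝ => (branchFreq V r).re - (freqPoly (moment M₀) n).eval (r ^ 2)) C⁻¹
          (fun r => r ^ (d - 1) + r ^ (2 * n + 2)) ∧
        SymbolBound C (fun r : ℝ => (branchFreq V r).im) C⁻¹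
          (fun r => r ^ (d - 1) + r ^ (2 * n + 2))) := by
    rw [Filter.eventually_all_finset]
    intro n _
    by_cases hn : 2 * (n : ℝ) + 1 < d
    swap
    · exact Filter.Eventually.of_forall fun C h1 => absurd h1 hn
    have f1 := Br.eventually_freq zero_le_one zero_le_one hd0 (hF n hn) weightLE_powLog_log
    by_cases hm : d = 2 * (n : ℝ) + 3 ∧ HasFiniteMoment M₀ (2 * n + 2)
    · have f2 := Br.eventually_freq le_rfl le_rfl hd0 (hF' n hm.1.ge hm.2)
        (w' := fun r => r ^ (d - 1) + r ^ (2 * n + 2))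
        (weightLE_powLog_of_le le_rfl fun r hr _ => by
          linarith [Real.rpow_pos_of_pos hr (d - 1)])
      filter_upwards [f1, f2] with C g1 g2 _ using ⟨g1, fun _ _ => g2⟩
    · filter_upwards [f1] with C g1 _ using ⟨g1, fun h1 h2 => absurd ⟨h1, h2⟩ hm⟩
  have e6 : ∀ᶠ C : ℝ in Filter.atTop, C⁻¹ < min (min ρ₁ (ρ / 4)) (min ρ₂ (1 / 2)) :=
    tendsto_inv_atTop_zero.eventually (gt_mem_nhds (lt_min (lt_min hρ₁
      (by linarith [Br.rho_pos])) hρ₃))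
  obtain ⟨C, g1, g2, g3, g4, g5, g6, hC⟩ := (e1.and (e2.and (e3.and (e4.and (e5.and
    (e6.and (Filter.eventually_gt_atTop 0))))))).exists
  rw [lt_min_iff, lt_min_iff, lt_min_iff] at g6
  obtain ⟨⟨hCρ₁, hCρ⟩, hCρ₂, -⟩ := g6
  have hCi : 0 < C⁻¹ := inv_pos.2 hC
  -- Half of 1/C makes 2r₀ ≤ 1/C, so the continued functions agree with the branch on (0, 2r₀) and
  -- do not depend on r₀.
  refine ⟨C⁻¹ / 2, C, cutoffExtend (branchFreq V) 1 C⁻¹,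
    cutoffExtend (fun s => branchAmp V s - 1) 0 C⁻¹, half_pos hCi, fun r₀ hr₀ hr₀' => ?_⟩
  have hR : 2 * r₀ ≤ C⁻¹ := by linarith
  have hω : ∀ r ∈ Set.Ioo 0 (2 * r₀), cutoffExtend (branchFreq V) 1 C⁻¹ r = branchFreq V r :=
    fun r hr => cutoffExtend_eq ⟨hr.1, hr.2.le.trans hR⟩
  have hm : ∀ r ∈ Set.Ioo 0 (2 * r₀),
      cutoffExtend (fun s => branchAmp V s - 1) 0 C⁻¹ r = branchAmp V r - 1 :=
    fun r hr => cutoffExtend_eq ⟨hr.1, hr.2.le.trans hR⟩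
  have him : ∀ r ∈ Set.Ioo 0 (2 * r₀),
      (cutoffExtend (branchFreq V) 1 C⁻¹ r).im = (branchFreq V r).im :=
    fun r hr => by rw [hω r hr]
  obtain ⟨γ₁, hγ₁, hhigh⟩ := D.exists_high (half_pos hr₀)
  -- The same rate has to serve both regimes. The high-frequency bound γ₁ depends on r₀; the
  -- low-frequency estimates are uniform for all rates up to sin(α)/4.
  have hγ₀ : 0 < min γ₁ (Real.sin α / 4) := lt_min hγ₁ (by positivity)
  obtain ⟨Ch, Eh, hE1, hE2⟩ := hhigh _ hγ₀ (min_le_left _ _)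
  have hsub : Set.Ioo 0 (2 * r₀) ⊆ Set.Ioo 0 C⁻¹ := Set.Ioo_subset_Ioo_right hR
  refine ⟨min γ₁ (Real.sin α / 4), hγ₀, ⟨Ch, Eh, fun ξ hξ => ?_, hE1⟩,
    fun r τ => contourPart k (min γ₁ (Real.sin α / 4) : ℝ) α r τ, fun ξ hξ0 hξ => ?_,
    g1.restrict hR hm,
    (g3 _ hγ₀.le (min_le_right _ _)).mono hsub fun _ _ => le_rfl,
    g2.1.restrict hR fun r hr => ?_, g2.2.restrict hR him, fun r hr => ?_,
    fun h3 hm2 => ?_, fun n hn hnd => ?_⟩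
  · have hne : ξ ≠ 0 := norm_pos_iff.1 ((half_pos hr₀).trans hξ)
    rw [greenHat_eq hne (hker ξ hne)]
    exact deltaPlus_congr fun τ hτ => hE2 ‖ξ‖ hξ τ hτ
  · have hne : ξ ≠ 0 := norm_pos_iff.1 hξ0
    have hr : ‖ξ‖ ∈ Set.Ioo 0 (2 * r₀) := ⟨hξ0, hξ⟩
    rw [greenHat_eq hne (hker ξ hne)]
    refine deltaPlus_congr fun τ hτ => ?_
    obtain ⟨z, hz, hzre, hzim, hzα, huniq⟩ := hzero ‖ξ‖ ⟨hξ0, by linarith⟩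
    have hmem : ((‖ξ‖ : ℝ) : ℂ) ∈ cone (Real.sin α ^ 2 / 8) ρ₂ :=
      ofReal_mem_cone (by positivity) ⟨hξ0, by linarith⟩
    rw [D.low_frequency_eq Br hα0 hα ⟨hξ0, by linarith⟩ hτ hc₁ (hline _ hmem) hz hzre hzim hzα
      huniq, hω _ hr, hm _ hr, ← exp_mul_contourPart k (min γ₁ (Real.sin α / 4)) α,
      add_sub_cancel]
    congr 2
    push_cast
    ring_nf
  · rw [hω r hr]; simp [freqPoly]
  · have hmain := Br.im_div_mem D (r := r) ⟨hr.1, by linarith [hr.2]⟩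
    rw [hω r hr]
    exact ⟨hmain.1.le, hmain.2.2⟩
  · obtain ⟨q1, q2, q3, q4⟩ := g4 h3 hm2
    refine ⟨q1.restrict hR hm, (q2 _ hγ₀.le (min_le_right _ _)).mono hsub fun _ _ => le_rfl,
      q3.restrict hR fun r hr => ?_, q4.restrict hR him⟩
    rw [hω r hr, eval_freqPoly_one ha0]
    ring
  · have hnr : n ∈ Finset.range ⌈d⌉₊ := by
      rw [Finset.mem_range, Nat.lt_ceil]
      have : (0 : ℝ) ≤ n := n.cast_nonneg
      linarith
    obtain ⟨⟨q1, q2⟩, q3⟩ := g5 n hnr hnd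
    have hpoly : ∀ r ∈ Set.Ioo 0 (2 * r₀), (cutoffExtend (branchFreq V) 1 C⁻¹ r).re -
        (1 + ∑ j ∈ Finset.Icc 1 n, freqCoeff j (fun i => moment M₀ i) * r ^ (2 * j)) =
        (branchFreq V r).re - (freqPoly (moment M₀) n).eval (r ^ 2) := fun r hr => by
      rw [hω r hr, eval_freqPoly]
    have hn1 : (1 : ℝ) ≤ n := by exact_mod_cast hn
    have hreg := Br.contDiffOn_cutoffExtend (q := d - 1) (by linarith) hn (hF n hnd)
      (aeval_zero_freqPoly _ _) hCi (by linarith)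
    exact ⟨hreg.2, hreg.1, q1.restrict hR hpoly, q2.restrict hR him, fun h1 h2 =>
      ⟨(q3 h1 h2).1.restrict hR hpoly, (q3 h1 h2).2.restrict hR him⟩⟩
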